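/- Let $\mathsf G$ be a Leray description of a smooth étale groupoid $\mathsf H$: there is an étale Morita morphism $\mathsf G\to\mathsf H$ of smooth étale groupoids, the manifolds $\mathsf G_0$ and $\mathsf G_1$ are Hausdorff and paracompact, and every space $\mathsf G_k$ ($k\ge 0$) of chains $x_0\xrightarrow{g_1}x_1\to\cdots\xrightarrow{g_k}x_k$ is a disjoint union of contractible open subspaces. Let $\mathcal A^l$ be the $\mathsf G$-sheaf of smooth complex $l$-forms, $\mathbb C^\times_{\mathsf G}$ the $\mathsf G$-sheaf of smooth $\mathbb C^\times$-valued functions, and $\epsilon_k:\mathsf G_k\to\mathsf G_0$, $\epsilon_k(g_1,\dots,g_k)=t(g_k)$. For a $\mathsf G$-sheaf $\mathcal F$ let $\delta=\sum_{i=0}^{k+1}(-1)^i\delta_i:\Gamma(\mathsf G_k,\epsilon_k^*\mathcal F)\to\Gamma(\mathsf G_{k+1},\epsilon_{k+1}^*\mathcal F)$, where $\delta_i$ is pull-back by the face $d_i$ for $i\le k$ and $(\delta_{k+1}\sigma)(g_1,\dots,g_{k+1})=\sigma(g_1,\dots,g_k)\cdot g_{k+1}$; for $\mathbb C^\times_{\mathsf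 G}$ the sum is a product. Let $\check C(\mathsf G,\mathbb C^\times(3)_{\mathsf G})$ be the total complex of the double complex $\Gamma(\mathsf G_k,\epsilon_k^*\mathbb C^\times_{\mathsf G})\xrightarrow{d\log}\Gamma(\mathsf G_k,\epsilon_k^*\mathcal A^1)\xrightarrow{d}\Gamma(\mathsf G_k,\epsilon_k^*\mathcal A^2)$, with differential $\delta-(-1)^q d$ in total degree $q$, where $d$ stands for $d\log$ on $\mathbb C^\times_{\mathsf G}$. A gerbe with connection on $\mathsf G$ is a smooth principal $\mathbb C^\times$-bundle $L$ with connection over $\mathsf G_1$, with a smooth associative product $L_{g_1}\otimes L_{g_2}\to L_{g_1g_2}$ compatible with the connections, and a $B\in\Gamma(\mathsf G_0,\mathcal A^2)$ with the curvature of $L$ equal to $\delta B$. An isomorphism $(L,B)\cong(L',B')$ is a smooth principal $\mathbb C^\times$-bundle $Q$ with connection over $\mathsf G_0$ with an isomorphism $Q_{s(g)}^{-1}\otimes L_g\otimes Q_{t(g)}\cong L'_g$, smooth and compatible with products and connections, such that $B'-B$ is the curvature of $Q$. A triple $(h,A,B)$ presents $(L,B')$ if $B'=B$ and $L$ has a global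 smooth section $\sigma$ with connection form $A$ and $\sigma(g_1)\sigma(g_2)=h(g_1,g_2)\,\sigma(g_1g_2)$. Then: 1. A triple $(h,A,B)$ with $h\in\Gamma(\mathsf G_2,\epsilon_2^*\mathbb C^\times_{\mathsf G})$, $A\in\Gamma(\mathsf G_1,\epsilon_1^*\mathcal A^1)$, $B\in\Gamma(\mathsf G_0,\mathcal A^2)$ is a $2$-cocycle of $\check C(\mathsf G,\mathbb C^\times(3)_{\mathsf G})$ if and only if $\delta B=dA$, $\delta A=d\log h$ and $\delta h=1$. 2. A gerbe with connection on $\mathsf G$ is a $2$-cocycle of $\check C(\mathsf G,\mathbb C^\times(3)_{\mathsf G})$: every gerbe with connection is presented by some $2$-cocycle, every triple which presents a gerbe with connection is a $2$-cocycle, and every $2$-cocycle presents a gerbe with connection. 3. Two gerbes with connection are isomorphic if and only if $2$-cocycles which present them lie in the same class of $\check H^2(\mathsf G,\mathbb C^\times(3)_{\mathsf G})$. 4. Let $\mathbb Z(3)=(2\pi i)^3\mathbb Z$ and let $\mathbb Z(3)_D^\infty$ be the complex $\mathbb Z(3)_{\mathsf G}\to\mathcal A^0\xrightarrow{d}\mathcal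 A^1\xrightarrow{d}\mathcal A^2$ of $\mathsf G$-sheaves, in degrees $0,\dots,3$. There is a quasi-isomorphism from $\mathbb Z(3)_D^\infty$ to a complex of injective abelian $\mathsf G$-sheaves in non-negative degrees. For each such quasi-isomorphism $\mathbb Z(3)_D^\infty\to\mathcal T^\bullet$, let $\mathbb H^3(\mathsf G,\mathbb Z(3)_D^\infty)=H^3(\Gamma_{inv}(\mathsf G,\mathcal T^\bullet))$. There is an isomorphism of groups $\check H^2(\mathsf G,\mathbb C^\times(3)_{\mathsf G})\cong\mathbb H^3(\mathsf G,\mathbb Z(3)_D^\infty)$ which sends the class of $(h,A,B)$ to the class of $\xi$ exactly when, for some $x_2\in\Gamma(\mathsf G_2,\epsilon_2^*\mathcal A^0)$ with $h=\exp((2\pi i)^{-2}x_2)$ and $\delta x_2$ with values in $\mathbb Z(3)$, the image of $(\delta x_2,\,x_2,\,(2\pi i)^2A,\,(2\pi i)^2B)$ in the total complex of $\Gamma(\mathsf G_k,\epsilon_k^*\mathcal T^l)$ (with differential $\delta+(-1)^q d$ in total degree $q$) is cohomologous to $\xi$. Through it, sending a gerbe with connection to the class of a $2$-cocycle which presents it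 induces a bijection from the set of isomorphism classes of gerbes with connection on $\mathsf G$ to $\mathbb H^3(\mathsf G,\mathbb Z(3)_D^\infty)$. -/

import Mathlib

universe u v

noncomputable section

set_option linter.unusedSectionVars false

open CategoryTheory Filter Topology
open scoped Manifold ContDiff

namespace EtaleGerbe

/-- The model space `ℝⁿ`. -/
abbrev Model (n : ℕ) : Type := EuclideanSpace ℝ (Fin n)

/-- Complex-valued alternating `l`-forms on `ℝⁿ`. Since Mathlib identifies every tangent space of a
manifold modelled on `ℝⁿ` with `ℝⁿ`, this is the fibre of the bundle of complex `l`-forms. -/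
abbrev Alt (n l : ℕ) : Type := Model n [⋀^Fin l]→L[ℝ] ℂ

/-! ### Complex differential forms on a manifold -/

section Forms

variable {n : ℕ} {M : Type u} [TopologicalSpace M] [ChartedSpace (Model n) M]

variable (n) in
/-- The preferred chart at `x`, as a map to `ℝⁿ`. -/
def chart (x : M) : PartialEquiv M (Model n) := extChartAt (𝓡 n) x

/-- The differential at `y` of the inverse of the preferred chart at `x`. -/
def chartSymmDeriv (x : M) (y : Model n) : Model n →L[ℝ] Model n :=
  mfderiv 𝓘(ℝ, Model n) (𝓡 n) (chart n x).symm y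

/-- The differential at `x` of the preferred chart at `x`. -/
def chartDeriv (x : M) : Model n →L[ℝ] Model n :=
  mfderiv (𝓡 n) 𝓘(ℝ, Model n) (chart n x) x

/-- The coordinate expression in the preferred chart at `x` of a (not necessarily smooth)
`l`-form `η`: its pull-back by the inverse of the chart. -/
def rep {l : ℕ} (η : M → Alt n l) (x : M) (y : Model n) : Alt n l :=
  (η ((chart n x).symm y)).compContinuousLinearMap (chartSymmDeriv x y)

/-- `η` is a smooth `l`-form on a neighbourhood of `x`. -/
def SmoothForm {l : ℕ} (η : M → Alt n l) (x : M) : Prop :=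
  ∀ᶠ y in 𝓝 (chart n x x), ContDiffAt ℝ ∞ (rep η x) y

/-- The exterior derivative of a form, computed in the preferred chart at each point. -/
def extD {l : ℕ} (η : M → Alt n l) (x : M) : Alt n (l + 1) :=
  (extDeriv (rep η x) (chart n x x)).compContinuousLinearMap (chartDeriv x)

/-- A complex function, regarded as a `0`-form. -/
def zeroForm (f : M → ℂ) (x : M) : Alt n 0 :=
  ContinuousAlternatingMap.constOfIsEmpty ℝ (Model n) (Fin 0) (f x)

/-- The pull-back of a form by a map. -/
def pullForm {l : ℕ} (ψ : M → M) (η : M → Alt n l) (x : M) : Alt n l :=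
  (η (ψ x)).compContinuousLinearMap (mfderiv (𝓡 n) (𝓡 n) ψ x : Model n →L[ℝ] Model n)

lemma two_le_infty : minSmoothness ℝ 2 ≤ (∞ : ℕ∞ω) := by
  simp only [minSmoothness_of_isRCLikeNormedField]
  exact WithTop.coe_le_coe.2 le_top

lemma finiteDimensional_alt (n l : ℕ) : FiniteDimensional ℝ (Alt n l) :=
  FiniteDimensional.of_injective
    (V₂ := MultilinearMap ℝ (fun _ : Fin l => Model n) ℂ)
    { toFun := fun f => f.toContinuousMultilinearMap.toMultilinearMap
      map_add' := fun _ _ => rfl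
      map_smul' := fun _ _ => rfl }
    (fun f g h => by
      ext v
      exact congrArg (fun q : MultilinearMap ℝ (fun _ : Fin l => Model n) ℂ => q v) h)

lemma finiteDimensional_cmm (n l : ℕ) :
    FiniteDimensional ℝ (ContinuousMultilinearMap ℝ (fun _ : Fin l => Model n) ℂ) :=
  FiniteDimensional.of_injective
    (V₂ := MultilinearMap ℝ (fun _ : Fin l => Model n) ℂ)
    { toFun := fun f => f.toMultilinearMap
      map_add' := fun _ _ => rfl
      map_smul' := fun _ _ => rfl }
    (fun f g h => by
      ext v
      exact congrArg (fun q : MultilinearMap ℝ (fun _ : Fin l => Model n) ℂ => q v) h)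

lemma contDiffAt_compCLM {l : ℕ} {w : Model n → Alt n l} {L : Model n → Model n →L[ℝ] Model n}
    {y : Model n} (hω : ContDiffAt ℝ ∞ w y) (hL : ContDiffAt ℝ ∞ L y) :
    ContDiffAt ℝ ∞ (fun z => (w z).compContinuousLinearMap (L z)) y := by
  have := finiteDimensional_cmm n l
  let J : Alt n l →L[ℝ] ContinuousMultilinearMap ℝ (fun _ : Fin l => Model n) ℂ :=
    ContinuousAlternatingMap.toContinuousMultilinearMapCLM ℝ
  have hJ : J.toLinearMap.ker = ⊥ := by
    rw [LinearMap.ker_eq_bot]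
    exact ContinuousAlternatingMap.toContinuousMultilinearMap_injective
  obtain ⟨P, hP⟩ := LinearMap.exists_leftInverse_of_injective _ hJ
  have hPJ : ∀ a, P (J a) = a := fun a => congrArg (fun q => q a) hP
  let P' := LinearMap.toContinuousLinearMap P
  let C := ContinuousMultilinearMap.compContinuousLinearMapContinuousMultilinear ℝ
    (fun _ : Fin l => Model n) (fun _ : Fin l => Model n) ℂ
  have hC : ContDiff ℝ ∞ (fun A : Fin l → (Model n →L[ℝ] Model n) => C A) :=
    ContinuousMultilinearMap.contDiff (𝕜 := ℝ) (n := ∞)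
      (E := fun _ : Fin l => (Model n →L[ℝ] Model n))
      (F := ContinuousMultilinearMap ℝ (fun _ : Fin l => Model n) ℂ →L[ℝ]
        ContinuousMultilinearMap ℝ (fun _ : Fin l => Model n) ℂ) C
  have h1 : ContDiffAt ℝ ∞ (fun z => C (fun _ => L z)) y :=
    ContDiffAt.comp y (g := fun A : Fin l → (Model n →L[ℝ] Model n) => C A)
      hC.contDiffAt (contDiffAt_pi.2 fun _ => hL)
  have h2 : ContDiffAt ℝ ∞ (fun z => C (fun _ => L z) (J (w z))) y :=
    h1.clm_apply (J.contDiff.contDiffAt.comp y hω)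
  have h3 : ContDiffAt ℝ ∞ (fun z => P' (C (fun _ => L z) (J (w z)))) y :=
    P'.contDiff.contDiffAt.comp y h2
  refine h3.congr_of_eventuallyEq (Eventually.of_forall fun z => ?_)
  change _ = P (J ((w z).compContinuousLinearMap (L z)))
  rw [hPJ]

lemma chart_source_mem {x₀ x : M} (hx : x ∈ (chart n x₀).source) :
    (chart n x₀).source ∈ 𝓝 x :=
  (isOpen_extChartAt_source (I := 𝓡 n) x₀).mem_nhds hx

lemma chart_target_mem {x₀ x : M} (hx : x ∈ (chart n x₀).source) :
    (chart n x₀).target ∈ 𝓝 (chart n x₀ x : Model n) :=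
  (isOpen_extChartAt_target (I := 𝓡 n) x₀).mem_nhds ((chart n x₀).map_source hx)

variable [IsManifold (𝓡 n) ∞ M]

lemma chart_smooth {x₀ x : M} (hx : x ∈ (chart n x₀).source) :
    ContMDiffAt (𝓡 n) 𝓘(ℝ, Model n) ∞ (chart n x₀) x :=
  contMDiffAt_extChartAt' (by simpa [chart] using hx)

lemma chart_symm_smooth {x₀ : M} {y : Model n} (hy : y ∈ (chart n x₀).target) :
    ContMDiffAt 𝓘(ℝ, Model n) (𝓡 n) ∞ (chart n x₀).symm y :=
  (contMDiffOn_extChartAt_symm x₀).contMDiffAt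
    ((isOpen_extChartAt_target (I := 𝓡 n) x₀).mem_nhds hy)

lemma tendsto_chart_symm {x₀ x : M} (hx : x ∈ (chart n x₀).source) :
    Tendsto (chart n x₀).symm (𝓝 (chart n x₀ x)) (𝓝 x) := by
  have h := (chart_symm_smooth ((chart n x₀).map_source hx)).continuousAt
  have h2 : (chart n x₀).symm (chart n x₀ x) = x := (chart n x₀).left_inv hx
  rw [ContinuousAt, h2] at h
  exact h

/-- Coordinate expression of a pull-back. -/
lemma rep_pullForm {l : ℕ} (η : M → Alt n l) (ψ : M → M) {x₀ x₁ x : M}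
    (hx : x ∈ (chart n x₀).source) (hψx : ψ x ∈ (chart n x₁).source)
    (hψ : ∀ᶠ z in 𝓝 x, ContMDiffAt (𝓡 n) (𝓡 n) ∞ ψ z) :
    rep (pullForm ψ η) x₀ =ᶠ[𝓝 (chart n x₀ x)] fun y =>
      (rep η x₁ (chart n x₁ (ψ ((chart n x₀).symm y)))).compContinuousLinearMap
        (fderiv ℝ (fun y => (chart n x₁ (ψ ((chart n x₀).symm y)) : Model n)) y) := by
  have hcont : ContinuousAt ψ x := hψ.self_of_nhds.continuousAt
  have hev : ∀ᶠ z in 𝓝 x, ψ z ∈ (chart n x₁).source :=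
    hcont.eventually (chart_source_mem hψx)
  have ht := tendsto_chart_symm (n := n) hx
  filter_upwards [chart_target_mem (n := n) hx, ht.eventually hψ,
    ht.eventually hev.eventually_nhds] with y hy h1 h2
  have h2' := h2.self_of_nhds
  have hsy := chart_symm_smooth (n := n) hy
  have e1 : (chart n x₁).symm (chart n x₁ (ψ ((chart n x₀).symm y)))
      = ψ ((chart n x₀).symm y) := (chart n x₁).left_inv h2'
  have hne : (∞ : ℕ∞ω) ≠ 0 := by simp
  have hd0 : MDifferentiableAt 𝓘(ℝ, Model n) (𝓡 n) (chart n x₀).symm y :=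
    hsy.mdifferentiableAt hne
  have hdψ : MDifferentiableAt (𝓡 n) (𝓡 n) ψ ((chart n x₀).symm y) :=
    h1.mdifferentiableAt hne
  have hd1 : MDifferentiableAt (𝓡 n) 𝓘(ℝ, Model n) (chart n x₁)
      (ψ ((chart n x₀).symm y)) := (chart_smooth h2').mdifferentiableAt hne
  have hd1s : MDifferentiableAt 𝓘(ℝ, Model n) (𝓡 n) (chart n x₁).symm
      (chart n x₁ (ψ ((chart n x₀).symm y))) :=
    (chart_symm_smooth ((chart n x₁).map_source h2')).mdifferentiableAt hne
  have hΨ : MDifferentiableAt 𝓘(ℝ, Model n) 𝓘(ℝ, Model n)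
      (fun y => (chart n x₁ (ψ ((chart n x₀).symm y)) : Model n)) y :=
    MDifferentiableAt.comp (I' := 𝓡 n) y hd1 (MDifferentiableAt.comp (I' := 𝓡 n) y hdψ hd0)
  have key : (mfderiv 𝓘(ℝ, Model n) (𝓡 n) (chart n x₁).symm
        (chart n x₁ (ψ ((chart n x₀).symm y)))).comp
        (mfderiv 𝓘(ℝ, Model n) 𝓘(ℝ, Model n)
          (fun y => (chart n x₁ (ψ ((chart n x₀).symm y)) : Model n)) y)
      = (mfderiv (𝓡 n) (𝓡 n) ψ ((chart n x₀).symm y)).comp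
        (mfderiv 𝓘(ℝ, Model n) (𝓡 n) (chart n x₀).symm y) := by
    have a := mfderiv_comp (I' := 𝓘(ℝ, Model n)) y hd1s hΨ
    have b := mfderiv_comp (I' := 𝓡 n) y hdψ hd0
    refine a.symm.trans (Eq.trans ?_ b)
    apply Filter.EventuallyEq.mfderiv_eq
    have := hd0.continuousAt.eventually h2
    filter_upwards [this] with w hw
    exact (chart n x₁).left_inv hw
  rw [mfderiv_eq_fderiv] at key
  have e2 : rep η x₁ (chart n x₁ (ψ ((chart n x₀).symm y)))
      = (η (ψ ((chart n x₀).symm y))).compContinuousLinearMap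
        (mfderiv 𝓘(ℝ, Model n) (𝓡 n) (chart n x₁).symm
          (chart n x₁ (ψ ((chart n x₀).symm y))) : Model n →L[ℝ] Model n) := by
    exact congrArg (fun m => (η m).compContinuousLinearMap
      (chartSymmDeriv x₁ (chart n x₁ (ψ ((chart n x₀).symm y))))) e1
  rw [e2]
  exact congrArg (fun q : Model n →L[ℝ] Model n =>
    (η (ψ ((chart n x₀).symm y))).compContinuousLinearMap q) key.symm

/-- A map read in the preferred charts at `x₀` and `x₁`. -/
def inCharts (ψ : M → M) (x₀ x₁ : M) (y : Model n) : Model n :=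
  chart n x₁ (ψ ((chart n x₀).symm y))

lemma inCharts_apply (ψ : M → M) {x₀ x₁ x : M} (hx : x ∈ (chart n x₀).source) :
    inCharts ψ x₀ x₁ (chart n x₀ x) = chart n x₁ (ψ x) := by
  unfold inCharts
  rw [(chart n x₀).left_inv hx]

lemma contDiffAt_inCharts (ψ : M → M) {x₀ x₁ x : M}
    (hx : x ∈ (chart n x₀).source) (hψx : ψ x ∈ (chart n x₁).source)
    (hψ : ContMDiffAt (𝓡 n) (𝓡 n) ∞ ψ x) :
    ContDiffAt ℝ ∞ (inCharts (n := n) ψ x₀ x₁) (chart n x₀ x) := by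
  rw [← contMDiffAt_iff_contDiffAt]
  have e : (chart n x₀).symm (chart n x₀ x) = x := (chart n x₀).left_inv hx
  have h0 := chart_symm_smooth ((chart n x₀).map_source hx)
  have h1 : ContMDiffAt (𝓡 n) 𝓘(ℝ, Model n) ∞ (fun z => (chart n x₁ (ψ z) : Model n)) x :=
    ContMDiffAt.comp (I' := 𝓡 n) x (chart_smooth hψx) hψ
  rw [← e] at h1
  exact ContMDiffAt.comp (I' := 𝓡 n) (g := fun z => (chart n x₁ (ψ z) : Model n)) _ h1 h0

lemma eventually_inCharts {ψ : M → M} {x₀ x₁ x : M}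
    (hx : x ∈ (chart n x₀).source) (hψx : ψ x ∈ (chart n x₁).source)
    (hψ : ∀ᶠ z in 𝓝 x, ContMDiffAt (𝓡 n) (𝓡 n) ∞ ψ z) :
    ∀ᶠ y in 𝓝 (chart n x₀ x), ContDiffAt ℝ ∞ (inCharts (n := n) ψ x₀ x₁) y := by
  have hev : ∀ᶠ z in 𝓝 x, ψ z ∈ (chart n x₁).source :=
    hψ.self_of_nhds.continuousAt.eventually (chart_source_mem hψx)
  have ht := tendsto_chart_symm (n := n) hx
  filter_upwards [chart_target_mem (n := n) hx, ht.eventually hψ, ht.eventually hev]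
    with y hy h1 h2
  have h := contDiffAt_inCharts (n := n) ψ ((chart n x₀).map_target hy) h2 h1
  rwa [(chart n x₀).right_inv hy] at h

lemma tendsto_inCharts {ψ : M → M} {x₀ x₁ x : M}
    (hx : x ∈ (chart n x₀).source) (hψx : ψ x ∈ (chart n x₁).source)
    (hψ : ContMDiffAt (𝓡 n) (𝓡 n) ∞ ψ x) :
    Tendsto (inCharts (n := n) ψ x₀ x₁) (𝓝 (chart n x₀ x)) (𝓝 (chart n x₁ (ψ x))) := by
  have h := (contDiffAt_inCharts (n := n) ψ hx hψx hψ).continuousAt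
  rwa [ContinuousAt, inCharts_apply ψ hx] at h

lemma smooth_pullForm_charts {l : ℕ} {η : M → Alt n l} {ψ : M → M} {x₀ x₁ x : M}
    (hx : x ∈ (chart n x₀).source) (hψx : ψ x ∈ (chart n x₁).source)
    (hψ : ∀ᶠ z in 𝓝 x, ContMDiffAt (𝓡 n) (𝓡 n) ∞ ψ z)
    (hη : ∀ᶠ y in 𝓝 (chart n x₁ (ψ x)), ContDiffAt ℝ ∞ (rep η x₁) y) :
    ∀ᶠ y in 𝓝 (chart n x₀ x), ContDiffAt ℝ ∞ (rep (pullForm ψ η) x₀) y := by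
  filter_upwards [(rep_pullForm η ψ hx hψx hψ).eventuallyEq_nhds,
    eventually_inCharts (x₁ := x₁) hx hψx hψ,
    (tendsto_inCharts hx hψx hψ.self_of_nhds).eventually hη] with y h1 h2 h3
  refine ContDiffAt.congr_of_eventuallyEq ?_ h1
  exact contDiffAt_compCLM (ContDiffAt.comp y h3 h2) (h2.fderiv_right (by simp))

lemma extDeriv_pullForm_charts {l : ℕ} {η : M → Alt n l} {ψ : M → M} {x₀ x₁ x : M}
    (hx : x ∈ (chart n x₀).source) (hψx : ψ x ∈ (chart n x₁).source)
    (hψ : ∀ᶠ z in 𝓝 x, ContMDiffAt (𝓡 n) (𝓡 n) ∞ ψ z)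
    (hη : ∀ᶠ y in 𝓝 (chart n x₁ (ψ x)), ContDiffAt ℝ ∞ (rep η x₁) y) :
    ∀ᶠ y in 𝓝 (chart n x₀ x), extDeriv (rep (pullForm ψ η) x₀) y =
      (extDeriv (rep η x₁) (inCharts ψ x₀ x₁ y)).compContinuousLinearMap
        (fderiv ℝ (inCharts ψ x₀ x₁) y) := by
  filter_upwards [(rep_pullForm η ψ hx hψx hψ).eventuallyEq_nhds,
    eventually_inCharts (x₁ := x₁) hx hψx hψ,
    (tendsto_inCharts hx hψx hψ.self_of_nhds).eventually hη] with y h1 h2 h3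
  rw [h1.extDeriv_eq]
  exact extDeriv_pullback (r := ∞) (h3.differentiableAt (by simp)) h2
    two_le_infty

lemma pullForm_id {l : ℕ} (η : M → Alt n l) : pullForm id η = η := by
  funext x
  unfold pullForm
  rw [mfderiv_id]
  ext v
  rfl

lemma smoothForm_iff_charts {l : ℕ} {η : M → Alt n l} {x₀ x : M}
    (hx : x ∈ (chart n x₀).source) :
    SmoothForm η x ↔ ∀ᶠ y in 𝓝 (chart n x₀ x), ContDiffAt ℝ ∞ (rep η x₀) y := by
  have hid : ∀ᶠ z in 𝓝 x, ContMDiffAt (𝓡 n) (𝓡 n) ∞ (id : M → M) z :=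
    Eventually.of_forall fun _ => contMDiffAt_id
  have hself : x ∈ (chart n x).source := mem_extChartAt_source x
  constructor
  · intro h
    have := smooth_pullForm_charts (ψ := id) (x₁ := x) hx hself hid h
    rwa [pullForm_id] at this
  · intro h
    have := smooth_pullForm_charts (ψ := id) (x₁ := x₀) hself hx hid h
    rwa [pullForm_id] at this

lemma SmoothForm.eventually {l : ℕ} {η : M → Alt n l} {x : M} (h : SmoothForm η x) :
    ∀ᶠ z in 𝓝 x, SmoothForm η z := by
  have hself : x ∈ (chart n x).source := mem_extChartAt_source x
  have hc := (chart_smooth (n := n) hself).continuousAt.eventually (Filter.Eventually.eventually_nhds h)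
  filter_upwards [hc, chart_source_mem hself] with z hz hz'
  exact (smoothForm_iff_charts hz').2 hz

lemma rep_congr {l : ℕ} {η θ : M → Alt n l} {x₀ x : M} (hx : x ∈ (chart n x₀).source)
    (h : η =ᶠ[𝓝 x] θ) : rep η x₀ =ᶠ[𝓝 (chart n x₀ x)] rep θ x₀ := by
  filter_upwards [(tendsto_chart_symm (n := n) hx).eventually h] with y hy
  unfold rep
  rw [hy]

lemma SmoothForm.congr {l : ℕ} {η θ : M → Alt n l} {x : M} (h : η =ᶠ[𝓝 x] θ)
    (hη : SmoothForm η x) : SmoothForm θ x := by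
  filter_upwards [hη, (rep_congr (mem_extChartAt_source x) h).eventuallyEq_nhds] with y h1 h2
  exact h1.congr_of_eventuallyEq h2.symm

lemma extD_congr {l : ℕ} {η θ : M → Alt n l} {x : M} (h : η =ᶠ[𝓝 x] θ) :
    extD η x = extD θ x := by
  unfold extD
  rw [(rep_congr (mem_extChartAt_source x) h).extDeriv_eq]

lemma SmoothForm.pullForm {l : ℕ} {η : M → Alt n l} {ψ : M → M} {x : M}
    (hη : SmoothForm η (ψ x)) (hψ : ∀ᶠ z in 𝓝 x, ContMDiffAt (𝓡 n) (𝓡 n) ∞ ψ z) :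
    SmoothForm (pullForm ψ η) x :=
  smooth_pullForm_charts (mem_extChartAt_source x) (mem_extChartAt_source (ψ x)) hψ hη

/-- The exterior derivative commutes with pull-back. -/
lemma extD_pullForm {l : ℕ} {η : M → Alt n l} {ψ : M → M} {x : M}
    (hη : SmoothForm η (ψ x)) (hψ : ∀ᶠ z in 𝓝 x, ContMDiffAt (𝓡 n) (𝓡 n) ∞ ψ z) :
    extD (pullForm ψ η) x = pullForm ψ (extD η) x := by
  have hx : x ∈ (chart n x).source := mem_extChartAt_source x
  have hψx : ψ x ∈ (chart n (ψ x)).source := mem_extChartAt_source (ψ x)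
  have h := (extDeriv_pullForm_charts (x₁ := ψ x) hx hψx hψ hη).self_of_nhds
  rw [inCharts_apply ψ hx] at h
  have hne : (∞ : ℕ∞ω) ≠ 0 := by simp
  have h0 := hψ.self_of_nhds
  have key : (fderiv ℝ (inCharts (n := n) ψ x (ψ x)) (chart n x x)).comp
      (mfderiv (𝓡 n) 𝓘(ℝ, Model n) (chart n x) x : Model n →L[ℝ] Model n) =
      (mfderiv (𝓡 n) 𝓘(ℝ, Model n) (chart n (ψ x)) (ψ x) : Model n →L[ℝ] Model n).comp
        (mfderiv (𝓡 n) (𝓡 n) ψ x : Model n →L[ℝ] Model n) := by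
    have a := mfderiv_comp (I' := 𝓘(ℝ, Model n)) x
      ((contDiffAt_inCharts (n := n) ψ hx hψx h0).contMDiffAt.mdifferentiableAt hne)
      ((chart_smooth hx).mdifferentiableAt hne)
    have b := mfderiv_comp (I' := 𝓡 n) x ((chart_smooth hψx).mdifferentiableAt hne)
      (h0.mdifferentiableAt hne)
    rw [mfderiv_eq_fderiv] at a
    refine a.symm.trans (Eq.trans ?_ b)
    apply Filter.EventuallyEq.mfderiv_eq
    filter_upwards [chart_source_mem hx] with z hz
    exact inCharts_apply ψ hz
  change (extDeriv (rep (EtaleGerbe.pullForm ψ η) x) (chart n x x)).compContinuousLinearMap _ = _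
  rw [h]
  exact congrArg (fun q : Model n →L[ℝ] Model n =>
    (extDeriv (rep η (ψ x)) (chart n (ψ x) (ψ x))).compContinuousLinearMap q) key

/-- The exterior derivative in coordinates. -/
lemma rep_extD {l : ℕ} {η : M → Alt n l} {x : M} (hη : SmoothForm η x) :
    rep (extD η) x =ᶠ[𝓝 (chart n x x)] extDeriv (rep η x) := by
  have hx : x ∈ (chart n x).source := mem_extChartAt_source x
  have hne : (∞ : ℕ∞ω) ≠ 0 := by simp
  have ht := tendsto_chart_symm (n := n) hx
  filter_upwards [chart_target_mem (n := n) hx, ht.eventually hη.eventually] with y hy h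
  set z := (chart n x).symm y with hz
  have hzx : z ∈ (chart n x).source := (chart n x).map_target hy
  have hzz : z ∈ (chart n z).source := mem_extChartAt_source z
  have hyz : chart n x z = y := (chart n x).right_inv hy
  have hid : ∀ᶠ z in 𝓝 z, ContMDiffAt (𝓡 n) (𝓡 n) ∞ (id : M → M) z :=
    Eventually.of_forall fun _ => contMDiffAt_id
  have h1 := (extDeriv_pullForm_charts (ψ := id) (x₁ := z) hzx hzz hid h).self_of_nhds
  rw [pullForm_id, inCharts_apply id hzx, hyz] at h1
  rw [h1]
  have b := mfderiv_comp (I' := 𝓡 n) y ((chart_smooth hzz).mdifferentiableAt hne)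
    ((chart_symm_smooth hy).mdifferentiableAt hne)
  rw [mfderiv_eq_fderiv] at b
  exact congrArg (fun q : Model n →L[ℝ] Model n =>
    (extDeriv (rep η z) (chart n z z)).compContinuousLinearMap q) b.symm

lemma contDiffAt_extDeriv {l : ℕ} {w : Model n → Alt n l} {y : Model n}
    (h : ContDiffAt ℝ ∞ w y) : ContDiffAt ℝ ∞ (extDeriv w) y :=
  (ContinuousAlternatingMap.alternatizeUncurryFinCLM ℝ (Model n) ℂ).contDiff.contDiffAt.comp y
    (h.fderiv_right (by simp))

lemma SmoothForm.extD {l : ℕ} {η : M → Alt n l} {x : M} (hη : SmoothForm η x) :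
    SmoothForm (extD η) x := by
  filter_upwards [(rep_extD hη).eventuallyEq_nhds, hη] with y h1 h2
  exact (contDiffAt_extDeriv h2).congr_of_eventuallyEq h1

lemma extD_extD {l : ℕ} {η : M → Alt n l} {x : M} (hη : SmoothForm η x) :
    extD (extD η) x = 0 := by
  change (extDeriv (rep (EtaleGerbe.extD η) x) (chart n x x)).compContinuousLinearMap _ = 0
  rw [(rep_extD hη).extDeriv_eq,
    extDeriv_extDeriv_apply (r := ∞) hη.self_of_nhds
      two_le_infty]
  rfl

lemma rep_add {l : ℕ} (η θ : M → Alt n l) (x : M) : rep (η + θ) x = rep η x + rep θ x := rfl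

lemma rep_neg {l : ℕ} (η : M → Alt n l) (x : M) : rep (-η) x = -rep η x := rfl

lemma rep_zero (l : ℕ) (x : M) : rep (0 : M → Alt n l) x = 0 := rfl

lemma SmoothForm.add {l : ℕ} {η θ : M → Alt n l} {x : M} (h : SmoothForm η x)
    (h' : SmoothForm θ x) : SmoothForm (η + θ) x := by
  filter_upwards [h, h'] with y h1 h2
  exact h1.add h2

lemma SmoothForm.neg {l : ℕ} {η : M → Alt n l} {x : M} (h : SmoothForm η x) :
    SmoothForm (-η) x := by
  filter_upwards [h] with y h1
  exact h1.neg

lemma SmoothForm.zero (l : ℕ) (x : M) : SmoothForm (0 : M → Alt n l) x :=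
  Eventually.of_forall fun _ => contDiffAt_const (c := (0 : Alt n l))

lemma extD_add {l : ℕ} {η θ : M → Alt n l} {x : M} (h : SmoothForm η x)
    (h' : SmoothForm θ x) : extD (η + θ) x = extD η x + extD θ x := by
  unfold extD
  rw [rep_add, extDeriv_add (h.self_of_nhds.differentiableAt (by simp))
    (h'.self_of_nhds.differentiableAt (by simp))]
  rfl

end Forms

/-! ### Smooth étale groupoids -/

/-- A smooth étale groupoid of dimension `n`: a groupoid whose objects and arrows form smooth
manifolds, with `s`, `t` local diffeomorphisms and all other structure maps continuous. The latter
are then automatically local diffeomorphisms, being continuous maps over `Obj` between spaces which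
are étale over `Obj`. The composite `comp g h` of `x ⟶ y ⟶ z` is written in diagrammatic order. No
separation axioms are imposed here. -/
structure SmoothEtaleGroupoid (n : ℕ) : Type (u + 1) where
  Obj : Type u
  Arr : Type u
  [topObj : TopologicalSpace Obj]
  [topArr : TopologicalSpace Arr]
  [chartedObj : ChartedSpace (Model n) Obj]
  [chartedArr : ChartedSpace (Model n) Arr]
  [manifoldObj : IsManifold (𝓡 n) ∞ Obj]
  [manifoldArr : IsManifold (𝓡 n) ∞ Arr]
  src : Arr → Obj
  tgt : Arr → Obj
  unit : Obj → Arr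
  inv : Arr → Arr
  comp : ∀ g h : Arr, tgt g = src h → Arr
  src_unit : ∀ x, src (unit x) = x
  tgt_unit : ∀ x, tgt (unit x) = x
  src_inv : ∀ g, src (inv g) = tgt g
  tgt_inv : ∀ g, tgt (inv g) = src g
  src_comp : ∀ g h e, src (comp g h e) = src g
  tgt_comp : ∀ g h e, tgt (comp g h e) = tgt h
  unit_comp : ∀ g, comp (unit (src g)) g (tgt_unit _) = g
  comp_unit : ∀ g, comp g (unit (tgt g)) (src_unit _).symm = g
  inv_comp : ∀ g, comp (inv g) g (tgt_inv g) = unit (tgt g)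
  comp_inv : ∀ g, comp g (inv g) (src_inv g).symm = unit (src g)
  assoc : ∀ g h k (e : tgt g = src h) (e' : tgt h = src k),
    comp (comp g h e) k ((tgt_comp g h e).trans e') =
      comp g (comp h k e') (e.trans (src_comp h k e').symm)
  src_etale : IsLocalDiffeomorph (𝓡 n) (𝓡 n) ∞ src
  tgt_etale : IsLocalDiffeomorph (𝓡 n) (𝓡 n) ∞ tgt
  continuous_unit : Continuous unit
  continuous_inv : Continuous inv
  continuous_comp : Continuous fun z : {z : Arr × Arr // tgt z.1 = src z.2} =>
    comp z.1.1 z.1.2 z.2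

attribute [instance] SmoothEtaleGroupoid.topObj SmoothEtaleGroupoid.topArr
  SmoothEtaleGroupoid.chartedObj SmoothEtaleGroupoid.chartedArr
  SmoothEtaleGroupoid.manifoldObj SmoothEtaleGroupoid.manifoldArr

/-- A space étale over a space `X`. -/
structure EtaleSpace (X : Type u) [TopologicalSpace X] : Type (u + 1) where
  carrier : Type u
  [top : TopologicalSpace carrier]
  proj : carrier → X
  isLocalHomeomorph : IsLocalHomeomorph proj

attribute [instance] EtaleSpace.top

namespace EtaleSpace

variable {X : Type u} [TopologicalSpace X]

/-- A continuous map over the base. -/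
structure Hom (Z W : EtaleSpace X) where
  toFun : Z.carrier → W.carrier
  continuous_toFun : Continuous toFun
  proj_toFun : ∀ z, W.proj (toFun z) = Z.proj z

variable (X) in
/-- The base, over itself. -/
def base : EtaleSpace X := ⟨X, id, IsLocalHomeomorph.mk _ fun _ => ⟨OpenPartialHomeomorph.refl X, trivial, fun _ _ => rfl⟩⟩

/-- An open subset of the base. -/
def ofOpens (U : TopologicalSpace.Opens X) : EtaleSpace X :=
  ⟨U, Subtype.val, U.isOpen.isOpenEmbedding_subtypeVal.isLocalHomeomorph⟩

variable (Z : EtaleSpace X)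

/-- A local section of `Z.proj` through `z`. -/
def loc (z : Z.carrier) : X → Z.carrier := Z.isLocalHomeomorph.localInverseAt z

lemma loc_proj (z : Z.carrier) : Z.loc z (Z.proj z) = z :=
  Z.isLocalHomeomorph.localInverseAt_apply_self

lemma proj_loc (z : Z.carrier) : ∀ᶠ x in 𝓝 (Z.proj z), Z.proj (Z.loc z x) = x := by
  have h := (Z.isLocalHomeomorph.localInverseAt z).open_source.mem_nhds
    Z.isLocalHomeomorph.apply_self_mem_localInverseAt_source
  filter_upwards [h] with x hx
  exact Z.isLocalHomeomorph.apply_localInverseAt_of_mem hx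

lemma continuousAt_loc (z : Z.carrier) : ContinuousAt (Z.loc z) (Z.proj z) :=
  (Z.isLocalHomeomorph.localInverseAt z).continuousAt
    Z.isLocalHomeomorph.apply_self_mem_localInverseAt_source

lemma tendsto_loc (z : Z.carrier) : Tendsto (Z.loc z) (𝓝 (Z.proj z)) (𝓝 z) := by
  have h := Z.continuousAt_loc z
  rwa [ContinuousAt, Z.loc_proj] at h

lemma tendsto_proj (z : Z.carrier) : Tendsto Z.proj (𝓝 z) (𝓝 (Z.proj z)) :=
  Z.isLocalHomeomorph.continuous.continuousAt

/-- Points near `z` lie on the local section through `z`. -/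
lemma eventually_loc (z : Z.carrier) : ∀ᶠ w in 𝓝 z, Z.loc z (Z.proj w) = w := by
  have h := (Z.isLocalHomeomorph.localInverseAt z).open_target.mem_nhds
    Z.isLocalHomeomorph.self_mem_localInverseAt_target
  filter_upwards [h] with w hw
  have e := Z.isLocalHomeomorph.localInverseAt_symm z
  have := (Z.isLocalHomeomorph.localInverseAt z).right_inv hw
  rwa [e] at this

end EtaleSpace

namespace SmoothEtaleGroupoid

variable {n : ℕ} (G : SmoothEtaleGroupoid.{u} n)

/-- The space of arrows, étale over the objects by the target map. -/
def arrows : EtaleSpace G.Obj := ⟨G.Arr, G.tgt, G.tgt_etale.isLocalHomeomorph⟩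

/-- The space of pairs `(z, g)` of a point `z` of `Z` over `x` and an arrow `g : x ⟶ y`,
étale over the objects by `(z, g) ↦ y`. -/
def snoc (Z : EtaleSpace G.Obj) : EtaleSpace G.Obj where
  carrier := {q : Z.carrier × G.Arr // Z.proj q.1 = G.src q.2}
  proj := fun q => G.tgt q.1.2
  isLocalHomeomorph := by
    classical
    refine G.tgt_etale.isLocalHomeomorph.comp ?_
    rintro ⟨⟨z, g⟩, e⟩
    change Z.proj z = G.src g at e
    let ez := Z.isLocalHomeomorph.localInverseAt z
    have hgz : G.src g ∈ ez.source := by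
      rw [← e]; exact Z.isLocalHomeomorph.apply_self_mem_localInverseAt_source
    have hcs : Continuous G.src := G.src_etale.contMDiff.continuous
    have hsymm : (ez.symm : Z.carrier → G.Obj) = Z.proj :=
      Z.isLocalHomeomorph.localInverseAt_symm z
    refine ⟨
      { toFun := fun q => q.1.2
        invFun := fun h => if hh : G.src h ∈ ez.source then ⟨(ez (G.src h), h),
            Z.isLocalHomeomorph.apply_localInverseAt_of_mem hh⟩ else ⟨(z, g), e⟩
        source := {q | q.1.1 ∈ ez.target}
        target := {h | G.src h ∈ ez.source}
        map_source' := ?_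
        map_target' := ?_
        left_inv' := ?_
        right_inv' := ?_
        open_source := ez.open_target.preimage (continuous_fst.comp continuous_subtype_val)
        open_target := ez.open_source.preimage hcs
        continuousOn_toFun := (continuous_snd.comp continuous_subtype_val).continuousOn
        continuousOn_invFun := ?_ }, ?_, rfl⟩
    · rintro ⟨⟨w, h⟩, e'⟩ hw
      change Z.proj w = G.src h at e'
      change G.src h ∈ ez.source
      rw [← e', ← hsymm]
      exact ez.map_target hw
    · intro h hh
      change G.src h ∈ ez.source at hh
      simp only [hh, dif_pos]
      exact ez.map_source hh
    · rintro ⟨⟨w, h⟩, e'⟩ hw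
      change Z.proj w = G.src h at e'
      have hw' : w ∈ ez.target := hw
      have h1 : G.src h ∈ ez.source := by
        rw [← e', ← hsymm]
        exact ez.map_target hw'
      have h2 : ez (G.src h) = w := by
        rw [← e', ← hsymm]
        exact ez.right_inv hw'
      simp only [h1, dif_pos]
      exact Subtype.ext (Prod.ext h2 rfl)
    · intro h hh
      change G.src h ∈ ez.source at hh
      simp only [hh, dif_pos]
    · refine (Topology.IsInducing.subtypeVal
        (t := {q : Z.carrier × G.Arr | Z.proj q.1 = G.src q.2})).continuousOn_iff.2 ?_
      have : ContinuousOn (fun h => (ez (G.src h), h)) {h | G.src h ∈ ez.source} :=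
        (ez.continuousOn.comp hcs.continuousOn fun _ h => h).prodMk continuousOn_id
      refine this.congr fun h hh => ?_
      change G.src h ∈ ez.source at hh
      simp [hh]
    · exact Z.isLocalHomeomorph.self_mem_localInverseAt_target

/-- The nerve: `G.nerve k` is the space `G_k` of chains `x₀ ⟶ x₁ ⟶ ⋯ ⟶ x_k`, with the map
`ε_k` to the objects which sends such a chain to `x_k`. -/
def nerve : ℕ → EtaleSpace G.Obj
  | 0 => EtaleSpace.base G.Obj
  | k + 1 => G.snoc (nerve k)

variable {G}

/-- The map on pairs `(z, g)` induced by a map over the objects. -/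
def snocMap {Z W : EtaleSpace G.Obj} (f : Z.Hom W) : (G.snoc Z).Hom (G.snoc W) where
  toFun := fun q => ⟨(f.toFun q.1.1, q.1.2), (f.proj_toFun _).trans q.2⟩
  continuous_toFun := by
    refine Continuous.subtype_mk (Continuous.prodMk ?_ ?_) _
    · exact f.continuous_toFun.comp (continuous_fst.comp continuous_subtype_val)
    · exact continuous_snd.comp continuous_subtype_val
  proj_toFun := fun _ => rfl

/-- `(x, g) ↦ t(g)`. -/
def snocTgt : (G.snoc (EtaleSpace.base G.Obj)).Hom (EtaleSpace.base G.Obj) where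
  toFun := fun q => G.tgt q.1.2
  continuous_toFun :=
    G.tgt_etale.contMDiff.continuous.comp (continuous_snd.comp continuous_subtype_val)
  proj_toFun := fun _ => rfl

/-- `((z, g), h) ↦ (z, gh)`. -/
def snocComp (Z : EtaleSpace G.Obj) : (G.snoc (G.snoc Z)).Hom (G.snoc Z) where
  toFun := fun q => ⟨(q.1.1.1.1, G.comp q.1.1.1.2 q.1.2 q.2),
    q.1.1.2.trans (G.src_comp _ _ _).symm⟩
  continuous_toFun := by
    refine Continuous.subtype_mk (Continuous.prodMk ?_ ?_) _
    · exact continuous_fst.comp (continuous_subtype_val.comp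
        (continuous_fst.comp continuous_subtype_val))
    · have h : Continuous fun q : (G.snoc (G.snoc Z)).carrier =>
          (⟨(q.1.1.1.2, q.1.2), q.2⟩ : {z : G.Arr × G.Arr // G.tgt z.1 = G.src z.2}) := by
        refine Continuous.subtype_mk (Continuous.prodMk ?_ ?_) _
        · exact continuous_snd.comp (continuous_subtype_val.comp
            (continuous_fst.comp continuous_subtype_val))
        · exact continuous_snd.comp continuous_subtype_val
      exact G.continuous_comp.comp h
  proj_toFun := fun _ => G.tgt_comp _ _ _

variable (G)

/-- The faces `d_i : G_{k+1} → G_k`, `0 ≤ i ≤ k`, which preserve the last object of a chain: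
`d_0` forgets the first arrow and the others compose the arrows `i` and `i + 1`. The remaining face
`d_{k+1}` forgets the last arrow; it is the map `(z, g) ↦ z`. -/
def face : (k : ℕ) → Fin (k + 1) → (G.nerve (k + 1)).Hom (G.nerve k)
  | 0, _ => snocTgt
  | k + 1, i => Fin.lastCases (motive := fun _ => (G.nerve (k + 2)).Hom (G.nerve (k + 1)))
      (snocComp (G.nerve k)) (fun j => snocMap (face k j)) i

/-- The differential `T_{t(g)} → T_{s(g)}` of the local diffeomorphism `s ∘ t⁻¹` defined by an
arrow `g`. -/
def arrowDeriv (g : G.Arr) : Model n →L[ℝ] Model n :=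
  (mfderiv (𝓡 n) (𝓡 n) G.src g : Model n →L[ℝ] Model n).comp
    ((G.tgt_etale g).mfderivToContinuousLinearEquiv (by simp)).symm.toContinuousLinearMap

/-- The groupoid is Leray if every connected component of every space `G_k`, `k ≥ 0`, is
contractible (that is, each `G_k` is a disjoint union of contractible spaces), where the spaces of
objects and arrows are Hausdorff and paracompact. -/
structure IsLeray : Prop where
  t2_obj : T2Space G.Obj
  t2_arr : T2Space G.Arr
  paracompact_obj : ParacompactSpace G.Obj
  paracompact_arr : ParacompactSpace G.Arr
  contractible : ∀ (k : ℕ) (z : (G.nerve k).carrier),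
    ContractibleSpace (connectedComponent z)

end SmoothEtaleGroupoid

/-! ### Sheaves on a smooth étale groupoid given by germs of functions -/

namespace SmoothEtaleGroupoid

variable {n : ℕ} (G : SmoothEtaleGroupoid.{u} n)

/-- A local section of the target map through the arrow `g`. -/
def arrLoc (g : G.Arr) (y : G.Obj) : G.Arr := G.arrows.loc g y

/-- The local diffeomorphism `s ∘ t⁻¹` defined near `t(g)` by an arrow `g`. -/
def germ (g : G.Arr) (y : G.Obj) : G.Obj := G.src (G.arrLoc g y)

lemma loc_tgt (g : G.Arr) : G.arrLoc g (G.tgt g) = g := G.arrows.loc_proj g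

lemma eventually_arrLoc (g : G.Arr) : ∀ᶠ w in 𝓝 g, G.arrLoc g (G.tgt w) = w :=
  G.arrows.eventually_loc g

lemma tgt_arrLoc (g : G.Arr) : ∀ᶠ y in 𝓝 (G.tgt g), G.tgt (G.arrLoc g y) = y :=
  G.arrows.proj_loc g

lemma germ_tgt (g : G.Arr) : G.germ g (G.tgt g) = G.src g := by
  unfold germ
  rw [loc_tgt]

lemma smooth_loc (g : G.Arr) :
    ∀ᶠ y in 𝓝 (G.tgt g), ContMDiffAt (𝓡 n) (𝓡 n) ∞ (G.arrLoc g) y := by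
  have hf := G.tgt_etale g
  have h1 : ∀ᶠ y in 𝓝 (G.tgt g), y ∈ hf.localInverse.source :=
    hf.localInverse_open_source.mem_nhds hf.localInverse_mem_source
  have hc : ContinuousAt hf.localInverse (G.tgt g) :=
    (hf.localInverse_contMDiffAt).continuousAt
  have hv : hf.localInverse (G.tgt g) = g := hf.localInverse_left_inv hf.localInverse_mem_target
  have h2 : ∀ᶠ w in 𝓝 (hf.localInverse (G.tgt g)), G.arrLoc g (G.tgt w) = w := by
    rw [hv]; exact G.eventually_arrLoc g
  have h3 : G.arrLoc g =ᶠ[𝓝 (G.tgt g)] hf.localInverse := by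
    filter_upwards [h1, hc.eventually h2] with y hy h
    rw [hf.localInverse_right_inv hy] at h
    exact h
  filter_upwards [h1, h3.eventuallyEq_nhds] with y hy h
  exact (hf.localInverse_contMDiffOn.contMDiffAt
    (hf.localInverse_open_source.mem_nhds hy)).congr_of_eventuallyEq h

lemma smooth_germ (g : G.Arr) :
    ∀ᶠ y in 𝓝 (G.tgt g), ContMDiffAt (𝓡 n) (𝓡 n) ∞ (G.germ g) y := by
  filter_upwards [G.smooth_loc g] with y hy
  exact ContMDiffAt.comp (I' := 𝓡 n) y G.src_etale.contMDiff.contMDiffAt hy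

lemma mfderiv_germ (g : G.Arr) : ∀ᶠ y in 𝓝 (G.tgt g),
    (mfderiv (𝓡 n) (𝓡 n) (G.germ g) y : Model n →L[ℝ] Model n) =
      G.arrowDeriv (G.arrLoc g y) := by
  have hne : (∞ : ℕ∞ω) ≠ 0 := by simp
  filter_upwards [G.smooth_loc g, (G.tgt_arrLoc g).eventually_nhds] with y hy h2
  have a := mfderiv_comp (I' := 𝓡 n) y (G.src_etale.mdifferentiable hne (G.arrLoc g y))
    (hy.mdifferentiableAt hne)
  have b := mfderiv_comp (I' := 𝓡 n) y (G.tgt_etale.mdifferentiable hne (G.arrLoc g y))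
    (hy.mdifferentiableAt hne)
  have c : mfderiv (𝓡 n) (𝓡 n) (G.tgt ∘ G.arrLoc g) y =
      mfderiv (𝓡 n) (𝓡 n) id y := by
    apply Filter.EventuallyEq.mfderiv_eq
    filter_upwards [h2] with w hw
    exact hw
  rw [mfderiv_id] at c
  rw [c] at b
  refine Eq.trans a ?_
  unfold arrowDeriv
  refine congrArg (fun q : Model n →L[ℝ] Model n =>
    (mfderiv (𝓡 n) (𝓡 n) G.src (G.arrLoc g y) : Model n →L[ℝ] Model n).comp q) ?_
  let T := (G.tgt_etale (G.arrLoc g y)).mfderivToContinuousLinearEquiv hne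
  apply ContinuousLinearMap.ext
  intro v
  have hv := congrArg (fun q : Model n →L[ℝ] Model n => q v) b
  exact (T.symm_apply_eq.2 hv).symm

lemma arrowDeriv_eq (g : G.Arr) : G.arrowDeriv g =
    (mfderiv (𝓡 n) (𝓡 n) (G.germ g) (G.tgt g) : Model n →L[ℝ] Model n) := by
  have h := (G.mfderiv_germ g).self_of_nhds
  rw [loc_tgt] at h
  exact h.symm

lemma germ_comp (g h : G.Arr) (e : G.tgt g = G.src h) :
    G.germ (G.comp g h e) =ᶠ[𝓝 (G.tgt h)] G.germ g ∘ G.germ h := by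
  let P := G.snoc G.arrows
  let z : P.carrier := ⟨(g, h), e⟩
  have hβ : Tendsto (P.loc z) (𝓝 (G.tgt h)) (𝓝 z) := P.tendsto_loc z
  have hp : ∀ᶠ y in 𝓝 (G.tgt h), G.tgt (P.loc z y).1.2 = y := P.proj_loc z
  have c1 : Tendsto (fun w : P.carrier => w.1.1) (𝓝 z) (𝓝 g) :=
    (continuous_fst.comp continuous_subtype_val).tendsto z
  have c2 : Tendsto (fun w : P.carrier => w.1.2) (𝓝 z) (𝓝 h) :=
    (continuous_snd.comp continuous_subtype_val).tendsto z
  have c3 : Tendsto (fun w : P.carrier => G.comp w.1.1 w.1.2 w.2) (𝓝 z) (𝓝 (G.comp g h e)) :=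
    G.continuous_comp.tendsto z
  have h1 := (c1.comp hβ).eventually (G.eventually_arrLoc g)
  have h2 := (c2.comp hβ).eventually (G.eventually_arrLoc h)
  have h3 := (c3.comp hβ).eventually (G.eventually_arrLoc (G.comp g h e))
  filter_upwards [hp, h1, h2, h3] with y hy k1 k2 k3
  have fin : ∀ (a b : G.Arr) (e' : G.tgt a = G.src b), G.tgt b = y →
      G.arrLoc g (G.tgt a) = a → G.arrLoc h (G.tgt b) = b →
      G.arrLoc (G.comp g h e) (G.tgt (G.comp a b e')) = G.comp a b e' →
      G.germ (G.comp g h e) y = G.germ g (G.germ h y) := by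
    intro a b e' hb l1 l2 l3
    rw [G.tgt_comp, hb] at l3
    rw [hb] at l2
    unfold germ
    rw [l3, l2, G.src_comp, ← e', l1]
  exact fin _ _ (P.loc z y).2 hy k1 k2 k3

lemma arrowDeriv_comp (g h : G.Arr) (e : G.tgt g = G.src h) :
    G.arrowDeriv (G.comp g h e) = (G.arrowDeriv g).comp (G.arrowDeriv h) := by
  have hne : (∞ : ℕ∞ω) ≠ 0 := by simp
  have h0 : G.germ h (G.tgt h) = G.tgt g := (G.germ_tgt h).trans e.symm
  have hg := (G.smooth_germ g).self_of_nhds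
  rw [← h0] at hg
  have b := mfderiv_comp (I' := 𝓡 n) (G.tgt h) (hg.mdifferentiableAt hne)
    ((G.smooth_germ h).self_of_nhds.mdifferentiableAt hne)
  have a := (G.germ_comp g h e).mfderiv_eq (I := 𝓡 n) (I' := 𝓡 n)
  rw [G.arrowDeriv_eq (G.comp g h e), G.arrowDeriv_eq g, G.arrowDeriv_eq h, G.tgt_comp]
  refine a.trans (b.trans ?_)
  rw [h0]
  rfl

lemma arrowDeriv_unit (x : G.Obj) : G.arrowDeriv (G.unit x) = ContinuousLinearMap.id ℝ _ := by
  have h : G.comp (G.unit x) (G.unit x) ((G.tgt_unit x).trans (G.src_unit x).symm)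
      = G.unit x := by
    have := G.comp_unit (G.unit x)
    simp only [G.tgt_unit] at this
    exact this
  have h2 := G.arrowDeriv_comp (G.unit x) (G.unit x) ((G.tgt_unit x).trans (G.src_unit x).symm)
  rw [h] at h2
  have hne : (∞ : ℕ∞ω) ≠ 0 := by simp
  let S := (G.src_etale (G.unit x)).mfderivToContinuousLinearEquiv hne
  let T := (G.tgt_etale (G.unit x)).mfderivToContinuousLinearEquiv hne
  apply ContinuousLinearMap.ext
  intro v
  have hv : G.arrowDeriv (G.unit x) v = G.arrowDeriv (G.unit x) (G.arrowDeriv (G.unit x) v) :=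
    congrArg (fun q : Model n →L[ℝ] Model n => q v) h2
  have h3 : S (T.symm v) = S (T.symm (S (T.symm v))) := hv
  exact (T.symm.injective (S.injective h3)).symm

end SmoothEtaleGroupoid

open SmoothEtaleGroupoid

/-- A `G`-sheaf of abelian groups presented by germs of functions: `IsSec η x` says that the
`A`-valued function `η` on the objects is a section of the sheaf near `x`, and
`act g : A → A`, `a ↦ a · g`, is the action of the arrow `g` from the values at `s(g)` to the
values at `t(g)`. -/
structure Coeff {n : ℕ} (G : SmoothEtaleGroupoid.{u} n) : Type (u + 1) where
  A : Type
  [grp : AddCommGroup A]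
  act : G.Arr → A →+ A
  IsSec : (G.Obj → A) → G.Obj → Prop
  congr : ∀ {η θ x}, η =ᶠ[𝓝 x] θ → IsSec η x → IsSec θ x
  eventually : ∀ {η x}, IsSec η x → ∀ᶠ y in 𝓝 x, IsSec η y
  zero : ∀ x, IsSec 0 x
  add : ∀ {η θ x}, IsSec η x → IsSec θ x → IsSec (η + θ) x
  neg : ∀ {η x}, IsSec η x → IsSec (-η) x
  act_unit : ∀ x a, act (G.unit x) a = a
  act_comp : ∀ g h e a, act (G.comp g h e) a = act h (act g a)
  isSec_act : ∀ g η, IsSec η (G.src g) →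
    IsSec (fun y => act (G.arrLoc g y) (η (G.germ g y))) (G.tgt g)

attribute [instance] Coeff.grp

/-- A morphism of `G`-sheaves presented by germs of functions, given by a local operator. -/
structure CoeffHom {n : ℕ} {G : SmoothEtaleGroupoid.{u} n} (F F' : Coeff G) where
  op : (G.Obj → F.A) → G.Obj → F'.A
  congr : ∀ {η θ x}, η =ᶠ[𝓝 x] θ → op η x = op θ x
  isSec : ∀ {η x}, F.IsSec η x → F'.IsSec (op η) x
  add : ∀ {η θ x}, F.IsSec η x → F.IsSec θ x → op (η + θ) x = op η x + op θ x
  act : ∀ {η} (g), F.IsSec η (G.src g) →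
    op (fun y => F.act (G.arrLoc g y) (η (G.germ g y))) (G.tgt g) = F'.act g (op η (G.src g))

namespace Coeff

variable {n : ℕ} {G : SmoothEtaleGroupoid.{u} n} (F : Coeff G)

/-- Near `z`, the function `f` on the étale space `Z` is the pull-back by `Z.proj` of a section of
the sheaf on the base. -/
def SecAt (Z : EtaleSpace G.Obj) (f : Z.carrier → F.A) (z : Z.carrier) : Prop :=
  ∃ η : G.Obj → F.A, F.IsSec η (Z.proj z) ∧ f =ᶠ[𝓝 z] η ∘ Z.proj

variable {F} in
lemma SecAt.congr {Z : EtaleSpace G.Obj} {f f' : Z.carrier → F.A} {z : Z.carrier}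
    (h : f =ᶠ[𝓝 z] f') (hf : F.SecAt Z f z) : F.SecAt Z f' z := by
  obtain ⟨η, h1, h2⟩ := hf
  exact ⟨η, h1, h.symm.trans h2⟩

/-- The group `Γ(Z, p^* F)` of global sections over `Z` of the pull-back of the sheaf `F` along the
étale map `p : Z → G_0`. -/
def sections (Z : EtaleSpace G.Obj) : AddSubgroup (Z.carrier → F.A) where
  carrier := {f | ∀ z, F.SecAt Z f z}
  zero_mem' := fun _ => ⟨0, F.zero _, Eventually.of_forall fun _ => rfl⟩
  add_mem' := by
    intro f f' h h' z
    obtain ⟨η, h1, h2⟩ := h z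
    obtain ⟨θ, h3, h4⟩ := h' z
    exact ⟨η + θ, F.add h1 h3, h2.add h4⟩
  neg_mem' := by
    intro f h z
    obtain ⟨η, h1, h2⟩ := h z
    exact ⟨-η, F.neg h1, h2.neg⟩

/-- Pull-back of sections along a continuous map over the base. -/
def pull {Z W : EtaleSpace G.Obj} (q : Z.Hom W) : F.sections W →+ F.sections Z where
  toFun c := ⟨fun z => c.1 (q.toFun z), fun z => by
    obtain ⟨η, h1, h2⟩ := c.2 (q.toFun z)
    refine ⟨η, by rwa [q.proj_toFun] at h1, ?_⟩
    filter_upwards [q.continuous_toFun.continuousAt.eventually h2] with w hw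
    rw [hw, Function.comp_apply, q.proj_toFun]
    rfl⟩
  map_zero' := rfl
  map_add' _ _ := rfl

/-- The map `Γ(Z, p^* F) → Γ(snoc Z, p^* F)` which sends `c` to `(z, g) ↦ c(z) · g`. -/
def twist (Z : EtaleSpace G.Obj) : F.sections Z →+ F.sections (G.snoc Z) where
  toFun c := ⟨fun q => F.act q.1.2 (c.1 q.1.1), fun q => by
    obtain ⟨η, h1, h2⟩ := c.2 q.1.1
    rw [q.2] at h1
    refine ⟨_, F.isSec_act q.1.2 η h1, ?_⟩
    have c1 : Tendsto (fun w : (G.snoc Z).carrier => w.1.1) (𝓝 q) (𝓝 q.1.1) :=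
      (continuous_fst.comp continuous_subtype_val).tendsto q
    have c2 : Tendsto (fun w : (G.snoc Z).carrier => w.1.2) (𝓝 q) (𝓝 q.1.2) :=
      (continuous_snd.comp continuous_subtype_val).tendsto q
    filter_upwards [c1.eventually h2, c2.eventually (G.eventually_arrLoc q.1.2)] with w hw hw2
    have hw2' : G.arrLoc q.1.2 (G.tgt w.1.2) = w.1.2 := hw2
    change F.act w.1.2 (c.1 w.1.1) =
      F.act (G.arrLoc q.1.2 (G.tgt w.1.2)) (η (G.src (G.arrLoc q.1.2 (G.tgt w.1.2))))
    rw [hw2', hw, ← w.2]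
    rfl⟩
  map_zero' := Subtype.ext (funext fun _ => map_zero _)
  map_add' _ _ := Subtype.ext (funext fun _ => map_add _ _ _)

/-- The last summand `(δ_{k+1} c)(g_1, …, g_{k+1}) = c(g_1, …, g_k) · g_{k+1}` of the horizontal
differential. -/
def deltaLast (k : ℕ) : F.sections (G.nerve k) →+ F.sections (G.nerve (k + 1)) :=
  F.twist (G.nerve k)

/-- The horizontal differential `δ = ∑ (-1)^i δ_i` from `Γ(G_k, ε_k^* F)` to
`Γ(G_{k+1}, ε_{k+1}^* F)`, where `δ_i` is the pull-back by the face `d_i` for `i ≤ k`. -/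
def delta (k : ℕ) : F.sections (G.nerve k) →+ F.sections (G.nerve (k + 1)) :=
  ∑ i : Fin (k + 1), (-1 : ℤ) ^ (i : ℕ) • F.pull (G.face k i) +
    (-1 : ℤ) ^ (k + 1) • F.deltaLast k

end Coeff

namespace CoeffHom

variable {n : ℕ} {G : SmoothEtaleGroupoid.{u} n} {F F' F'' : Coeff G} (L : CoeffHom F F')

/-- A local operator, applied to a function on an étale space. -/
def app (Z : EtaleSpace G.Obj) (f : Z.carrier → F.A) (z : Z.carrier) : F'.A :=
  L.op (fun x => f (Z.loc z x)) (Z.proj z)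

lemma app_eq (Z : EtaleSpace G.Obj) {f : Z.carrier → F.A} {z : Z.carrier} {η : G.Obj → F.A}
    (h : f =ᶠ[𝓝 z] η ∘ Z.proj) : L.app Z f z = L.op η (Z.proj z) := by
  apply L.congr
  filter_upwards [(Z.tendsto_loc z).eventually h, Z.proj_loc z] with x h1 h2
  rw [h1, Function.comp_apply, h2]

lemma app_eventuallyEq (Z : EtaleSpace G.Obj) {f : Z.carrier → F.A} {z : Z.carrier}
    {η : G.Obj → F.A} (h : f =ᶠ[𝓝 z] η ∘ Z.proj) : L.app Z f =ᶠ[𝓝 z] L.op η ∘ Z.proj := by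
  filter_upwards [h.eventuallyEq_nhds] with w hw
  exact L.app_eq Z hw

/-- The map on global sections over an étale space. -/
def map (Z : EtaleSpace G.Obj) : F.sections Z →+ F'.sections Z :=
  AddMonoidHom.mk' (fun f => ⟨L.app Z f.1, fun z => by
    obtain ⟨η, h1, h2⟩ := f.2 z
    exact ⟨L.op η, L.isSec h1, L.app_eventuallyEq Z h2⟩⟩) (by
    intro f f'
    apply Subtype.ext
    funext z
    obtain ⟨η, h1, h2⟩ := f.2 z
    obtain ⟨θ, h3, h4⟩ := f'.2 z
    have h5 : (f + f').1 =ᶠ[𝓝 z] (η + θ) ∘ Z.proj := h2.add h4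
    change L.app Z (f + f').1 z = L.app Z f.1 z + L.app Z f'.1 z
    rw [L.app_eq Z h5, L.app_eq Z h2, L.app_eq Z h4, L.add h1 h3])

lemma map_pull {Z W : EtaleSpace G.Obj} (q : Z.Hom W) (c : F.sections W) :
    L.map Z (F.pull q c) = F'.pull q (L.map W c) := by
  apply Subtype.ext
  funext z
  obtain ⟨η, h1, h2⟩ := c.2 (q.toFun z)
  change L.app Z (fun z => c.1 (q.toFun z)) z = L.app W c.1 (q.toFun z)
  have h3 : (fun z => c.1 (q.toFun z)) =ᶠ[𝓝 z] η ∘ Z.proj := by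
    filter_upwards [q.continuous_toFun.continuousAt.eventually h2] with w hw
    rw [hw, Function.comp_apply, q.proj_toFun]
    rfl
  rw [L.app_eq W h2, L.app_eq Z h3, q.proj_toFun]

lemma map_twist (Z : EtaleSpace G.Obj) (c : F.sections Z) :
    L.map (G.snoc Z) (F.twist Z c) = F'.twist Z (L.map Z c) := by
  apply Subtype.ext
  funext q
  obtain ⟨η, h1, h2⟩ := c.2 q.1.1
  have h1' := h1
  rw [q.2] at h1'
  change L.app (G.snoc Z) (F.twist Z c).1 q = F'.act q.1.2 (L.app Z c.1 q.1.1)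
  have c1 : Tendsto (fun w : (G.snoc Z).carrier => w.1.1) (𝓝 q) (𝓝 q.1.1) :=
    (continuous_fst.comp continuous_subtype_val).tendsto q
  have c2 : Tendsto (fun w : (G.snoc Z).carrier => w.1.2) (𝓝 q) (𝓝 q.1.2) :=
    (continuous_snd.comp continuous_subtype_val).tendsto q
  have h3 : (F.twist Z c).1 =ᶠ[𝓝 q]
      (fun y => F.act (G.arrLoc q.1.2 y) (η (G.germ q.1.2 y))) ∘ (G.snoc Z).proj := by
    filter_upwards [c1.eventually h2, c2.eventually (G.eventually_arrLoc q.1.2)] with w hw hw2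
    have hw2' : G.arrLoc q.1.2 (G.tgt w.1.2) = w.1.2 := hw2
    change F.act w.1.2 (c.1 w.1.1) =
      F.act (G.arrLoc q.1.2 (G.tgt w.1.2)) (η (G.src (G.arrLoc q.1.2 (G.tgt w.1.2))))
    rw [hw2', hw, ← w.2]
    rfl
  rw [L.app_eq (G.snoc Z) h3, L.app_eq Z h2, q.2]
  exact L.act q.1.2 h1'

end CoeffHom

/-! ### The sheaves of the Deligne complex -/

section Coefficients

variable {n : ℕ} (G : SmoothEtaleGroupoid.{u} n)

lemma pullForm_germ_eq {l : ℕ} (g : G.Arr) (η : G.Obj → Alt n l) :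
    pullForm (G.germ g) η =ᶠ[𝓝 (G.tgt g)] fun y =>
      (η (G.germ g y)).compContinuousLinearMap (G.arrowDeriv (G.arrLoc g y)) := by
  filter_upwards [G.mfderiv_germ g] with y hy
  exact congrArg (fun q : Model n →L[ℝ] Model n => (η (G.germ g y)).compContinuousLinearMap q) hy

lemma pullForm_germ_tgt {l : ℕ} (g : G.Arr) (η : G.Obj → Alt n l) :
    pullForm (G.germ g) η (G.tgt g) =
      (η (G.src g)).compContinuousLinearMap (G.arrowDeriv g) := by
  have h2 := (pullForm_germ_eq G g η).self_of_nhds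
  simp only [G.loc_tgt, G.germ_tgt] at h2
  exact h2

/-- The `G`-sheaf `𝓐^l` of smooth complex-valued `l`-forms on the objects; arrows act by pull-back
by the local diffeomorphisms `s ∘ t⁻¹` which they define. -/
def forms (l : ℕ) : Coeff G where
  A := Alt n l
  act g := AddMonoidHom.mk' (fun a => a.compContinuousLinearMap (G.arrowDeriv g)) fun _ _ => rfl
  IsSec := SmoothForm
  congr h := SmoothForm.congr h
  eventually h := h.eventually
  zero x := SmoothForm.zero l x
  add h h' := h.add h'
  neg h := h.neg
  act_unit x a := by
    change a.compContinuousLinearMap (G.arrowDeriv (G.unit x)) = a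
    rw [G.arrowDeriv_unit]
    rfl
  act_comp g h e a := by
    change a.compContinuousLinearMap (G.arrowDeriv (G.comp g h e)) = _
    rw [G.arrowDeriv_comp]
    rfl
  isSec_act g η hη := by
    rw [← G.germ_tgt] at hη
    exact (hη.pullForm (G.smooth_germ g)).congr (pullForm_germ_eq G g η)

/-- The subgroup `ℤ(p) = (2πi)^p ℤ` of `ℂ`. -/
def twistedIntegers (p : ℕ) : AddSubgroup ℂ :=
  AddSubgroup.zmultiples ((2 * Real.pi * Complex.I) ^ p)

/-- The constant `G`-sheaf `ℤ(p)`. -/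
def constants (p : ℕ) : Coeff G where
  A := ℂ
  act _ := AddMonoidHom.id ℂ
  IsSec η x := ∃ c ∈ twistedIntegers p, ∀ᶠ y in 𝓝 x, η y = c
  congr h := by
    rintro ⟨c, hc, h'⟩
    exact ⟨c, hc, by filter_upwards [h, h'] with y h1 h2; rw [← h1, h2]⟩
  eventually := by
    rintro η x ⟨c, hc, h'⟩
    filter_upwards [h'.eventually_nhds] with y hy using ⟨c, hc, hy⟩
  zero x := ⟨0, zero_mem _, Eventually.of_forall fun _ => rfl⟩
  add := by
    rintro η θ x ⟨c, hc, h⟩ ⟨c', hc', h'⟩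
    exact ⟨c + c', add_mem hc hc', by
      filter_upwards [h, h'] with y h1 h2; rw [Pi.add_apply, h1, h2]⟩
  neg := by
    rintro η x ⟨c, hc, h⟩
    exact ⟨-c, neg_mem hc, by filter_upwards [h] with y h1; rw [Pi.neg_apply, h1]⟩
  act_unit _ _ := rfl
  act_comp _ _ _ _ := rfl
  isSec_act := by
    rintro g η ⟨c, hc, h⟩
    refine ⟨c, hc, ?_⟩
    have ht := (G.smooth_germ g).self_of_nhds.continuousAt
    rw [ContinuousAt, G.germ_tgt] at ht
    exact ht.eventually h

/-- The complex function underlying a function with values in `ℂˣ` (written additively). -/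
def unitsVal {M : Type u} (η : M → Additive ℂˣ) (x : M) : ℂ := ((η x).toMul : ℂ)

/-- The logarithmic derivative `f⁻¹ df` of a function with values in `ℂˣ`. -/
def dlogForm {M : Type u} [TopologicalSpace M] [ChartedSpace (Model n) M]
    (η : M → Additive ℂˣ) (x : M) : Alt n 1 :=
  (unitsVal η x)⁻¹ • extD (zeroForm (unitsVal η)) x

/-- The `G`-sheaf of smooth functions with values in `ℂˣ`, written additively. -/
def units : Coeff G where
  A := Additive ℂˣ
  act _ := AddMonoidHom.id _
  IsSec η x := ∀ᶠ y in 𝓝 x, ContMDiffAt (𝓡 n) 𝓘(ℝ, ℂ) ∞ (unitsVal η) y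
  congr h h' := by
    filter_upwards [h.eventuallyEq_nhds, h'] with y h1 h2
    refine h2.congr_of_eventuallyEq ?_
    filter_upwards [h1] with z hz
    unfold unitsVal
    rw [hz]
  eventually h := h.eventually_nhds
  zero x := Eventually.of_forall fun y => contMDiffAt_const (c := (1 : ℂ))
  add h h' := by
    filter_upwards [h, h'] with y h1 h2
    exact (contDiff_mul (𝕜 := ℝ) (𝔸 := ℂ)).contMDiff.contMDiffAt.comp y (h1.prodMk_space h2)
  neg {η x} h := by
    filter_upwards [h] with y h1
    have h2 : ContDiffAt ℝ ∞ (fun z : ℂ => z⁻¹) (unitsVal η y) :=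
      contDiffAt_inv ℝ (Units.ne_zero _)
    refine (h2.contMDiffAt.comp y h1).congr_of_eventuallyEq (Eventually.of_forall fun z => ?_)
    simp [unitsVal]
  act_unit _ _ := rfl
  act_comp _ _ _ _ := rfl
  isSec_act g η h := by
    have hg := G.smooth_germ g
    have ht := hg.self_of_nhds.continuousAt
    rw [ContinuousAt, G.germ_tgt] at ht
    filter_upwards [hg, ht.eventually h] with y h1 h2
    exact ContMDiffAt.comp (I' := 𝓡 n) (g := unitsVal η) y h2 h1

/-- The exterior derivative `d : 𝓐^l → 𝓐^{l+1}`. -/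
def dForms (l : ℕ) : CoeffHom (forms G l) (forms G (l + 1)) where
  op := extD
  congr h := extD_congr h
  isSec h := SmoothForm.extD h
  add h h' := extD_add h h'
  act {η} g hη := by
    have hη' : SmoothForm η (G.germ g (G.tgt g)) := by rw [G.germ_tgt]; exact hη
    have h1 := extD_congr (pullForm_germ_eq G g η)
    rw [extD_pullForm hη' (G.smooth_germ g)] at h1
    refine h1.symm.trans ?_
    exact pullForm_germ_tgt G g (extD η)

lemma smooth_comp_chart_symm {u : G.Obj → ℂ} {x : G.Obj}
    (h : ∀ᶠ y in 𝓝 x, ContMDiffAt (𝓡 n) 𝓘(ℝ, ℂ) ∞ u y) :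
    ∀ᶠ y in 𝓝 (chart n x x), ContDiffAt ℝ ∞ (u ∘ (chart n x).symm) y := by
  have hx : x ∈ (chart n x).source := mem_extChartAt_source x
  filter_upwards [chart_target_mem (n := n) hx, (tendsto_chart_symm (n := n) hx).eventually h]
    with y hy h1
  exact (ContMDiffAt.comp (I' := 𝓡 n) y h1 (chart_symm_smooth hy)).contDiffAt

lemma rep_zeroForm (u : G.Obj → ℂ) (x : G.Obj) :
    rep (n := n) (zeroForm u) x = fun y => ContinuousAlternatingMap.constOfIsEmpty ℝ (Model n)
      (Fin 0) (u ((chart n x).symm y)) := rfl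

lemma smoothForm_zeroForm {u : G.Obj → ℂ} {x : G.Obj}
    (h : ∀ᶠ y in 𝓝 x, ContMDiffAt (𝓡 n) 𝓘(ℝ, ℂ) ∞ u y) : SmoothForm (n := n) (zeroForm u) x := by
  filter_upwards [smooth_comp_chart_symm G h] with y hy
  exact (ContinuousAlternatingMap.constOfIsEmptyLIE ℝ (Model n) ℂ
    (Fin 0)).toContinuousLinearEquiv.toContinuousLinearMap.contDiff.contDiffAt.comp y hy

lemma extD_zeroForm (u : G.Obj → ℂ) (x : G.Obj) :
    extD (n := n) (zeroForm u) x = (ContinuousAlternatingMap.ofSubsingleton ℝ (Model n) ℂ (0 : Fin 1)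
      (fderiv ℝ (u ∘ (chart n x).symm) (chart n x x))).compContinuousLinearMap (chartDeriv x) := by
  unfold extD
  rw [rep_zeroForm, extDeriv_constOfIsEmpty]
  rfl

lemma extD_zeroForm_mul {u v : G.Obj → ℂ} {x : G.Obj}
    (hu : ∀ᶠ y in 𝓝 x, ContMDiffAt (𝓡 n) 𝓘(ℝ, ℂ) ∞ u y)
    (hv : ∀ᶠ y in 𝓝 x, ContMDiffAt (𝓡 n) 𝓘(ℝ, ℂ) ∞ v y) :
    extD (n := n) (zeroForm (u * v)) x =
      u x • extD (n := n) (zeroForm v) x + v x • extD (n := n) (zeroForm u) x := by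
  rw [extD_zeroForm, extD_zeroForm, extD_zeroForm]
  have hx : (chart n x).symm (chart n x x) = x := (chart n x).left_inv (mem_extChartAt_source x)
  have h1 := (smooth_comp_chart_symm G hu).self_of_nhds.differentiableAt (by simp)
  have h2 := (smooth_comp_chart_symm G hv).self_of_nhds.differentiableAt (by simp)
  have h3 : fderiv ℝ ((u * v) ∘ (chart n x).symm) (chart n x x) =
      u x • fderiv ℝ (v ∘ (chart n x).symm) (chart n x x) +
        v x • fderiv ℝ (u ∘ (chart n x).symm) (chart n x x) := by
    have := fderiv_mul h1 h2
    simp only [Function.comp_apply, hx] at this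
    exact this
  rw [h3]
  rfl

/-- The inclusion `i : ℤ(p) → 𝓐^0`. -/
def inclusion (p : ℕ) : CoeffHom (constants G p) (forms G 0) where
  op := zeroForm
  congr h := congrArg _ h.self_of_nhds
  isSec := by
    rintro η x ⟨c, -, h⟩
    refine smoothForm_zeroForm G ?_
    filter_upwards [h.eventually_nhds] with y hy
    exact (contMDiffAt_const (c := c)).congr_of_eventuallyEq hy
  add _ _ := rfl
  act {η} g _ := by
    exact congrArg (fun x => zeroForm (n := n) η x) (G.germ_tgt g)

lemma dlogForm_congr {η θ : G.Obj → Additive ℂˣ} {x : G.Obj} (h : η =ᶠ[𝓝 x] θ) :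
    dlogForm (n := n) η x = dlogForm θ x := by
  have h1 : zeroForm (n := n) (unitsVal η) =ᶠ[𝓝 x] zeroForm (unitsVal θ) := by
    filter_upwards [h] with y hy
    unfold zeroForm unitsVal
    rw [hy]
  unfold dlogForm
  rw [extD_congr h1]
  unfold unitsVal
  rw [h.self_of_nhds]

lemma smoothForm_dlogForm {η : G.Obj → Additive ℂˣ} {x : G.Obj} (h : (units G).IsSec η x) :
    SmoothForm (n := n) (dlogForm η) x := by
  have h0 := smoothForm_zeroForm G h
  filter_upwards [smooth_comp_chart_symm G h, h0.extD] with y h1 h2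
  exact (h1.inv (Units.ne_zero _)).smul h2

lemma dlogForm_add {η θ : G.Obj → Additive ℂˣ} {x : G.Obj} (h : (units G).IsSec η x)
    (h' : (units G).IsSec θ x) :
    dlogForm (n := n) (η + θ) x = dlogForm η x + dlogForm θ x := by
  have e := extD_zeroForm_mul G h h'
  have a : unitsVal η x ≠ 0 := Units.ne_zero _
  have b : unitsVal θ x ≠ 0 := Units.ne_zero _
  have e1 : unitsVal (η + θ) = unitsVal η * unitsVal θ := rfl
  unfold dlogForm
  rw [e1, e, Pi.mul_apply, smul_add, smul_smul, smul_smul, add_comm]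
  congr 2 <;> field_simp

lemma dlogForm_act {η : G.Obj → Additive ℂˣ} (g : G.Arr) (h : (units G).IsSec η (G.src g)) :
    dlogForm (n := n) (fun y => η (G.germ g y)) (G.tgt g) =
      (dlogForm η (G.src g)).compContinuousLinearMap (G.arrowDeriv g) := by
  have hη' : SmoothForm (n := n) (zeroForm (unitsVal η)) (G.germ g (G.tgt g)) := by
    rw [G.germ_tgt]; exact smoothForm_zeroForm G h
  have h1 := extD_pullForm hη' (G.smooth_germ g)
  rw [pullForm_germ_tgt] at h1
  have h3 : pullForm (G.germ g) (zeroForm (n := n) (unitsVal η)) =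
    zeroForm (unitsVal fun y => η (G.germ g y)) := rfl
  rw [h3] at h1
  unfold dlogForm
  rw [h1]
  unfold unitsVal
  beta_reduce
  rw [G.germ_tgt]
  rfl

/-- The morphism `d log : ℂˣ → 𝓐^1`, `f ↦ f⁻¹ df`. -/
def dlog : CoeffHom (units G) (forms G 1) where
  op := dlogForm (n := n)
  congr h := dlogForm_congr G h
  isSec h := smoothForm_dlogForm G h
  add h h' := dlogForm_add G h h'
  act g hη := dlogForm_act G g hη

lemma extD_zeroForm_const {η : G.Obj → ℂ} {x : G.Obj} {c : ℂ} (h : ∀ᶠ y in 𝓝 x, η y = c) :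
    extD (n := n) (zeroForm η) x = 0 := by
  have h1 : zeroForm (n := n) η =ᶠ[𝓝 x] zeroForm fun _ => c := by
    filter_upwards [h] with y hy
    unfold zeroForm
    rw [hy]
  rw [extD_congr h1, extD_zeroForm]
  have : fderiv ℝ ((fun _ : G.Obj => c) ∘ (chart n x).symm) (chart n x x) = 0 :=
    fderiv_const_apply (c := c)
  rw [this]
  rfl

end Coefficients

/-! ### The site of a smooth étale groupoid, and the smooth Deligne complex -/

/-- The site of `G`: its objects are the open subsets of the space of objects of `G`. -/
structure Site {n : ℕ} (G : SmoothEtaleGroupoid.{u} n) : Type u where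
  opens : TopologicalSpace.Opens G.Obj

namespace Site

variable {n : ℕ} {G : SmoothEtaleGroupoid.{u} n}

/-- A morphism `U ⟶ V` of the site of `G`: a continuous family of arrows `σ(x) : x ⟶ τ(x)`, for
`x ∈ U`, with `τ(x) ∈ V`. -/
@[ext]
structure Hom (U V : Site G) : Type u where
  arr : U.opens → G.Arr
  continuous_arr : Continuous arr
  src_arr : ∀ x, G.src (arr x) = x
  tgt_mem : ∀ x, G.tgt (arr x) ∈ V.opens

/-- The map `U → V` underlying a morphism of the site. -/
def Hom.fn {U V : Site G} (σ : Hom U V) (x : U.opens) : V.opens := ⟨G.tgt (σ.arr x), σ.tgt_mem x⟩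

lemma Hom.continuous_fn {U V : Site G} (σ : Hom U V) : Continuous σ.fn :=
  (G.tgt_etale.contMDiff.continuous.comp σ.continuous_arr).subtype_mk _

/-- The morphism given by the identity arrows over an inclusion `U ⊆ V`. -/
def incl {U V : Site G} (h : U.opens ≤ V.opens) : Hom U V where
  arr x := G.unit x
  continuous_arr := G.continuous_unit.comp continuous_subtype_val
  src_arr x := G.src_unit x
  tgt_mem x := by rw [G.tgt_unit]; exact h x.2

/-- Composition in the site. -/
def Hom.trans {U V W : Site G} (σ : Hom U V) (τ : Hom V W) : Hom U W where
  arr x := G.comp (σ.arr x) (τ.arr (σ.fn x)) (τ.src_arr (σ.fn x)).symm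
  continuous_arr := by
    have h : Continuous fun x => (⟨(σ.arr x, τ.arr (σ.fn x)), (τ.src_arr (σ.fn x)).symm⟩ :
        {z : G.Arr × G.Arr // G.tgt z.1 = G.src z.2}) :=
      (σ.continuous_arr.prodMk (τ.continuous_arr.comp σ.continuous_fn)).subtype_mk _
    exact G.continuous_comp.comp h
  src_arr x := (G.src_comp _ _ _).trans (σ.src_arr x)
  tgt_mem x := (congrArg (· ∈ W.opens) (G.tgt_comp _ _ _)).mpr (τ.tgt_mem (σ.fn x))

lemma comp_congr {g g' h h' : G.Arr} (hg : g = g') (hh : h = h') (e : G.tgt g = G.src h)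
    (e' : G.tgt g' = G.src h') : G.comp g h e = G.comp g' h' e' := by
  subst hg hh
  rfl

lemma Hom.trans_fn {U V W : Site G} (σ : Hom U V) (τ : Hom V W) (x : U.opens) :
    (σ.trans τ).fn x = τ.fn (σ.fn x) := Subtype.ext (G.tgt_comp _ _ _)

instance : Category (Site G) where
  Hom := Hom
  id U := incl le_rfl
  comp σ τ := σ.trans τ
  id_comp {U V} σ := by
    ext x
    have hx : (incl (le_refl U.opens)).fn x = x := Subtype.ext (G.tgt_unit x)
    have h1 := G.unit_comp (σ.arr x)
    refine Eq.trans (comp_congr ?_ ?_ _ _) h1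
    · exact congrArg G.unit (σ.src_arr x).symm
    · rw [hx]
  comp_id {U V} σ := by
    ext x
    exact G.comp_unit (σ.arr x)
  assoc {U V W X} σ τ ρ := by
    ext x
    have h1 := G.assoc (σ.arr x) (τ.arr (σ.fn x)) (ρ.arr (τ.fn (σ.fn x)))
      (τ.src_arr (σ.fn x)).symm (ρ.src_arr (τ.fn (σ.fn x))).symm
    refine Eq.trans (comp_congr rfl ?_ _ _) h1
    rw [Hom.trans_fn]

/-- The inclusion of an open subset, as a morphism of the site. -/
def inclHom {U V : Site G} (h : U.opens ≤ V.opens) : U ⟶ V := incl h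

/-- The inverse image of an open subset under a morphism of the site. -/
lemma exists_square {U V W : Site G} (σ : V ⟶ U) (hW : W.opens ≤ U.opens) (x : V.opens)
    (hxW : (Hom.fn σ x : G.Obj) ∈ W.opens) :
    ∃ (W' : Site G) (hW' : W'.opens ≤ V.opens) (ρ : W' ⟶ W), (x : G.Obj) ∈ W'.opens ∧
      inclHom hW' ≫ σ = ρ ≫ inclHom hW ∧
      ∀ y : W'.opens, Hom.arr ρ y = Hom.arr σ ⟨y.1, hW' y.2⟩ := by
  let O : Set V.opens := (Hom.fn σ) ⁻¹' (Subtype.val ⁻¹' W.opens)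
  have hO : IsOpen O := (W.opens.isOpen.preimage continuous_subtype_val).preimage
    (Hom.continuous_fn σ)
  let W' : Site G := ⟨⟨Subtype.val '' O, V.opens.isOpen.isOpenMap_subtype_val O hO⟩⟩
  have hW' : W'.opens ≤ V.opens := by
    rintro _ ⟨y, -, rfl⟩
    exact y.2
  let ρ : W' ⟶ W :=
    { arr := fun y => Hom.arr σ ⟨y.1, hW' y.2⟩
      continuous_arr := (Hom.continuous_arr σ).comp (continuous_subtype_val.subtype_mk _)
      src_arr := fun y => Hom.src_arr σ ⟨y.1, hW' y.2⟩
      tgt_mem := by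
        rintro ⟨_, ⟨y, hy, rfl⟩⟩
        exact hy }
  refine ⟨W', hW', ρ, ⟨x, hxW, rfl⟩, ?_, fun y => rfl⟩
  apply Hom.ext
  funext y
  have h1 := G.comp_unit (Hom.arr ρ y)
  have h2 := G.unit_comp (Hom.arr ρ y)
  have hy : (Hom.fn (inclHom hW') y) = ⟨y.1, hW' y.2⟩ := Subtype.ext (G.tgt_unit y)
  refine Eq.trans ?_ (h2.trans h1.symm)
  refine comp_congr ?_ ?_ _ _
  · exact congrArg G.unit (Hom.src_arr ρ y).symm
  · exact congrArg (Hom.arr σ) hy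

lemma inclHom_comp {U V W : Site G} (hW : W.opens ≤ V.opens) (hV : V.opens ≤ U.opens) :
    inclHom hW ≫ inclHom hV = inclHom (hW.trans hV) := by
  apply Hom.ext
  funext y
  have h1 := G.comp_unit (G.unit y.1)
  exact h1

/-- The topology of the site: a sieve covers `U` if it contains the inclusions of the members of
an open cover of `U`. -/
def topology (G : SmoothEtaleGroupoid.{u} n) : GrothendieckTopology (Site G) where
  sieves U := {S | ∀ x ∈ U.opens, ∃ (V : Site G) (h : V.opens ≤ U.opens),
    x ∈ V.opens ∧ S.arrows (inclHom h)}
  top_mem' U := fun x hx => ⟨U, le_rfl, hx, trivial⟩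
  pullback_stable' := by
    intro U V S σ hS x hx
    obtain ⟨W, hW, hxW, hSW⟩ := hS _ (Hom.tgt_mem σ ⟨x, hx⟩)
    obtain ⟨W', hW', ρ, hx', e, -⟩ := exists_square σ hW ⟨x, hx⟩ hxW
    refine ⟨W', hW', hx', ?_⟩
    change S.arrows (inclHom hW' ≫ σ)
    rw [e]
    exact S.downward_closed hSW ρ
  transitive' := by
    intro U S hS R hR x hx
    obtain ⟨V, hV, hxV, hSV⟩ := hS x hx
    obtain ⟨W, hW, hxW, hRW⟩ := hR hSV x hxV
    refine ⟨W, hW.trans hV, hxW, ?_⟩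
    rw [← inclHom_comp]
    exact hRW

/-- A morphism `σ : U ⟶ V` of the site as a map over the objects: `x ↦ (t(σ(x)), σ(x)⁻¹)`. -/
def Hom.toSnoc {U V : Site G} (σ : Hom U V) :
    (EtaleSpace.ofOpens U.opens).Hom (G.snoc (EtaleSpace.ofOpens V.opens)) where
  toFun x := ⟨(σ.fn x, G.inv (σ.arr x)), (G.src_inv _).symm⟩
  continuous_toFun :=
    (σ.continuous_fn.prodMk (G.continuous_inv.comp σ.continuous_arr)).subtype_mk _
  proj_toFun x := (G.tgt_inv _).trans (σ.src_arr x)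

end Site

namespace Coeff

variable {n : ℕ} {G : SmoothEtaleGroupoid.{u} n} (F : Coeff G)

lemma act_inv_act (g : G.Arr) (a : F.A) : F.act (G.inv g) (F.act g a) = a := by
  rw [← F.act_comp g (G.inv g) (G.src_inv g).symm, G.comp_inv, F.act_unit]

lemma act_act_inv (g : G.Arr) (a : F.A) : F.act g (F.act (G.inv g) a) = a := by
  rw [← F.act_comp (G.inv g) g (G.tgt_inv g), G.inv_comp, F.act_unit]

/-- The restriction `σ^* c`, `(σ^* c)(x) = c(t(σ(x))) · σ(x)⁻¹`, of sections along a morphism of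
the site. -/
def restrict {U V : Site G} (σ : U ⟶ V) :
    F.sections (EtaleSpace.ofOpens V.opens) →+ F.sections (EtaleSpace.ofOpens U.opens) :=
  (F.pull (Site.Hom.toSnoc σ)).comp (F.twist _)

lemma restrict_apply {U V : Site G} (σ : U ⟶ V) (c : F.sections (EtaleSpace.ofOpens V.opens))
    (x : U.opens) : (F.restrict σ c).1 x =
      F.act (G.inv (Site.Hom.arr σ x)) (c.1 (Site.Hom.fn σ x)) := rfl

lemma restrict_inclHom {U V : Site G} (h : U.opens ≤ V.opens)
    (c : F.sections (EtaleSpace.ofOpens V.opens)) (x : U.opens) :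
    (F.restrict (Site.inclHom h) c).1 x = c.1 ⟨x.1, h x.2⟩ := by
  rw [restrict_apply]
  have hx : Site.Hom.fn (Site.inclHom h) x = ⟨x.1, h x.2⟩ := Subtype.ext (G.tgt_unit _)
  rw [hx]
  have h1 := F.act_act_inv (G.unit x.1) (c.1 ⟨x.1, h x.2⟩)
  rw [F.act_unit] at h1
  exact h1

lemma restrict_comp {U V W : Site G} (τ : W ⟶ V) (σ : V ⟶ U)
    (c : F.sections (EtaleSpace.ofOpens U.opens)) (x : W.opens) :
    (F.restrict (τ ≫ σ) c).1 x = (F.restrict τ (F.restrict σ c)).1 x := by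
  rw [restrict_apply, restrict_apply, restrict_apply]
  let g := Site.Hom.arr τ x
  let h := Site.Hom.arr σ (Site.Hom.fn τ x)
  have e : G.tgt g = G.src h := (Site.Hom.src_arr σ (Site.Hom.fn τ x)).symm
  have h1 : Site.Hom.fn (τ ≫ σ) x = Site.Hom.fn σ (Site.Hom.fn τ x) := Site.Hom.trans_fn _ _ _
  rw [h1]
  generalize c.1 (Site.Hom.fn σ (Site.Hom.fn τ x)) = a
  have h2 := F.act_act_inv (G.comp g h e) a
  rw [F.act_comp] at h2
  have h3 : F.act (G.inv (G.comp g h e)) a = F.act (G.inv g) (F.act (G.inv h) a) := by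
    nth_rewrite 2 [← h2]
    rw [F.act_inv_act, F.act_inv_act]
  exact h3

/-- The presheaf on the site of `G` given by the sections of a `G`-sheaf. -/
def presheaf : (Site G)ᵒᵖ ⥤ AddCommGrpCat.{u} where
  obj U := AddCommGrpCat.of (F.sections (EtaleSpace.ofOpens U.unop.opens))
  map σ := AddCommGrpCat.ofHom (F.restrict σ.unop)
  map_id U := by
    ext c x
    exact F.restrict_inclHom le_rfl c x
  map_comp {U V W} σ τ := by
    ext c x
    exact F.restrict_comp τ.unop σ.unop c x

lemma isSheaf_presheaf : Presheaf.IsSheaf (Site.topology G) F.presheaf := by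
  rw [Presheaf.isSheaf_iff_isSheaf_forget _ _ (forget AddCommGrpCat.{u}),
    isSheaf_iff_isSheaf_of_type]
  intro U S hS fam hfam
  choose V hV hxV hSV using hS
  let s : U.opens → F.A := fun x =>
    ((fam (Site.inclHom (hV x.1 x.2)) (hSV x.1 x.2) :
      F.sections (EtaleSpace.ofOpens (V x.1 x.2).opens))).1 ⟨x.1, hxV x.1 x.2⟩
  have key : ∀ (W : Site G) (h : W.opens ≤ U.opens) (hSW : S.arrows (Site.inclHom h))
      (y : W.opens), (fam (Site.inclHom h) hSW :
        F.sections (EtaleSpace.ofOpens W.opens)).1 y = s ⟨y.1, h y.2⟩ := by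
    intro W h hSW y
    let T := V y.1 (h y.2)
    let I : Site G := ⟨W.opens ⊓ T.opens⟩
    have hc := hfam (Site.inclHom (inf_le_left : I.opens ≤ W.opens))
      (Site.inclHom (inf_le_right : I.opens ≤ T.opens)) hSW (hSV y.1 (h y.2))
      ((Site.inclHom_comp _ _).trans (Site.inclHom_comp _ _).symm)
    have hc' := congrArg (fun q : F.sections (EtaleSpace.ofOpens I.opens) =>
      q.1 ⟨y.1, y.2, hxV y.1 (h y.2)⟩) hc
    have l := F.restrict_inclHom (inf_le_left : I.opens ≤ W.opens) (fam (Site.inclHom h) hSW)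
      ⟨y.1, y.2, hxV y.1 (h y.2)⟩
    have r := F.restrict_inclHom (inf_le_right : I.opens ≤ T.opens) (fam _ (hSV y.1 (h y.2)))
      ⟨y.1, y.2, hxV y.1 (h y.2)⟩
    exact l.symm.trans (hc'.trans r)
  have hs : s ∈ F.sections (EtaleSpace.ofOpens U.opens) := by
    intro x
    obtain ⟨η, h1, h2⟩ := (fam (Site.inclHom (hV x.1 x.2)) (hSV x.1 x.2) :
      F.sections (EtaleSpace.ofOpens (V x.1 x.2).opens)).2 ⟨x.1, hxV x.1 x.2⟩
    refine ⟨η, h1, ?_⟩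
    have h3 : ∀ᶠ w : U.opens in 𝓝 x, (w : G.Obj) ∈ (V x.1 x.2).opens :=
      continuous_subtype_val.continuousAt.eventually
        ((V x.1 x.2).opens.isOpen.mem_nhds (hxV x.1 x.2))
    have h2' : ∀ᶠ y in 𝓝 x.1, ∀ a : (V x.1 x.2).opens, a.1 = y →
        (fam (Site.inclHom (hV x.1 x.2)) (hSV x.1 x.2) :
          F.sections (EtaleSpace.ofOpens (V x.1 x.2).opens)).1 a = η a.1 := by
      have e := nhds_subtype_eq_comap (p := (· ∈ (V x.1 x.2).opens)) (h := hxV x.1 x.2)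
      exact Filter.eventually_comap.1 (e ▸ h2)
    have h4 := ((continuous_subtype_val (p := fun w => w ∈ U.opens)).tendsto x).eventually h2'
    filter_upwards [h3, h4] with w hw hw2
    have h5 := hw2 ⟨w.1, hw⟩ rfl
    rw [key] at h5
    exact h5
  refine ⟨(⟨s, hs⟩ : F.sections (EtaleSpace.ofOpens U.opens)), ?_, ?_⟩
  · intro W σ hσ
    apply Subtype.ext
    funext w
    have hm := (Site.Hom.fn σ w).2
    obtain ⟨W', hW', ρ, hx', e, hρ⟩ := Site.exists_square σ (hV _ hm) w (hxV _ hm)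
    have hc := hfam (Site.inclHom hW') ρ hσ (hSV _ hm) e
    have hc' := congrArg (fun q : F.sections (EtaleSpace.ofOpens W'.opens) =>
      q.1 ⟨w.1, hx'⟩) hc
    have l := F.restrict_inclHom hW' (fam σ hσ) ⟨w.1, hx'⟩
    have r := F.restrict_apply ρ (fam _ (hSV _ hm)) ⟨w.1, hx'⟩
    rw [key, hρ] at r
    have h1 := l.symm.trans (hc'.trans r)
    refine Eq.trans ?_ h1.symm
    refine (F.restrict_apply σ ⟨s, hs⟩ w).trans ?_
    have h2 : (⟨(Site.Hom.fn ρ ⟨w.1, hx'⟩).1, hV _ hm (Site.Hom.fn ρ ⟨w.1, hx'⟩).2⟩ : U.opens) =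
      Site.Hom.fn σ w := Subtype.ext (congrArg G.tgt (hρ ⟨w.1, hx'⟩))
    exact congrArg (fun q => F.act (G.inv (Site.Hom.arr σ w)) (s q)) h2.symm
  · intro t ht
    apply Subtype.ext
    funext x
    have h1 := congrArg (fun q : F.sections (EtaleSpace.ofOpens (V x.1 x.2).opens) =>
      q.1 ⟨x.1, hxV x.1 x.2⟩) (ht (Site.inclHom (hV x.1 x.2)) (hSV x.1 x.2))
    exact (F.restrict_inclHom (hV x.1 x.2) t ⟨x.1, hxV x.1 x.2⟩).symm.trans h1

/-- The sheaf on the site of `G` given by a `G`-sheaf. -/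
def sheaf : Sheaf (Site.topology G) AddCommGrpCat.{u} := ⟨F.presheaf, F.isSheaf_presheaf⟩

end Coeff

/-- The morphism of sheaves on the site of `G` given by a morphism of `G`-sheaves. -/
def CoeffHom.sheafHom {n : ℕ} {G : SmoothEtaleGroupoid.{u} n} {F F' : Coeff G}
    (L : CoeffHom F F') : F.sheaf ⟶ F'.sheaf where
  hom :=
    { app := fun U => AddCommGrpCat.ofHom (L.map (EtaleSpace.ofOpens U.unop.opens))
      naturality := fun U V σ => by
        ext c
        change L.map _ (F.restrict σ.unop c) = F'.restrict σ.unop (L.map _ c)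
        exact (L.map_pull _ _).trans (congrArg _ (L.map_twist _ c)) }

section Deligne

variable {n : ℕ} (G : SmoothEtaleGroupoid.{u} n)

lemma dForms_comp_inclusion (p : ℕ) :
    (inclusion G p).sheafHom ≫ (dForms G 0).sheafHom = 0 := by
  ext U c
  apply Subtype.ext
  funext x
  obtain ⟨η, ⟨k, hk, h1⟩, h2⟩ := c.2 x
  have h3 := (inclusion G p).app_eventuallyEq _ h2
  refine ((dForms G 0).app_eq _ h3).trans ?_
  exact extD_zeroForm_const G h1

lemma dForms_comp (l : ℕ) : (dForms G l).sheafHom ≫ (dForms G (l + 1)).sheafHom = 0 := by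
  ext U c
  apply Subtype.ext
  funext x
  obtain ⟨η, h1, h2⟩ := c.2 x
  have h3 := (dForms G l).app_eventuallyEq _ h2
  refine ((dForms G (l + 1)).app_eq _ h3).trans ?_
  exact extD_extD h1
end Deligne

section DeligneComplex

open scoped ZeroObject

variable {n : ℕ} (G : SmoothEtaleGroupoid.{u} n)

/-- The category of abelian `G`-sheaves, as sheaves on the site of `G`. -/
abbrev GSheaf : Type (u + 1) := Sheaf (Site.topology G) AddCommGrpCat.{u}

/-- The terms of the smooth Deligne complex `ℤ(3)_D^∞`. -/
def deligneX : ℕ → GSheaf G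
  | 0 => (constants G 3).sheaf
  | 1 => (forms G 0).sheaf
  | 2 => (forms G 1).sheaf
  | 3 => (forms G 2).sheaf
  | _ + 4 => 0

/-- The differentials of the smooth Deligne complex `ℤ(3)_D^∞`. -/
def deligneD : (k : ℕ) → (deligneX G k ⟶ deligneX G (k + 1))
  | 0 => (inclusion G 3).sheafHom
  | 1 => (dForms G 0).sheafHom
  | 2 => (dForms G 1).sheafHom
  | _ + 3 => 0

/-- The smooth Deligne complex `ℤ(3)_D^∞`, that is `ℤ(3) → 𝓐^0 → 𝓐^1 → 𝓐^2`, with `ℤ(3)` in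
degree `0`. -/
def deligne : CochainComplex (GSheaf G) ℕ :=
  CochainComplex.of (deligneX G) (deligneD G) fun k => match k with
    | 0 => dForms_comp_inclusion G 3
    | 1 => dForms_comp G 0
    | _ + 2 => Limits.comp_zero

end DeligneComplex

/-! ### Hypercohomology -/

section Hypercohomology

variable {n : ℕ} {G : SmoothEtaleGroupoid.{u} n}

/-- The sections `F(U)` of a sheaf over an open set of objects. -/
abbrev sec (F : GSheaf G) (U : Site G) : AddCommGrpCat.{u} := F.obj.obj (Opposite.op U)

/-- The restriction of sections along a morphism of the site. -/
def secMap (F : GSheaf G) {U V : Site G} (σ : U ⟶ V) : sec F V →+ sec F U :=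
  (F.obj.map σ.op).hom

/-- The map on sections given by a morphism of sheaves. -/
def homOn {F F' : GSheaf G} (φ : F ⟶ F') (U : Site G) : sec F U →+ sec F' U :=
  (φ.hom.app (Opposite.op U)).hom

lemma homOn_secMap {F F' : GSheaf G} (φ : F ⟶ F') {U V : Site G} (σ : U ⟶ V) (c : sec F V) :
    homOn φ U (secMap F σ c) = secMap F' σ (homOn φ V c) :=
  ConcreteCategory.congr_hom (φ.hom.naturality σ.op) c

/-- The space of all objects of `G`, as an object of the site. -/
def Site.whole (G : SmoothEtaleGroupoid.{u} n) : Site G := ⟨⊤⟩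

/-- The group `Γ_inv(G, F)` of invariant sections of a `G`-sheaf over the space of objects. -/
def invSections (F : GSheaf G) : AddSubgroup (sec F (Site.whole G)) where
  carrier := {c | ∀ (U : Site G) (σ τ : U ⟶ Site.whole G), secMap F σ c = secMap F τ c}
  zero_mem' := fun U σ τ => by simp
  add_mem' := fun {a b} ha hb U σ τ => by rw [map_add, map_add, ha U σ τ, hb U σ τ]
  neg_mem' := fun {a} ha U σ τ => by rw [map_neg, map_neg, ha U σ τ]

/-- The map on invariant sections given by a morphism of sheaves. -/
def invMap {F F' : GSheaf G} (φ : F ⟶ F') : invSections F →+ invSections F' :=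
  ((homOn φ (Site.whole G)).comp (invSections F).subtype).codRestrict _ fun c U σ τ => by
    change secMap F' σ (homOn φ _ c.1) = secMap F' τ (homOn φ _ c.1)
    rw [← homOn_secMap, ← homOn_secMap, c.2 U σ τ]

/-- The group of `k`-cocycles of the complex `Γ_inv(G, T^•)`. -/
abbrev invCocycles (T : CochainComplex (GSheaf G) ℕ) (k : ℕ) :
    AddSubgroup (invSections (T.X k)) := (invMap (T.d k (k + 1))).ker

/-- The cohomology in degree `k + 1` of the complex `Γ_inv(G, T^•)`. -/
abbrev InvCohomology (T : CochainComplex (GSheaf G) ℕ) (k : ℕ) : Type u :=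
  invCocycles T (k + 1) ⧸ (invMap (T.d k (k + 1))).range.addSubgroupOf (invCocycles T (k + 1))

/-- A quasi-isomorphism from `K` to a cochain complex of injective `G`-sheaves. For such a
resolution, `ℍ^{k+1}(G, K)` is `InvCohomology T k`. -/
structure InjectiveModel (K : CochainComplex (GSheaf G) ℕ) where
  T : CochainComplex (GSheaf G) ℕ
  η : K ⟶ T
  quasiIso : QuasiIso η
  injective : ∀ i, Injective (T.X i)

end Hypercohomology

/-! ### The Čech complex with coefficients in `ℂˣ → 𝓐^1 → 𝓐^2` -/

section Cech

variable {n : ℕ} (G : SmoothEtaleGroupoid.{u} n)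

/-- The group `Γ(G_k, ε_k^* ℂˣ)`, written additively. -/
abbrev CechUnits (k : ℕ) : Type u := (units G).sections (G.nerve k)

/-- The group `Γ(G_k, ε_k^* 𝓐^l)`. -/
abbrev CechForms (k l : ℕ) : Type u := (forms G l).sections (G.nerve k)

variable {G}

/-- The horizontal differential on `Γ(G_k, ε_k^* 𝓐^l)`. -/
abbrev δForms {k l : ℕ} : CechForms G k l →+ CechForms G (k + 1) l := (forms G l).delta k

/-- The horizontal differential on `Γ(G_k, ε_k^* ℂˣ)`. -/
abbrev δUnits {k : ℕ} : CechUnits G k →+ CechUnits G (k + 1) := (units G).delta k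

/-- The exterior derivative of forms on `G_k`. -/
abbrev dCech {k l : ℕ} : CechForms G k l →+ CechForms G k (l + 1) := (dForms G l).map (G.nerve k)

/-- The logarithmic derivative on `G_k`. -/
abbrev dlogCech {k : ℕ} : CechUnits G k →+ CechForms G k 1 := (dlog G).map (G.nerve k)

variable (G)

/-- Čech cochains `(f, a)` of total degree `1`. -/
abbrev Cech1 : Type u := CechUnits G 1 × CechForms G 0 1

/-- Čech cochains `(h, A, B)` of total degree `2`. -/
abbrev Cech2 : Type u := CechUnits G 2 × CechForms G 1 1 × CechForms G 0 2

/-- Čech cochains of total degree `3`. -/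
abbrev Cech3 : Type u := CechUnits G 3 × CechForms G 2 1 × CechForms G 1 2

/-- The differential `(f, a) ↦ (δf, δa + d log f, da)`. In total degree `k` the differential of
the total complex is `δ - (-1)^k d`. -/
def D1 : Cech1 G →+ Cech2 G :=
  (δUnits.comp (AddMonoidHom.fst _ _)).prod
    ((δForms.comp (AddMonoidHom.snd _ _) + dlogCech.comp (AddMonoidHom.fst _ _)).prod
      (dCech.comp (AddMonoidHom.snd _ _)))

/-- The differential `(h, A, B) ↦ (δh, δA - d log h, δB - dA)`. -/
def D2 : Cech2 G →+ Cech3 G :=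
  (δUnits.comp (AddMonoidHom.fst _ _)).prod
    (((δForms.comp ((AddMonoidHom.fst _ _).comp (AddMonoidHom.snd _ _))) -
        dlogCech.comp (AddMonoidHom.fst _ _)).prod
      (δForms.comp ((AddMonoidHom.snd _ _).comp (AddMonoidHom.snd _ _)) -
        dCech.comp ((AddMonoidHom.fst _ _).comp (AddMonoidHom.snd _ _))))

/-- The group of `2`-cocycles of the Čech complex. -/
abbrev cechCocycles : AddSubgroup (Cech2 G) := (D2 G).ker

/-- The second cohomology group of the Čech complex. -/
abbrev CechH2 : Type u := cechCocycles G ⧸ (D1 G).range.addSubgroupOf (cechCocycles G)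

end Cech

/-! ### The comparison of Čech cocycles and hypercohomology classes -/

section Comparison

variable {n : ℕ} {G : SmoothEtaleGroupoid.{u} n}

/-- The restriction of a local section of an étale space to an open subset. -/
def EtaleSpace.Hom.restr {Z : EtaleSpace G.Obj} {U V : Site G} (h : U.opens ≤ V.opens)
    (f : (EtaleSpace.ofOpens V.opens).Hom Z) : (EtaleSpace.ofOpens U.opens).Hom Z where
  toFun x := f.toFun ⟨x.1, h x.2⟩
  continuous_toFun := f.continuous_toFun.comp (continuous_subtype_val.subtype_mk _)
  proj_toFun x := f.proj_toFun ⟨x.1, h x.2⟩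

/-- Composition of maps over the base. -/
def EtaleSpace.Hom.comp {X : Type u} [TopologicalSpace X] {Z W V : EtaleSpace X}
    (f : Z.Hom W) (q : W.Hom V) : Z.Hom V where
  toFun x := q.toFun (f.toFun x)
  continuous_toFun := q.continuous_toFun.comp f.continuous_toFun
  proj_toFun x := (q.proj_toFun _).trans (f.proj_toFun x)

/-- The group `Γ(Z, p^* F)` of global sections over an étale space `p : Z → G_0` of the pull-back
of a `G`-sheaf `F`. Such a section is a family which assigns to every local section
`f : U → Z` of `p` an element of `F(U)`, compatibly with restriction to open subsets. -/
def etaleSections (F : GSheaf G) (Z : EtaleSpace G.Obj) :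
    AddSubgroup (∀ U : Site G, (EtaleSpace.ofOpens U.opens).Hom Z → sec F U) where
  carrier := {c | ∀ (U V : Site G) (h : U.opens ≤ V.opens)
    (f : (EtaleSpace.ofOpens V.opens).Hom Z), secMap F (Site.inclHom h) (c V f) = c U (f.restr h)}
  zero_mem' := fun U V h f => by simp
  add_mem' := fun {a b} ha hb U V h f => by simp [ha U V h f, hb U V h f]
  neg_mem' := fun {a} ha U V h f => by simp [ha U V h f]

/-- The map on sections over an étale space given by a morphism of `G`-sheaves. -/
def etaleMap {F F' : GSheaf G} (φ : F ⟶ F') (Z : EtaleSpace G.Obj) :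
    etaleSections F Z →+ etaleSections F' Z where
  toFun c := ⟨fun U f => homOn φ U (c.1 U f), fun U V h f => by
    rw [← homOn_secMap, c.2 U V h f]⟩
  map_zero' := Subtype.ext (funext fun _ => funext fun _ => map_zero _)
  map_add' _ _ := Subtype.ext (funext fun _ => funext fun _ => map_add _ _ _)

/-- The pull-back of sections along a map of étale spaces. -/
def etalePull (F : GSheaf G) {Z W : EtaleSpace G.Obj} (q : Z.Hom W) :
    etaleSections F W →+ etaleSections F Z where
  toFun c := ⟨fun U f => c.1 U (f.comp q), fun U V h f => c.2 U V h (f.comp q)⟩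
  map_zero' := rfl
  map_add' _ _ := rfl

/-- A section over the space of objects, as a section over `G_0`. -/
def etaleOfSec (F : GSheaf G) (c : sec F (Site.whole G)) :
    etaleSections F (G.nerve 0) :=
  ⟨fun _ _ => secMap F (Site.inclHom le_top) c, fun U V h f => by
    change secMap F _ (secMap F _ c) = _
    have h1 := ConcreteCategory.congr_hom
      (F.obj.map_comp (Site.inclHom (le_top : V.opens ≤ (Site.whole G).opens)).op
        (Site.inclHom h).op) c
    rw [← op_comp, Site.inclHom_comp] at h1
    exact h1.symm⟩

/-- A section over `Z` of a sheaf given by germs of functions, as a section of the associated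
sheaf on the site. -/
def etaleOfCoeff (F : Coeff G) {Z : EtaleSpace G.Obj} (c : F.sections Z) :
    etaleSections F.sheaf Z :=
  ⟨fun _ f => F.pull f c, fun _ _ h f =>
    Subtype.ext (funext fun x => F.restrict_inclHom h (F.pull f c) x)⟩

/-- `e` is the section `(z, g) ↦ c(z) · g`: whenever `f = (z, g)` is a local section over `U` of
`G.snoc Z`, and `f'` is a local section of `Z` over `V` with `f'(s(g(x))) = z(x)` for `x ∈ U`, the
element `e(f)` is the restriction of `c(f')` along the morphism `g⁻¹ : U ⟶ V`. -/
def IsTwist {F : GSheaf G} {Z : EtaleSpace G.Obj} (c : etaleSections F Z)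
    (e : etaleSections F (G.snoc Z)) : Prop :=
  ∀ (U V : Site G) (f : (EtaleSpace.ofOpens U.opens).Hom (G.snoc Z))
    (f' : (EtaleSpace.ofOpens V.opens).Hom Z) (σ : U ⟶ V),
    (∀ x : U.opens, Site.Hom.arr σ x = G.inv (f.toFun x).1.2) →
    (∀ x : U.opens, f'.toFun (Site.Hom.fn σ x) = (f.toFun x).1.1) →
    e.1 U f = secMap F σ (c.1 V f')

/-- `e = δ c`, for the horizontal differential `δ` on sections over the nerve. -/
def IsDelta {F : GSheaf G} {k : ℕ} (c : etaleSections F (G.nerve k))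
    (e : etaleSections F (G.nerve (k + 1))) : Prop :=
  ∃ b : etaleSections F (G.nerve (k + 1)), IsTwist (Z := G.nerve k) c b ∧
    e = ∑ i : Fin (k + 1), (-1 : ℤ) ^ (i : ℕ) • etalePull F (G.face k i) c +
      (-1 : ℤ) ^ (k + 1) • b

/-- The value of a form at a point of the nerve. -/
def formAt {k l : ℕ} (α : CechForms G k l) (z : (G.nerve k).carrier) : Alt n l := α.1 z

variable (G) in
/-- `(x₃, x₂, x₁, x₀)` is a lift of the Čech cocycle `(h, A, B)` to a Čech cocycle with
coefficients in the Deligne complex: `h = exp((2πi)⁻² x₂)`, `x₁ = (2πi)² A`, `x₀ = (2πi)² B` and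
`x₃ = δ x₂`. -/
structure IsDeligneLift (c : Cech2 G) (x₃ : (constants G 3).sections (G.nerve 3))
    (x₂ : CechForms G 2 0) (x₁ : CechForms G 1 1) (x₀ : CechForms G 0 2) : Prop where
  exp_eq : ∀ z, unitsVal c.1.1 z =
    Complex.exp (((2 * Real.pi * Complex.I) ^ 2)⁻¹ * formAt x₂ z 0)
  eq₁ : ∀ z, formAt x₁ z = ((2 * Real.pi * Complex.I) ^ 2 : ℂ) • formAt c.2.1 z
  eq₀ : ∀ z, formAt x₀ z = ((2 * Real.pi * Complex.I) ^ 2 : ℂ) • formAt c.2.2 z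
  eq₃ : (inclusion G 3).map (G.nerve 3) x₃ = δForms x₂

/-- The Čech cocycle `c = (h, A, B)` and the cocycle `ξ` of `Γ_inv(G, T^•)` define the same
hypercohomology class: the image in `T^•` of a lift of `c` to the Deligne complex and `ξ` are
cohomologous in the total complex of the double complex `Γ(G_k, ε_k^* T^l)`, whose differential in
total degree `k` is `δ + (-1)^k d`. -/
def Corresponds (R : InjectiveModel (deligne G)) (c : Cech2 G)
    (ξ : invSections (R.T.X 3)) : Prop :=
  ∃ x₃ x₂ x₁ x₀, IsDeligneLift G c x₃ x₂ x₁ x₀ ∧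
  ∃ (b₀ : etaleSections (R.T.X 2) (G.nerve 0)) (b₁ : etaleSections (R.T.X 1) (G.nerve 1))
    (b₂ : etaleSections (R.T.X 0) (G.nerve 2)),
    etaleMap (R.η.f 3) (G.nerve 0) (etaleOfCoeff (forms G 2) x₀) -
      etaleOfSec (R.T.X 3) ξ.1 = etaleMap (R.T.d 2 3) (G.nerve 0) b₀ ∧
    IsDelta b₀ (etaleMap (R.η.f 2) (G.nerve 1) (etaleOfCoeff (forms G 1) x₁) -
      etaleMap (R.T.d 1 2) (G.nerve 1) b₁) ∧
    IsDelta b₁ (etaleMap (R.η.f 1) (G.nerve 2) (etaleOfCoeff (forms G 0) x₂) -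
      etaleMap (R.T.d 0 1) (G.nerve 2) b₂) ∧
    IsDelta b₂ (etaleMap (R.η.f 0) (G.nerve 3) (etaleOfCoeff (constants G 3) x₃))

end Comparison

/-! ### Leray descriptions -/

/-- A morphism of smooth étale groupoids. -/
structure GroupoidHom {n m : ℕ} (G : SmoothEtaleGroupoid.{u} n)
    (H : SmoothEtaleGroupoid.{v} m) where
  obj : G.Obj → H.Obj
  arr : G.Arr → H.Arr
  smooth_obj : ContMDiff (𝓡 n) (𝓡 m) ∞ obj
  smooth_arr : ContMDiff (𝓡 n) (𝓡 m) ∞ arr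
  src_arr : ∀ g, H.src (arr g) = obj (G.src g)
  tgt_arr : ∀ g, H.tgt (arr g) = obj (G.tgt g)
  unit : ∀ x, arr (G.unit x) = H.unit (obj x)
  inv : ∀ g, arr (G.inv g) = H.inv (arr g)
  comp : ∀ g h e, arr (G.comp g h e) =
    H.comp (arr g) (arr h) ((tgt_arr g).trans ((congrArg obj e).trans (src_arr h).symm))

/-- The morphism is étale Morita: the square formed by `arr`, `obj × obj` and the maps `(s, t)` is
cartesian, and the map `(x, h) ↦ s(h)`, on pairs with `t(h) = obj x`, is an étale surjection. Since
`s` and `t` are étale, this map is étale if and only if `obj` is. -/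
structure GroupoidHom.IsEtaleMorita {n m : ℕ} {G : SmoothEtaleGroupoid.{u} n}
    {H : SmoothEtaleGroupoid.{v} m} (F : GroupoidHom G H) : Prop where
  cartesian : IsHomeomorph fun g : G.Arr =>
    (⟨((G.src g, G.tgt g), F.arr g), F.src_arr g, F.tgt_arr g⟩ :
      {q : (G.Obj × G.Obj) × H.Arr // H.src q.2 = F.obj q.1.1 ∧ H.tgt q.2 = F.obj q.1.2})
  etale : IsLocalDiffeomorph (𝓡 n) (𝓡 m) ∞ F.obj
  surjective : ∀ y : H.Obj, ∃ (x : G.Obj) (h : H.Arr), H.tgt h = F.obj x ∧ H.src h = y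

/-- A Leray description of `H`: an étale Morita morphism `G ⟶ H` whose source is Leray. -/
structure LerayDescription {n m : ℕ} (G : SmoothEtaleGroupoid.{u} n)
    (H : SmoothEtaleGroupoid.{v} m) extends GroupoidHom G H where
  isEtaleMorita : toGroupoidHom.IsEtaleMorita
  isLeray : G.IsLeray

/-! ### Gerbes with connection -/

section Gerbes

variable {n : ℕ} (G : SmoothEtaleGroupoid.{u} n)

variable {G} in
/-- A value of the sheaf `ℂˣ`, written multiplicatively. -/
def unitOf (a : (units G).A) : ℂˣ := Additive.toMul (show Additive ℂˣ from a)

/-- A smooth principal `ℂˣ`-bundle with connection (equivalently, a complex line bundle with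
connection) on a space `Z` étale over the objects of `G`. The smooth structure is given by the
(possibly discontinuous) sections which are smooth near a given point, and the connection by the
connection form `conn σ` of a section `σ`, which is meaningful at the points near which `σ` is
smooth. -/
structure LineBundle (Z : EtaleSpace G.Obj) : Type (u + 1) where
  P : Type u
  [action : MulAction ℂˣ P]
  π : P → Z.carrier
  surjective : Function.Surjective π
  π_smul : ∀ (a : ℂˣ) p, π (a • p) = π p
  existsUnique_smul : ∀ p q, π p = π q → ∃! a : ℂˣ, a • p = q
  SmoothAt : {σ : Z.carrier → P // ∀ z, π (σ z) = z} → Z.carrier → Prop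
  eventually_smoothAt : ∀ σ z, SmoothAt σ z → ∀ᶠ w in 𝓝 z, SmoothAt σ w
  exists_smoothAt : ∀ z, ∃ σ, SmoothAt σ z
  smoothAt_iff : ∀ σ τ z (f : Z.carrier → (units G).A), SmoothAt σ z →
    (∀ᶠ w in 𝓝 z, τ.1 w = unitOf (f w) • σ.1 w) →
    (SmoothAt τ z ↔ (units G).SecAt Z f z)
  conn : {σ : Z.carrier → P // ∀ z, π (σ z) = z} → Z.carrier → (forms G 1).A
  secAt_conn : ∀ σ z, SmoothAt σ z → (forms G 1).SecAt Z (conn σ) z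
  conn_smul : ∀ σ τ z (f : Z.carrier → (units G).A), SmoothAt σ z → SmoothAt τ z →
    (∀ᶠ w in 𝓝 z, τ.1 w = unitOf (f w) • σ.1 w) →
    conn τ z = conn σ z + (dlog G).app Z f z

attribute [instance] LineBundle.action

variable {G}

/-- The (possibly discontinuous) sections of a bundle. -/
abbrev LineBundle.Sect {Z : EtaleSpace G.Obj} (L : LineBundle G Z) : Type u :=
  {σ : Z.carrier → L.P // ∀ z, L.π (σ z) = z}

/-- The arrow `g₁` of a composable pair `(g₁, g₂)`. -/
def fstArr (z : (G.nerve 2).carrier) : G.Arr := z.1.1.1.2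

/-- The arrow `g₂` of a composable pair `(g₁, g₂)`. -/
def sndArr (z : (G.nerve 2).carrier) : G.Arr := z.1.2

lemma tgt_fstArr (z : (G.nerve 2).carrier) : G.tgt (fstArr z) = G.src (sndArr z) := z.2

/-- The composite `g₁g₂` of a composable pair `(g₁, g₂)`. -/
def compArr (z : (G.nerve 2).carrier) : G.Arr := G.comp (fstArr z) (sndArr z) (tgt_fstArr z)

variable (G)

/-- A gerbe with connection on `G`: a principal `ℂˣ`-bundle with connection over the space of
arrows with an associative product `L_{g₁} ⊗ L_{g₂} → L_{g₁g₂}`, smooth and compatible with the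
connections, and a complex `2`-form `B` on the objects (the curving) whose coboundary
`B(t(g)) - B(s(g)) · g` is the curvature of the bundle. -/
structure Gerbe : Type (u + 1) where
  L : LineBundle G G.arrows
  mul : ∀ p q : L.P, G.tgt (L.π p) = G.src (L.π q) → L.P
  π_mul : ∀ p q e, L.π (mul p q e) = G.comp (L.π p) (L.π q) e
  smul_mul : ∀ (a b : ℂˣ) p q e e', mul (a • p) (b • q) e' = (a * b) • mul p q e
  mul_assoc : ∀ p q r e₁ e₂ e₃ e₄, mul (mul p q e₁) r e₂ = mul p (mul q r e₃) e₄
  mul_smooth : ∀ (σ₁ σ₂ σ₃ : L.Sect) (z : (G.nerve 2).carrier)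
    (h : (G.nerve 2).carrier → (units G).A),
    L.SmoothAt σ₁ (fstArr z) → L.SmoothAt σ₂ (sndArr z) → L.SmoothAt σ₃ (compArr z) →
    (∀ᶠ w in 𝓝 z, ∀ e, mul (σ₁.1 (fstArr w)) (σ₂.1 (sndArr w)) e =
      unitOf (h w) • σ₃.1 (compArr w)) →
    (units G).SecAt (G.nerve 2) h z ∧
      (forms G 1).act (sndArr z) (L.conn σ₁ (fstArr z)) + L.conn σ₂ (sndArr z) =
        L.conn σ₃ (compArr z) + (dlog G).app (G.nerve 2) h z
  B : CechForms G 0 2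
  curvature : ∀ (σ : L.Sect) (g : G.Arr), L.SmoothAt σ g →
    (dForms G 1).app G.arrows (L.conn σ) g =
      B.1 (G.tgt g) - (forms G 2).act g (B.1 (G.src g))

variable {G}

/-- An isomorphism of gerbes with connection `𝒢 ⟶ 𝒢'`: a principal `ℂˣ`-bundle with connection
`Q` over the objects and an isomorphism `Q_{s(g)}⁻¹ ⊗ L_g ⊗ Q_{t(g)} ≅ L'_g`, compatible with the
products, smooth and compatible with the connections, such that the curvings differ by the
curvature of `Q`. -/
structure Gerbe.Iso (𝒢 𝒢' : Gerbe G) : Type (u + 1) where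
  Q : LineBundle G (G.nerve 0)
  map : ∀ (p q : Q.P) (r : 𝒢.L.P), Q.π p = G.src (𝒢.L.π r) → Q.π q = G.tgt (𝒢.L.π r) → 𝒢'.L.P
  π_map : ∀ p q r e₁ e₂, 𝒢'.L.π (map p q r e₁ e₂) = 𝒢.L.π r
  map_smul : ∀ (a b c : ℂˣ) p q r e₁ e₂ e₃ e₄,
    map (a • p) (b • q) (c • r) e₁ e₂ = (a⁻¹ * c * b) • map p q r e₃ e₄
  map_mul : ∀ p q k r r' e₁ e₂ e₃ e₄ e₅ e₆ e₇ e₈,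
    𝒢'.mul (map p q r e₁ e₂) (map q k r' e₃ e₄) e₅ = map p k (𝒢.mul r r' e₆) e₇ e₈
  map_smooth : ∀ (ρ₁ ρ₂ : Q.Sect) (σ : 𝒢.L.Sect) (σ' : 𝒢'.L.Sect) (g : G.Arr)
    (f : G.Arr → (units G).A),
    Q.SmoothAt ρ₁ (G.src g) → Q.SmoothAt ρ₂ (G.tgt g) → 𝒢.L.SmoothAt σ g → 𝒢'.L.SmoothAt σ' g →
    (∀ᶠ w in 𝓝 g, ∀ e₁ e₂, map (ρ₁.1 (G.src w)) (ρ₂.1 (G.tgt w)) (σ.1 w) e₁ e₂ =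
      unitOf (f w) • σ'.1 w) →
    (units G).SecAt G.arrows f g ∧
      𝒢.L.conn σ g + Q.conn ρ₂ (G.tgt g) - (forms G 1).act g (Q.conn ρ₁ (G.src g)) =
        𝒢'.L.conn σ' g + (dlog G).app G.arrows f g
  curving : ∀ (ρ : Q.Sect) (x : G.Obj), Q.SmoothAt ρ x →
    𝒢'.B.1 x = 𝒢.B.1 x + (dForms G 1).app (G.nerve 0) (Q.conn ρ) x

/-- `(h, A, B)` is the triple which describes the gerbe `𝒢` with respect to some global smooth
section `σ` of its bundle: `A` is the connection form of `σ`, `σ(g₁)σ(g₂) = h(g₁, g₂) σ(g₁g₂)`, and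
`B` is the curving. -/
def Gerbe.Presents (𝒢 : Gerbe G) (c : Cech2 G) : Prop :=
  ∃ σ : 𝒢.L.Sect, (∀ g, 𝒢.L.SmoothAt σ g) ∧
    (∀ (z : (G.nerve 2).carrier) e, 𝒢.mul (σ.1 (fstArr z)) (σ.1 (sndArr z)) e =
      unitOf (c.1.1 z) • σ.1 (compArr z)) ∧
    (∀ z : (G.nerve 1).carrier, c.2.1.1 z = 𝒢.L.conn σ z.1.2) ∧
    c.2.2 = 𝒢.B

end Gerbes

end EtaleGerbe

end

open EtaleGerbe

noncomputable section
open CategoryTheory Filter Topology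
open scoped Manifold ContDiff
namespace EtaleGerbe

/-! ### Sheaves of abelian groups as families of stalks -/

/-! Over a Leray groupoid nothing obstructs the trivialisation of a bundle over the arrows or over
the objects. The exponential sequence `0 → ℤ(3) → 𝓐⁰ → ℂˣ → 0` squeezes the first cohomology of `ℂˣ`
between that of `𝓐⁰`, which vanishes by partitions of unity, and the second cohomology of `ℤ(3)`,
which vanishes because the components are contractible. So the bundle of a gerbe has a global smooth
section (`LineBundle.exists_smooth`). With respect to it, associativity, compatibility of the
product with the connection, and the curvature condition become `δh = 1`, `δA = d log h` and `δB =
dA`. Conversely a cocycle defines these structures on the trivial bundle. In the same way a global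
section of the bundle `Q` of an isomorphism turns the isomorphism into a 1-cochain `(f, a)` whose
differential is the difference of the two cocycles, and each such cochain defines an isomorphism
(`Gerbe.nonempty_iso_iff`).

The comparison with hypercohomology is a chase in two double complexes over the nerve. Since
`(2πi)⁻²` times the kernel `ℤ(3)` is `2πiℤ`, taking logarithms over `G_2` and `G_1` replaces
cocycles and coboundaries with values in `ℂˣ → 𝓐¹ → 𝓐²` by those with values in the Deligne complex
(`exists_isDeligneLift`, `mem_range_D1_iff`). These are compared with a complex `T` of injectives.
In the direction of the nerve the complex of an injective sheaf is exact, and its kernel in degree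
zero is the group of invariant sections (`exists_etaleDelta_eq`, `exists_etaleOfSec_eq`); hence a
Deligne cocycle can be pushed to an invariant section of `T³`. In the direction of the sheaf degree,
the cone of the quasi-isomorphism is a resolution over each étale space (`resolution_cone`). Its
terms are acyclic where needed, so that closed sections of `T` can be pulled back to Deligne
cochains (`exists_etale_lift_succ`). The zigzags give an additive relation between cocycles which
respects coboundaries on both sides, and such a relation is an isomorphism of quotients
(`exists_quotient_equiv`). Total degree three needs forms to be acyclic only over `G_0` and `G_1`,
which are paracompact and Hausdorff; over `G_2` only the constant sheaf matters, and over `G_3`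
nothing is needed.

Both properties of injective sheaves come from coinduction: an injective `T` is a retract of the
presheaf `U ↦ ∏_{W → U} T(W)`. Extension by zero in the product shows that `T` is flasque on étale
spaces (`flasque_gs`). Evaluation at translated sections gives a contracting homotopy of the complex
over the nerve (`exists_contraction`).

Cohomology on a space enters only through its vanishing. The sheaf `F.Q` of all families of germs'
values modulo `F` fits in a short exact sequence with a flasque middle term, so `H¹(F)` is the group
of global sections of `F.Q` modulo families, and each further `Q` shifts the degree by one. All the
vanishing statements (flasque sheaves, fine sheaves, and constant sheaves on spaces contractible to
a discrete set) are proved in degree one for a class of sheaves and then moved up by this shift. -/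

/-- A sheaf of abelian groups on `X`, given by its stalks and by the predicate that a family of
elements of the stalks is a section near a point. -/
structure GermSheaf (X : Type u) [TopologicalSpace X] : Type (u + 1) where
  stalk : X → Type u
  [grp : ∀ x, AddCommGroup (stalk x)]
  IsSec : (∀ x, stalk x) → X → Prop
  congr : ∀ {s t : ∀ x, stalk x} {x}, (∀ᶠ y in 𝓝 x, s y = t y) → IsSec s x → IsSec t x
  eventually : ∀ {s x}, IsSec s x → ∀ᶠ y in 𝓝 x, IsSec s y
  zero : ∀ x, IsSec (fun _ => 0) x
  add : ∀ {s t x}, IsSec s x → IsSec t x → IsSec (fun y => s y + t y) x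
  neg : ∀ {s x}, IsSec s x → IsSec (fun y => -s y) x
  exists_isSec : ∀ x (a : stalk x), ∃ s, IsSec s x ∧ s x = a
  unique : ∀ {s t x}, IsSec s x → IsSec t x → s x = t x → ∀ᶠ y in 𝓝 x, s y = t y

attribute [instance] GermSheaf.grp

namespace GermSheaf

variable {X : Type u} [TopologicalSpace X] {Y : Type u} [TopologicalSpace Y]
  {Z : Type u} [TopologicalSpace Z]

lemma sub (F : GermSheaf X) {s t : ∀ x, F.stalk x} {x : X} (hs : F.IsSec s x) (ht : F.IsSec t x) :
    F.IsSec (fun y => s y - t y) x := by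
  have := F.add hs (F.neg ht)
  simpa only [← sub_eq_add_neg] using this

/-- The family `s` is a global section. -/
def IsGlobal (F : GermSheaf X) (s : ∀ x, F.stalk x) : Prop := ∀ x, F.IsSec s x

/-- A map from a sheaf `F` on `X` to a sheaf `F'` on `Y` over a map `f : Y → X`. -/
@[ext]
structure Cohom (f : Y → X) (F : GermSheaf X) (F' : GermSheaf Y) where
  app : ∀ y, F.stalk (f y) →+ F'.stalk y
  isSec : ∀ s y, F.IsSec s (f y) → F'.IsSec (fun y => app y (s (f y))) y

/-- A morphism of sheaves. -/
abbrev Hom (F F' : GermSheaf X) := Cohom (fun x : X => x) F F'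

/-- The identity. -/
def Hom.id (F : GermSheaf X) : Hom F F := ⟨fun _ => AddMonoidHom.id _, fun _ _ h => h⟩

/-- A subsheaf is determined by its stalks: extend the value at `x` to a section of `F`, compare its
image with the given section of `F'` by uniqueness of germs, and cancel the injection. -/
lemma Hom.isSec_of_injective {F F' : GermSheaf X} (a : Hom F F')
    (ha : ∀ x, Function.Injective (a.app x)) {s : ∀ x, F.stalk x} {x : X}
    (h : F'.IsSec (fun y => a.app y (s y)) x) : F.IsSec s x := by
  obtain ⟨t, ht, e⟩ := F.exists_isSec x (s x)
  refine F.congr ?_ ht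
  filter_upwards [F'.unique (a.isSec t x ht) h (by simp only [e])] with y hy
  exact ha y hy

/-- The sheaf whose sections near `x` are the elements of `S` in `P x`, up to those in `N x`. -/
def ofLocal {S : Type u} [AddCommGroup S] (P N : X → AddSubgroup S)
    (hP : ∀ x, ∀ s ∈ P x, ∀ᶠ y in 𝓝 x, s ∈ P y)
    (hN : ∀ x, ∀ s ∈ N x, ∀ᶠ y in 𝓝 x, s ∈ N y) : GermSheaf X where
  stalk x := P x ⧸ (N x).addSubgroupOf (P x)
  IsSec η x := ∃ s, ∀ᶠ y in 𝓝 x, ∃ h : s ∈ P y, η y = QuotientAddGroup.mk ⟨s, h⟩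
  congr := by
    rintro s t x h ⟨u, hu⟩
    refine ⟨u, ?_⟩
    filter_upwards [h, hu] with y h1 h2
    rwa [← h1]
  eventually := by
    rintro s x ⟨u, hu⟩
    filter_upwards [hu.eventually_nhds] with y hy using ⟨u, hy⟩
  zero x := ⟨0, Eventually.of_forall fun y => ⟨zero_mem _, rfl⟩⟩
  add := by
    rintro s t x ⟨u, hu⟩ ⟨v, hv⟩
    refine ⟨u + v, ?_⟩
    filter_upwards [hu, hv] with y ⟨h1, e1⟩ ⟨h2, e2⟩
    exact ⟨add_mem h1 h2, by rw [e1, e2]; rfl⟩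
  neg := by
    rintro s x ⟨u, hu⟩
    refine ⟨-u, ?_⟩
    filter_upwards [hu] with y ⟨h1, e1⟩
    exact ⟨neg_mem h1, by rw [e1]; rfl⟩
  exists_isSec := by
    classical
    intro x a
    obtain ⟨⟨s, hs⟩, rfl⟩ := QuotientAddGroup.mk_surjective a
    refine ⟨fun y => if h : s ∈ P y then QuotientAddGroup.mk ⟨s, h⟩ else 0, ⟨s, ?_⟩, ?_⟩
    · filter_upwards [hP x s hs] with y hy
      exact ⟨hy, by simp [hy]⟩
    · simp [hs]
  unique := by
    rintro s t x ⟨u, hu⟩ ⟨v, hv⟩ e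
    obtain ⟨h1, e1⟩ := hu.self_of_nhds
    obtain ⟨h2, e2⟩ := hv.self_of_nhds
    rw [e1, e2, QuotientAddGroup.eq, AddSubgroup.mem_addSubgroupOf] at e
    filter_upwards [hu, hv, hN x _ e] with y ⟨k1, l1⟩ ⟨k2, l2⟩ hy
    rw [l1, l2, QuotientAddGroup.eq, AddSubgroup.mem_addSubgroupOf]
    exact hy

section ofLocal

variable {S : Type u} [AddCommGroup S] {P N : X → AddSubgroup S}
    {hP : ∀ x, ∀ s ∈ P x, ∀ᶠ y in 𝓝 x, s ∈ P y}
    {hN : ∀ x, ∀ s ∈ N x, ∀ᶠ y in 𝓝 x, s ∈ N y}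

variable (P N hP hN) in
/-- The germ at `x` of an element of `S`. -/
def germ (x : X) : P x →+ (ofLocal P N hP hN).stalk x := QuotientAddGroup.mk' _

lemma germ_surjective (x : X) : Function.Surjective (germ P N hP hN x) :=
  QuotientAddGroup.mk_surjective

lemma germ_eq_zero_iff {x : X} (s : P x) : germ P N hP hN x s = 0 ↔ s.1 ∈ N x :=
  (QuotientAddGroup.eq_zero_iff _).trans AddSubgroup.mem_addSubgroupOf

lemma germ_eq_iff {x : X} (s t : P x) :
    germ P N hP hN x s = germ P N hP hN x t ↔ s.1 - t.1 ∈ N x := by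
  rw [← sub_eq_zero, ← map_sub, germ_eq_zero_iff]
  rfl

lemma isSec_ofLocal {η : ∀ x, (ofLocal P N hP hN).stalk x} {x : X} :
    (ofLocal P N hP hN).IsSec η x ↔
      ∃ s, ∀ᶠ y in 𝓝 x, ∃ h : s ∈ P y, η y = germ P N hP hN y ⟨s, h⟩ := Iff.rfl

/-- A map out of `ofLocal`, given by a map which is additive up to null elements. -/
def ofLocalHom {f : Y → X} (hf : Continuous f) {F : GermSheaf Y}
    (a : ∀ y, P (f y) →+ F.stalk y) (h0 : ∀ y s, s.1 ∈ N (f y) → a y s = 0)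
    (h1 : ∀ y, ∀ s ∈ P (f y), ∃ t, F.IsSec t y ∧
      ∀ᶠ z in 𝓝 y, ∀ h : s ∈ P (f z), a z ⟨s, h⟩ = t z) :
    Cohom f (ofLocal P N hP hN) F where
  app y := QuotientAddGroup.lift _ (a y) fun s hs => h0 y s (AddSubgroup.mem_addSubgroupOf.1 hs)
  isSec := by
    rintro η y ⟨s, hs⟩
    obtain ⟨h, e⟩ := hs.self_of_nhds
    obtain ⟨t, ht, h2⟩ := h1 y s h
    refine F.congr ?_ ht
    filter_upwards [h2, hf.continuousAt.eventually hs] with z hz ⟨hz1, hz2⟩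
    rw [hz2, ← hz hz1]
    rfl

/-- A map between sheaves given by local data, induced by a homomorphism. -/
def ofLocalMap {S' : Type u} [AddCommGroup S'] {P' N' : Y → AddSubgroup S'}
    {hP' : ∀ x, ∀ s ∈ P' x, ∀ᶠ y in 𝓝 x, s ∈ P' y}
    {hN' : ∀ x, ∀ s ∈ N' x, ∀ᶠ y in 𝓝 x, s ∈ N' y} {f : Y → X} (hf : Continuous f) (φ : S →+ S')
    (h1 : ∀ y, ∀ s ∈ P (f y), φ s ∈ P' y) (h2 : ∀ y, ∀ s ∈ P (f y), s ∈ N (f y) → φ s ∈ N' y) :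
    Cohom f (ofLocal P N hP hN) (ofLocal P' N' hP' hN') :=
  ofLocalHom hf (fun y => (germ P' N' hP' hN' y).comp
      ((φ.comp (P (f y)).subtype).codRestrict (P' y) fun s => h1 y s.1 s.2))
    (fun y s hs => (germ_eq_zero_iff _).2 (h2 y s.1 s.2 hs))
    (fun y s hs => by
      classical
      refine ⟨fun z => if h : φ s ∈ P' z then germ P' N' hP' hN' z ⟨φ s, h⟩ else 0, ⟨φ s, ?_⟩, ?_⟩
      · filter_upwards [hP' y _ (h1 y s hs)] with z hz
        exact ⟨hz, by simp only [hz, dif_pos]; rfl⟩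
      · filter_upwards with z hz
        have : φ s ∈ P' z := h1 z s hz
        simp only [this, dif_pos]
        rfl)

end ofLocal

/-! ### The sheaf of obstructions -/

/-- The null families at `x`: those which are sections near `x`. -/
def secSub (F : GermSheaf X) (x : X) : AddSubgroup (∀ y, F.stalk y) where
  carrier := {s | F.IsSec s x}
  zero_mem' := F.zero x
  add_mem' := F.add
  neg_mem' := F.neg

/-- The quotient of the sheaf of all families of elements of the stalks of `F` by `F`. -/
def Q (F : GermSheaf X) : GermSheaf X :=
  ofLocal (fun _ => ⊤) F.secSub (fun _ _ _ => Eventually.of_forall fun _ => trivial)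
    fun _ _ h => F.eventually h

/-- The class of a family. -/
def qmk (F : GermSheaf X) (x : X) : (∀ y, F.stalk y) →+ F.Q.stalk x :=
  (germ _ _ _ _ x).comp ((AddMonoidHom.id _).codRestrict _ fun _ => trivial)

lemma qmk_surjective (F : GermSheaf X) (x : X) : Function.Surjective (F.qmk x) := by
  intro a
  obtain ⟨s, rfl⟩ := germ_surjective x a
  exact ⟨s.1, rfl⟩

lemma qmk_eq_zero_iff (F : GermSheaf X) {x : X} {s : ∀ y, F.stalk y} :
    F.qmk x s = 0 ↔ F.IsSec s x :=
  (QuotientAddGroup.eq_zero_iff _).trans AddSubgroup.mem_addSubgroupOf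

lemma isSec_Q (F : GermSheaf X) {η : ∀ x, F.Q.stalk x} {x : X} :
    F.Q.IsSec η x ↔ ∃ s, ∀ᶠ y in 𝓝 x, η y = F.qmk y s := by
  constructor
  · rintro ⟨s, hs⟩
    exact ⟨s, by filter_upwards [hs] with y ⟨_, h⟩ using h⟩
  · rintro ⟨s, hs⟩
    exact ⟨s, by filter_upwards [hs] with y h using ⟨trivial, h⟩⟩

/-- The map on families of elements of the stalks. -/
def Cohom.onFam {f : Y → X} {F : GermSheaf X} {F' : GermSheaf Y} (a : Cohom f F F') :
    (∀ x, F.stalk x) →+ (∀ y, F'.stalk y) where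
  toFun s y := a.app y (s (f y))
  map_zero' := funext fun _ => map_zero _
  map_add' _ _ := funext fun _ => map_add _ _ _

/-- Functoriality of the sheaf of obstructions. -/
def Cohom.Q {f : Y → X} (hf : Continuous f) {F : GermSheaf X} {F' : GermSheaf Y}
    (a : Cohom f F F') : Cohom f F.Q F'.Q :=
  ofLocalMap hf a.onFam (fun _ _ _ => trivial) fun y s _ h => a.isSec s y h

lemma Cohom.Q_qmk {f : Y → X} (hf : Continuous f) {F : GermSheaf X} {F' : GermSheaf Y}
    (a : Cohom f F F') (y : Y) (s : ∀ x, F.stalk x) :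
    (a.Q hf).app y (F.qmk (f y) s) = F'.qmk y (fun z => a.app z (s (f z))) := rfl

/-- Functoriality of the sheaf of obstructions for morphisms. -/
abbrev Hom.Q {F F' : GermSheaf X} (a : Hom F F') : Hom F.Q F'.Q := Cohom.Q continuous_id a

lemma Hom.Q_qmk {F F' : GermSheaf X} (a : Hom F F') (y : X) (s : ∀ x, F.stalk x) :
    (a.Q).app y (F.qmk y s) = F'.qmk y (fun z => a.app z (s z)) := rfl

lemma Hom.Q_id (F : GermSheaf X) : (Hom.id F).Q = Hom.id F.Q := by
  ext x a
  obtain ⟨s, rfl⟩ := F.qmk_surjective x a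
  rfl

/-- A short exact sequence of sheaves. -/
structure SES {F E R : GermSheaf X} (i : Hom F E) (p : Hom E R) : Prop where
  inj : ∀ x, Function.Injective (i.app x)
  zero : ∀ x a, p.app x (i.app x a) = 0
  exact : ∀ x a, p.app x a = 0 → ∃ b, i.app x b = a
  surj : ∀ x, Function.Surjective (p.app x)

/-- The functor of all families is exact by stalkwise choice, so this is the nine lemma. At the
middle, a family whose image in `R` is a section near `x` is corrected by a section of `E` with the
same value at `x`; the difference then has zero image near `x` and comes from `F`. -/
lemma SES.Q {F E R : GermSheaf X} {i : Hom F E} {p : Hom E R} (h : SES i p) : SES i.Q p.Q where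
  inj x := by
    rw [injective_iff_map_eq_zero]
    intro a ha
    obtain ⟨s, rfl⟩ := F.qmk_surjective x a
    rw [Hom.Q_qmk, qmk_eq_zero_iff] at ha
    rw [qmk_eq_zero_iff]
    exact i.isSec_of_injective h.inj ha
  zero x a := by
    obtain ⟨s, rfl⟩ := F.qmk_surjective x a
    rw [Hom.Q_qmk, Hom.Q_qmk]
    simp only [h.zero]
    exact map_zero (R.qmk x)
  exact x a ha := by
    classical
    obtain ⟨s, rfl⟩ := E.qmk_surjective x a
    rw [Hom.Q_qmk, qmk_eq_zero_iff] at ha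
    obtain ⟨e, he⟩ := h.surj x (p.app x (s x))
    obtain ⟨t, ht, hte⟩ := E.exists_isSec x (s x)
    have h1 := R.unique (p.isSec t x ht) ha (by simp only [hte])
    choose! f hf using fun y => h.exact y (s y - t y)
    refine ⟨F.qmk x f, ?_⟩
    rw [Hom.Q_qmk, ← sub_eq_zero, ← map_sub, qmk_eq_zero_iff]
    refine E.congr ?_ (E.neg ht)
    filter_upwards [h1] with y hy
    have := hf y (by rw [map_sub, sub_eq_zero]; exact hy.symm)
    rw [Pi.sub_apply, this]
    abel
  surj x a := by
    obtain ⟨s, rfl⟩ := R.qmk_surjective x a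
    choose e he using fun y => h.surj y (s y)
    exact ⟨E.qmk x e, by rw [Hom.Q_qmk]; simp only [he]⟩

/-! ### Vanishing of cohomology -/

/-- The morphism `a` induces zero on cohomology in degree `q + 1`. -/
def Kills : ℕ → ∀ {F F' : GermSheaf X}, Hom F F' → Prop
  | 0, F, F', a => ∀ η, F.Q.IsGlobal η → ∃ s, ∀ x, a.Q.app x (η x) = F'.qmk x s
  | q + 1, _, _, a => Kills q a.Q

/-- The cohomology of `F` vanishes in degree `q + 1`. -/
def Acyclic (q : ℕ) (F : GermSheaf X) : Prop := Kills q (Hom.id F)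

lemma acyclic_succ {q : ℕ} {F : GermSheaf X} : Acyclic (q + 1) F ↔ Acyclic q F.Q := by
  unfold Acyclic
  rw [← Hom.Q_id]
  exact Iff.rfl

lemma acyclic_zero {F : GermSheaf X} :
    Acyclic 0 F ↔ ∀ η, F.Q.IsGlobal η → ∃ s, ∀ x, η x = F.qmk x s := by
  unfold Acyclic Kills
  rw [Hom.Q_id]
  exact Iff.rfl

lemma kills_of_eq_zero {F F' : GermSheaf X} (a : Hom F F') (ha : ∀ x b, a.app x b = 0) (q : ℕ) :
    Kills q a := by
  have hQ : ∀ {F F' : GermSheaf X} (a : Hom F F') (_ : ∀ x b, a.app x b = 0) x b,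
      a.Q.app x b = 0 := by
    intro F F' a ha x b
    obtain ⟨s, rfl⟩ := F.qmk_surjective x b
    rw [Hom.Q_qmk]
    simp only [ha]
    exact map_zero (F'.qmk x)
  induction q generalizing F F' with
  | zero => exact fun η _ => ⟨0, fun x => by rw [hQ a ha, map_zero]⟩
  | succ q ih => exact ih a.Q (hQ a ha)

section LES

variable {F E R F' E' R' : GermSheaf X} {i : Hom F E} {p : Hom E R} {i' : Hom F' E'}
  {p' : Hom E' R'}

/-- This is the connecting homomorphism in degree zero. A family `e0` lifting `r` has a class in
`E.Q` that comes from a global section `η` of `F.Q`, which represents the obstruction in `H¹(F)`. If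
`aF` sends `η` to the class of a family `s`, then subtracting `s` from the image of `e0` makes it a
section. -/
lemma SES.lift_of_kills (h : SES i p) {aF : Hom F F'} {aE : Hom E E'}
    {aR : Hom R R'} (hi : ∀ x b, aE.app x (i.app x b) = i'.app x (aF.app x b))
    (hp : ∀ x b, aR.app x (p.app x b) = p'.app x (aE.app x b)) (hp' : ∀ x b, p'.app x (i'.app x b)
        = 0)
    (hk : Kills 0 aF) {r : ∀ x, R.stalk x} (hr : R.IsGlobal r) :
    ∃ e, E'.IsGlobal e ∧ ∀ x, p'.app x (e x) = aR.app x (r x) := by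
  choose e0 he0 using fun x => h.surj x (r x)
  have h1 : ∀ x, p.Q.app x (E.qmk x e0) = 0 := by
    intro x
    rw [Hom.Q_qmk, qmk_eq_zero_iff]
    simp only [he0]
    exact hr x
  choose η hη using fun x => h.Q.exact x _ (h1 x)
  have h2 : F.Q.IsGlobal η := by
    intro x
    refine i.Q.isSec_of_injective h.Q.inj ?_
    simp only [hη]
    exact E.isSec_Q.2 ⟨e0, Eventually.of_forall fun _ => rfl⟩
  obtain ⟨s, hs⟩ := hk η h2
  refine ⟨fun x => aE.app x (e0 x) - i'.app x (s x), fun x => ?_, fun x => ?_⟩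
  · rw [← qmk_eq_zero_iff]
    have e1 : i'.Q.app x (aF.Q.app x (η x)) = aE.Q.app x (i.Q.app x (η x)) := by
      obtain ⟨t, ht⟩ := F.qmk_surjective x (η x)
      rw [← ht, Hom.Q_qmk, Hom.Q_qmk, Hom.Q_qmk, Hom.Q_qmk]
      simp only [hi]
    rw [hs, hη, Hom.Q_qmk, Hom.Q_qmk] at e1
    have := map_sub (E'.qmk x) (fun z => aE.app z (e0 z)) (fun z => i'.app z (s z))
    rw [e1, sub_self] at this
    exact this
  · rw [map_sub, hp', sub_zero, ← hp, he0]

/-- The connecting homomorphism of the long exact sequence. -/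
lemma SES.kills (h : SES i p) (h' : SES i' p') {aF : Hom F F'} {aE : Hom E E'} {aR : Hom R R'}
    (hi : ∀ x b, aE.app x (i.app x b) = i'.app x (aF.app x b))
    (hp : ∀ x b, aR.app x (p.app x b) = p'.app x (aE.app x b)) {q : ℕ}
    (hk : Kills (q + 1) aF) (hE : Acyclic q E') : Kills q aR := by
  have hQ : ∀ {F E F' E' : GermSheaf X} {i : Hom F E} {i' : Hom F' E'} {aF : Hom F F'}
      {aE : Hom E E'} (_ : ∀ x b, aE.app x (i.app x b) = i'.app x (aF.app x b)) x b,
      aE.Q.app x (i.Q.app x b) = i'.Q.app x (aF.Q.app x b) := by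
    intro F E F' E' i i' aF aE hi x b
    obtain ⟨t, rfl⟩ := F.qmk_surjective x b
    rw [Hom.Q_qmk, Hom.Q_qmk, Hom.Q_qmk, Hom.Q_qmk]
    simp only [hi]
  induction q generalizing F E R F' E' R' with
  | zero =>
    intro ρ hρ
    obtain ⟨ε, h1, h2⟩ := h.Q.lift_of_kills (hQ hi) (hQ hp) h'.Q.zero hk hρ
    obtain ⟨s, hs⟩ := acyclic_zero.1 hE ε h1
    refine ⟨fun x => p'.app x (s x), fun x => ?_⟩
    rw [← h2, hs, Hom.Q_qmk]
  | succ q ih => exact ih h.Q h'.Q (hQ hi) (hQ hp) hk (acyclic_succ.1 hE)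

lemma SES.lift (h : SES i p) (hF : Acyclic 0 F) {r : ∀ x, R.stalk x} (hr : R.IsGlobal r) :
    ∃ e, E.IsGlobal e ∧ ∀ x, p.app x (e x) = r x :=
  h.lift_of_kills (i' := i) (p' := p) (aF := Hom.id F) (aE := Hom.id E) (aR := Hom.id R)
      (fun _ _ => rfl) (fun _ _ => rfl) h.zero hF hr

/-- In the long exact sequence, the cohomology of `R` lies between that of `E` in the same degree
and that of `F` one degree higher. -/
lemma SES.acyclic_right (h : SES i p) {q : ℕ} (hF : Acyclic (q + 1) F) (hE : Acyclic q E) :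
    Acyclic q R :=
  h.kills h (aE := Hom.id E) (fun _ _ => rfl) (fun _ _ => rfl) hF hE

lemma SES.acyclic_mid (h : SES i p) {q : ℕ} (hF : Acyclic q F) (hR : Acyclic q R) :
    Acyclic q E := by
  induction q generalizing F E R with
  | zero =>
    rw [acyclic_zero] at *
    intro η hη
    obtain ⟨s, hs⟩ := hR _ (fun x => p.Q.isSec η x (hη x))
    choose t ht using fun x => h.surj x (s x)
    have h1 : ∀ x, p.Q.app x (η x - E.qmk x t) = 0 := by
      intro x
      rw [map_sub, hs, Hom.Q_qmk]
      simp only [ht, sub_self]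
    choose θ hθ using fun x => h.Q.exact x _ (h1 x)
    obtain ⟨w, hw⟩ := hF θ fun x => i.Q.isSec_of_injective h.Q.inj (by
      simp only [hθ]
      exact E.Q.sub (hη x) (E.isSec_Q.2 ⟨t, Eventually.of_forall fun _ => rfl⟩))
    refine ⟨fun x => i.app x (w x) + t x, fun x => ?_⟩
    have := hθ x
    rw [hw, Hom.Q_qmk, eq_sub_iff_add_eq, ← map_add] at this
    exact this.symm
  | succ q ih =>
    rw [acyclic_succ] at *
    exact ih h.Q hF hR

end LES

end GermSheaf
end EtaleGerbe
end

noncomputable section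
open CategoryTheory Filter Topology
open scoped Manifold ContDiff
namespace EtaleGerbe
namespace GermSheaf

variable {X : Type u} [TopologicalSpace X]

lemma qmk_congr (F : GermSheaf X) {s t : ∀ y, F.stalk y} {x : X} (h : ∀ᶠ y in 𝓝 x, s y = t y) :
    F.qmk x s = F.qmk x t := by
  rw [← sub_eq_zero, ← map_sub, qmk_eq_zero_iff]
  refine F.congr ?_ (F.zero x)
  filter_upwards [h] with y hy
  rw [Pi.sub_apply, hy, sub_self]

lemma qmk_eq_iff (F : GermSheaf X) {s t : ∀ y, F.stalk y} {x : X} :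
    F.qmk x s = F.qmk x t ↔ F.IsSec (fun y => s y - t y) x := by
  rw [← sub_eq_zero, ← map_sub, qmk_eq_zero_iff]
  rfl

lemma isGlobal_qmk (F : GermSheaf X) (s : ∀ y, F.stalk y) : F.Q.IsGlobal fun x => F.qmk x s :=
  fun _ => F.isSec_Q.2 ⟨s, Eventually.of_forall fun _ => rfl⟩

/-! ### Flasque sheaves -/

/-- Sections over open sets extend. -/
def Flasque (F : GermSheaf X) : Prop :=
  ∀ W : Set X, IsOpen W → ∀ s, (∀ x ∈ W, F.IsSec s x) → ∃ t, F.IsGlobal t ∧ ∀ x ∈ W, t x = s x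

/-- Zorn's lemma on partial lifts over open subsets of `W`. A maximal lift is defined on all of `W`,
since a local lift near a missing point can be corrected by a section of the flasque sheaf so as to
match on the overlap. -/
lemma Flasque.exists_lift {F : GermSheaf X} (hF : F.Flasque) {W : Set X} (hW : IsOpen W)
    {η : ∀ x, F.Q.stalk x} (hη : ∀ x ∈ W, F.Q.IsSec η x) : ∃ s, ∀ x ∈ W, η x = F.qmk x s := by
  classical
  let T := {p : Set X × (∀ y, F.stalk y) // IsOpen p.1 ∧ p.1 ⊆ W ∧ ∀ x ∈ p.1, η x = F.qmk x p.2}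
  let r : T → T → Prop := fun p q => p.1.1 ⊆ q.1.1 ∧ ∀ x ∈ p.1.1, p.1.2 x = q.1.2 x
  obtain ⟨⟨⟨V, s⟩, hV, hVW, hs⟩, hmax⟩ : ∃ m : T, ∀ a, r m a → r a m := by
    refine exists_maximal_of_chains_bounded (fun c hc => ?_) fun {a b c} h1 h2 =>
      ⟨h1.1.trans h2.1, fun x hx => (h1.2 x hx).trans (h2.2 x (h1.1 hx))⟩
    let V : Set X := ⋃ p ∈ c, p.1.1
    -- The union of a chain of lifts: any member whose domain contains `y` gives the same value. The
    -- value `0` elsewhere is irrelevant, because classes are only compared on the open union of the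
    -- domains.
    let s : ∀ y, F.stalk y := fun y => if h : ∃ p ∈ c, y ∈ p.1.1 then h.choose.1.2 y else 0
    have key : ∀ p ∈ c, ∀ y ∈ p.1.1, s y = p.1.2 y := by
      intro p hp y hy
      have h : ∃ p ∈ c, y ∈ p.1.1 := ⟨p, hp, hy⟩
      have e : s y = h.choose.1.2 y := dif_pos h
      rw [e]
      by_cases hne : h.choose = p
      · rw [hne]
      · rcases hc h.choose_spec.1 hp hne with h1 | h1
        · exact h1.2 y h.choose_spec.2
        · exact (h1.2 y hy).symm
    refine ⟨⟨(V, s), isOpen_biUnion fun p _ => p.2.1, Set.iUnion₂_subset fun p _ => p.2.2.1, ?_⟩,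
      fun p hp => ⟨Set.subset_biUnion_of_mem (u := fun p : T => p.1.1) hp,
        fun x hx => (key p hp x hx).symm⟩⟩
    intro x hx
    obtain ⟨p, hp, hxp⟩ := Set.mem_iUnion₂.1 hx
    rw [p.2.2.2 x hxp]
    refine F.qmk_congr ?_
    filter_upwards [p.2.1.mem_nhds hxp] with y hy
    exact (key p hp y hy).symm
  refine ⟨s, fun x hx => ?_⟩
  by_contra hne
  have hxV : x ∉ V := fun h => hne (hs x h)
  obtain ⟨u, hu⟩ := F.isSec_Q.1 (hη x hx)
  obtain ⟨V', hV', hV'o, hxV'⟩ := mem_nhds_iff.1 (hu.and (hW.mem_nhds hx))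
  -- On the overlap the two lifts have the same class, so they differ by a section of `F`. Its
  -- global extension `t` turns `u` into another lift `u + t` on `V'` which agrees with `s` on the
  -- overlap.
  obtain ⟨t, ht, hte⟩ := hF (V ∩ V') (hV.inter hV'o) (fun y => s y - u y) fun y hy => by
    rw [← F.qmk_eq_iff, ← hs y hy.1, (hV' hy.2).1]
  let s' : ∀ y, F.stalk y := fun y => if y ∈ V then s y else u y + t y
  have h1 : ∀ y ∈ V, s' y = s y := fun y hy => if_pos hy
  have h2 : ∀ y ∈ V', s' y = u y + t y := by
    intro y hy
    by_cases hyV : y ∈ V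
    · rw [h1 y hyV, hte y ⟨hyV, hy⟩]
      abel
    · exact if_neg hyV
  have := hmax ⟨(V ∪ V', s'), hV.union hV'o, Set.union_subset hVW fun y hy => (hV' hy).2, ?_⟩
    ⟨Set.subset_union_left, fun y hy => (h1 y hy).symm⟩
  · exact hxV (this.1 (Or.inr hxV'))
  · rintro y (hy | hy)
    · rw [hs y hy]
      refine F.qmk_congr ?_
      filter_upwards [hV.mem_nhds hy] with z hz
      exact (h1 z hz).symm
    · rw [(hV' hy).1, F.qmk_eq_iff]
      refine F.congr ?_ (F.neg (ht y))
      filter_upwards [hV'o.mem_nhds hy] with z hz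
      rw [h2 z hz]
      abel

/-- A section of `F.Q` over an open set lifts to a family, and every family defines a global section
of `F.Q`. -/
lemma Flasque.Q {F : GermSheaf X} (hF : F.Flasque) : F.Q.Flasque := by
  intro W hW η hη
  obtain ⟨s, hs⟩ := hF.exists_lift hW hη
  exact ⟨_, F.isGlobal_qmk s, fun x hx => (hs x hx).symm⟩

lemma Flasque.acyclic {F : GermSheaf X} (hF : F.Flasque) (q : ℕ) : Acyclic q F := by
  induction q generalizing F with
  | zero =>
    rw [acyclic_zero]
    intro η hη
    obtain ⟨s, hs⟩ := hF.exists_lift isOpen_univ fun x _ => hη x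
    exact ⟨s, fun x => hs x trivial⟩
  | succ q ih => exact acyclic_succ.2 (ih hF.Q)

/-! ### Fine sheaves -/

/-- A sheaf is fine if it admits partitions of unity by endomorphisms. -/
def Fine (F : GermSheaf X) : Prop :=
  ∀ U : X → Set X, (∀ x, U x ∈ 𝓝 x) → ∃ (ι : Type u) (y : ι → X) (ρ : ι → Hom F F),
    (∀ x, ∃ S : Finset ι, ∀ᶠ z in 𝓝 x, (∀ i ∉ S, ∀ a, (ρ i).app z a = 0) ∧
      ∀ a, ∑ i ∈ S, (ρ i).app z a = a) ∧
    ∀ i x, (∀ᶠ z in 𝓝 x, ∀ a, (ρ i).app z a = 0) ∨ U (y i) ∈ 𝓝 x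

lemma Hom.Q_eq_zero {F F' : GermSheaf X} (a : Hom F F') {x : X}
    (h : ∀ᶠ z in 𝓝 x, ∀ b, a.app z b = 0) (b : F.Q.stalk x) : a.Q.app x b = 0 := by
  obtain ⟨s, rfl⟩ := F.qmk_surjective x b
  rw [Hom.Q_qmk, ← map_zero (F'.qmk x)]
  refine F'.qmk_congr ?_
  filter_upwards [h] with z hz
  exact hz _

lemma Fine.sum_Q {F : GermSheaf X} {ι : Type u} {ρ : ι → Hom F F} {S : Finset ι} {x : X}
    (h : ∀ᶠ z in 𝓝 x, ∀ a, ∑ i ∈ S, (ρ i).app z a = a) (a : F.Q.stalk x) :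
    ∑ i ∈ S, (ρ i).Q.app x a = a := by
  obtain ⟨s, rfl⟩ := F.qmk_surjective x a
  simp only [Hom.Q_qmk]
  rw [← map_sum]
  refine F.qmk_congr ?_
  filter_upwards [h] with z hz
  rw [Finset.sum_apply]
  exact hz _

/-- Partitions of unity act through endomorphisms, and these pass to `F.Q` by functoriality. Their
supports do not grow, because classes in `F.Q` depend only on families near the point. -/
lemma Fine.Q {F : GermSheaf X} (hF : F.Fine) : F.Q.Fine := by
  intro U hU
  obtain ⟨ι, y, ρ, h1, h2⟩ := hF U hU
  refine ⟨ι, y, fun i => (ρ i).Q, fun x => ?_, fun i x => ?_⟩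
  · obtain ⟨S, hS⟩ := h1 x
    refine ⟨S, ?_⟩
    filter_upwards [hS.eventually_nhds] with z hz
    refine ⟨fun i hi => (ρ i).Q_eq_zero ?_, Fine.sum_Q ?_⟩
    · filter_upwards [hz] with w hw using hw.1 i hi
    · filter_upwards [hz] with w hw using hw.2
  · refine (h2 i x).imp (fun h => ?_) id
    filter_upwards [h.eventually_nhds] with z hz using (ρ i).Q_eq_zero hz

/-- The usual argument with a partition of unity: if `η` is the class of `s y` on `U y`, then `∑ ρ_i
(s (y_i))` is a family with class `∑ ρ_i η = η`. Higher degrees follow since `F.Q` is fine again. -/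
lemma Fine.acyclic {F : GermSheaf X} (hF : F.Fine) (q : ℕ) : Acyclic q F := by
  classical
  induction q generalizing F with
  | succ q ih => exact acyclic_succ.2 (ih hF.Q)
  | zero =>
    rw [acyclic_zero]
    intro η hη
    choose s hs using fun x => F.isSec_Q.1 (hη x)
    obtain ⟨ι, y, ρ, h1, h2⟩ := hF (fun x => {z | η z = F.qmk z (s x)}) hs
    choose S hS using h1
    let σ : ι → ∀ z, F.stalk z := fun i z => (ρ i).app z (s (y i) z)
    refine ⟨fun z => ∑ i ∈ S z, σ i z, fun x => ?_⟩
    -- The finite index set `S z` varies with `z`. Near `x` both `S z` and `S x` can be enlarged to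
    -- their union without changing the sum, so the family agrees with a fixed finite sum.
    have e1 : F.qmk x (fun z => ∑ i ∈ S z, σ i z) = F.qmk x (∑ i ∈ S x, σ i) := by
      refine F.qmk_congr ?_
      filter_upwards [hS x] with z hz
      rw [Finset.sum_apply]
      have a1 : ∑ i ∈ S z, σ i z = ∑ i ∈ S z ∪ S x, σ i z :=
        Finset.sum_subset Finset.subset_union_left fun i _ hi => (hS z).self_of_nhds.1 i hi _
      have a2 : ∑ i ∈ S x, σ i z = ∑ i ∈ S z ∪ S x, σ i z :=
        Finset.sum_subset Finset.subset_union_right fun i _ hi => hz.1 i hi _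
      rw [a1, a2]
    rw [e1, map_sum]
    have e2 : ∀ i, F.qmk x (σ i) = (ρ i).Q.app x (η x) := by
      intro i
      have : F.qmk x (σ i) = (ρ i).Q.app x (F.qmk x (s (y i))) := (Hom.Q_qmk _ _ _).symm
      rw [this]
      -- Either `ρ i` vanishes near `x`, and both sides are zero, or `x` lies in the set where `η`
      -- is the class of `s (y i)`.
      rcases h2 i x with h | h
      · rw [(ρ i).Q_eq_zero h, (ρ i).Q_eq_zero h]
      · rw [← mem_of_mem_nhds h]
    simp only [e2]
    refine (Fine.sum_Q ?_ _).symm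
    filter_upwards [hS x] with z hz using hz.2

/-! ### Products, kernels and isomorphisms -/

/-- The product of two sheaves. -/
def prod (F F' : GermSheaf X) : GermSheaf X where
  stalk x := F.stalk x × F'.stalk x
  IsSec s x := F.IsSec (fun y => (s y).1) x ∧ F'.IsSec (fun y => (s y).2) x
  congr h hs := ⟨F.congr (h.mono fun y hy => by rw [hy]) hs.1,
    F'.congr (h.mono fun y hy => by rw [hy]) hs.2⟩
  eventually hs := (F.eventually hs.1).and (F'.eventually hs.2)
  zero x := ⟨F.zero x, F'.zero x⟩
  add hs ht := ⟨F.add hs.1 ht.1, F'.add hs.2 ht.2⟩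
  neg hs := ⟨F.neg hs.1, F'.neg hs.2⟩
  exists_isSec x a := by
    obtain ⟨s, hs, e⟩ := F.exists_isSec x a.1
    obtain ⟨t, ht, e'⟩ := F'.exists_isSec x a.2
    exact ⟨fun y => (s y, t y), ⟨hs, ht⟩, Prod.ext e e'⟩
  unique hs ht e := by
    filter_upwards [F.unique hs.1 ht.1 (congrArg Prod.fst e),
      F'.unique hs.2 ht.2 (congrArg Prod.snd e)] with y h1 h2 using Prod.ext h1 h2

lemma Acyclic.prod {F F' : GermSheaf X} {q : ℕ} (hF : Acyclic q F) (hF' : Acyclic q F') :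
    Acyclic q (F.prod F') := by
  let i : Hom F (F.prod F') := ⟨fun x => AddMonoidHom.inl _ _, fun s x h => ⟨h, F'.zero x⟩⟩
  let p : Hom (F.prod F') F' := ⟨fun x => AddMonoidHom.snd _ _, fun s x h => h.2⟩
  have h : SES i p :=
    { inj := fun x a b h => congrArg Prod.fst h
      zero := fun x a => rfl
      exact := fun x a h => ⟨a.1, Prod.ext rfl h.symm⟩
      surj := fun x a => ⟨(0, a), rfl⟩ }
  exact h.acyclic_mid hF hF'

variable (X) in
/-- The zero sheaf. -/
def zeroSheaf : GermSheaf X where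
  stalk _ := PUnit
  IsSec _ _ := True
  congr _ _ := trivial
  eventually _ := Eventually.of_forall fun _ => trivial
  zero _ := trivial
  add _ _ := trivial
  neg _ := trivial
  exists_isSec _ _ := ⟨fun _ => PUnit.unit, trivial, rfl⟩
  unique _ _ _ := Eventually.of_forall fun _ => rfl

/-- A stalkwise bijection is a short exact sequence whose quotient is the zero sheaf. -/
lemma Acyclic.of_bijective {F F' : GermSheaf X} {q : ℕ} (hF : Acyclic q F) (a : Hom F F')
    (ha : ∀ x, Function.Bijective (a.app x)) : Acyclic q F' := by
  let p : Hom F' (zeroSheaf X) := ⟨fun x => 0, fun _ _ _ => trivial⟩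
  have h : SES a p :=
    { inj := fun x => (ha x).1
      zero := fun x a => rfl
      exact := fun x b _ => (ha x).2 b
      surj := fun x _ => ⟨0, rfl⟩ }
  exact h.acyclic_mid hF (kills_of_eq_zero _ (fun _ _ => rfl) q)

/-- The kernel of a morphism. -/
def ker {E R : GermSheaf X} (a : Hom E R) : GermSheaf X where
  stalk x := (a.app x).ker
  IsSec s x := E.IsSec (fun y => (s y).1) x
  congr h hs := E.congr (h.mono fun y hy => by rw [hy]) hs
  eventually hs := E.eventually hs
  zero x := E.zero x
  add hs ht := E.add hs ht
  neg hs := E.neg hs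
  exists_isSec x b := by
    classical
    obtain ⟨s, hs, e⟩ := E.exists_isSec x b.1
    have h1 := R.unique (a.isSec s x hs) (R.zero x) (by simp only [e]; exact b.2)
    refine ⟨fun y => if h : a.app y (s y) = 0 then ⟨s y, h⟩ else 0, E.congr ?_ hs, ?_⟩
    · filter_upwards [h1] with y hy
      simp only [hy, dif_pos]
    · have := h1.self_of_nhds
      simp only [this, dif_pos]
      exact Subtype.ext e
  unique hs ht e := by
    filter_upwards [E.unique hs ht (congrArg Subtype.val e)] with y h1 using Subtype.ext h1

/-- The inclusion of the kernel. -/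
def kerι {E R : GermSheaf X} (a : Hom E R) : Hom (ker a) E :=
  ⟨fun x => (a.app x).ker.subtype, fun _ _ h => h⟩

/-- A morphism into the kernel. -/
def kerLift {F E R : GermSheaf X} (b : Hom F E) (a : Hom E R) (h : ∀ x c, a.app x (b.app x c) = 0) :
    Hom F (ker a) :=
  ⟨fun x => (b.app x).codRestrict _ (h x), fun s x hs => b.isSec s x hs⟩

/-- A complex exact at `E` splits into short exact sequences between consecutive kernels; this is
how resolutions are used below. -/
lemma ses_kerLift {F E R : GermSheaf X} (b : Hom F E) (a : Hom E R)
    (h : ∀ x c, a.app x (b.app x c) = 0) (h' : ∀ x e, a.app x e = 0 → ∃ c, b.app x c = e) :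
    SES (kerι b) (kerLift b a h) where
  inj x := Subtype.val_injective
  zero x c := Subtype.ext c.2
  exact x c hc := ⟨⟨c, congrArg Subtype.val hc⟩, rfl⟩
  surj x e := by
    obtain ⟨c, hc⟩ := h' x e.1 e.2
    exact ⟨c, Subtype.ext hc⟩

end GermSheaf
end EtaleGerbe
end

noncomputable section
open CategoryTheory Filter Topology
open scoped Manifold ContDiff
namespace EtaleGerbe
namespace GermSheaf

variable {X : Type u} [TopologicalSpace X] {Y : Type u} [TopologicalSpace Y]
  {Z : Type u} [TopologicalSpace Z]

/-! ### Homotopy invariance of the cohomology of constant sheaves -/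

/-- The families which vanish near `x`. -/
def nullSub (F : GermSheaf X) (x : X) : AddSubgroup (∀ y, F.stalk y) where
  carrier := {s | ∀ᶠ y in 𝓝 x, s y = 0}
  zero_mem' := Eventually.of_forall fun _ => rfl
  add_mem' hs ht := by filter_upwards [hs, ht] with y h1 h2; rw [Pi.add_apply, h1, h2, add_zero]
  neg_mem' hs := by filter_upwards [hs] with y h1; rw [Pi.neg_apply, h1, neg_zero]

/-- The sheaf of all families of elements of the stalks. -/
def godement (F : GermSheaf X) : GermSheaf X :=
  ofLocal (fun _ => ⊤) F.nullSub (fun _ _ _ => Eventually.of_forall fun _ => trivial)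
    fun _ _ h => Filter.Eventually.eventually_nhds h

/-- The germ of a family. -/
def gmk (F : GermSheaf X) (x : X) : (∀ y, F.stalk y) →+ F.godement.stalk x :=
  (germ _ _ _ _ x).comp ((AddMonoidHom.id _).codRestrict _ fun _ => trivial)

lemma gmk_surjective (F : GermSheaf X) (x : X) : Function.Surjective (F.gmk x) := by
  intro a
  obtain ⟨s, rfl⟩ := germ_surjective x a
  exact ⟨s.1, rfl⟩

lemma gmk_eq_zero_iff (F : GermSheaf X) {x : X} {s : ∀ y, F.stalk y} :
    F.gmk x s = 0 ↔ ∀ᶠ y in 𝓝 x, s y = 0 :=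
  (QuotientAddGroup.eq_zero_iff _).trans AddSubgroup.mem_addSubgroupOf

lemma gmk_eq_iff (F : GermSheaf X) {x : X} {s t : ∀ y, F.stalk y} :
    F.gmk x s = F.gmk x t ↔ ∀ᶠ y in 𝓝 x, s y = t y := by
  rw [← sub_eq_zero, ← map_sub, gmk_eq_zero_iff]
  simp only [Pi.sub_apply, sub_eq_zero]

lemma isSec_godement (F : GermSheaf X) {η : ∀ x, F.godement.stalk x} {x : X} :
    F.godement.IsSec η x ↔ ∃ s, ∀ᶠ y in 𝓝 x, η y = F.gmk y s := by
  constructor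
  · rintro ⟨s, hs⟩
    exact ⟨s, by filter_upwards [hs] with y ⟨_, h⟩ using h⟩
  · rintro ⟨s, hs⟩
    exact ⟨s, by filter_upwards [hs] with y h using ⟨trivial, h⟩⟩

/-- A section of the sheaf of germs of arbitrary families is one family: its value at `x` is read
from the germ at `x`. This makes the sheaf flasque. -/
lemma exists_gmk (F : GermSheaf X) {W : Set X} {η : ∀ x, F.godement.stalk x}
    (hη : ∀ x ∈ W, F.godement.IsSec η x) : ∃ s, ∀ x ∈ W, η x = F.gmk x s := by
  choose s hs using fun x => F.gmk_surjective x (η x)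
  refine ⟨fun x => s x x, fun x hx => ?_⟩
  obtain ⟨t, ht⟩ := F.isSec_godement.1 (hη x hx)
  rw [ht.self_of_nhds, gmk_eq_iff]
  filter_upwards [ht] with y hy
  rw [← hs, gmk_eq_iff] at hy
  exact hy.self_of_nhds.symm

lemma flasque_godement (F : GermSheaf X) : F.godement.Flasque := by
  intro W _ η hη
  obtain ⟨s, hs⟩ := F.exists_gmk hη
  exact ⟨fun x => F.gmk x s, fun x => F.isSec_godement.2 ⟨s, Eventually.of_forall fun _ => rfl⟩,
    fun x hx => (hs x hx).symm⟩

/-- The inclusion of a sheaf in the sheaf of all families. -/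
def toGodement (F : GermSheaf X) : Hom F F.godement where
  app x := AddMonoidHom.mk' (fun a => F.gmk x (F.exists_isSec x a).choose) fun a b => by
    have ha := (F.exists_isSec x a).choose_spec
    have hb := (F.exists_isSec x b).choose_spec
    have hab := (F.exists_isSec x (a + b)).choose_spec
    rw [← map_add, gmk_eq_iff]
    exact F.unique hab.1 (F.add ha.1 hb.1)
      (hab.2.trans (congrArg₂ (· + ·) ha.2.symm hb.2.symm))
  isSec s x hs := by
    refine F.isSec_godement.2 ⟨s, ?_⟩
    filter_upwards [F.eventually hs] with y hy
    have h := (F.exists_isSec y (s y)).choose_spec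
    exact F.gmk_eq_iff.2 (F.unique h.1 hy h.2)

lemma toGodement_app (F : GermSheaf X) {x : X} {s : ∀ y, F.stalk y} (hs : F.IsSec s x) :
    F.toGodement.app x (s x) = F.gmk x s := by
  have h := (F.exists_isSec x (s x)).choose_spec
  exact F.gmk_eq_iff.2 (F.unique h.1 hs h.2)

/-- The projection of the sheaf of all families on the sheaf of obstructions. -/
def godementQ (F : GermSheaf X) : Hom F.godement F.Q :=
  ofLocalMap continuous_id (AddMonoidHom.id _) (fun _ _ _ => trivial) fun x s _ h => by
    refine F.congr ?_ (F.zero x)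
    filter_upwards [h] with y hy using hy.symm

lemma godementQ_gmk (F : GermSheaf X) (x : X) (s : ∀ y, F.stalk y) :
    F.godementQ.app x (F.gmk x s) = F.qmk x s := rfl

/-- The middle term is flasque, so `F.Q` computes the cohomology of `F` with a shift by one. -/
lemma ses_godement (F : GermSheaf X) : SES F.toGodement F.godementQ where
  inj x a b h := by
    have ha := (F.exists_isSec x a).choose_spec
    have hb := (F.exists_isSec x b).choose_spec
    have := (F.gmk_eq_iff.1 h).self_of_nhds
    rwa [ha.2, hb.2] at this
  zero x a := by
    obtain ⟨s, hs, rfl⟩ := F.exists_isSec x a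
    rw [F.toGodement_app hs, godementQ_gmk, qmk_eq_zero_iff]
    exact hs
  exact x a h := by
    obtain ⟨s, rfl⟩ := F.gmk_surjective x a
    rw [godementQ_gmk, qmk_eq_zero_iff] at h
    exact ⟨s x, F.toGodement_app h⟩
  surj x a := by
    obtain ⟨s, rfl⟩ := F.qmk_surjective x a
    exact ⟨_, F.godementQ_gmk x s⟩

section Push

variable (p : Y → X) (F : GermSheaf Y)

/-- The families which are sections near the fibre over `x`. -/
def fibreSec (x : X) : AddSubgroup (∀ y, F.stalk y) where
  carrier := {s | ∀ᶠ x' in 𝓝 x, ∀ y, p y = x' → F.IsSec s y}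
  zero_mem' := Eventually.of_forall fun _ y _ => F.zero y
  add_mem' hs ht := by filter_upwards [hs, ht] with x' h1 h2 y hy using F.add (h1 y hy) (h2 y hy)
  neg_mem' hs := by filter_upwards [hs] with x' h1 y hy using F.neg (h1 y hy)

/-- The families which vanish near the fibre over `x`. -/
def fibreNull (x : X) : AddSubgroup (∀ y, F.stalk y) where
  carrier := {s | ∀ᶠ x' in 𝓝 x, ∀ y, p y = x' → s y = 0}
  zero_mem' := Eventually.of_forall fun _ y _ => rfl
  add_mem' hs ht := by
    filter_upwards [hs, ht] with x' h1 h2 y hy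
    rw [Pi.add_apply, h1 y hy, h2 y hy, add_zero]
  neg_mem' hs := by
    filter_upwards [hs] with x' h1 y hy
    rw [Pi.neg_apply, h1 y hy, neg_zero]

/-- The direct image of a sheaf by a proper map. -/
def push : GermSheaf X :=
  ofLocal (fibreSec p F) (fibreNull p F) (fun _ _ h => Filter.Eventually.eventually_nhds h)
    fun _ _ h => Filter.Eventually.eventually_nhds h

/-- The direct image of the sheaf of all families. -/
def pushFam : GermSheaf X :=
  ofLocal (fun _ => ⊤) (fibreNull p F) (fun _ _ _ => Eventually.of_forall fun _ => trivial)
    fun _ _ h => Filter.Eventually.eventually_nhds h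

/-- The inclusion in the sheaf of families. -/
def pushι : Hom (push p F) (pushFam p F) :=
  ofLocalMap continuous_id (AddMonoidHom.id _) (fun _ _ _ => trivial) fun _ _ _ h => h

variable {p}

/-- The projection of the sheaf of families on the direct image of the sheaf of obstructions. -/
def pushπ (hp : Continuous p) : Hom (pushFam p F) (push p F.Q) :=
  ofLocalMap continuous_id
    (AddMonoidHom.mk' (fun s y => F.qmk y s) fun s t => funext fun y => map_add (F.qmk y) s t)
    (fun _ s _ => Eventually.of_forall fun _ y _ => F.isGlobal_qmk s y) fun x s _ h => by
      filter_upwards [Filter.Eventually.eventually_nhds h] with x' hx' y hy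
      change F.qmk y s = 0
      rw [← map_zero (F.qmk y)]
      refine F.qmk_congr ?_
      have := hp.continuousAt.eventually (by rw [hy]; exact hx')
      filter_upwards [this] with z hz using hz z rfl

/-- Direct image is left exact, and it stays exact on the right if sections of `F.Q` near a fibre
lift to families near that fibre. The hypothesis `hlift` says that the first higher direct image of
`F` vanishes. -/
lemma ses_push (hp : Continuous p) (hlift : ∀ (η : ∀ y, F.Q.stalk y) (x : X),
      η ∈ fibreSec p F.Q x → ∃ s, ∀ᶠ x' in 𝓝 x, ∀ y, p y = x' → η y = F.qmk y s) :
    SES (pushι p F) (pushπ F hp) where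
  inj x := by
    rw [injective_iff_map_eq_zero]
    intro a ha
    obtain ⟨s, rfl⟩ := germ_surjective x a
    have h : germ (fun _ => ⊤) (fibreNull p F) (fun _ _ _ => Eventually.of_forall fun _ => trivial)
      (fun _ _ h => Filter.Eventually.eventually_nhds h) x ⟨s.1, trivial⟩ = 0 := ha
    have h' := (germ_eq_zero_iff _).1 h
    exact (germ_eq_zero_iff _).2 h'
  zero x a := by
    obtain ⟨s, rfl⟩ := germ_surjective x a
    refine (germ_eq_zero_iff _).2 ?_
    filter_upwards [s.2] with x' h y hy using F.qmk_eq_zero_iff.2 (h y hy)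
  exact x a ha := by
    obtain ⟨s, rfl⟩ := germ_surjective x a
    have h : germ (fibreSec p F.Q) (fibreNull p F.Q) (fun _ _ h =>
        Filter.Eventually.eventually_nhds h)
      (fun _ _ h => Filter.Eventually.eventually_nhds h) x ⟨fun y => F.qmk y s.1,
        Eventually.of_forall fun _ y _ => F.isGlobal_qmk s.1 y⟩ = 0 := ha
    have h' : ∀ᶠ x' in 𝓝 x, ∀ y, p y = x' → F.qmk y s.1 = 0 := (germ_eq_zero_iff _).1 h
    refine ⟨germ _ _ _ _ x ⟨s.1, ?_⟩, rfl⟩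
    filter_upwards [h'] with x' h y hy using F.qmk_eq_zero_iff.1 (h y hy)
  surj x a := by
    obtain ⟨η, rfl⟩ := germ_surjective x a
    obtain ⟨s, hs⟩ := hlift η.1 x η.2
    refine ⟨germ _ _ _ _ x ⟨s, trivial⟩, (germ_eq_iff _ _).2 ?_⟩
    filter_upwards [hs] with x' h y hy
    exact sub_eq_zero.2 (h y hy).symm

variable {F} {F' : GermSheaf X} {i₁ i₀ : X → Y} (a₁ : Cohom i₁ F F') (a₀ : Cohom i₀ F F')

/-- The difference of the restrictions of a section along two sections of `p`. -/
def pushDiff (h₁ : ∀ x, p (i₁ x) = x) (h₀ : ∀ x, p (i₀ x) = x) : Hom (push p F) F' :=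
  ofLocalHom continuous_id
    (fun x => AddMonoidHom.mk' (fun s => a₁.app x (s.1 (i₁ x)) - a₀.app x (s.1 (i₀ x))) fun s t =>
        by
      change a₁.app x (s.1 _ + t.1 _) - a₀.app x (s.1 _ + t.1 _) = _
      rw [map_add, map_add]
      abel)
    (fun x s hs => by
      have h := hs.self_of_nhds
      change a₁.app x (s.1 (i₁ x)) - a₀.app x (s.1 (i₀ x)) = 0
      rw [h _ (h₁ x), h _ (h₀ x), map_zero, map_zero, sub_zero])
    fun x s hs => by
      have h := hs.self_of_nhds
      exact ⟨_, F'.sub (a₁.isSec s x (h _ (h₁ x))) (a₀.isSec s x (h _ (h₀ x))),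
        Eventually.of_forall fun _ _ => rfl⟩

/-- The difference of the restrictions of a family along two sections of `p`. -/
def pushFamDiff (h₁ : ∀ x, p (i₁ x) = x) (h₀ : ∀ x, p (i₀ x) = x) :
    Hom (pushFam p F) F'.godement :=
  ofLocalMap continuous_id
    (AddMonoidHom.mk' (fun s x => a₁.app x (s (i₁ x)) - a₀.app x (s (i₀ x))) fun s t => by
      funext x
      change a₁.app x (s _ + t _) - a₀.app x (s _ + t _) = (_ - _) + (_ - _)
      rw [map_add, map_add]
      abel)
    (fun _ _ _ => trivial) fun x s _ h => by
      filter_upwards [h] with x' h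
      change a₁.app x' (s (i₁ x')) - a₀.app x' (s (i₀ x')) = 0
      rw [h _ (h₁ x'), h _ (h₀ x'), map_zero, map_zero, sub_zero]

/-- Together with the next lemma, this makes the differences of restrictions a morphism from the
direct image sequence to the sequence with the flasque middle term. The connecting homomorphism then
passes from `F` to `F.Q`. -/
lemma pushFamDiff_pushι (h₁ : ∀ x, p (i₁ x) = x) (h₀ : ∀ x, p (i₀ x) = x) (x : X)
    (b : (push p F).stalk x) : (pushFamDiff a₁ a₀ h₁ h₀).app x ((pushι p F).app x b) =
      F'.toGodement.app x ((pushDiff a₁ a₀ h₁ h₀).app x b) := by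
  obtain ⟨s, rfl⟩ := germ_surjective x b
  have h := s.2.self_of_nhds
  exact (F'.toGodement_app
    (F'.sub (a₁.isSec s.1 x (h _ (h₁ x))) (a₀.isSec s.1 x (h _ (h₀ x))))).symm

lemma pushDiff_pushπ (hp : Continuous p) (h₁ : ∀ x, p (i₁ x) = x) (h₀ : ∀ x, p (i₀ x) = x)
    (hi₁ : Continuous i₁) (hi₀ : Continuous i₀) (x : X)
    (b : (pushFam p F).stalk x) : (pushDiff (a₁.Q hi₁) (a₀.Q hi₀)
        h₁ h₀).app x ((pushπ F hp).app x b)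
      = F'.godementQ.app x ((pushFamDiff a₁ a₀ h₁ h₀).app x b) := by
  obtain ⟨s, rfl⟩ := germ_surjective x b
  exact (map_sub (F'.qmk x) (fun x => a₁.app x (s.1 (i₁ x))) (fun x => a₀.app x (s.1 (i₀ x)))).symm

end Push

/-- Every germ extends to a global section. -/
def GloballyGenerated (F : GermSheaf X) : Prop := ∀ x a, ∃ s, F.IsGlobal s ∧ s x = a

lemma globallyGenerated_Q (F : GermSheaf X) : F.Q.GloballyGenerated := by
  intro x a
  obtain ⟨s, rfl⟩ := F.qmk_surjective x a
  exact ⟨_, F.isGlobal_qmk s, rfl⟩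

/-- The fibre is an interval. Lifts over the parts `[0, t]` are continued step by step: the set of
reachable `t` is open and closed, and contains `0`. Global generation replaces flasqueness in the
gluing, because the mismatch has to be extended from only one point of the fibre. -/
lemma lift_near_fibre {F : GermSheaf (X × unitInterval)} (hF : F.GloballyGenerated)
    {η : ∀ y, F.Q.stalk y} {x : X} (hη : η ∈ fibreSec Prod.fst F.Q x) :
    ∃ s, ∀ᶠ x' in 𝓝 x, ∀ y, y.1 = x' → η y = F.qmk y s := by
  classical
  let good : Set unitInterval :=
    {t | ∃ s, ∀ᶠ x' in 𝓝 x, ∀ y, y.1 = x' → y.2 ≤ t → η y = F.qmk y s}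
  have h0 := hη.self_of_nhds
  have hloc : ∀ t : unitInterval, ∃ u, ∃ V ∈ 𝓝 x, ∃ a b, t ∈ Set.Icc a b ∧ Set.Icc a b ∈ 𝓝 t ∧
      ∀ x' ∈ V, ∀ t' ∈ Set.Icc a b, η (x', t') = F.qmk (x', t') u := by
    intro t
    obtain ⟨u, hu⟩ := F.isSec_Q.1 (h0 (x, t) rfl)
    obtain ⟨V, hV, N, hN, h⟩ := mem_nhds_prod_iff.1 hu
    obtain ⟨a, b, h1, h2, h3⟩ := exists_Icc_mem_subset_of_mem_nhds hN
    exact ⟨u, V, hV, a, b, h1, h2, fun x' hx' t' ht' => h ⟨hx', h3 ht'⟩⟩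
  have hstep : ∀ t, ∃ N ∈ 𝓝 t, ∀ t₁ ∈ N, ∀ t₂ ∈ N, t₁ ∈ good → t₂ ∈ good := by
    intro t
    obtain ⟨u, V, hV, a, b, -, hN, hu⟩ := hloc t
    refine ⟨_, hN, fun t₁ ht₁ t₂ ht₂ ⟨s, hs⟩ => ?_⟩
    -- At `(x, t₁)` both lifts have the same class, so `s - u` is a section there. A global section
    -- `g` with the same germ corrects `u` to a lift which agrees with `s` near that point.
    obtain ⟨g, hg, hgx⟩ := hF (x, t₁) (s (x, t₁) - u (x, t₁))
    have h1 : F.IsSec (fun y => s y - u y) (x, t₁) := by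
      rw [← F.qmk_eq_iff, ← hs.self_of_nhds (x, t₁) rfl le_rfl,
        hu x (mem_of_mem_nhds hV) t₁ ht₁]
    obtain ⟨V', hV', N', hN', h2⟩ := mem_nhds_prod_iff.1 (F.unique h1 (hg _) hgx.symm)
    -- The glued family switches from `s` to `u + g` at height `t₁`. Only the class at height
    -- exactly `t₁` uses the agreement of `s - u` with `g`, and this holds near `(x, t₁)`, hence at
    -- `(x', t₁)` for `x'` close to `x`.
    let s' : ∀ y, F.stalk y := fun y => if y.2 ≤ t₁ then s y else u y + g y
    refine ⟨s', ?_⟩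
    filter_upwards [hs, eventually_mem_nhds_iff.2 hV,
        eventually_mem_nhds_iff.2 hV'] with x' h3 h4 h5
    rintro ⟨_, t'⟩ rfl ht'
    rcases lt_trichotomy t' t₁ with hlt | rfl | hgt
    · rw [h3 _ rfl hlt.le]
      refine F.qmk_congr ?_
      filter_upwards [continuous_snd.continuousAt.eventually (gt_mem_nhds hlt)] with z hz
      exact (if_pos (le_of_lt hz)).symm
    · rw [h3 _ rfl le_rfl]
      refine F.qmk_congr ?_
      filter_upwards [prod_mem_nhds h5 hN'] with z hz
      have h6 : s z - u z = g z := h2 hz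
      by_cases h : z.2 ≤ t'
      · exact (if_pos h).symm
      · refine Eq.trans ?_ (if_neg h).symm
        rw [← h6]
        abel
    · rw [hu _ (mem_of_mem_nhds h4) t' ⟨ht₁.1.trans hgt.le, ht'.trans ht₂.2⟩]
      rw [F.qmk_eq_iff]
      refine F.congr ?_ (F.neg (hg _))
      filter_upwards [continuous_snd.continuousAt.eventually (lt_mem_nhds hgt)] with z hz
      have : s' z = u z + g z := if_neg (not_le.2 hz)
      rw [this]
      abel
  have hgood : good = Set.univ := by
    refine IsClopen.eq_univ ⟨?_, ?_⟩ ⟨0, ?_⟩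
    · rw [← isOpen_compl_iff, isOpen_iff_mem_nhds]
      intro t ht
      obtain ⟨N, hN, h⟩ := hstep t
      filter_upwards [hN] with t' ht' ht''
      exact ht (h t' ht' t (mem_of_mem_nhds hN) ht'')
    · rw [isOpen_iff_mem_nhds]
      intro t ht
      obtain ⟨N, hN, h⟩ := hstep t
      filter_upwards [hN] with t' ht' using h t (mem_of_mem_nhds hN) t' ht' ht
    · obtain ⟨u, V, hV, a, b, hm, -, hu⟩ := hloc 0
      refine ⟨u, ?_⟩
      filter_upwards [hV] with x' hx'
      rintro ⟨_, t'⟩ rfl ht'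
      have : t' = 0 := le_antisymm ht' unitInterval.nonneg'
      subst this
      exact hu _ hx' _ hm
  obtain ⟨s, hs⟩ : (1 : unitInterval) ∈ good := hgood ▸ trivial
  exact ⟨s, by filter_upwards [hs] with x' h y hy using h y hy unitInterval.le_one'⟩

/-- The constant sheaf with stalks `A`. -/
def const (A : Type u) [AddCommGroup A] (X : Type u) [TopologicalSpace X] : GermSheaf X where
  stalk _ := A
  IsSec s x := ∀ᶠ y in 𝓝 x, s y = s x
  congr h hs := by
    filter_upwards [h, hs] with y h1 h2
    rw [← h1, ← h.self_of_nhds, h2]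
  eventually hs := by
    filter_upwards [hs.eventually_nhds] with y hy
    filter_upwards [hy] with z hz
    rw [hz, hy.self_of_nhds]
  zero _ := Eventually.of_forall fun _ => rfl
  add hs ht := by filter_upwards [hs, ht] with y h1 h2; rw [h1, h2]
  neg hs := by filter_upwards [hs] with y h1; rw [h1]
  exists_isSec _ a := ⟨fun _ => a, Eventually.of_forall fun _ => rfl, rfl⟩
  unique hs ht e := by filter_upwards [hs, ht] with y h1 h2; rw [h1, h2, e]

variable (A : Type u) [AddCommGroup A]

/-- The iterated sheaf of obstructions of a constant sheaf. -/
def constQ (X : Type u) [TopologicalSpace X] : ℕ → GermSheaf X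
  | 0 => const A X
  | j + 1 => (constQ X j).Q

/-- The pull-back maps of the sheaves `constQ`. -/
def constQMap {f : Y → X} (hf : Continuous f) : ∀ j, Cohom f (constQ A X j) (constQ A Y j)
  | 0 => ⟨fun _ => AddMonoidHom.id A, fun _ _ h => hf.continuousAt.eventually h⟩
  | j + 1 => (constQMap hf j).Q hf

lemma constQMap_comp {f : Y → X} (hf : Continuous f) {g : Z → Y} (hg : Continuous g) (j : ℕ) (z : Z)
    (a : (constQ A X j).stalk (f (g z))) :
    (constQMap A (f := fun z => f (g z)) (hf.comp hg) j).app z a =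
      (constQMap A hg j).app z ((constQMap A hf j).app (g z) a) := by
  induction j generalizing z with
  | zero => rfl
  | succ j ih =>
    obtain ⟨s, rfl⟩ := (constQ A X j).qmk_surjective _ a
    have e : ∀ {U W : Type u} [TopologicalSpace U] [TopologicalSpace W] {h : U → W}
        (hh : Continuous h) (w : U) (t : ∀ y, (constQ A W j).stalk y),
        (constQMap A hh (j + 1)).app w ((constQ A W j).qmk (h w) t) = (constQ A U j).qmk w
          (fun z => (constQMap A hh j).app z (t (h z))) := fun _ _ _ => rfl
    rw [e hf (g z), e hg z]
    refine (e (hf.comp hg) z s).trans ?_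
    congr 1
    funext w
    exact ih w _

lemma constQMap_id (j : ℕ) (x : X) (a : (constQ A X j).stalk x) :
    (constQMap A (f := fun x : X => x) continuous_id j).app x a = a := by
  induction j generalizing x with
  | zero => rfl
  | succ j ih =>
    obtain ⟨s, rfl⟩ := (constQ A X j).qmk_surjective _ a
    refine (Hom.Q_qmk (constQMap A (f := fun x : X => x) continuous_id j) x s).trans ?_
    congr 1
    funext w
    exact ih w _

lemma constQMap_of_eq_id {f : X → X} (hf : Continuous f) (h : ∀ x, f x = x) (j : ℕ)
    (η : ∀ x, (constQ A X j).stalk x) (x : X) : (constQMap A hf j).app x (η (f x)) = η x := by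
  obtain rfl : f = fun x => x := funext h
  exact constQMap_id A j x _

/-- Near each point the map `f` factors through a one-point space, so pull-back along `f` kills
cohomology in positive degree. -/
lemma constQMap_locallyConstant {f : X → X} (hf : Continuous f) (h : ∀ x, ∀ᶠ y in 𝓝 x, f y = f x)
    (j : ℕ) (η : ∀ x, (constQ A X (j + 1)).stalk x) :
    ∃ s, ∀ x, (constQMap A hf (j + 1)).app x (η (f x)) = (constQ A X j).qmk x s := by
  choose ψ hψ using fun x => (constQ A X j).qmk_surjective x (η x)
  -- The representative chosen at `f x` is evaluated on the diagonal. Since `f` is constant near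
  -- `x`, near `x` the resulting family is the pull-back of the single family `ψ (f x)`, whose class
  -- is the pull-back of `η`.
  refine ⟨fun x => (constQMap A hf j).app x (ψ (f x) (f x)), fun x => ?_⟩
  rw [← hψ]
  refine (Cohom.Q_qmk hf (constQMap A hf j) x _).trans ((constQ A X j).qmk_congr ?_)
  filter_upwards [h x] with y hy
  have : ∀ z, z = f x → ψ (f x) z = ψ z z := by rintro _ rfl; rfl
  rw [this _ hy]

lemma acyclic_constQ {q j : ℕ} : Acyclic q (constQ A X j) ↔ Acyclic (q + j) (const A X) := by
  induction j generalizing q with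
  | zero => exact Iff.rfl
  | succ j ih =>
    refine acyclic_succ.symm.trans (ih.trans ?_)
    rw [Nat.add_right_comm]
    exact Iff.rfl

lemma globallyGenerated_constQ (j : ℕ) : (constQ A X j).GloballyGenerated := by
  cases j with
  | zero => exact fun x a => ⟨fun _ => a, fun _ => Eventually.of_forall fun _ => rfl, rfl⟩
  | succ j => exact globallyGenerated_Q _

/-- The higher cohomology of a constant sheaf vanishes if the identity is homotopic to a locally
constant map. -/
theorem acyclic_const (H : X × unitInterval → X) (hH : Continuous H) (h₁ : ∀ x, H (x, 1) = x)
    (h₀ : ∀ x, ∀ᶠ y in 𝓝 x, H (y, 0) = H (x, 0)) (q : ℕ) : Acyclic q (const A X) := by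
  have hi : ∀ t : unitInterval, Continuous fun x : X => (x, t) := fun t => by fun_prop
  -- `b j` is restriction to the end `1` minus restriction to the end `0`, from sections near the
  -- fibres of `X × I → X`. Homotopy invariance is the claim that it vanishes on cohomology.
  let b : ∀ j, Hom (push (Prod.fst : X × unitInterval → X) (constQ A (X × unitInterval) j))
      (constQ A X j) := fun j =>
    pushDiff (constQMap A (hi 1) j) (constQMap A (hi 0) j) (fun _ => rfl) fun _ => rfl
  have hses : ∀ j, SES (pushι (Prod.fst : X × unitInterval → X) (constQ A (X × unitInterval) j))
      (pushπ _ continuous_fst) := fun j =>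
    ses_push _ _ fun η x h => lift_near_fibre (globallyGenerated_constQ A j) h
  -- For the constant sheaf itself `b` is zero, because its sections are constant on the connected
  -- fibre. Each application of `Q` uses the connecting homomorphism of the direct image sequence,
  -- whose target has a flasque middle term.
  have hb : ∀ j r, Kills r (b j) := by
    intro j
    induction j with
    | zero =>
      refine kills_of_eq_zero _ fun x a => ?_
      obtain ⟨s, rfl⟩ := germ_surjective x a
      have hs : ∀ y : X × unitInterval, y.1 = x → ∀ᶠ z in 𝓝 y, s.1 z = s.1 y := s.2.self_of_nhds
      have hc : IsLocallyConstant fun t : unitInterval => (show A from s.1 (x, t)) := by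
        rw [IsLocallyConstant.iff_eventually_eq]
        intro t
        exact (by fun_prop : Continuous fun t : unitInterval => (x, t)).continuousAt.eventually
          (hs (x, t) rfl)
      have : s.1 (x, 1) = s.1 (x, 0) := hc.apply_eq_of_isPreconnected isPreconnected_univ
        trivial trivial
      exact sub_eq_zero.2 this
    | succ j ih =>
      intro r
      exact (hses j).kills (ses_godement _)
        (pushFamDiff_pushι (constQMap A (hi 1) j) (constQMap A (hi 0) j) _ _)
        (pushDiff_pushπ (constQMap A (hi 1) j) (constQMap A (hi 0) j) continuous_fst _ _ (hi 1)
            (hi 0))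
        (ih (r + 1)) ((flasque_godement _).acyclic r)
  have h := (acyclic_constQ A (X := X) (q := 0) (j := q))
  rw [Nat.zero_add] at h
  rw [← h, acyclic_zero]
  intro η hη
  let η' : ∀ y, (constQ A (X × unitInterval) (q + 1)).stalk y := fun y =>
    (constQMap A hH (q + 1)).app y (η (H y))
  have hη' : (constQ A (X × unitInterval) (q + 1)).IsGlobal η' := fun y =>
    (constQMap A hH (q + 1)).isSec η y (hη (H y))
  -- Applied to the pull-back of `η` by the homotopy: since `b q` kills degree one, the difference
  -- of the two end restrictions of this pull-back lifts to a section of the sheaf of all families,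
  -- that is, it is the class of a family.
  obtain ⟨e, he, h2⟩ := (hses q).lift_of_kills
    (pushFamDiff_pushι (constQMap A (hi 1) q) (constQMap A (hi 0) q) _ _)
    (pushDiff_pushπ (constQMap A (hi 1) q) (constQMap A (hi 0) q) continuous_fst _ _ (hi 1) (hi 0))
    (ses_godement _).zero (hb q 0)
    (r := fun x => germ _ _ _ _ x ⟨η', Eventually.of_forall fun _ y _ => hη' y⟩)
    (fun x => ⟨η', Eventually.of_forall fun z => ⟨Eventually.of_forall fun _ y _ => hη' y, rfl⟩⟩)
  obtain ⟨s, hs⟩ := (constQ A X q).exists_gmk (W := Set.univ) fun x _ => he x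
  -- The restriction to the end `1` is `η`, and the restriction to the end `0` is a pull-back by a
  -- locally constant map, hence again the class of a family. The sum of the two families represents
  -- `η`.
  obtain ⟨s', hs'⟩ := constQMap_locallyConstant A (hH.comp (hi 0)) h₀ q η
  refine ⟨s + s', fun x => ?_⟩
  have h3 := h2 x
  rw [hs x trivial, godementQ_gmk] at h3
  rw [map_add, h3, ← hs']
  have e1 : (constQMap A (hi 1) (q + 1)).app x (η' (x, 1)) = η x :=
    (constQMap_comp A hH (hi 1) (q + 1) x (η (H (x, 1)))).symm.trans
      (constQMap_of_eq_id A (hH.comp (hi 1)) h₁ (q + 1) η x)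
  have e0 : (constQMap A (hi 0) (q + 1)).app x (η' (x, 0)) =
      (constQMap A (hH.comp (hi 0)) (q + 1)).app x (η (H (x, 0))) :=
    (constQMap_comp A hH (hi 0) (q + 1) x (η (H (x, 0)))).symm
  have h4 : ∀ a b a' b' : (constQ A X (q + 1)).stalk x, a = a' → b = b' → a' = (a - b) + b' := by
    rintro a b _ _ rfl rfl
    exact (sub_add_cancel _ _).symm
  exact h4 _ _ _ _ e1 e0

end GermSheaf
end EtaleGerbe
end

noncomputable section
open CategoryTheory Filter Topology
open scoped Manifold ContDiff
namespace EtaleGerbe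

/-! ### Sections of sheaves on the site -/

section SiteSections

variable {n : ℕ} {G : SmoothEtaleGroupoid.{u} n}

@[simp]
lemma secMap_id (F : GSheaf G) {U : Site G} (c : sec F U) : secMap F (𝟙 U) c = c := by
  change (F.obj.map (𝟙 (Opposite.op U))) c = c
  rw [F.obj.map_id]
  rfl

lemma secMap_comp (F : GSheaf G) {U V W : Site G} (σ : U ⟶ V) (τ : V ⟶ W) (c : sec F W) :
    secMap F (σ ≫ τ) c = secMap F σ (secMap F τ c) :=
  ConcreteCategory.congr_hom (F.obj.map_comp τ.op σ.op) c

lemma secMap_inclHom_comp (F : GSheaf G) {U V W : Site G} (h : U.opens ≤ V.opens)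
    (h' : V.opens ≤ W.opens) (c : sec F W) :
    secMap F (Site.inclHom h) (secMap F (Site.inclHom h') c) =
      secMap F (Site.inclHom (h.trans h')) c := by
  rw [← secMap_comp, Site.inclHom_comp]

lemma secMap_inclHom_self (F : GSheaf G) {U : Site G} (h : U.opens ≤ U.opens) (c : sec F U) :
    secMap F (Site.inclHom h) c = c := secMap_id F c

lemma homOn_comp {F F' F'' : GSheaf G} (φ : F ⟶ F') (ψ : F' ⟶ F'') (U : Site G) (c : sec F U) :
    homOn (φ ≫ ψ) U c = homOn ψ U (homOn φ U c) := rfl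

lemma homOn_add {F F' : GSheaf G} (φ ψ : F ⟶ F') (U : Site G) (c : sec F U) :
    homOn (φ + ψ) U c = homOn φ U c + homOn ψ U c := rfl

lemma homOn_zero {F F' : GSheaf G} (U : Site G) (c : sec F U) :
    homOn (0 : F ⟶ F') U c = 0 := rfl

lemma isSheafFor_cover (F : GSheaf G) {U : Site G} {ι : Type u} (V : ι → Site G)
    (hV : ∀ i, (V i).opens ≤ U.opens) (hcov : ∀ x ∈ U.opens, ∃ i, x ∈ (V i).opens) :
    (Presieve.ofArrows V fun i => Site.inclHom (hV i)).IsSheafFor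
      (F.obj ⋙ forget AddCommGrpCat.{u}) := by
  have h := F.property
  rw [Presheaf.isSheaf_iff_isSheaf_forget _ _ (forget AddCommGrpCat.{u}),
    isSheaf_iff_isSheaf_of_type] at h
  rw [Presieve.isSheafFor_iff_generate]
  refine h _ fun x hx => ?_
  obtain ⟨i, hi⟩ := hcov x hx
  exact ⟨V i, hV i, hi, Sieve.le_generate _ _ _ (Presieve.ofArrows.mk i)⟩

lemma sec_ext (F : GSheaf G) {U : Site G} {s t : sec F U}
    (h : ∀ x ∈ U.opens, ∃ (V : Site G) (hV : V.opens ≤ U.opens), x ∈ V.opens ∧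
      secMap F (Site.inclHom hV) s = secMap F (Site.inclHom hV) t) : s = t := by
  choose V hV hxV e using fun x : U.opens => h x.1 x.2
  refine (isSheafFor_cover F V hV fun x hx => ⟨⟨x, hx⟩, hxV _⟩).isSeparatedFor.ext ?_
  rintro _ _ ⟨x⟩
  exact e x

/-- The sheaf condition on the site tests compatibility on all pairs of morphisms into the cover,
not only on inclusions. It is enough to test inclusions, because two morphisms that agree in `U` are
given by the same arrows and factor through the intersection. -/
lemma sec_glue (F : GSheaf G) {U : Site G} {ι : Type u} (V : ι → Site G)
    (hV : ∀ i, (V i).opens ≤ U.opens) (hcov : ∀ x ∈ U.opens, ∃ i, x ∈ (V i).opens)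
    (s : ∀ i, sec F (V i))
    (hs : ∀ i j (W : Site G) (hi : W.opens ≤ (V i).opens) (hj : W.opens ≤ (V j).opens),
      secMap F (Site.inclHom hi) (s i) = secMap F (Site.inclHom hj) (s j)) :
    ∃ t : sec F U, ∀ i, secMap F (Site.inclHom (hV i)) t = s i := by
  obtain ⟨t, ht, -⟩ := Presieve.isSheafFor_arrows_iff _ _ |>.1 (isSheafFor_cover F V hV hcov) s (by
    intro i j W gi gj hg
    -- Composition with an inclusion multiplies the arrows by units, so equality of the composites
    -- already means equality of the families of arrows.
    have h1 : ∀ x : W.opens, Site.Hom.arr gi x = Site.Hom.arr gj x := by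
      intro x
      have e := congrArg (fun q : Site.Hom W U => q.arr x) hg
      have a1 := G.comp_unit (Site.Hom.arr gi x)
      have a2 := G.comp_unit (Site.Hom.arr gj x)
      exact a1.symm.trans (Eq.trans e a2)
    let I : Site G := ⟨(V i).opens ⊓ (V j).opens⟩
    let ρ : W ⟶ I := (⟨gi.arr, gi.continuous_arr, gi.src_arr, fun x => ⟨gi.tgt_mem x, by
      have := gj.tgt_mem x
      rwa [← h1 x] at this⟩⟩ : Site.Hom W I)
    have e1 : ρ ≫ Site.inclHom (inf_le_left : I.opens ≤ _) = gi := by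
      apply Site.Hom.ext
      funext x
      exact G.comp_unit (Site.Hom.arr gi x)
    have e2 : ρ ≫ Site.inclHom (inf_le_right : I.opens ≤ _) = gj := by
      apply Site.Hom.ext
      funext x
      exact (G.comp_unit (Site.Hom.arr gi x)).trans (h1 x)
    change secMap F gi (s i) = secMap F gj (s j)
    rw [← e1, ← e2, secMap_comp, secMap_comp, hs i j I])
  exact ⟨t, ht⟩

/-- Epimorphisms of sheaves are locally surjective, and covering sieves of this site contain
inclusions of open neighbourhoods. -/
lemma exists_local_lift {F F' : GSheaf G} (φ : F ⟶ F') [Epi φ] {U : Site G} (c : sec F' U)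
    {x : G.Obj} (hx : x ∈ U.opens) : ∃ (V : Site G) (hV : V.opens ≤ U.opens) (b : sec F V),
      x ∈ V.opens ∧ homOn φ V b = secMap F' (Site.inclHom hV) c := by
  have h : Sheaf.IsLocallySurjective φ := (Sheaf.isLocallySurjective_iff_epi' _ φ).2 inferInstance
  obtain ⟨V, hV, hxV, b, hb⟩ := h.imageSieve_mem c x hx
  exact ⟨V, hV, b, hxV, hb⟩

/-- The sheaf which represents the sections over `U`. -/
def freeSheaf (U : Site G) : GSheaf G :=
  (presheafToSheaf (Site.topology G) AddCommGrpCat.{u}).obj (yoneda.obj U ⋙ AddCommGrpCat.free)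

/-- Morphisms from `freeSheaf U` are sections over `U`. -/
def freeSheafEquiv (U : Site G) (F : GSheaf G) : (freeSheaf U ⟶ F) ≃ sec F U :=
  ((sheafificationAdjunction (Site.topology G) AddCommGrpCat.{u}).homEquiv _ _).trans
    (((AddCommGrpCat.adj.whiskerRight (Site G)ᵒᵖ).homEquiv (yoneda.obj U) F.obj).trans
      yonedaEquiv)

lemma freeSheafEquiv_comp (U : Site G) {F F' : GSheaf G} (f : freeSheaf U ⟶ F) (φ : F ⟶ F') :
    freeSheafEquiv U F' (f ≫ φ) = homOn φ U (freeSheafEquiv U F f) := by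
  have h1 := (sheafificationAdjunction (Site.topology G)
    AddCommGrpCat.{u}).homEquiv_naturality_right (X := yoneda.obj U ⋙ AddCommGrpCat.free) f φ
  have h2 := (AddCommGrpCat.adj.whiskerRight (Site G)ᵒᵖ).homEquiv_naturality_right
    (X := yoneda.obj U) ((sheafificationAdjunction (Site.topology G)
    AddCommGrpCat.{u}).homEquiv _ _ f) φ.hom
  exact congrArg yonedaEquiv ((congrArg _ h1).trans h2)

/-- A universal section `e` makes sections over `U` the same as morphisms out of one object.
Statements about homology up to an epimorphic refinement then become statements about sections after
passage to a smaller open set. -/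
lemma exists_freeSheaf_hom (U : Site G) : ∃ e : sec (freeSheaf U) U, ∀ (F : GSheaf G) (t : sec F U),
    ∃! τ : freeSheaf U ⟶ F, homOn τ U e = t := by
  have key : ∀ (F : GSheaf G) (f : freeSheaf U ⟶ F),
      homOn f U (freeSheafEquiv U _ (𝟙 _)) = freeSheafEquiv U F f := by
    intro F f
    rw [← freeSheafEquiv_comp, Category.id_comp]
  refine ⟨freeSheafEquiv U _ (𝟙 _), fun F t => ⟨(freeSheafEquiv U F).symm t, ?_, fun τ hτ => ?_⟩⟩
  · beta_reduce
    rw [key, Equiv.apply_symm_apply]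
  · rw [← hτ, key, Equiv.symm_apply_apply]

section QuasiIso

variable {K T : CochainComplex (GSheaf G) ℕ} {η : K ⟶ T} (hη : QuasiIso η) {i j k : ℕ}

-- Surjectivity on homology, for sections: a closed section is locally the image of a closed section
-- up to a boundary.
include hη in
lemma exists_local_surj (hi : (ComplexShape.up ℕ).prev j = i) (hk : (ComplexShape.up ℕ).next j = k)
    {U : Site G} (t : sec (T.X j) U) (ht : homOn (T.d j k) U t = 0) {x : G.Obj} (hx : x ∈ U.opens) :
    ∃ (V : Site G) (hV : V.opens ≤ U.opens) (a : sec (K.X j) V) (b : sec (T.X i) V), x ∈ V.opens ∧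
      homOn (K.d j k) V a = 0 ∧
      secMap _ (Site.inclHom hV) t = homOn (η.f j) V a + homOn (T.d i j) V b := by
  obtain ⟨e, he⟩ := exists_freeSheaf_hom U
  obtain ⟨τ, hτ, -⟩ := he _ t
  have hiso := (quasiIsoAt_iff_isIso_homologyMap η j).1 (hη.quasiIsoAt j)
  have hepi : Epi (HomologicalComplex.homologyMap η j) := inferInstance
  have h0 : τ ≫ T.d j k = 0 := (he _ 0).unique ((congrArg _ hτ).trans ht) rfl
  obtain ⟨A, π, hπ, x₂, hx₂, y₁, h⟩ :=
    (HomologicalComplex.epi_homologyMap_iff_up_to_refinements η i j k hi hk).1 hepi τ h0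
  obtain ⟨V, hV, b, hxV, hb⟩ := exists_local_lift π e hx
  refine ⟨V, hV, homOn x₂ V b, homOn y₁ V b, hxV, ?_, ?_⟩
  · rw [← homOn_comp, hx₂, homOn_zero]
  · rw [← homOn_comp, ← homOn_comp, ← homOn_add, ← h, homOn_comp, hb, homOn_secMap, hτ]

-- Injectivity on homology, for sections: a closed section whose image is a boundary is locally a
-- boundary.
include hη in
lemma exists_local_inj (hi : (ComplexShape.up ℕ).prev j = i) (hk : (ComplexShape.up ℕ).next j = k)
    {U : Site G} (a : sec (K.X j) U) (ha : homOn (K.d j k) U a = 0) (t : sec (T.X i) U)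
    (ht : homOn (η.f j) U a = homOn (T.d i j) U t) {x : G.Obj} (hx : x ∈ U.opens) :
    ∃ (V : Site G) (hV : V.opens ≤ U.opens) (b : sec (K.X i) V), x ∈ V.opens ∧
      secMap _ (Site.inclHom hV) a = homOn (K.d i j) V b := by
  obtain ⟨e, he⟩ := exists_freeSheaf_hom U
  obtain ⟨τ, hτ, -⟩ := he _ a
  obtain ⟨θ, hθ, -⟩ := he _ t
  have hiso := (quasiIsoAt_iff_isIso_homologyMap η j).1 (hη.quasiIsoAt j)
  have hmono : Mono (HomologicalComplex.homologyMap η j) := inferInstance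
  have h0 : τ ≫ K.d j k = 0 := (he _ 0).unique ((congrArg _ hτ).trans ha) rfl
  have h1 : τ ≫ η.f j = θ ≫ T.d i j := (he _ _).unique (congrArg (homOn (η.f j) U) hτ)
    ((congrArg (homOn (T.d i j) U) hθ).trans ht.symm)
  obtain ⟨A, π, hπ, x₁, h⟩ :=
    (HomologicalComplex.mono_homologyMap_iff_up_to_refinements η i j k hi hk).1 hmono τ h0
      θ h1
  obtain ⟨V, hV, b, hxV, hb⟩ := exists_local_lift π e hx
  refine ⟨V, hV, homOn x₁ V b, hxV, ?_⟩
  rw [← homOn_comp, ← h, homOn_comp, hb, homOn_secMap, hτ]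

end QuasiIso

end SiteSections
end EtaleGerbe
end

noncomputable section
open CategoryTheory Filter Topology
open scoped Manifold ContDiff
namespace EtaleGerbe

/-! ### The pull-back of a sheaf to an étale space -/

section EtaleGerms

variable {n : ℕ} {G : SmoothEtaleGroupoid.{u} n}

/-- The local sections over `U` of an étale space. -/
abbrev LocSec (Z : EtaleSpace G.Obj) (U : Site G) : Type u := (EtaleSpace.ofOpens U.opens).Hom Z

lemma EtaleSpace.Hom.ext_fun {X : Type u} [TopologicalSpace X] {Z W : EtaleSpace X} {f g : Z.Hom W}
    (h : ∀ z, f.toFun z = g.toFun z) : f = g := by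
  obtain ⟨f, _, _⟩ := f
  obtain ⟨g, _, _⟩ := g
  obtain rfl : f = g := funext h
  rfl

lemma exists_site_nhds {U : Site G} {x : U.opens} {p : U.opens → Prop} (h : ∀ᶠ y in 𝓝 x, p y) :
    ∃ (V : Site G) (hV : V.opens ≤ U.opens), x.1 ∈ V.opens ∧ ∀ y : V.opens, p ⟨y.1, hV y.2⟩ := by
  obtain ⟨O, hO, hOo, hx⟩ := eventually_nhds_iff.1 h
  refine ⟨⟨⟨Subtype.val '' O, U.opens.isOpen.isOpenMap_subtype_val O hOo⟩⟩, ?_, ⟨x, hx, rfl⟩, ?_⟩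
  · rintro _ ⟨y, -, rfl⟩
    exact y.2
  · rintro ⟨_, y, hy, rfl⟩
    exact hO _ hy

variable {Z : EtaleSpace G.Obj}

lemma proj_locSec {U : Site G} (f : LocSec Z U) (x : U.opens) : Z.proj (f.toFun x) = x.1 :=
  f.proj_toFun x

lemma exists_locSec (z : Z.carrier) {p : Z.carrier → Prop} (h : ∀ᶠ w in 𝓝 z, p w) :
    ∃ (U : Site G) (f : LocSec Z U) (x : U.opens), f.toFun x = z ∧ ∀ y, p (f.toFun y) := by
  have h1 : ∀ᶠ x in 𝓝 (Z.proj z), ContinuousAt (Z.loc z) x := by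
    have h := (Z.isLocalHomeomorph.localInverseAt z).open_source.mem_nhds
      Z.isLocalHomeomorph.apply_self_mem_localInverseAt_source
    filter_upwards [h] with x hx
    exact (Z.isLocalHomeomorph.localInverseAt z).continuousAt hx
  obtain ⟨O, hO, hOo, hx⟩ := eventually_nhds_iff.1
    ((h1.and (Z.proj_loc z)).and ((Z.tendsto_loc z).eventually h))
  exact ⟨⟨⟨O, hOo⟩⟩, ⟨fun x => Z.loc z x.1, continuous_iff_continuousAt.2 fun x =>
      (hO x.1 x.2).1.1.comp continuous_subtype_val.continuousAt, fun x => (hO x.1 x.2).1.2⟩,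
    ⟨Z.proj z, hx⟩, Z.loc_proj z, fun y => (hO y.1 y.2).2⟩

/-- The image of a local section of a local homeomorphism is open: near its value the section agrees
with the local inverse of the projection. -/
lemma eventually_mem_range {U : Site G} (f : LocSec Z U) (x : U.opens) :
    ∀ᶠ w in 𝓝 (f.toFun x), ∃ y, f.toFun y = w := by
  have hpx : Z.proj (f.toFun x) = x.1 := f.proj_toFun x
  have h1 : ∀ᶠ y in 𝓝 x, Z.loc (f.toFun x) y.1 = f.toFun y := by
    filter_upwards [f.continuous_toFun.continuousAt.eventually (Z.eventually_loc (f.toFun x))]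
      with y hy
    exact (congrArg _ (f.proj_toFun y)).symm.trans hy
  obtain ⟨V, hV, hx, h2⟩ := exists_site_nhds h1
  have h3 : ∀ᶠ w in 𝓝 (f.toFun x), Z.proj w ∈ V.opens :=
    (Z.tendsto_proj _).eventually (V.opens.isOpen.mem_nhds (by rwa [hpx]))
  filter_upwards [h3, Z.eventually_loc (f.toFun x)] with w hw h4
  exact ⟨⟨Z.proj w, hV hw⟩, (h2 ⟨Z.proj w, hw⟩).symm.trans h4⟩

/-- The projection recovers the parameter of a point on a local section, so a section with values in
the image of `f` has to be a restriction of `f`. -/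
lemma eq_restr_of_mem_range {U V : Site G} (f : LocSec Z U) (g : LocSec Z V)
    (h : ∀ y, ∃ x, f.toFun x = g.toFun y) : ∃ hV : V.opens ≤ U.opens, g = f.restr hV := by
  have key : ∀ y : V.opens, ∃ hy : y.1 ∈ U.opens, f.toFun ⟨y.1, hy⟩ = g.toFun y := by
    intro y
    obtain ⟨x, hx⟩ := h y
    have e : x.1 = y.1 := by rw [← proj_locSec f x, hx, proj_locSec]
    obtain ⟨y, hy⟩ := y
    obtain ⟨x, hx'⟩ := x
    subst e
    exact ⟨hx', hx⟩
  refine ⟨fun y hy => (key ⟨y, hy⟩).1, EtaleSpace.Hom.ext_fun fun y => (key y).2.symm⟩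

lemma exists_common_restr {U V : Site G} (f : LocSec Z U) (g : LocSec Z V)
    {x : U.opens} {y : V.opens}
    (h : f.toFun x = g.toFun y) {p : Z.carrier → Prop} (hp : ∀ᶠ w in 𝓝 (f.toFun x), p w) :
    ∃ (W : Site G) (h1 : W.opens ≤ U.opens) (h2 : W.opens ≤ V.opens), x.1 ∈ W.opens ∧
      f.restr h1 = g.restr h2 ∧ ∀ w, p ((f.restr h1).toFun w) := by
  have h0 := (eventually_mem_range f x).and hp
  rw [h] at h0
  obtain ⟨W, hW, hyW, hw⟩ := exists_site_nhds (g.continuous_toFun.continuousAt.eventually h0)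
  obtain ⟨hWU, e⟩ := eq_restr_of_mem_range f (g.restr hW) fun w => (hw w).1
  refine ⟨W, hWU, hW, ?_, e.symm, fun w => ?_⟩
  · rwa [← proj_locSec f x, h, proj_locSec]
  · rw [← e]
    exact (hw w).2

end EtaleGerms

section EtaleGerms

variable {n : ℕ} {G : SmoothEtaleGroupoid.{u} n} (F : GSheaf G) (Z : EtaleSpace G.Obj)

/-- Families of sections indexed by the local sections of an étale space. -/
abbrev EtaleFam : Type u := ∀ U : Site G, LocSec Z U → sec F U

/-- The families compatible with restriction near `z`. -/
def compatNear (z : Z.carrier) : AddSubgroup (EtaleFam F Z) where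
  carrier := {c | ∀ᶠ W in (𝓝 z).smallSets, ∀ (U V : Site G) (h : U.opens ≤ V.opens)
    (f : LocSec Z V), (∀ x, f.toFun x ∈ W) → secMap F (Site.inclHom h) (c V f) = c U (f.restr h)}
  zero_mem' := Eventually.of_forall fun W U V h f _ => map_zero _
  add_mem' ha hb := by
    filter_upwards [ha, hb] with W h1 h2 U V h f hf
    rw [Pi.add_apply, Pi.add_apply, map_add, h1 U V h f hf, h2 U V h f hf]
    rfl
  neg_mem' ha := by
    filter_upwards [ha] with W h1 U V h f hf
    rw [Pi.neg_apply, Pi.neg_apply, map_neg, h1 U V h f hf]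
    rfl

/-- The families which vanish near `z`. -/
def zeroNear (z : Z.carrier) : AddSubgroup (EtaleFam F Z) where
  carrier := {c | ∀ᶠ W in (𝓝 z).smallSets, ∀ (U : Site G) (f : LocSec Z U),
    (∀ x, f.toFun x ∈ W) → c U f = 0}
  zero_mem' := Eventually.of_forall fun W U f _ => rfl
  add_mem' ha hb := by
    filter_upwards [ha, hb] with W h1 h2 U f hf
    rw [Pi.add_apply, Pi.add_apply, h1 U f hf, h2 U f hf, add_zero]
  neg_mem' ha := by
    filter_upwards [ha] with W h1 U f hf
    rw [Pi.neg_apply, Pi.neg_apply, h1 U f hf, neg_zero]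

lemma mem_compatNear {z : Z.carrier} {c : EtaleFam F Z} : c ∈ compatNear F Z z ↔
    ∃ W ∈ 𝓝 z, ∀ (U V : Site G) (h : U.opens ≤ V.opens) (f : LocSec Z V), (∀ x, f.toFun x ∈ W) →
      secMap F (Site.inclHom h) (c V f) = c U (f.restr h) :=
  eventually_smallSets' fun _ _ hst h U V hUV f hf => h U V hUV f fun x => hst (hf x)

lemma mem_zeroNear {z : Z.carrier} {c : EtaleFam F Z} : c ∈ zeroNear F Z z ↔
    ∃ W ∈ 𝓝 z, ∀ (U : Site G) (f : LocSec Z U), (∀ x, f.toFun x ∈ W) → c U f = 0 :=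
  eventually_smallSets' fun _ _ hst h U f hf => h U f fun x => hst (hf x)

/-- The pull-back to an étale space of a sheaf on the site. -/
def gs : GermSheaf Z.carrier :=
  GermSheaf.ofLocal (compatNear F Z) (zeroNear F Z)
    (fun z c hc => by
      obtain ⟨W, hW, h⟩ := (mem_compatNear F Z).1 hc
      filter_upwards [eventually_mem_nhds_iff.2 hW] with w hw
      exact (mem_compatNear F Z).2 ⟨W, hw, h⟩)
    (fun z c hc => by
      obtain ⟨W, hW, h⟩ := (mem_zeroNear F Z).1 hc
      filter_upwards [eventually_mem_nhds_iff.2 hW] with w hw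
      exact (mem_zeroNear F Z).2 ⟨W, hw, h⟩)

variable {F Z}

/-- The germ of a family at a point near which it is compatible. -/
def gsMk (z : Z.carrier) : compatNear F Z z →+ (gs F Z).stalk z := GermSheaf.germ _ _ _ _ z

lemma gsMk_surjective (z : Z.carrier) : Function.Surjective (gsMk (F := F) z) :=
  GermSheaf.germ_surjective z

lemma gsMk_eq_zero_iff {z : Z.carrier} (c : compatNear F Z z) :
    gsMk z c = 0 ↔ ∃ W ∈ 𝓝 z, ∀ (U : Site G) (f : LocSec Z U), (∀ x, f.toFun x ∈ W) →
      c.1 U f = 0 :=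
  (GermSheaf.germ_eq_zero_iff c).trans (mem_zeroNear F Z)

lemma gsMk_eq_iff {z : Z.carrier} (c c' : compatNear F Z z) :
    gsMk z c = gsMk z c' ↔ ∃ W ∈ 𝓝 z, ∀ (U : Site G) (f : LocSec Z U), (∀ x, f.toFun x ∈ W) →
      c.1 U f = c'.1 U f := by
  rw [← sub_eq_zero, ← map_sub, gsMk_eq_zero_iff]
  exact exists_congr fun W => and_congr_right fun _ => forall_congr' fun U => forall_congr' fun f =>
    imp_congr_right fun _ => sub_eq_zero

lemma isSec_gs {η : ∀ z, (gs F Z).stalk z} {z : Z.carrier} : (gs F Z).IsSec η z ↔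
    ∃ c, ∀ᶠ w in 𝓝 z, ∃ h : c ∈ compatNear F Z w, η w = gsMk w ⟨c, h⟩ := Iff.rfl

/-- The family of the restrictions of a section along the restrictions of a local section. -/
def locFam {U : Site G} (f : LocSec Z U) : sec F U →+ EtaleFam F Z where
  toFun s V g := open Classical in if h : ∃ hV : V.opens ≤ U.opens, g = f.restr hV then
    secMap F (Site.inclHom h.1) s else 0
  map_zero' := by
    funext V g
    split_ifs
    · exact map_zero _
    · rfl
  map_add' s t := by
    funext V g
    rw [Pi.add_apply, Pi.add_apply]
    split_ifs
    · exact map_add _ _ _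
    · exact (add_zero _).symm

lemma locFam_restr {U V : Site G} (f : LocSec Z U) (s : sec F U) (h : V.opens ≤ U.opens) :
    locFam f s V (f.restr h) = secMap F (Site.inclHom h) s :=
  dif_pos (⟨h, rfl⟩ : ∃ hV : V.opens ≤ U.opens, f.restr h = f.restr hV)

lemma locFam_compat {U : Site G} (f : LocSec Z U) (s : sec F U) {z : Z.carrier}
    (hz : ∃ x, f.toFun x = z) : locFam f s ∈ compatNear F Z z := by
  obtain ⟨x, rfl⟩ := hz
  refine (mem_compatNear F Z).2 ⟨_, eventually_mem_range f x, fun V' V h g hg => ?_⟩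
  obtain ⟨hV, rfl⟩ := eq_restr_of_mem_range f g hg
  rw [locFam_restr, secMap_inclHom_comp, ← locFam_restr]
  rfl

/-- The germ at `z` of a section over the domain of a local section through `z`. -/
def gsGerm (z : Z.carrier) {U : Site G} (f : LocSec Z U) (hz : ∃ x, f.toFun x = z) :
    sec F U →+ (gs F Z).stalk z :=
  (gsMk z).comp ((locFam f).codRestrict _ fun s => locFam_compat f s hz)

lemma gsGerm_eq_zero_iff {U : Site G} (f : LocSec Z U) (x : U.opens) (s : sec F U) :
    gsGerm (f.toFun x) f ⟨x, rfl⟩ s = 0 ↔ ∃ (V : Site G) (h : V.opens ≤ U.opens), x.1 ∈ V.opens ∧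
      secMap F (Site.inclHom h) s = 0 := by
  refine (gsMk_eq_zero_iff _).trans ⟨fun ⟨W, hW, h⟩ => ?_, fun ⟨V, hV, hx, h⟩ => ?_⟩
  · obtain ⟨V, hV, hx, h1⟩ := exists_site_nhds (f.continuous_toFun.continuousAt.eventually hW)
    refine ⟨V, hV, hx, ?_⟩
    rw [← locFam_restr f]
    exact h V (f.restr hV) h1
  · refine ⟨_, eventually_mem_range (f.restr hV) ⟨x.1, hx⟩, fun V' g hg => ?_⟩
    obtain ⟨hV', rfl⟩ := eq_restr_of_mem_range _ g hg
    refine (locFam_restr f s (hV'.trans hV)).trans ?_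
    rw [← secMap_inclHom_comp F hV' hV, h, map_zero]

/-- Near a point all local sections through it are restrictions of one of them, so a compatible
family is determined near that point by a single member. -/
lemma gsMk_eq_gsGerm {z : Z.carrier} (c : compatNear F Z z) {W : Set Z.carrier}
    (hW : ∀ (U V : Site G) (h : U.opens ≤ V.opens) (f : LocSec Z V), (∀ x, f.toFun x ∈ W) →
      secMap F (Site.inclHom h) (c.1 V f) = c.1 U (f.restr h)) {U : Site G} (f : LocSec Z U)
    (hz : ∃ x, f.toFun x = z) (hf : ∀ x, f.toFun x ∈ W) : gsMk z c = gsGerm z f hz (c.1 U f) := by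
  obtain ⟨x, rfl⟩ := hz
  refine (gsMk_eq_iff _ _).2 ⟨_, eventually_mem_range f x, fun V g hg => ?_⟩
  obtain ⟨hV, rfl⟩ := eq_restr_of_mem_range f g hg
  exact (hW _ _ hV f hf).symm.trans (locFam_restr f _ hV).symm

lemma exists_gsGerm (z : Z.carrier) (a : (gs F Z).stalk z) {p : Z.carrier → Prop}
    (hp : ∀ᶠ w in 𝓝 z, p w) : ∃ (U : Site G) (f : LocSec Z U)
      (hz : ∃ x, f.toFun x = z) (s : sec F U), (∀ x, p (f.toFun x)) ∧ a = gsGerm z f hz s := by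
  obtain ⟨c, rfl⟩ := gsMk_surjective z a
  obtain ⟨W, hW, h⟩ := (mem_compatNear F Z).1 c.2
  obtain ⟨U, f, x, hx, hf⟩ := exists_locSec z (hp.and hW)
  exact ⟨U, f, ⟨x, hx⟩, c.1 U f, fun x => (hf x).1,
    gsMk_eq_gsGerm c h f ⟨x, hx⟩ fun x => (hf x).2⟩

lemma gsGerm_restr {U V : Site G} (f : LocSec Z U) (h : V.opens ≤ U.opens) {z : Z.carrier}
    (hz : ∃ x, (f.restr h).toFun x = z) (hz' : ∃ x, f.toFun x = z) (s : sec F U) :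
    gsGerm z (f.restr h) hz (secMap F (Site.inclHom h) s) = gsGerm z f hz' s := by
  obtain ⟨x, rfl⟩ := hz
  refine (gsMk_eq_iff _ _).2 ⟨_, eventually_mem_range (f.restr h) x, fun V g hg => ?_⟩
  obtain ⟨hV, rfl⟩ := eq_restr_of_mem_range _ g hg
  refine (locFam_restr (f.restr h) _ hV).trans ?_
  rw [secMap_inclHom_comp]
  exact (locFam_restr f s (hV.trans h)).symm

/-- The morphism induced by a morphism of sheaves. -/
def gsMap {F F' : GSheaf G} (φ : F ⟶ F') (Z : EtaleSpace G.Obj) :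
    GermSheaf.Hom (gs F Z) (gs F' Z) :=
  GermSheaf.ofLocalMap continuous_id
    (AddMonoidHom.mk' (fun c U f => homOn φ U (c U f))
      fun c c' => funext fun U => funext fun f => map_add _ _ _)
    (fun z c hc => by
      obtain ⟨W, hW, h⟩ := (mem_compatNear F Z).1 hc
      refine (mem_compatNear F' Z).2 ⟨W, hW, fun U V hUV f hf => ?_⟩
      refine (homOn_secMap φ _ _).symm.trans ?_
      rw [h U V hUV f hf]
      rfl)
    (fun z c _ hc => by
      obtain ⟨W, hW, h⟩ := (mem_zeroNear F Z).1 hc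
      refine (mem_zeroNear F' Z).2 ⟨W, hW, fun U f hf => ?_⟩
      change homOn φ U (c U f) = 0
      rw [h U f hf, map_zero])

lemma gsMap_gsGerm {F F' : GSheaf G} (φ : F ⟶ F') (z : Z.carrier) {U : Site G} (f : LocSec Z U)
    (hz : ∃ x, f.toFun x = z) (s : sec F U) :
    (gsMap φ Z).app z (gsGerm z f hz s) = gsGerm z f hz (homOn φ U s) := by
  have e : (fun V g => homOn φ V (locFam f s V g)) = locFam f (homOn φ U s) := by
    funext V g
    by_cases h : ∃ hV : V.opens ≤ U.opens, g = f.restr hV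
    · obtain ⟨hV, rfl⟩ := h
      rw [locFam_restr, locFam_restr, homOn_secMap]
    · have e1 : ∀ {E : GSheaf G} (t : sec E U), locFam f t V g = 0 := fun t => dif_neg h
      rw [e1, e1, map_zero]
  refine congrArg (gsMk z) (Subtype.ext e)

lemma gsMap_zero {F F' : GSheaf G} (z : Z.carrier) (a : (gs F Z).stalk z) :
    (gsMap (0 : F ⟶ F') Z).app z a = 0 := by
  obtain ⟨U, f, hz, s, -, rfl⟩ := exists_gsGerm z a (Eventually.of_forall fun _ => trivial)
  rw [gsMap_gsGerm, homOn_zero, map_zero]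

lemma gsMap_comp {F F' F'' : GSheaf G} (φ : F ⟶ F') (ψ : F' ⟶ F'') (z : Z.carrier)
    (a : (gs F Z).stalk z) :
    (gsMap ψ Z).app z ((gsMap φ Z).app z a) = (gsMap (φ ≫ ψ) Z).app z a := by
  obtain ⟨U, f, hz, s, -, rfl⟩ := exists_gsGerm z a (Eventually.of_forall fun _ => trivial)
  rw [gsMap_gsGerm, gsMap_gsGerm, gsMap_gsGerm, homOn_comp]

lemma isSec_gsGerm {U : Site G} (f : LocSec Z U) (s : sec F U) (x : U.opens) :
    ∃ η, (gs F Z).IsSec η (f.toFun x) ∧ ∀ y, η (f.toFun y) = gsGerm (f.toFun y) f ⟨y, rfl⟩ s := by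
  classical
  let η : ∀ z, (gs F Z).stalk z := fun z =>
    if hz : ∃ y, f.toFun y = z then gsGerm z f hz s else 0
  have h : ∀ z (hz : ∃ y, f.toFun y = z), η z = gsGerm z f hz s := fun z hz => dif_pos hz
  refine ⟨η, isSec_gs.2 ⟨locFam f s, ?_⟩, fun y => h _ ⟨y, rfl⟩⟩
  filter_upwards [eventually_mem_range f x] with w hw
  exact ⟨locFam_compat f s hw, h w hw⟩

lemma eq_of_gsGerm_eq {U : Site G} (f : LocSec Z U) (s t : sec F U)
    (h : ∀ x, gsGerm (f.toFun x) f ⟨x, rfl⟩ s = gsGerm (f.toFun x) f ⟨x, rfl⟩ t) : s = t := by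
  refine sec_ext F fun x hx => ?_
  have := h ⟨x, hx⟩
  rw [← sub_eq_zero, ← map_sub, gsGerm_eq_zero_iff] at this
  obtain ⟨V, hV, hxV, e⟩ := this
  exact ⟨V, hV, hxV, by rwa [map_sub, sub_eq_zero] at e⟩

/-- The germs along `f` are represented locally by sections over smaller open sets. These have equal
germs on overlaps, hence agree there, and they glue. -/
lemma exists_sec_of_isSec {U : Site G} (f : LocSec Z U) {η : ∀ z, (gs F Z).stalk z}
    (hη : ∀ x, (gs F Z).IsSec η (f.toFun x)) :
    ∃ t : sec F U, ∀ x, η (f.toFun x) = gsGerm (f.toFun x) f ⟨x, rfl⟩ t := by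
  have hloc : ∀ x : U.opens, ∃ (V : Site G) (hV : V.opens ≤ U.opens) (t : sec F V), x.1 ∈ V.opens ∧
      ∀ y : V.opens, η ((f.restr hV).toFun y) =
        gsGerm ((f.restr hV).toFun y) (f.restr hV) ⟨y, rfl⟩ t := by
    intro x
    obtain ⟨V, g, ⟨y, hy⟩, s, -, e⟩ := exists_gsGerm _ (η (f.toFun x))
      (Eventually.of_forall fun _ => trivial)
    obtain ⟨θ, hθ, hθ'⟩ := isSec_gsGerm g s y
    have h1 : ∀ᶠ w in 𝓝 (f.toFun x), η w = θ w := by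
      refine (gs F Z).unique (hη x) (by rwa [← hy]) ?_
      have h2 : ∀ w, g.toFun y = w → ∀ hw, θ w = gsGerm w g hw s := by
        rintro _ rfl _
        exact hθ' y
      rw [e, h2 _ hy]
    obtain ⟨W, hWU, hWV, hxW, e', hw⟩ := exists_common_restr f g hy.symm h1
    refine ⟨W, hWU, secMap F (Site.inclHom hWV) s, hxW, fun w => ?_⟩
    rw [hw w]
    -- The restrictions of `f` and of `g` to `W` are equal but not syntactically so. The claim is
    -- stated for a variable `q` so that the dependent indices can be rewritten.
    have h3 : ∀ (q : LocSec Z W) (hq : q = g.restr hWV), θ (q.toFun w) =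
        gsGerm (q.toFun w) q ⟨w, rfl⟩ (secMap F (Site.inclHom hWV) s) := by
      rintro _ rfl
      rw [gsGerm_restr g hWV ⟨w, rfl⟩ ⟨⟨w.1, hWV w.2⟩, rfl⟩]
      exact hθ' ⟨w.1, hWV w.2⟩
    exact h3 _ e'
  choose V hV t hxV ht using hloc
  have hcompat : ∀ i j (W : Site G) (hi : W.opens ≤ (V i).opens) (hj : W.opens ≤ (V j).opens),
      secMap F (Site.inclHom hi) (t i) = secMap F (Site.inclHom hj) (t j) := by
    intro i j W hi hj
    have key : ∀ i (hi : W.opens ≤ (V i).opens) (w : W.opens),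
        gsGerm ((f.restr (hi.trans (hV i))).toFun w) (f.restr (hi.trans (hV i))) ⟨w, rfl⟩
          (secMap F (Site.inclHom hi) (t i)) = η ((f.restr (hi.trans (hV i))).toFun w) := by
      intro i hi w
      refine (gsGerm_restr (f.restr (hV i)) hi ⟨w, rfl⟩ ⟨⟨w.1, hi w.2⟩, rfl⟩ (t i)).trans ?_
      exact (ht i ⟨w.1, hi w.2⟩).symm
    exact eq_of_gsGerm_eq (f.restr (hi.trans (hV i))) _ _ fun w =>
        (key i hi w).trans (key j hj w).symm
  obtain ⟨s, hs⟩ := sec_glue F V hV (fun x hx => ⟨⟨x, hx⟩, hxV _⟩) t hcompat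
  refine ⟨s, fun x => ?_⟩
  have h4 := ht x ⟨x.1, hxV x⟩
  have h5 := gsGerm_restr f (hV x) (z := f.toFun x) ⟨⟨x.1, hxV x⟩, rfl⟩ ⟨x, rfl⟩ s
  exact h4.trans ((congrArg _ (hs x).symm).trans h5)

/-- The section over the domain of a local section defined by a family of germs. -/
def secOf (η : ∀ z, (gs F Z).stalk z) : EtaleFam F Z := fun _ f => open Classical in
  if h : ∀ x, (gs F Z).IsSec η (f.toFun x) then (exists_sec_of_isSec f h).choose else 0

lemma secOf_spec {η : ∀ z, (gs F Z).stalk z} {U : Site G} {f : LocSec Z U}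
    (h : ∀ x, (gs F Z).IsSec η (f.toFun x)) (x : U.opens) :
    gsGerm (f.toFun x) f ⟨x, rfl⟩ (secOf η U f) = η (f.toFun x) := by
  have e : secOf η U f = (exists_sec_of_isSec f h).choose := dif_pos h
  rw [e]
  exact ((exists_sec_of_isSec f h).choose_spec x).symm

lemma secOf_restr {η : ∀ z, (gs F Z).stalk z} {U V : Site G} {f : LocSec Z V}
    (h : ∀ x, (gs F Z).IsSec η (f.toFun x)) (hU : U.opens ≤ V.opens) :
    secMap F (Site.inclHom hU) (secOf η V f) = secOf η U (f.restr hU) := by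
  refine eq_of_gsGerm_eq (f.restr hU) _ _ fun x => ?_
  have h1 := gsGerm_restr f hU (z := (f.restr hU).toFun x) ⟨x, rfl⟩ ⟨⟨x.1, hU x.2⟩, rfl⟩
      (secOf η V f)
  exact (h1.trans (secOf_spec h ⟨x.1, hU x.2⟩)).trans
    (secOf_spec (f := f.restr hU) (fun x => h ⟨x.1, hU x.2⟩) x).symm

lemma secOf_compat {η : ∀ z, (gs F Z).stalk z} {z : Z.carrier} (h : (gs F Z).IsSec η z) :
    secOf η ∈ compatNear F Z z :=
  (mem_compatNear F Z).2 ⟨_, (gs F Z).eventually h, fun _ _ hUV _ hf => secOf_restr hf hUV⟩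

lemma gsMk_secOf {η : ∀ z, (gs F Z).stalk z} {z : Z.carrier} (h : (gs F Z).IsSec η z) :
    gsMk z ⟨secOf η, secOf_compat h⟩ = η z := by
  obtain ⟨U, f, x, rfl, hf⟩ := exists_locSec z ((gs F Z).eventually h)
  rw [gsMk_eq_gsGerm _ (W := {w | (gs F Z).IsSec η w}) (fun U V hUV f hf => secOf_restr hf hUV)
      f ⟨x, rfl⟩ hf]
  exact secOf_spec hf x

/-- The germs of a global section. -/
def gsSec : etaleSections F Z →+ ∀ z, (gs F Z).stalk z :=
  AddMonoidHom.mk' (fun c z => gsMk z ⟨c.1, (mem_compatNear F Z).2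
    ⟨Set.univ, univ_mem, fun U V h f _ => c.2 U V h f⟩⟩) fun _ _ => rfl

lemma gsSec_apply (c : etaleSections F Z) {z : Z.carrier} {U : Site G} (f : LocSec Z U)
    (hz : ∃ x, f.toFun x = z) : gsSec c z = gsGerm z f hz (c.1 U f) :=
  gsMk_eq_gsGerm _ (W := Set.univ) (fun U V h f _ => c.2 U V h f) f hz fun _ => trivial

lemma gsSec_isGlobal (c : etaleSections F Z) : (gs F Z).IsGlobal (gsSec c) := fun _ =>
  isSec_gs.2 ⟨c.1, Eventually.of_forall fun _ => ⟨_, rfl⟩⟩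

lemma gsSec_injective : Function.Injective (gsSec (F := F) (Z := Z)) := by
  intro c c' h
  refine Subtype.ext (funext fun U => funext fun f => eq_of_gsGerm_eq f _ _ fun x => ?_)
  rw [← gsSec_apply, ← gsSec_apply, h]

/-- With `gsSec_injective`, this identifies families compatible with restriction with global
sections of the germ sheaf, so that the acyclicity results apply to them. -/
lemma exists_gsSec {η : ∀ z, (gs F Z).stalk z} (hη : (gs F Z).IsGlobal η) : ∃ c, gsSec c = η :=
  ⟨⟨secOf η, fun _ _ h _ => secOf_restr (fun _ => hη _) h⟩, funext fun z => gsMk_secOf (hη z)⟩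

lemma gsSec_etaleMap {F F' : GSheaf G} (φ : F ⟶ F') (c : etaleSections F Z) (z : Z.carrier) :
    gsSec (etaleMap φ Z c) z = (gsMap φ Z).app z (gsSec c z) := rfl

end EtaleGerms
end EtaleGerbe
end

noncomputable section
open CategoryTheory Filter Topology
open scoped Manifold ContDiff
namespace EtaleGerbe
open SmoothEtaleGroupoid

/-! ### The horizontal differential -/

section Inverses

variable {n : ℕ} {G : SmoothEtaleGroupoid.{u} n}

lemma eq_inv_of_comp {g h : G.Arr} (e : G.tgt g = G.src h) (H : G.comp g h e = G.unit (G.src g)) :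
    h = G.inv g := by
  have h1 := G.unit_comp h
  have h2 : G.comp (G.unit (G.src h)) h (G.tgt_unit _) =
      G.comp (G.comp (G.inv g) g (G.tgt_inv g)) h ((G.tgt_comp _ _ _).trans e) :=
    Site.comp_congr (by rw [G.inv_comp, e]) rfl _ _
  have h3 := G.assoc (G.inv g) g h (G.tgt_inv g) e
  have h4 : G.comp (G.inv g) (G.comp g h e) ((G.tgt_inv g).trans (G.src_comp g h e).symm) =
      G.comp (G.inv g) (G.unit (G.tgt (G.inv g))) (G.src_unit _).symm :=
    Site.comp_congr rfl (by rw [H, G.tgt_inv]) _ _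
  rw [← h1, h2, h3, h4, G.comp_unit]

lemma inv_inv_arr (g : G.Arr) : G.inv (G.inv g) = g :=
  (eq_inv_of_comp (G.tgt_inv g) ((G.inv_comp g).trans (congrArg _ (G.src_inv g).symm))).symm

lemma comp_assoc_inv (g h : G.Arr) (e : G.tgt g = G.src h) (e' : G.tgt (G.comp g h e)
    = G.src (G.inv h)) :
    G.comp (G.comp g h e) (G.inv h) e' = g := by
  have h1 := G.assoc g h (G.inv h) e (G.src_inv h).symm
  refine Eq.trans h1 (Eq.trans (Site.comp_congr rfl ?_ _ _) (G.comp_unit g))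
  rw [G.comp_inv, e]

lemma inv_comp_arr (g h : G.Arr) (e : G.tgt g = G.src h)
    (e' : G.tgt (G.inv h) = G.src (G.inv g)) :
    G.comp (G.inv h) (G.inv g) e' = G.inv (G.comp g h e) := by
  have e1 : G.tgt (G.comp g h e) = G.src (G.comp (G.inv h) (G.inv g) e') := by
    rw [G.tgt_comp, G.src_comp, G.src_inv]
  refine eq_inv_of_comp e1 ?_
  have e2 : G.tgt (G.comp g h e) = G.src (G.inv h) := by rw [G.tgt_comp, G.src_inv]
  have h1 := G.assoc (G.comp g h e) (G.inv h) (G.inv g) e2 e'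
  refine h1.symm.trans ?_
  refine (Site.comp_congr (comp_assoc_inv g h e e2) rfl _ (G.src_inv g).symm).trans ?_
  rw [G.comp_inv, G.src_comp]

lemma arr_inclHom_comp {U V W : Site G} (h : U.opens ≤ V.opens) (σ : V ⟶ W) (y : U.opens) :
    Site.Hom.arr (Site.inclHom h ≫ σ) y = Site.Hom.arr σ ⟨y.1, h y.2⟩ := by
  have hy : (Site.Hom.fn (Site.inclHom h) y) = ⟨y.1, h y.2⟩ := Subtype.ext (G.tgt_unit y.1)
  have h2 := G.unit_comp (Site.Hom.arr σ ⟨y.1, h y.2⟩)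
  refine Eq.trans (Site.comp_congr ?_ ?_ _ _) h2
  · exact congrArg G.unit (Site.Hom.src_arr σ ⟨y.1, h y.2⟩).symm
  · exact congrArg (Site.Hom.arr σ) hy

lemma arr_comp_inclHom {U V W : Site G} (ρ : U ⟶ V) (h : V.opens ≤ W.opens) (y : U.opens) :
    Site.Hom.arr (ρ ≫ Site.inclHom h) y = Site.Hom.arr ρ y :=
  G.comp_unit (Site.Hom.arr ρ y)

lemma arr_comp {U V W : Site G} (σ : U ⟶ V) (τ : V ⟶ W) (y : U.opens) :
    Site.Hom.arr (σ ≫ τ) y = G.comp (Site.Hom.arr σ y) (Site.Hom.arr τ (Site.Hom.fn σ y))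
      (Site.Hom.src_arr τ (Site.Hom.fn σ y)).symm := rfl

end Inverses

/-! ### Translation of sections by arrows -/

section Twist

variable {n : ℕ} {G : SmoothEtaleGroupoid.{u} n} {F : GSheaf G} {Z : EtaleSpace G.Obj}

/-- The section `(z, g)` over `U` is the translate of the section `f'` over `V` by the arrows
`g = σ⁻¹`. -/
def IsTranslate {U V : Site G} (f : LocSec (G.snoc Z) U) (f' : LocSec Z V) (σ : U ⟶ V) : Prop :=
  (∀ x : U.opens, Site.Hom.arr σ x = G.inv (f.toFun x).1.2) ∧
    ∀ x : U.opens, f'.toFun (Site.Hom.fn σ x) = (f.toFun x).1.1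

lemma continuous_snoc_fst : Continuous fun q : (G.snoc Z).carrier => q.1.1 :=
  continuous_fst.comp continuous_subtype_val

lemma continuous_snoc_snd : Continuous fun q : (G.snoc Z).carrier => q.1.2 :=
  continuous_snd.comp continuous_subtype_val

/-- A morphism of the site given by the inverses of a family of arrows. -/
def invHom {U V : Site G} (f : LocSec (G.snoc Z) U)
    (h : ∀ x : U.opens, G.src (f.toFun x).1.2 ∈ V.opens) : U ⟶ V :=
  (⟨fun x => G.inv (f.toFun x).1.2,
    G.continuous_inv.comp (continuous_snoc_snd.comp f.continuous_toFun),
    fun x => (G.src_inv _).trans (f.proj_toFun x), fun x => by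
      rw [G.tgt_inv]
      exact h x⟩ : Site.Hom U V)

/-- Near a point of its domain, a section `(z, g)` has its component `z` on a local section `f'` of
`Z`, and the inverse arrows define a morphism of the site into the domain of `f'`. -/
lemma exists_isTranslate {U : Site G} (f : LocSec (G.snoc Z) U) (x : U.opens) :
    ∃ (W V : Site G) (h : W.opens ≤ U.opens) (f' : LocSec Z V) (σ : W ⟶ V), x.1 ∈ W.opens ∧
      IsTranslate (f.restr h) f' σ := by
  obtain ⟨V, f', y, hy, -⟩ := exists_locSec (f.toFun x).1.1 (p := fun _ => True)
    (Eventually.of_forall fun _ => trivial)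
  have h1 := eventually_mem_range f' y
  rw [hy] at h1
  have h2 : Continuous fun x => (f.toFun x).1.1 := continuous_snoc_fst.comp f.continuous_toFun
  obtain ⟨W, hW, hx, hw⟩ := exists_site_nhds (h2.continuousAt.eventually h1)
  have h3 : ∀ w : W.opens, ∃ hw : G.src ((f.restr hW).toFun w).1.2 ∈ V.opens,
      f'.toFun ⟨_, hw⟩ = ((f.restr hW).toFun w).1.1 := by
    intro w
    obtain ⟨v, hv⟩ := hw w
    have e : v.1 = G.src ((f.restr hW).toFun w).1.2 :=
      (f'.proj_toFun v).symm.trans ((congrArg Z.proj hv).trans ((f.restr hW).toFun w).2)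
    obtain ⟨v, hv'⟩ := v
    subst e
    exact ⟨hv', hv⟩
  refine ⟨W, V, hW, f', invHom (f.restr hW) fun w => (h3 w).1, hx, fun _ => rfl, fun w => ?_⟩
  rw [← (h3 w).2]
  congr 1
  exact Subtype.ext (G.tgt_inv _)

lemma IsTranslate.src_mem {U V : Site G} {f : LocSec (G.snoc Z) U} {f' : LocSec Z V} {σ : U ⟶ V}
    (h : IsTranslate f f' σ) (x : U.opens) : (Site.Hom.fn σ x).1 = G.src (f.toFun x).1.2 :=
  (congrArg G.tgt (h.1 x)).trans (G.tgt_inv _)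

/-- The translate at a point does not depend on the chosen `f'` and `σ`. Two choices of `f'` agree
near the common value, and the arrows are determined by the section `(z, g)`. -/
lemma IsTranslate.local_eq (c : etaleSections F Z) {U V U₁ V₁ : Site G} {f : LocSec (G.snoc Z) U}
    {f' : LocSec Z V} {σ : U ⟶ V} (h : IsTranslate f f' σ) {f₁ : LocSec (G.snoc Z) U₁}
    {f₁' : LocSec Z V₁} {σ₁ : U₁ ⟶ V₁} (h₁ : IsTranslate f₁ f₁' σ₁) {x : U.opens} {x₁ : U₁.opens}
    (e : f.toFun x = f₁.toFun x₁) : ∃ (W : Site G) (hW : W.opens ≤ U.opens)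
      (hW₁ : W.opens ≤ U₁.opens), x.1 ∈ W.opens ∧ f.restr hW = f₁.restr hW₁ ∧
      secMap F (Site.inclHom hW) (secMap F σ (c.1 V f')) =
        secMap F (Site.inclHom hW₁) (secMap F σ₁ (c.1 V₁ f₁')) := by
  have e1 : f'.toFun (Site.Hom.fn σ x) = f₁'.toFun (Site.Hom.fn σ₁ x₁) := by
    rw [h.2, h₁.2, e]
  obtain ⟨V₂, hV, hV₁, hx, e2, -⟩ := exists_common_restr f' f₁' e1 (p := fun _ => True)
    (Eventually.of_forall fun _ => trivial)
  have h2 : ∀ᶠ q in 𝓝 (f.toFun x), G.src q.1.2 ∈ V₂.opens := by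
    refine (G.src_etale.contMDiff.continuous.comp continuous_snoc_snd).continuousAt.eventually
      (V₂.opens.isOpen.mem_nhds ?_)
    change G.src (f.toFun x).1.2 ∈ V₂.opens
    rwa [← h.src_mem]
  obtain ⟨W, hW, hW₁, hxW, e3, hw⟩ := exists_common_restr f f₁ e h2
  refine ⟨W, hW, hW₁, hxW, e3, ?_⟩
  have key : ∀ {U V : Site G} {f : LocSec (G.snoc Z) U} {f' : LocSec Z V} {σ : U ⟶ V}
      (_ : IsTranslate f f' σ) (hW : W.opens ≤ U.opens)
      (hw : ∀ w, G.src ((f.restr hW).toFun w).1.2 ∈ V₂.opens) (hV : V₂.opens ≤ V.opens),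
      secMap F (Site.inclHom hW) (secMap F σ (c.1 V f')) =
        secMap F (invHom (f.restr hW) hw) (c.1 V₂ (f'.restr hV)) := by
    intro U V f f' σ h hW hw hV
    rw [← c.2 V₂ V hV f', ← secMap_comp, ← secMap_comp]
    congr 1
    congr 1
    apply Site.Hom.ext
    funext w
    exact (arr_inclHom_comp hW σ w).trans
      ((h.1 _).trans (arr_comp_inclHom (invHom (f.restr hW) hw) hV w).symm)
  rw [key h hW hw hV]
  have hw' : ∀ w, G.src ((f₁.restr hW₁).toFun w).1.2 ∈ V₂.opens := by
    rw [← e3]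
    exact hw
  rw [key h₁ hW₁ hw' hV₁, e2]
  congr 1
  congr 1
  apply Site.Hom.ext
  funext w
  exact congrArg (fun q : LocSec (G.snoc Z) W => G.inv (q.toFun w).1.2) e3

/-- The translated sections are defined only locally, so their germs are formed with a choice at
each point. By `IsTranslate.local_eq` the germs do not depend on the choice; hence they form a
global section. -/
lemma exists_isTwist (c : etaleSections F Z) : ∃ e, IsTwist c e := by
  have hd : ∀ q : (G.snoc Z).carrier, ∃ (U V : Site G) (f : LocSec (G.snoc Z) U) (f' : LocSec Z V)
      (σ : U ⟶ V), IsTranslate f f' σ ∧ ∃ x, f.toFun x = q := by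
    intro q
    obtain ⟨U, f, x, hx, -⟩ := exists_locSec q (p := fun _ => True)
      (Eventually.of_forall fun _ => trivial)
    obtain ⟨W, V, h, f', σ, hxW, ht⟩ := exists_isTranslate f x
    exact ⟨W, V, f.restr h, f', σ, ht, ⟨x.1, hxW⟩, hx⟩
  choose U V f f' σ ht hq using hd
  let η : ∀ q, (gs F (G.snoc Z)).stalk q := fun q =>
    gsGerm q (f q) (hq q) (secMap F (σ q) (c.1 (V q) (f' q)))
  have key : ∀ {U₁ V₁ : Site G} {f₁ : LocSec (G.snoc Z) U₁}
    {f₁' : LocSec Z V₁} {σ₁ : U₁ ⟶ V₁} (_ : IsTranslate f₁ f₁' σ₁) (q) (hx : ∃ x, f₁.toFun x = q),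
      η q = gsGerm q f₁ hx (secMap F σ₁ (c.1 V₁ f₁')) := by
    intro U₁ V₁ f₁ f₁' σ₁ h₁ q hx
    have hx' := hx
    obtain ⟨x, hx⟩ := hx
    obtain ⟨y, hy⟩ := hq q
    obtain ⟨W, hW, hW₁, hyW, e1, e2⟩ := (ht q).local_eq c h₁ (hy.trans hx.symm)
    have hz : ∃ x, ((f q).restr hW).toFun x = q := ⟨⟨y.1, hyW⟩, hy⟩
    have hz₁ : ∃ x, (f₁.restr hW₁).toFun x = q := by rwa [← e1]
    change gsGerm q (f q) (hq q) _ = _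
    rw [← gsGerm_restr (f q) hW hz, e2, ← gsGerm_restr f₁ hW₁ hz₁]
    congr 2
  have hη : (gs F (G.snoc Z)).IsGlobal η := by
    intro q
    obtain ⟨y, hy⟩ := hq q
    obtain ⟨θ, hθ, h⟩ := isSec_gsGerm (f q) (secMap F (σ q) (c.1 (V q) (f' q))) y
    rw [hy] at hθ
    refine (gs F (G.snoc Z)).congr ?_ hθ
    have h0 := eventually_mem_range (f q) y
    rw [hy] at h0
    filter_upwards [h0]
    rintro _ ⟨w, rfl⟩
    rw [h, key (ht q) _ ⟨w, rfl⟩]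
  obtain ⟨e, he⟩ := exists_gsSec hη
  refine ⟨e, fun U V f f' σ h1 h2 => eq_of_gsGerm_eq f _ _ fun x => ?_⟩
  rw [← gsSec_apply, he, key ⟨h1, h2⟩]

/-- The section `(z, g) ↦ c(z) · g`. -/
def etaleTwist (c : etaleSections F Z) : etaleSections F (G.snoc Z) := (exists_isTwist c).choose

lemma isTwist_etaleTwist (c : etaleSections F Z) : IsTwist c (etaleTwist c) :=
  (exists_isTwist c).choose_spec

lemma IsTwist.unique {c : etaleSections F Z} {e e' : etaleSections F (G.snoc Z)} (h : IsTwist c e)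
    (h' : IsTwist c e') : e = e' := by
  refine Subtype.ext (funext fun U => funext fun f => sec_ext F fun x hx => ?_)
  obtain ⟨W, V, hW, f', σ, hxW, h1, h2⟩ := exists_isTranslate f ⟨x, hx⟩
  refine ⟨W, hW, hxW, ?_⟩
  rw [e.2, e'.2, h W V _ f' σ h1 h2, h' W V _ f' σ h1 h2]

lemma isTwist_iff {c : etaleSections F Z} {e : etaleSections F (G.snoc Z)} :
    IsTwist c e ↔ e = etaleTwist c :=
  ⟨fun h => h.unique (isTwist_etaleTwist c), fun h => h ▸ isTwist_etaleTwist c⟩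

lemma etaleTwist_add (c c' : etaleSections F Z) :
    etaleTwist (c + c') = etaleTwist c + etaleTwist c' := by
  refine (isTwist_iff.1 fun U V f f' σ h1 h2 => ?_).symm
  refine (congrArg₂ (· + ·) (isTwist_etaleTwist c U V f f' σ h1 h2)
    (isTwist_etaleTwist c' U V f f' σ h1 h2)).trans (map_add _ _ _).symm

/-- `etaleTwist` as a homomorphism. -/
def etaleTwistHom (F : GSheaf G) (Z : EtaleSpace G.Obj) :
    etaleSections F Z →+ etaleSections F (G.snoc Z) := AddMonoidHom.mk' etaleTwist etaleTwist_add

lemma etaleTwist_etaleMap {F' : GSheaf G} (φ : F ⟶ F') (c : etaleSections F Z) :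
    etaleTwist (etaleMap φ Z c) = etaleMap φ (G.snoc Z) (etaleTwist c) := by
  refine (isTwist_iff.1 fun U V f f' σ h1 h2 => ?_).symm
  exact (congrArg (homOn φ U) (isTwist_etaleTwist c U V f f' σ h1 h2)).trans (homOn_secMap _ _ _)

lemma etaleTwist_etalePull {Z' : EtaleSpace G.Obj} (q : Z'.Hom Z) (c : etaleSections F Z) :
    etaleTwist (etalePull F q c) = etalePull F (snocMap q) (etaleTwist c) :=
  (isTwist_iff.1 fun U V f f' σ h1 h2 => isTwist_etaleTwist c U V (f.comp (snocMap q)) (f'.comp q) σ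
    h1 fun x => congrArg q.toFun (h2 x)).symm

/-- This is `(c · g) · h = c · (gh)`. The morphism of the site for `gh` is `(gh)⁻¹ = h⁻¹g⁻¹`, the
composite of the two translating morphisms, and restriction is functorial. -/
lemma etaleTwist_etaleTwist (c : etaleSections F Z) :
    etaleTwist (etaleTwist c) = etalePull F (snocComp Z) (etaleTwist c) := by
  refine (isTwist_iff.1 fun U V f f' σ h1 h2 => sec_ext F fun x hx => ?_).symm
  obtain ⟨V₁, V₂, hV, f'', τ, hxV, ht⟩ := exists_isTranslate f' (Site.Hom.fn σ ⟨x, hx⟩)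
  have hs : ∀ᶠ y in 𝓝 (⟨x, hx⟩ : U.opens), (Site.Hom.fn σ y).1 ∈ V₁.opens :=
    (continuous_subtype_val.comp (Site.Hom.continuous_fn σ)).continuousAt.eventually
      (V₁.opens.isOpen.mem_nhds hxV)
  obtain ⟨W, hW, hxW, hw⟩ := exists_site_nhds hs
  let ρ : W ⟶ V₁ := (⟨fun w => Site.Hom.arr σ ⟨w.1, hW w.2⟩,
    (Site.Hom.continuous_arr σ).comp (continuous_subtype_val.subtype_mk _),
    fun w => Site.Hom.src_arr σ ⟨w.1, hW w.2⟩, hw⟩ : Site.Hom W V₁)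
  have e1 : Site.inclHom hW ≫ σ = ρ ≫ Site.inclHom hV := by
    apply Site.Hom.ext
    funext w
    exact (arr_inclHom_comp hW σ w).trans (arr_comp_inclHom ρ hV w).symm
  refine ⟨W, hW, hxW, ?_⟩
  rw [← secMap_comp, e1, secMap_comp, (etaleTwist c).2, isTwist_etaleTwist c _ _ _ f'' τ ht.1 ht.2,
    ← secMap_comp]
  refine ((etalePull F (snocComp Z) (etaleTwist c)).2 W U hW f).trans ?_
  have e3 : ∀ w : W.opens, (f'.restr hV).toFun (Site.Hom.fn ρ w) = (f.toFun ⟨w.1, hW w.2⟩).1.1 :=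
    fun w => h2 ⟨w.1, hW w.2⟩
  have e2 : ∀ w : W.opens, Site.Hom.arr (ρ ≫ τ) w =
      G.inv (((f.restr hW).comp (snocComp Z)).toFun w).1.2 := by
    intro w
    rw [arr_comp]
    have k1 : Site.Hom.arr ρ w = G.inv (f.toFun ⟨w.1, hW w.2⟩).1.2 := h1 ⟨w.1, hW w.2⟩
    have k2 : Site.Hom.arr τ (Site.Hom.fn ρ w) = G.inv (f.toFun ⟨w.1, hW w.2⟩).1.1.1.2 := by
      rw [ht.1, e3]
    refine (Site.comp_congr k1 k2 _ ?_).trans (inv_comp_arr _ _ _ _)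
    rw [G.tgt_inv, G.src_inv]
    exact (f.toFun ⟨w.1, hW w.2⟩).2.symm
  refine isTwist_etaleTwist c W V₂ _ f'' (ρ ≫ τ) e2 fun w => ?_
  have k3 : f''.toFun (Site.Hom.fn (ρ ≫ τ) w) = f''.toFun (Site.Hom.fn τ (Site.Hom.fn ρ w)) :=
    congrArg f''.toFun (Site.Hom.trans_fn ρ τ w)
  refine k3.trans ((ht.2 (Site.Hom.fn ρ w)).trans ?_)
  exact congrArg (fun q => q.1.1) (e3 w)

end Twist
end EtaleGerbe
end

/-! ### The simplicial identities and `δ² = 0` -/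

noncomputable section
open CategoryTheory Filter Topology
open scoped Manifold ContDiff
namespace EtaleGerbe
open SmoothEtaleGroupoid

section Delta

variable {n : ℕ} {G : SmoothEtaleGroupoid.{u} n}

/-- The map of nerves which acts on the first arrows of a chain. -/
def nerveMap {k l : ℕ} (f : (G.nerve k).Hom (G.nerve l)) : (G.nerve (k + 1)).Hom (G.nerve (l + 1))
    :=
  snocMap f

/-- The face which composes the last two arrows. -/
def nerveComp (k : ℕ) : (G.nerve (k + 2)).Hom (G.nerve (k + 1)) := snocComp (G.nerve k)

lemma face_castSucc (k : ℕ) (i : Fin (k + 1)) :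
    G.face (k + 1) i.castSucc = nerveMap (G.face k i) := Fin.lastCases_castSucc _

lemma face_last (k : ℕ) : G.face (k + 1) (Fin.last (k + 1)) = nerveComp k := Fin.lastCases_last

/-- A contravariant functor from the nerve to abelian groups. -/
structure NerveSystem (G : SmoothEtaleGroupoid.{u} n) : Type (u + 1) where
  obj : ℕ → Type u
  [grp : ∀ k, AddCommGroup (obj k)]
  pull : ∀ {k l : ℕ}, (G.nerve k).Hom (G.nerve l) → (obj l →+ obj k)
  pull_comp : ∀ {k l m : ℕ} (f : (G.nerve k).Hom (G.nerve l)) (q : (G.nerve l).Hom (G.nerve m))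
    (c : obj m), pull (f.comp q) c = pull f (pull q c)

attribute [instance] NerveSystem.grp

namespace NerveSystem

/-- The composition with the functor which adds an arrow. -/
abbrev shift (P : NerveSystem G) : NerveSystem G where
  obj k := P.obj (k + 1)
  pull f := P.pull (nerveMap f)
  pull_comp f q c := P.pull_comp (nerveMap f) (nerveMap q) c

/-- The alternating sum of the pull-backs by the faces which preserve the last object. -/
def alt (P : NerveSystem G) (k : ℕ) : P.obj k →+ P.obj (k + 1) :=
  ∑ i : Fin (k + 1), (-1 : ℤ) ^ (i : ℕ) • P.pull (G.face k i)

lemma alt_zero (P : NerveSystem G) (c : P.obj 0) : P.alt 0 c = P.pull (G.face 0 0) c := by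
  simp [alt]

lemma alt_apply (P : NerveSystem G) (k : ℕ) (c : P.obj k) :
    P.alt k c = ∑ i : Fin (k + 1), (-1 : ℤ) ^ (i : ℕ) • P.pull (G.face k i) c :=
  AddMonoidHom.finsetSum_apply _ _ _

lemma alt_succ (P : NerveSystem G) (k : ℕ) (c : P.obj (k + 1)) :
    P.alt (k + 1) c = P.shift.alt k c + (-1 : ℤ) ^ (k + 1) • P.pull (nerveComp k) c := by
  rw [alt_apply, Fin.sum_univ_castSucc, alt_apply, face_last, Fin.val_last]
  simp only [face_castSucc, Fin.val_castSucc]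

lemma alt_natural {P P' : NerveSystem G} (φ : ∀ k, P.obj k →+ P'.obj k)
    (h : ∀ {k l : ℕ} (f : (G.nerve k).Hom (G.nerve l)) (c : P.obj l),
      φ k (P.pull f c) = P'.pull f (φ l c)) (k : ℕ) (c : P.obj k) :
    φ _ (P.alt k c) = P'.alt k (φ _ c) := by
  rw [alt_apply, alt_apply, map_sum]
  simp only [map_zsmul, h]

/-- Induction on the degree, for all systems at once. The differential of `P` is that of the shifted
system plus the face which composes the last two arrows. The square of the first part is zero by
induction, the mixed terms cancel by naturality, and the remaining ones by associativity of
composition. -/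
lemma alt_alt (P : NerveSystem G) (k : ℕ) (c : P.obj k) : P.alt (k + 1) (P.alt k c) = 0 := by
  induction k generalizing P with
  | zero =>
    have h1 : (-1 : ℤ) ^ (0 + 1) = -1 := by norm_num
    rw [alt_succ, alt_zero, alt_zero, h1, neg_smul, one_smul, ← sub_eq_add_neg,
      sub_eq_zero]
    refine (P.pull_comp _ _ c).symm.trans (Eq.trans ?_ (P.pull_comp _ _ c))
    exact congrArg (fun f => P.pull f c) (EtaleSpace.Hom.ext_fun fun q => (G.tgt_comp _ _ _).symm)
  | succ k ih =>
    have h1 : P.pull (nerveComp (k + 1)) (P.shift.alt k c) =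
        P.shift.shift.alt k (P.pull (nerveComp k) c) := by
      refine alt_natural (P := P.shift) (P' := P.shift.shift) (fun k => P.pull (nerveComp k))
        (fun f c => ?_) k c
      exact (P.pull_comp _ _ c).symm.trans (P.pull_comp (nerveMap (nerveMap f)) (nerveComp _) c)
    have h2 : P.pull (nerveMap (nerveComp k)) (P.pull (nerveComp k) c) =
        P.pull (nerveComp (k + 1)) (P.pull (nerveComp k) c) := by
      rw [← P.pull_comp, ← P.pull_comp]
      refine congrArg (fun f => P.pull f c) (EtaleSpace.Hom.ext_fun fun q =>
        Subtype.ext (Prod.ext rfl ?_))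
      exact G.assoc _ _ _ _ _
    have h4 := ih P.shift c
    have h5 := P.shift.alt_succ k (P.pull (nerveComp k) c)
    rw [alt_succ P (k + 1), alt_succ P k, map_add, map_add, map_zsmul, map_zsmul, h4, h5, h1, h2,
      pow_succ (-1 : ℤ) (k + 1)]
    rcases neg_one_pow_eq_or ℤ (k + 1) with h | h <;> rw [h] <;> simp <;> abel

end NerveSystem

/-- A contravariant functor on the nerve with the additional face which forgets the last arrow. -/
structure TwistSystem (G : SmoothEtaleGroupoid.{u} n) extends NerveSystem G where
  twist : ∀ k, obj k →+ obj (k + 1)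
  twist_pull : ∀ {k l : ℕ} (f : (G.nerve k).Hom (G.nerve l)) (c : obj l),
    twist k (pull f c) = pull (nerveMap f) (twist l c)
  twist_twist : ∀ k c, twist (k + 1) (twist k c) = pull (nerveComp k) (twist k c)

/-- The alternating sum of all the faces. -/
def TwistSystem.delta (P : TwistSystem G) (k : ℕ) : P.obj k →+ P.obj (k + 1) :=
  P.alt k + (-1 : ℤ) ^ (k + 1) • P.twist k

lemma TwistSystem.delta_apply (P : TwistSystem G) (k : ℕ) (c : P.obj k) :
    P.delta k c = P.alt k c + (-1 : ℤ) ^ (k + 1) • P.twist k c := rfl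

/-- The translation satisfies the identities of a last face: it commutes with the earlier faces up
to the shift, and its square is a composition face after a translation. The signs then cancel as in
`alt_alt`. -/
lemma TwistSystem.delta_delta (P : TwistSystem G) (k : ℕ) (c : P.obj k) :
    P.delta (k + 1) (P.delta k c) = 0 := by
  have h0 : P.twist (k + 1) (P.alt k c) = P.shift.alt k (P.twist k c) :=
    NerveSystem.alt_natural (P := P.toNerveSystem) (P' := P.shift) P.twist P.twist_pull k c
  rw [P.delta_apply (k + 1), P.delta_apply k, map_add, map_add, map_zsmul, map_zsmul,
    NerveSystem.alt_alt, NerveSystem.alt_succ, h0, P.twist_twist, pow_succ (-1 : ℤ) (k + 1)]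
  rcases neg_one_pow_eq_or ℤ (k + 1) with h | h <;> rw [h] <;> simp <;> abel

/-- The sections over the nerve of the pull-backs of a sheaf. -/
abbrev etaleSystem (F : GSheaf G) : TwistSystem G where
  obj k := etaleSections F (G.nerve k)
  pull q := etalePull F q
  pull_comp _ _ _ := rfl
  twist k := etaleTwistHom F (G.nerve k)
  twist_pull f c := etaleTwist_etalePull f c
  twist_twist _ c := etaleTwist_etaleTwist c

/-- The horizontal differential on sections over the nerve. -/
def etaleDelta (F : GSheaf G) (k : ℕ) :
    etaleSections F (G.nerve k) →+ etaleSections F (G.nerve (k + 1)) := (etaleSystem F).delta k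

/-- `etaleTwist` over the nerve. -/
def nerveTwist (F : GSheaf G) (k : ℕ) :
    etaleSections F (G.nerve k) →+ etaleSections F (G.nerve (k + 1)) := etaleTwistHom F (G.nerve k)

lemma isDelta_iff {F : GSheaf G} {k : ℕ} {c : etaleSections F (G.nerve k)}
    {e : etaleSections F (G.nerve (k + 1))} : IsDelta c e ↔ e = etaleDelta F k c := by
  have h : etaleDelta F k c = ∑ i : Fin (k + 1), (-1 : ℤ) ^ (i : ℕ) • etalePull F (G.face k i) c +
      (-1 : ℤ) ^ (k + 1) • nerveTwist F k c :=
    congrArg (· + _) ((etaleSystem F).alt_apply k c)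
  rw [h]
  constructor
  · rintro ⟨b, hb, rfl⟩
    obtain rfl : b = nerveTwist F k c := isTwist_iff.1 hb
    rfl
  · rintro rfl
    exact ⟨nerveTwist F k c, isTwist_etaleTwist c, rfl⟩

lemma etaleDelta_etaleDelta (F : GSheaf G) (k : ℕ) (c : etaleSections F (G.nerve k)) :
    etaleDelta F (k + 1) (etaleDelta F k c) = 0 := (etaleSystem F).delta_delta k c

lemma TwistSystem.delta_natural {P P' : TwistSystem G} (φ : ∀ k, P.obj k →+ P'.obj k)
    (h : ∀ {k l : ℕ} (f : (G.nerve k).Hom (G.nerve l)) (c : P.obj l),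
      φ k (P.pull f c) = P'.pull f (φ l c))
    (ht : ∀ (k : ℕ) (c : P.obj k), φ (k + 1) (P.twist k c) = P'.twist k (φ k c)) (k : ℕ)
    (c : P.obj k) : φ _ (P.delta k c) = P'.delta k (φ _ c) := by
  rw [P.delta_apply, P'.delta_apply, map_add, map_zsmul, ht,
    NerveSystem.alt_natural (P := P.toNerveSystem) (P' := P'.toNerveSystem) φ h]

lemma etaleDelta_etaleMap {F F' : GSheaf G} (φ : F ⟶ F') (k : ℕ)
    (c : etaleSections F (G.nerve k)) :
    etaleDelta F' k (etaleMap φ _ c) = etaleMap φ _ (etaleDelta F k c) :=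
  (TwistSystem.delta_natural (P := etaleSystem F) (P' := etaleSystem F')
    (fun k => etaleMap φ (G.nerve k)) (fun _ _ => rfl)
    (fun _ c => (etaleTwist_etaleMap φ c).symm) k c).symm

/-! ### Sections as functions and sections as families -/

section Coeff

variable (F : Coeff G)

/-- `etaleOfCoeff` as a homomorphism. -/
def etaleOfCoeffHom (Z : EtaleSpace G.Obj) : F.sections Z →+ etaleSections F.sheaf Z :=
  AddMonoidHom.mk' (etaleOfCoeff F) fun _ _ => rfl

lemma etaleOfCoeff_injective (Z : EtaleSpace G.Obj) :
    Function.Injective (etaleOfCoeff F (Z := Z)) := by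
  intro c c' h
  refine Subtype.ext (funext fun z => ?_)
  obtain ⟨U, f, x, rfl, -⟩ := exists_locSec z (p := fun _ => True)
    (Eventually.of_forall fun _ => trivial)
  have h1 := congrArg (fun e : etaleSections F.sheaf Z => e.1 U f) h
  exact congrArg (fun e : F.sections (EtaleSpace.ofOpens U.opens) => e.1 x) h1

lemma etaleOfCoeff_twist (Z : EtaleSpace G.Obj) (c : F.sections Z) :
    etaleOfCoeff F (F.twist Z c) = etaleTwist (etaleOfCoeff F c) := by
  refine isTwist_iff.1 fun U V f f' σ h1 h2 => Subtype.ext (funext fun x => ?_)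
  refine Eq.trans ?_ (F.restrict_apply σ (F.pull f' c) x).symm
  have h3 : G.inv (Site.Hom.arr σ x) = (f.toFun x).1.2 :=
    (congrArg G.inv (h1 x)).trans (inv_inv_arr _)
  have h4 : c.1 (f'.toFun (Site.Hom.fn σ x)) = c.1 (f.toFun x).1.1 := congrArg c.1 (h2 x)
  exact (congrArg₂ (fun g a => F.act g a) h3 h4).symm

/-- The sections of a sheaf given by germs of functions. -/
abbrev coeffSystem : TwistSystem G where
  obj k := F.sections (G.nerve k)
  pull q := F.pull q
  pull_comp _ _ _ := rfl
  twist k := F.twist (G.nerve k)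
  twist_pull _ _ := rfl
  twist_twist _ _ := Subtype.ext (funext fun _ => (F.act_comp _ _ _ _).symm)

lemma etaleOfCoeff_delta (k : ℕ) (c : F.sections (G.nerve k)) :
    etaleOfCoeff F (F.delta k c) = etaleDelta F.sheaf k (etaleOfCoeff F c) :=
  TwistSystem.delta_natural (P := coeffSystem F) (P' := etaleSystem F.sheaf)
    (fun k => etaleOfCoeffHom F (G.nerve k)) (fun _ _ => rfl)
    (fun _ c => etaleOfCoeff_twist F _ c) k c

lemma delta_delta (k : ℕ) (c : F.sections (G.nerve k)) : F.delta (k + 1) (F.delta k c) = 0 := by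
  exact (coeffSystem F).delta_delta k c

variable {F} in
lemma etaleMap_etaleOfCoeff {F' : Coeff G} (L : CoeffHom F F') {Z : EtaleSpace G.Obj}
    (c : F.sections Z) :
    etaleMap L.sheafHom Z (etaleOfCoeff F c) = etaleOfCoeff F' (L.map Z c) :=
  Subtype.ext (funext fun _ => funext fun f => L.map_pull f c)

variable {F} in
lemma CoeffHom.map_delta {F' : Coeff G} (L : CoeffHom F F') (k : ℕ) (c : F.sections (G.nerve k)) :
    F'.delta k (L.map _ c) = L.map _ (F.delta k c) := by
  apply etaleOfCoeff_injective
  rw [etaleOfCoeff_delta, ← etaleMap_etaleOfCoeff, ← etaleMap_etaleOfCoeff, etaleOfCoeff_delta,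
    etaleDelta_etaleMap]

/-- The function underlying a section. -/
def coeffVal {Z : EtaleSpace G.Obj} (c : etaleSections F.sheaf Z) (z : Z.carrier) : F.A :=
  let h := exists_locSec z (p := fun _ => True) (Eventually.of_forall fun _ => trivial)
  (show F.sections (EtaleSpace.ofOpens h.choose.opens) from
    c.1 h.choose h.choose_spec.choose).1 h.choose_spec.choose_spec.choose

/-- The value at a point is read on an arbitrary local section through it. Two local sections
through the point agree nearby, and compatibility with restriction removes the choice. -/
lemma coeffVal_apply {Z : EtaleSpace G.Obj} (c : etaleSections F.sheaf Z) {U : Site G}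
    (f : LocSec Z U) (x : U.opens) : coeffVal F c (f.toFun x) =
      (show F.sections (EtaleSpace.ofOpens U.opens) from c.1 U f).1 x := by
  let h := exists_locSec (f.toFun x) (p := fun _ => True) (Eventually.of_forall fun _ => trivial)
  have hx := h.choose_spec.choose_spec.choose_spec.1
  obtain ⟨W, h1, h2, hw, e, -⟩ := exists_common_restr h.choose_spec.choose f hx (p := fun _ => True)
    (Eventually.of_forall fun _ => trivial)
  have hxx : h.choose_spec.choose_spec.choose.1 = x.1 := by
    rw [← proj_locSec h.choose_spec.choose, hx, proj_locSec]
  have key : ∀ {U : Site G} (g : LocSec Z U) (hU : W.opens ≤ U.opens) (y : U.opens)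
      (hy : y.1 ∈ W.opens),
      (show F.sections (EtaleSpace.ofOpens U.opens) from c.1 U g).1 y =
        (show F.sections (EtaleSpace.ofOpens W.opens) from c.1 W (g.restr hU)).1 ⟨y.1, hy⟩ := by
    intro U g hU y hy
    have h3 := congrArg (fun e : F.sections (EtaleSpace.ofOpens W.opens) => e.1 ⟨y.1, hy⟩)
      (c.2 W U hU g)
    exact (F.restrict_inclHom hU (c.1 U g) ⟨y.1, hy⟩).symm.trans h3
  refine (key _ h1 _ hw).trans (Eq.trans ?_ (key f h2 x (by rwa [← hxx])).symm)
  rw [e]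
  exact congrArg _ (Subtype.ext hxx)

lemma etaleOfCoeff_surjective (Z : EtaleSpace G.Obj) :
    Function.Surjective (etaleOfCoeff F (Z := Z)) := by
  intro c
  refine ⟨⟨coeffVal F c, fun z => ?_⟩, Subtype.ext (funext fun U => funext fun f =>
    Subtype.ext (funext fun x => coeffVal_apply F c f x))⟩
  obtain ⟨U, f, x, rfl, -⟩ := exists_locSec z (p := fun _ => True)
    (Eventually.of_forall fun _ => trivial)
  obtain ⟨η, h1, h2⟩ := (show F.sections (EtaleSpace.ofOpens U.opens) from c.1 U f).2 x
  refine ⟨η, by rw [proj_locSec]; exact h1, ?_⟩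
  obtain ⟨V, hV, hx, h3⟩ := exists_site_nhds h2
  filter_upwards [eventually_mem_range (f.restr hV) ⟨x.1, hx⟩]
  rintro _ ⟨w, rfl⟩
  refine (coeffVal_apply F c f ⟨w.1, hV w.2⟩).trans ((h3 w).trans ?_)
  exact congrArg η (proj_locSec (f.restr hV) w).symm

end Coeff
end Delta
end EtaleGerbe
end

noncomputable section
open CategoryTheory Filter Topology
open scoped Manifold ContDiff
namespace EtaleGerbe
open SmoothEtaleGroupoid

/-! ### Injective sheaves -/

section Coinduced

variable {n : ℕ} {G : SmoothEtaleGroupoid.{u} n}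

/-- The presheaf of families of sections over all the objects over a given one. -/
def coindPresheaf (T : GSheaf G) : (Site G)ᵒᵖ ⥤ AddCommGrpCat.{u} where
  obj U := AddCommGrpCat.of (∀ (W : Site G) (_ : W ⟶ U.unop), sec T W)
  map τ := AddCommGrpCat.ofHom (AddMonoidHom.mk' (fun m W σ => m W (σ ≫ τ.unop)) fun _ _ => rfl)
  map_id U := by
    ext m W σ
    exact congrArg (m W) (Category.comp_id σ)
  map_comp τ τ' := by
    ext m W σ
    exact congrArg (m W) (Category.assoc σ _ _).symm

/-- The embedding of a sheaf in the presheaf of families. -/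
def toCoind (T : GSheaf G) : T.obj ⟶ coindPresheaf T where
  app U := AddCommGrpCat.ofHom (AddMonoidHom.mk' (fun c W σ => secMap T σ c)
    fun a b => funext fun W => funext fun σ => map_add _ _ _)
  naturality U V τ := by
    ext c
    funext W σ
    exact (secMap_comp T σ τ.unop c).symm

instance mono_toCoind (T : GSheaf G) : Mono (toCoind T) := by
  have : ∀ U, Mono ((toCoind T).app U) := fun U => by
    rw [AddCommGrpCat.mono_iff_injective]
    intro a b h
    have h1 := congrFun (congrFun h U.unop) (𝟙 _)
    exact (secMap_id T a).symm.trans (h1.trans (secMap_id T b))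
  exact NatTrans.mono_of_mono_app _

/-- Sections over `U` embed in the product of the sections over all objects above `U`. An injective
sheaf is also injective as a presheaf, because the inclusion is right adjoint to the exact
sheafification; so the embedding splits, naturally in `U`. -/
lemma exists_coind_retraction (T : GSheaf G) [Injective T] :
    ∃ r : ∀ U : Site G, (∀ (W : Site G) (_ : W ⟶ U), sec T W) →+ sec T U,
      (∀ (U V : Site G) (τ : V ⟶ U) (m : ∀ (W : Site G) (_ : W ⟶ U), sec T W),
        secMap T τ (r U m) = r V fun W σ => m W (σ ≫ τ)) ∧
      ∀ (U : Site G) (c : sec T U), r U (fun _ σ => secMap T σ c) = c := by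
  have : Injective T.obj := Injective.injective_of_adjoint
    (sheafificationAdjunction (Site.topology G) AddCommGrpCat.{u}) T
  let ρ : coindPresheaf T ⟶ T.obj := Injective.factorThru (𝟙 T.obj) (toCoind T)
  have hρ : toCoind T ≫ ρ = 𝟙 T.obj := Injective.comp_factorThru _ _
  refine ⟨fun U => (ρ.app (Opposite.op U)).hom, fun U V τ m => ?_, fun U c => ?_⟩
  · exact (ConcreteCategory.congr_hom (ρ.naturality τ.op) m).symm
  · exact ConcreteCategory.congr_hom (NatTrans.congr_app hρ (Opposite.op U)) c

end Coinduced

/-! ### Injective sheaves are flasque on étale spaces -/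

section Flasque

variable {n : ℕ} {G : SmoothEtaleGroupoid.{u} n}

/-- The corestriction of a morphism of the site. -/
def siteCorestr {U V : Site G} (σ : U ⟶ V) (O : Site G)
    (h : ∀ x, (Site.Hom.fn σ x).1 ∈ O.opens) : U ⟶ O :=
  (⟨Site.Hom.arr σ, Site.Hom.continuous_arr σ, Site.Hom.src_arr σ, h⟩ : Site.Hom U O)

lemma siteCorestr_comp {U V O O' : Site G} (σ : U ⟶ V) (h : ∀ x, (Site.Hom.fn σ x).1 ∈ O.opens)
    (hO : O.opens ≤ O'.opens) (τ : U ⟶ O')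
    (hτ : ∀ x, Site.Hom.arr τ x = Site.Hom.arr σ x) : siteCorestr σ O h ≫ Site.inclHom hO = τ :=
  Site.Hom.ext (funext fun x => (arr_comp_inclHom _ hO x).trans (hτ x).symm)

/-- The inverse image of an open set under a local section. -/
def preSite {Z : EtaleSpace G.Obj} {U : Site G} (f : LocSec Z U) {W : Set Z.carrier}
    (hW : IsOpen W) : Site G :=
  ⟨⟨Subtype.val '' (f.toFun ⁻¹' W),
    U.opens.isOpen.isOpenMap_subtype_val _ (hW.preimage f.continuous_toFun)⟩⟩

lemma preSite_le {Z : EtaleSpace G.Obj} {U : Site G} (f : LocSec Z U) {W : Set Z.carrier}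
    (hW : IsOpen W) : (preSite f hW).opens ≤ U.opens := by
  rintro _ ⟨x, -, rfl⟩
  exact x.2

lemma preSite_mem {Z : EtaleSpace G.Obj} {U : Site G} (f : LocSec Z U) {W : Set Z.carrier}
    (hW : IsOpen W) (x : (preSite f hW).opens) : (f.restr (preSite_le f hW)).toFun x ∈ W := by
  obtain ⟨_, ⟨x, hx, rfl⟩⟩ := x
  exact hx

lemma preSite_restr_le {Z : EtaleSpace G.Obj} {U V : Site G} (f : LocSec Z V) {W : Set Z.carrier}
    (hW : IsOpen W) (h : U.opens ≤ V.opens) :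
    (preSite (f.restr h) hW).opens ≤ (preSite f hW).opens := by
  rintro _ ⟨x, hx, rfl⟩
  exact ⟨⟨x.1, h x.2⟩, hx, rfl⟩

/-- Extension by zero is possible in the product over all objects above `U`, where no compatibility
is required between the components. The retraction turns the extended family into a section, and it
fixes families of restrictions; hence nothing changes over `W₀`. -/
lemma flasque_gs (T : GSheaf G) [Injective T] (Z : EtaleSpace G.Obj) : (gs T Z).Flasque := by
  classical
  obtain ⟨r, hr, hr'⟩ := exists_coind_retraction T
  intro W₀ hW₀ η hη
  -- The component at `σ : W ⟶ U` is the translate of `η` if the part of `f` reached by `σ` lies in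
  -- `W₀`, and zero otherwise.
  let m : ∀ (U : Site G) (_ : LocSec Z U) (W : Site G) (_ : W ⟶ U), sec T W := fun U f W σ =>
    if h : ∀ x, f.toFun (Site.Hom.fn σ x) ∈ W₀ then
      secMap T (siteCorestr σ (preSite f hW₀) fun x => ⟨_, h x, rfl⟩)
        (secOf η _ (f.restr (preSite_le f hW₀))) else 0
  have hm : ∀ (U V : Site G) (h : U.opens ≤ V.opens) (f : LocSec Z V) (W : Site G) (σ : W ⟶ U),
      m V f W (σ ≫ Site.inclHom h) = m U (f.restr h) W σ := by
    intro U V h f W σ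
    have e : ∀ x, f.toFun (Site.Hom.fn (σ ≫ Site.inclHom h) x) =
        (f.restr h).toFun (Site.Hom.fn σ x) := fun x => congrArg f.toFun
      (Subtype.ext (congrArg G.tgt (arr_comp_inclHom σ h x)))
    by_cases hx : ∀ x, (f.restr h).toFun (Site.Hom.fn σ x) ∈ W₀
    · have hx' : ∀ x, f.toFun (Site.Hom.fn (σ ≫ Site.inclHom h) x) ∈ W₀ := fun x => by
        rw [e]; exact hx x
      refine (dif_pos hx').trans (Eq.trans ?_ (dif_pos hx).symm)
      have h1 := secOf_restr (f := f.restr (preSite_le f hW₀))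
        (fun x => hη _ (preSite_mem f hW₀ x)) (preSite_restr_le f hW₀ h)
      have h2 : secMap T (siteCorestr σ (preSite (f.restr h) hW₀) fun x => ⟨_, hx x, rfl⟩)
          (secOf η _ ((f.restr h).restr (preSite_le (f.restr h) hW₀))) =
          secMap T (siteCorestr σ (preSite (f.restr h) hW₀) fun x => ⟨_, hx x, rfl⟩)
            (secMap T (Site.inclHom (preSite_restr_le f hW₀ h))
              (secOf η _ (f.restr (preSite_le f hW₀)))) := congrArg _ h1.symm
      rw [h2, ← secMap_comp]
      exact congrArg (fun τ => secMap T τ _)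
        (siteCorestr_comp (O := preSite (f.restr h) hW₀) σ (fun x => ⟨_, hx x, rfl⟩) _
          (siteCorestr (σ ≫ Site.inclHom h) (preSite f hW₀) fun x => ⟨_, hx' x, rfl⟩) fun x =>
              arr_comp_inclHom σ h x).symm
    · have hx' : ¬ ∀ x, f.toFun (Site.Hom.fn (σ ≫ Site.inclHom h) x) ∈ W₀ := fun h1 =>
        hx fun x => by rw [← e]; exact h1 x
      exact (dif_neg hx').trans (Eq.symm (show m U (f.restr h) W σ = 0 from dif_neg hx))
  let c : etaleSections T Z := ⟨fun U f => r U (m U f), fun U V h f => by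
    rw [hr]
    congr 1
    funext W σ
    exact hm U V h f W σ⟩
  refine ⟨gsSec c, gsSec_isGlobal c, fun z hz => ?_⟩
  obtain ⟨U, f, x, rfl, hf⟩ := exists_locSec z (hW₀.mem_nhds hz)
  have h1 : c.1 U f = secOf η U f := by
    refine Eq.trans ?_ (hr' U _)
    refine congrArg (r U) (funext fun W => funext fun σ => ?_)
    refine (dif_pos fun x => hf _).trans ?_
    have h2 := secOf_restr (f := f) (fun x => hη _ (hf x)) (preSite_le f hW₀)
    rw [← h2, ← secMap_comp]
    exact congrArg (fun τ => secMap T τ _) (siteCorestr_comp _ _ _ _ fun _ => rfl)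
  rw [gsSec_apply c f ⟨x, rfl⟩, h1]
  exact secOf_spec (fun x => hη _ (hf x)) x

end Flasque

/-! ### Exactness over the nerve for injective coefficients -/

section Rows

variable {n : ℕ} {G : SmoothEtaleGroupoid.{u} n}

/-- The local section `x ↦ (f(t(σ(x))), σ(x)⁻¹)`. -/
def transSec {Z : EtaleSpace G.Obj} {U W : Site G} (f : LocSec Z U) (σ : W ⟶ U) :
    LocSec (G.snoc Z) W where
  toFun x := ⟨(f.toFun (Site.Hom.fn σ x), G.inv (Site.Hom.arr σ x)),
    (proj_locSec f _).trans (G.src_inv _).symm⟩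
  continuous_toFun := ((f.continuous_toFun.comp (Site.Hom.continuous_fn σ)).prodMk
    (G.continuous_inv.comp (Site.Hom.continuous_arr σ))).subtype_mk _
  proj_toFun x := (G.tgt_inv _).trans (Site.Hom.src_arr σ x)

/-- Apply the retraction to the family `σ ↦ c(f ∘ σ, σ⁻¹)`: it removes the last arrow by evaluating
`c` at all possible arrows at once. On a translate `c · g` the family consists of restrictions of
`c`, so `h` inverts the translation. Naturality of the retraction gives the exchange of the
composition face with the translation. -/
lemma exists_contraction (T : GSheaf G) [Injective T] :
    ∃ h : ∀ Z : EtaleSpace G.Obj, etaleSections T (G.snoc Z) →+ etaleSections T Z,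
      (∀ Z (c : etaleSections T Z), h Z (etaleTwist c) = c) ∧
      (∀ (Z Z' : EtaleSpace G.Obj) (q : Z.Hom Z') (c : etaleSections T (G.snoc Z')),
        h Z (etalePull T (snocMap q) c) = etalePull T q (h Z' c)) ∧
      ∀ Z (c : etaleSections T (G.snoc Z)),
        h (G.snoc Z) (etalePull T (snocComp Z) c) = etaleTwist (h Z c) := by
  obtain ⟨r, hr, hr'⟩ := exists_coind_retraction T
  let h : ∀ Z : EtaleSpace G.Obj, etaleSections T (G.snoc Z) →+ etaleSections T Z := fun Z =>
    AddMonoidHom.mk' (fun c => ⟨fun U f => r U fun W σ => c.1 W (transSec f σ), fun U V hUV f => by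
      rw [hr]
      refine congrArg (r U) (funext fun W => funext fun σ => congrArg (c.1 W)
        (EtaleSpace.Hom.ext_fun fun x => Subtype.ext (Prod.ext ?_ ?_)))
      · exact congrArg f.toFun (Subtype.ext (congrArg G.tgt (arr_comp_inclHom σ hUV x)))
      · exact congrArg G.inv (arr_comp_inclHom σ hUV x)⟩)
      fun c c' => Subtype.ext (funext fun U => funext fun f => map_add (r U) _ _)
  refine ⟨h, fun Z c => Subtype.ext (funext fun U => funext fun f => ?_), fun Z Z' q c => rfl,
    fun Z c => isTwist_iff.1 fun U V f f' σ h1 h2 => ?_⟩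
  · refine Eq.trans ?_ (hr' U _)
    refine congrArg (r U) (funext fun W => funext fun σ => ?_)
    exact isTwist_etaleTwist c W U (transSec f σ) f σ (fun x => (inv_inv_arr _).symm) fun x => rfl
  · refine Eq.trans ?_ (hr V U σ _).symm
    refine congrArg (r U) (funext fun W => funext fun τ => congrArg (c.1 W)
      (EtaleSpace.Hom.ext_fun fun x => Subtype.ext (Prod.ext ?_ ?_)))
    · refine (h2 (Site.Hom.fn τ x)).symm.trans (congrArg f'.toFun (Subtype.ext ?_))
      exact (G.tgt_comp _ _ _).symm
    · have e1 := h1 (Site.Hom.fn τ x)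
      have e2 : G.inv (Site.Hom.arr σ (Site.Hom.fn τ x)) = (f.toFun (Site.Hom.fn τ x)).1.2 := by
        rw [e1, inv_inv_arr]
      have e3 := inv_comp_arr (Site.Hom.arr τ x) (Site.Hom.arr σ (Site.Hom.fn τ x))
        (Site.Hom.src_arr σ (Site.Hom.fn τ x)).symm
        (by rw [G.tgt_inv, G.src_inv, Site.Hom.src_arr]; rfl)
      exact (Site.comp_congr e2.symm rfl _ _).trans e3

/-- The operator `h` is an extra degeneracy: `h δ c = δ h c + (-1)^(k+2) c`, so a cocycle is, up to
sign, the differential of `h c`. -/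
lemma exists_etaleDelta_eq (T : GSheaf G) [Injective T] (k : ℕ)
    (c : etaleSections T (G.nerve (k + 1))) (hc : etaleDelta T (k + 1) c = 0) :
    ∃ b, etaleDelta T k b = c := by
  obtain ⟨h, h1, h2, h3⟩ := exists_contraction T
  let P := (etaleSystem T).toNerveSystem
  have e1 : h (G.nerve (k + 1)) (P.shift.alt k c) = P.alt k (h (G.nerve k) c) :=
    NerveSystem.alt_natural (P := P.shift) (P' := P) (fun k => h (G.nerve k))
      (fun f c => h2 _ _ f c) k c
  have e2 : h (G.nerve (k + 1)) (P.pull (nerveComp k) c) = nerveTwist T k (h (G.nerve k) c) :=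
    h3 (G.nerve k) c
  have e3 : h (G.nerve (k + 1)) (nerveTwist T (k + 1) c) = c := h1 (G.nerve (k + 1)) c
  have e4 : h (G.nerve (k + 1)) (etaleDelta T (k + 1) c) = etaleDelta T k (h (G.nerve k) c) +
      (-1 : ℤ) ^ (k + 2) • c := by
    have e5 : etaleDelta T (k + 1) c = P.shift.alt k c + (-1 : ℤ) ^ (k + 1) • P.pull (nerveComp k) c
        + (-1 : ℤ) ^ (k + 2) • nerveTwist T (k + 1) c :=
      congrArg (· + _) (NerveSystem.alt_succ P k c)
    have e6 := congrArg (h (G.nerve (k + 1))) e5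
    refine e6.trans ?_
    refine (map_add _ _ _).trans (congrArg₂ (· + ·) ((map_add _ _ _).trans (congrArg₂ (· + ·) e1
      ((map_zsmul _ _ _).trans (congrArg _ e2)))) ((map_zsmul _ _ _).trans (congrArg _ e3)))
  rw [hc] at e4
  replace e4 := (map_zero (h (G.nerve (k + 1)))).symm.trans e4
  refine ⟨(-1 : ℤ) ^ (k + 1) • h (G.nerve k) c, ?_⟩
  rw [map_zsmul, eq_neg_of_add_eq_zero_left (b := (-1 : ℤ) ^ (k + 2) • c) e4.symm, smul_neg,
      smul_smul, ← pow_add]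
  have e7 : (-1 : ℤ) ^ (k + 1 + (k + 2)) = -1 := Odd.neg_one_pow ⟨k + 1, by ring⟩
  rw [e7, neg_smul, one_smul, neg_neg]

/-- In degree zero `δ` is the target pull-back minus the translation. For an invariant section these
agree, since both are restrictions along morphisms into the space of all objects. -/
lemma etaleDelta_etaleOfSec (T : GSheaf G) (ξ : invSections T) :
    etaleDelta T 0 (etaleOfSec T ξ.1) = 0 := by
  have h1 : etalePull T (G.face 0 0) (etaleOfSec T ξ.1) = nerveTwist T 0 (etaleOfSec T ξ.1) := by
    refine isTwist_iff.1 fun U V f f' σ _ _ => ?_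
    refine Eq.trans ?_ (secMap_comp T σ (Site.inclHom le_top) ξ.1)
    exact ξ.2 U _ _
  have h2 : etaleDelta T 0 (etaleOfSec T ξ.1) = etalePull T (G.face 0 0) (etaleOfSec T ξ.1) +
      (-1 : ℤ) ^ (0 + 1) • nerveTwist T 0 (etaleOfSec T ξ.1) :=
    congrArg (· + _) (NerveSystem.alt_zero _ _)
  have h3 : (-1 : ℤ) ^ (0 + 1) = -1 := by norm_num
  rw [h2, h1, h3, neg_smul, one_smul]
  exact add_neg_cancel _

lemma exists_etaleOfSec_eq (T : GSheaf G) (c : etaleSections T (G.nerve 0))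
    (hc : etaleDelta T 0 c = 0) : ∃ ξ : invSections T, etaleOfSec T ξ.1 = c := by
  have h2 : etaleDelta T 0 c = etalePull T (G.face 0 0) c +
      (-1 : ℤ) ^ (0 + 1) • nerveTwist T 0 c := congrArg (· + _) (NerveSystem.alt_zero _ _)
  have h3 : (-1 : ℤ) ^ (0 + 1) = -1 := by norm_num
  rw [h2, h3, neg_smul, one_smul] at hc
  have h4 : etalePull T (G.face 0 0) c = nerveTwist T 0 c := by
    have := eq_neg_of_add_eq_zero_left hc
    rwa [neg_neg] at this
  -- The identity of the space of objects. Every local section of `G_0` is a restriction of it, so a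
  -- family over `G_0` is determined by its member at `f₀`.
  let f₀ : LocSec (G.nerve 0) (Site.whole G) :=
    ⟨fun x => x.1, continuous_subtype_val, fun _ => rfl⟩
  have h5 : ∀ (U : Site G) (f : LocSec (G.nerve 0) U), f = f₀.restr le_top := fun U f =>
    EtaleSpace.Hom.ext_fun fun x => f.proj_toFun x
  have h6 : ∀ (U : Site G) (σ : U ⟶ Site.whole G),
      secMap T σ (c.1 (Site.whole G) f₀) = c.1 U (f₀.restr le_top) := by
    intro U σ
    have h7 := isTwist_etaleTwist (Z := G.nerve 0) c U (Site.whole G) (transSec f₀ σ) f₀ σ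
      (fun x => (inv_inv_arr _).symm) fun x => rfl
    have h8 := congrArg (fun e : etaleSections T (G.nerve 1) => e.1 U (transSec f₀ σ)) h4
    refine h7.symm.trans (h8.symm.trans ?_)
    exact congrArg (c.1 U) (h5 U _)
  refine ⟨⟨c.1 (Site.whole G) f₀, fun U σ τ => (h6 U σ).trans (h6 U τ).symm⟩,
    Subtype.ext (funext fun U => funext fun f => ?_)⟩
  rw [h5 U f]
  exact h6 U _

lemma etaleOfSec_injective (T : GSheaf G) {ξ ξ' : invSections T}
    (h : etaleOfSec T ξ.1 = etaleOfSec T ξ'.1) : ξ = ξ' := by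
  let f₀ : LocSec (G.nerve 0) (Site.whole G) :=
    ⟨fun x => x.1, continuous_subtype_val, fun _ => rfl⟩
  have h1 := congrArg (fun e : etaleSections T (G.nerve 0) => e.1 (Site.whole G) f₀) h
  exact Subtype.ext ((secMap_inclHom_self T le_rfl ξ.1).symm.trans (h1.trans (secMap_inclHom_self T le_rfl ξ'.1)))

end Rows
end EtaleGerbe
end

noncomputable section
open CategoryTheory Filter Topology
open scoped Manifold ContDiff
namespace EtaleGerbe
open SmoothEtaleGroupoid

/-! ### Resolutions -/

namespace GermSheaf

variable {X : Type u} [TopologicalSpace X] {E : GermSheaf X} {C : ℕ → GermSheaf X}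
  {B : Hom E (C 0)} {D : ∀ j, Hom (C j) (C (j + 1))}

/-- The sequence `0 → E → C 0 → C 1 → ⋯` is exact. -/
structure Resolution (B : Hom E (C 0)) (D : ∀ j, Hom (C j) (C (j + 1))) : Prop where
  inj : ∀ x, Function.Injective (B.app x)
  comp_zero : ∀ x a, (D 0).app x (B.app x a) = 0
  exact_zero : ∀ x a, (D 0).app x a = 0 → ∃ b, B.app x b = a
  comp : ∀ j x a, (D (j + 1)).app x ((D j).app x a) = 0
  exact : ∀ j x a, (D (j + 1)).app x a = 0 → ∃ b, (D j).app x b = a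

/-- Dimension shifting: each sequence `ker D_j → C_j → ker D_{j+1}` lowers the degree by one,
starting from `ker D_0 ≅ E`. The term `C_i` is needed only in degree `q + k + 1` with `i + k + 1 =
j`. -/
lemma Resolution.acyclic_ker (h : Resolution B D) {j q : ℕ} (hE : Acyclic (q + j) E)
    (hC : ∀ i k, i + k + 1 = j → Acyclic (q + k) (C i)) : Acyclic q (ker (D j)) := by
  induction j generalizing q with
  | zero =>
    refine Acyclic.of_bijective hE (kerLift B (D 0) h.comp_zero) fun x => ⟨fun a b hab => ?_,
        fun a => ?_⟩
    · exact h.inj x (congrArg Subtype.val hab)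
    · obtain ⟨b, hb⟩ := h.exact_zero x a.1 a.2
      exact ⟨b, Subtype.ext hb⟩
  | succ j ih =>
    refine (ses_kerLift (D j) (D (j + 1)) (h.comp j) (h.exact j)).acyclic_right
      (ih (by rwa [Nat.add_assoc, Nat.add_comm 1]) fun i k hik => ?_) (hC j 0 (by omega))
    rw [Nat.add_assoc, Nat.add_comm 1]
    exact hC i (k + 1) (by omega)

lemma Resolution.exists_of_ker (h : Resolution B D) {j : ℕ} (hE : Acyclic j E)
    (hC : ∀ i k, i + k + 1 = j → Acyclic k (C i)) {c : ∀ x, (C (j + 1)).stalk x}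
    (hc : (C (j + 1)).IsGlobal c) (hc' : ∀ x, (D (j + 1)).app x (c x) = 0) :
    ∃ b, (C j).IsGlobal b ∧ ∀ x, (D j).app x (b x) = c x := by
  have h0 : Acyclic 0 (ker (D j)) := h.acyclic_ker (by rwa [Nat.zero_add]) fun i k hik => by
    rw [Nat.zero_add]
    exact hC i k hik
  obtain ⟨b, hb, hb'⟩ := (ses_kerLift (D j) (D (j + 1)) (h.comp j) (h.exact j)).lift h0
    (r := fun x => ⟨c x, hc' x⟩) hc
  exact ⟨b, hb, fun x => congrArg Subtype.val (hb' x)⟩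

lemma Resolution.exists_of_ker_zero (h : Resolution B D) {c : ∀ x, (C 0).stalk x}
    (hc : (C 0).IsGlobal c) (hc' : ∀ x, (D 0).app x (c x) = 0) :
    ∃ b, E.IsGlobal b ∧ ∀ x, B.app x (b x) = c x := by
  choose b hb using fun x => h.exact_zero x (c x) (hc' x)
  refine ⟨b, fun x => Hom.isSec_of_injective B h.inj ?_, hb⟩
  simp only [hb]
  exact hc x

end GermSheaf

/-! ### The cone of a quasi-isomorphism -/

section Cone

variable {n : ℕ} {G : SmoothEtaleGroupoid.{u} n} {Z : EtaleSpace G.Obj}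

lemma exists_gsGerm_pair {F F' : GSheaf G} (z : Z.carrier) (a : (gs F Z).stalk z)
    (b : (gs F' Z).stalk z) : ∃ (U : Site G) (f : LocSec Z U) (x : U.opens) (h : f.toFun x = z)
      (s : sec F U) (t : sec F' U), a = gsGerm z f ⟨x, h⟩ s ∧ b = gsGerm z f ⟨x, h⟩ t := by
  obtain ⟨U, f, ⟨x, hx⟩, s, -, rfl⟩ := exists_gsGerm z a (Eventually.of_forall fun _ => trivial)
  obtain ⟨V, g, ⟨y, hy⟩, t, -, rfl⟩ := exists_gsGerm z b (Eventually.of_forall fun _ => trivial)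
  obtain ⟨W, h1, h2, hxW, e, -⟩ := exists_common_restr f g (hx.trans hy.symm) (p := fun _ => True)
    (Eventually.of_forall fun _ => trivial)
  have hx' : (f.restr h1).toFun ⟨x.1, hxW⟩ = z := hx
  have hy' : ∃ w, (g.restr h2).toFun w = z := ⟨⟨x.1, hxW⟩, by rw [← e]; exact hx'⟩
  refine ⟨W, f.restr h1, ⟨x.1, hxW⟩, hx', secMap F (Site.inclHom h1) s,
    secMap F' (Site.inclHom h2) t, (gsGerm_restr f h1 _ _ s).symm, ?_⟩
  rw [← gsGerm_restr g h2 hy' ⟨y, hy⟩ t]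
  simp only [e]

lemma gsGerm_eq_zero {F : GSheaf G} {U : Site G} {f : LocSec Z U} {x : U.opens} {z : Z.carrier}
    (h : f.toFun x = z) {s : sec F U} (hs : gsGerm z f ⟨x, h⟩ s = 0) :
    ∃ (V : Site G) (hV : V.opens ≤ U.opens), x.1 ∈ V.opens ∧ secMap F (Site.inclHom hV) s = 0 := by
  subst h
  exact (gsGerm_eq_zero_iff f x s).1 hs

variable {K T : CochainComplex (GSheaf G) ℕ} {η : K ⟶ T}

/-- Exactness of the cone of `η` at a stalk. Injectivity on homology writes `a` as the differential
of some element; the defect of `t` is then closed and, by surjectivity on homology, is the image of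
a closed element up to a boundary. Adding that closed element does not change the differential. -/
lemma stalk_exact (hη : QuasiIso η) {i j k : ℕ} (hi : (ComplexShape.up ℕ).prev j = i)
    (hj : j + 1 = k) (z : Z.carrier) (a : (gs (K.X k) Z).stalk z) (t : (gs (T.X j) Z).stalk z)
    (ha : (gsMap (K.d k (k + 1)) Z).app z a = 0)
    (hat : (gsMap (η.f k) Z).app z a = (gsMap (T.d j k) Z).app z t) :
    ∃ x b, (gsMap (K.d j k) Z).app z x = a ∧
      t = (gsMap (η.f j) Z).app z x + (gsMap (T.d i j) Z).app z b := by
  obtain ⟨U, f, x, hx, s, r, rfl, rfl⟩ := exists_gsGerm_pair z a t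
  rw [gsMap_gsGerm] at ha
  obtain ⟨V, hV, hxV, hs⟩ := gsGerm_eq_zero hx ha
  rw [gsMap_gsGerm, gsMap_gsGerm, ← sub_eq_zero, ← map_sub] at hat
  obtain ⟨V', hV', hxV', hr⟩ := gsGerm_eq_zero hx hat
  rw [map_sub, sub_eq_zero] at hr
  let W : Site G := ⟨V.opens ⊓ V'.opens⟩
  have hW : W.opens ≤ V.opens := inf_le_left
  have hW' : W.opens ≤ V'.opens := inf_le_right
  have h1 : homOn (K.d k (k + 1)) W (secMap _ (Site.inclHom (hW.trans hV)) s) = 0 := by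
    rw [homOn_secMap, ← secMap_inclHom_comp _ hW hV, hs, map_zero]
  have h2 : homOn (η.f k) W (secMap _ (Site.inclHom (hW.trans hV)) s) =
      homOn (T.d j k) W (secMap _ (Site.inclHom (hW.trans hV)) r) := by
    rw [homOn_secMap, homOn_secMap]
    have := congrArg (secMap _ (Site.inclHom hW')) hr
    rwa [secMap_inclHom_comp, secMap_inclHom_comp] at this
  obtain ⟨O, hO, b, hxO, hb⟩ := exists_local_inj hη (by subst hj; exact CochainComplex.prev_nat_succ j)
    (CochainComplex.next ℕ k) _ h1 _ h2 (x := x.1) ⟨hxV, hxV'⟩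
  have hOU : O.opens ≤ U.opens := hO.trans (hW.trans hV)
  rw [secMap_inclHom_comp] at hb
  have h3 : homOn (T.d j k) O (secMap _ (Site.inclHom hOU) r - homOn (η.f j) O b) = 0 := by
    have h4 := congrArg (secMap _ (Site.inclHom hO)) h2
    rw [← homOn_secMap, ← homOn_secMap, secMap_inclHom_comp, secMap_inclHom_comp, hb] at h4
    rw [map_sub, ← h4, ← homOn_comp, ← homOn_comp, η.comm, sub_self]
  obtain ⟨O', hO', a', b', hxO', ha', hab⟩ := exists_local_surj hη hi
    ((CochainComplex.next ℕ j).trans hj) _ h3 hxO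
  rw [map_sub, secMap_inclHom_comp, sub_eq_iff_eq_add, ← homOn_secMap] at hab
  have hz : (f.restr (hO'.trans hOU)).toFun ⟨x.1, hxO'⟩ = z := hx
  refine ⟨gsGerm z (f.restr (hO'.trans hOU)) ⟨_, hz⟩ (a' + secMap _ (Site.inclHom hO') b),
    gsGerm z (f.restr (hO'.trans hOU)) ⟨_, hz⟩ b', ?_, ?_⟩
  · rw [gsMap_gsGerm, map_add, ha', zero_add, homOn_secMap, ← hb, secMap_inclHom_comp]
    exact gsGerm_restr f _ _ _ s
  · rw [gsMap_gsGerm, gsMap_gsGerm, ← map_add, ← gsGerm_restr f (hO'.trans hOU) ⟨_, hz⟩ ⟨x, hx⟩ r,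
      hab]
    simp only [map_add]
    abel

variable (η Z)

/-- The terms of the cone. -/
def coneX (j : ℕ) : GermSheaf Z.carrier := (gs (K.X (j + 1)) Z).prod (gs (T.X j) Z)

/-- The augmentation of the cone. -/
def coneB : GermSheaf.Hom (gs (K.X 0) Z) (coneX (K := K) (T := T) Z 0) where
  app z := ((gsMap (K.d 0 1) Z).app z).prod ((gsMap (η.f 0) Z).app z)
  isSec _ z h := ⟨(gsMap _ Z).isSec _ z h, (gsMap _ Z).isSec _ z h⟩

/-- The differentials of the cone. -/
def coneD (j : ℕ) : GermSheaf.Hom (coneX (K := K) (T := T) Z j) (coneX (K := K) (T := T) Z (j + 1))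
    where
  app z := (((gsMap (K.d (j + 1) (j + 2)) Z).app z).comp (AddMonoidHom.fst _ _)).prod
    (((gsMap (η.f (j + 1)) Z).app z).comp (AddMonoidHom.fst _ _) -
      ((gsMap (T.d j (j + 1)) Z).app z).comp (AddMonoidHom.snd _ _))
  isSec _ z h := ⟨(gsMap _ Z).isSec _ z h.1,
    (gs _ Z).sub ((gsMap _ Z).isSec _ z h.1) ((gsMap _ Z).isSec _ z h.2)⟩

variable {η}

/-- The cone of a quasi-isomorphism is acyclic. Written with terms `K_{j+1} ⊕ T_j`, it is a
resolution of `K_0`. -/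
lemma resolution_cone (hη : QuasiIso η) : GermSheaf.Resolution (coneB Z η) (coneD Z η) where
  inj z := by
    rw [injective_iff_map_eq_zero]
    intro a ha
    have h1 : (gsMap (K.d 0 1) Z).app z a = 0 := congrArg Prod.fst ha
    have h2 : (gsMap (η.f 0) Z).app z a = 0 := congrArg Prod.snd ha
    obtain ⟨U, f, ⟨x, hx⟩, s, -, rfl⟩ := exists_gsGerm z a (Eventually.of_forall fun _ => trivial)
    rw [gsMap_gsGerm] at h1 h2
    obtain ⟨V, hV, hxV, hs⟩ := gsGerm_eq_zero hx h1
    obtain ⟨V', hV', hxV', hs'⟩ := gsGerm_eq_zero hx h2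
    let W : Site G := ⟨V.opens ⊓ V'.opens⟩
    have hW : W.opens ≤ V.opens := inf_le_left
    have hW' : W.opens ≤ V'.opens := inf_le_right
    have h3 : homOn (K.d 0 1) W (secMap _ (Site.inclHom (hW.trans hV)) s) = 0 := by
      rw [homOn_secMap, ← secMap_inclHom_comp _ hW hV, hs, map_zero]
    have h4 : homOn (η.f 0) W (secMap _ (Site.inclHom (hW.trans hV)) s) =
        homOn (T.d 0 0) W 0 := by
      rw [homOn_secMap, map_zero]
      have := congrArg (secMap _ (Site.inclHom hW')) hs'
      rwa [secMap_inclHom_comp, map_zero] at this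
    obtain ⟨O, hO, b, hxO, hb⟩ := exists_local_inj hη (CochainComplex.prev_nat_zero)
      (CochainComplex.next ℕ 0) _ h3 _ h4 (x := x.1) ⟨hxV, hxV'⟩
    -- In degree zero the predecessor index is again `0`, and the differential from `0` to `0` is
    -- zero; so there are no boundaries.
    rw [K.shape 0 0 (by simp), homOn_zero, secMap_inclHom_comp] at hb
    rw [← gsGerm_restr f (hO.trans (hW.trans hV)) ⟨⟨x.1, hxO⟩, hx⟩, hb, map_zero]
  comp_zero z a := by
    refine Prod.ext ?_ ?_
    · change (gsMap _ Z).app z ((gsMap _ Z).app z a) = 0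
      rw [gsMap_comp, K.d_comp_d, gsMap_zero]
    · change (gsMap _ Z).app z ((gsMap _ Z).app z a) - (gsMap _ Z).app z ((gsMap _ Z).app z a) = 0
      rw [gsMap_comp, gsMap_comp, η.comm, sub_self]
  exact_zero z a h := by
    obtain ⟨x, b, h1, h2⟩ := stalk_exact hη CochainComplex.prev_nat_zero rfl z a.1 a.2
      (congrArg Prod.fst h) (sub_eq_zero.1 (congrArg Prod.snd h))
    rw [T.shape 0 0 (by simp), gsMap_zero, add_zero] at h2
    exact ⟨x, Prod.ext h1 h2.symm⟩
  comp j z a := by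
    refine Prod.ext ?_ ?_
    · change (gsMap _ Z).app z ((gsMap _ Z).app z a.1) = 0
      rw [gsMap_comp, K.d_comp_d, gsMap_zero]
    · change (gsMap _ Z).app z ((gsMap _ Z).app z a.1) -
        (gsMap _ Z).app z ((gsMap _ Z).app z a.1 - (gsMap _ Z).app z a.2) = 0
      rw [map_sub, gsMap_comp, gsMap_comp, gsMap_comp, T.d_comp_d, gsMap_zero, η.comm, sub_zero,
        sub_self]
  exact j z a h := by
    obtain ⟨x, b, h1, h2⟩ := stalk_exact hη (CochainComplex.prev_nat_succ j) rfl z a.1 a.2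
      (congrArg Prod.fst h) (sub_eq_zero.1 (congrArg Prod.snd h))
    -- The sign compensates the minus sign before the differential of `T` in the cone.
    refine ⟨(x, -b), Prod.ext h1 ?_⟩
    change (gsMap _ Z).app z x - (gsMap _ Z).app z (-b) = a.2
    rw [h2, map_neg, sub_neg_eq_add]

/-- At the left end of the cone a global closed section comes from the sheaf `K_0` itself by left
exactness, without any acyclicity. -/
lemma exists_etale_lift_zero (hη : QuasiIso η) (x' : etaleSections (K.X 1) Z)
    (t : etaleSections (T.X 0) Z) (h1 : etaleMap (K.d 1 2) Z x' = 0)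
    (h2 : etaleMap (η.f 1) Z x' = etaleMap (T.d 0 1) Z t) :
    ∃ x, etaleMap (K.d 0 1) Z x = x' ∧ t = etaleMap (η.f 0) Z x := by
  obtain ⟨b, hb, hb'⟩ := (resolution_cone Z hη).exists_of_ker_zero
    (c := fun z => (gsSec x' z, gsSec t z))
    (fun z => ⟨gsSec_isGlobal x' z, gsSec_isGlobal t z⟩) fun z => Prod.ext
      ((gsSec_etaleMap _ _ _).symm.trans (by rw [h1, map_zero]; rfl))
      (sub_eq_zero.2 ((gsSec_etaleMap _ _ _).symm.trans (by rw [h2]; rfl)))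
  obtain ⟨x, rfl⟩ := exists_gsSec hb
  exact ⟨x, gsSec_injective (funext fun z => congrArg Prod.fst (hb' z)),
    gsSec_injective (funext fun z => (congrArg Prod.snd (hb' z)).symm)⟩

/-- Global exactness of the cone at `(x', t)`. The obstruction is in the first cohomology of a
kernel, which shifts to the groups `H^{k+1}(K_i)` with `i + k = j`; the terms of `T` are flasque and
do not contribute. -/
lemma exists_etale_lift_succ (hη : QuasiIso η) (hT : ∀ i, Injective (T.X i)) {j : ℕ}
    (hK : ∀ i k, i + k = j → GermSheaf.Acyclic k (gs (K.X i) Z)) (x' : etaleSections (K.X (j + 2))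
        Z)
    (t : etaleSections (T.X (j + 1)) Z) (h1 : etaleMap (K.d (j + 2) (j + 3)) Z x' = 0)
    (h2 : etaleMap (η.f (j + 2)) Z x' = etaleMap (T.d (j + 1) (j + 2)) Z t) :
    ∃ x b, etaleMap (K.d (j + 1) (j + 2)) Z x = x' ∧
      t = etaleMap (η.f (j + 1)) Z x + etaleMap (T.d j (j + 1)) Z b := by
  obtain ⟨b, hb, hb'⟩ := (resolution_cone Z hη).exists_of_ker (j := j) (hK 0 j (Nat.zero_add j))
    (fun i k hik => (hK (i + 1) k (by omega)).prod
      (have := hT i; (flasque_gs (T.X i) Z).acyclic k))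
    (c := fun z => (gsSec x' z, gsSec t z))
    (fun z => ⟨gsSec_isGlobal x' z, gsSec_isGlobal t z⟩) fun z => Prod.ext
      ((gsSec_etaleMap _ _ _).symm.trans (by rw [h1, map_zero]; rfl))
      (sub_eq_zero.2 ((gsSec_etaleMap _ _ _).symm.trans (by rw [h2]; rfl)))
  obtain ⟨x, hx⟩ := exists_gsSec (η := fun z => (b z).1) fun z => (hb z).1
  obtain ⟨y, hy⟩ := exists_gsSec (η := fun z => (b z).2) fun z => (hb z).2
  refine ⟨x, -y, gsSec_injective (funext fun z => ?_), gsSec_injective (funext fun z => ?_)⟩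
  · rw [gsSec_etaleMap, hx]
    exact congrArg Prod.fst (hb' z)
  · rw [map_neg, ← sub_eq_add_neg, map_sub, Pi.sub_apply, gsSec_etaleMap, gsSec_etaleMap, hx, hy]
    exact (congrArg Prod.snd (hb' z)).symm

end Cone
end EtaleGerbe
end

noncomputable section
open CategoryTheory Filter Topology
open scoped Manifold ContDiff
namespace EtaleGerbe
open SmoothEtaleGroupoid

/-! ### Sheaves of germs of functions -/

section CoeffGerms

variable {n : ℕ} {G : SmoothEtaleGroupoid.{u} n} {F : Coeff G} {Z : EtaleSpace G.Obj}

lemma Coeff.SecAt.eventually {f : Z.carrier → F.A} {z : Z.carrier} (h : F.SecAt Z f z) :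
    ∀ᶠ w in 𝓝 z, F.SecAt Z f w := by
  obtain ⟨η, h1, h2⟩ := h
  filter_upwards [(Z.tendsto_proj z).eventually (F.eventually h1),
      h2.eventuallyEq_nhds] with w h3 h4
  exact ⟨η, h3, h4⟩

lemma Coeff.SecAt.add {f g : Z.carrier → F.A} {z : Z.carrier} (h : F.SecAt Z f z)
    (h' : F.SecAt Z g z) : F.SecAt Z (f + g) z := by
  obtain ⟨η, h1, h2⟩ := h
  obtain ⟨θ, h3, h4⟩ := h'
  exact ⟨η + θ, F.add h1 h3, h2.add h4⟩

lemma Coeff.SecAt.neg {f : Z.carrier → F.A} {z : Z.carrier} (h : F.SecAt Z f z) :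
    F.SecAt Z (-f) z := by
  obtain ⟨η, h1, h2⟩ := h
  exact ⟨-η, F.neg h1, h2.neg⟩

lemma Coeff.SecAt.sub {f g : Z.carrier → F.A} {z : Z.carrier} (h : F.SecAt Z f z)
    (h' : F.SecAt Z g z) : F.SecAt Z (f - g) z := by
  rw [sub_eq_add_neg]
  exact h.add h'.neg

lemma Coeff.SecAt.pull {W : EtaleSpace G.Obj} (q : Z.Hom W) {f : W.carrier → F.A} {z : Z.carrier}
    (h : F.SecAt W f (q.toFun z)) : F.SecAt Z (fun w => f (q.toFun w)) z := by
  obtain ⟨η, h1, h2⟩ := h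
  refine ⟨η, by rwa [q.proj_toFun] at h1, ?_⟩
  filter_upwards [q.continuous_toFun.continuousAt.eventually h2] with w hw
  rw [hw, Function.comp_apply, q.proj_toFun]
  rfl

variable (F Z)

/-- The functions which are sections near `z`. -/
def secAtSub (z : Z.carrier) : AddSubgroup (Z.carrier → F.A) where
  carrier := {f | F.SecAt Z f z}
  zero_mem' := ⟨0, F.zero _, Eventually.of_forall fun _ => rfl⟩
  add_mem' h h' := h.add h'
  neg_mem' h := h.neg

/-- The functions which vanish near `z`. -/
def nullAt (z : Z.carrier) : AddSubgroup (Z.carrier → F.A) where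
  carrier := {f | ∀ᶠ w in 𝓝 z, f w = 0}
  zero_mem' := Eventually.of_forall fun _ => rfl
  add_mem' h h' := by filter_upwards [h, h'] with w h1 h2; rw [Pi.add_apply, h1, h2, add_zero]
  neg_mem' h := by filter_upwards [h] with w h1; rw [Pi.neg_apply, h1, neg_zero]

/-- The pull-back to an étale space of a sheaf of germs of functions. -/
def cg : GermSheaf Z.carrier :=
  GermSheaf.ofLocal (secAtSub F Z) (nullAt F Z) (fun _ _ h => Coeff.SecAt.eventually h)
    fun _ _ h => Filter.Eventually.eventually_nhds h

variable {F Z}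

/-- The germ of a function. -/
def cgMk (z : Z.carrier) : secAtSub F Z z →+ (cg F Z).stalk z := GermSheaf.germ _ _ _ _ z

lemma cgMk_surjective (z : Z.carrier) : Function.Surjective (cgMk (F := F) z) :=
  GermSheaf.germ_surjective z

lemma cgMk_eq_zero_iff {z : Z.carrier} (f : secAtSub F Z z) :
    cgMk z f = 0 ↔ ∀ᶠ w in 𝓝 z, f.1 w = 0 := GermSheaf.germ_eq_zero_iff f

lemma cgMk_eq_iff {z : Z.carrier} (f g : secAtSub F Z z) :
    cgMk z f = cgMk z g ↔ ∀ᶠ w in 𝓝 z, f.1 w = g.1 w := by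
  rw [← sub_eq_zero, ← map_sub, cgMk_eq_zero_iff]
  exact eventually_congr (Eventually.of_forall fun w => sub_eq_zero)

lemma isSec_cg {η : ∀ z, (cg F Z).stalk z} {z : Z.carrier} : (cg F Z).IsSec η z ↔
    ∃ f, ∀ᶠ w in 𝓝 z, ∃ h : f ∈ secAtSub F Z w, η w = cgMk w ⟨f, h⟩ := Iff.rfl

lemma isSec_cgMk (c : F.sections Z) : (cg F Z).IsGlobal fun z => cgMk z ⟨c.1, c.2 z⟩ :=
  fun _ => isSec_cg.2 ⟨c.1, Eventually.of_forall fun w => ⟨c.2 w, rfl⟩⟩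

/-- A global family of germs of functions is the family of germs of one function, namely of the
values of the germs. -/
lemma exists_cg_sections {η : ∀ z, (cg F Z).stalk z} (hη : (cg F Z).IsGlobal η) :
    ∃ c : F.sections Z, ∀ z, η z = cgMk z ⟨c.1, c.2 z⟩ := by
  choose s hs using fun z => cgMk_surjective z (η z)
  have h : ∀ z, ∀ᶠ w in 𝓝 z, (s w).1 w = (s z).1 w := by
    intro z
    obtain ⟨f, hf⟩ := isSec_cg.1 (hη z)
    have h1 : ∀ᶠ w in 𝓝 z, f w = (s w).1 w := by
      filter_upwards [hf] with w ⟨hw, e⟩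
      exact ((cgMk_eq_iff _ _).1 (e.symm.trans (hs w).symm)).self_of_nhds
    obtain ⟨h2, e2⟩ := hf.self_of_nhds
    filter_upwards [h1, (cgMk_eq_iff _ _).1 (e2.symm.trans (hs z).symm)] with w h3 h4
    exact h3.symm.trans h4
  have hc : ∀ z, F.SecAt Z (fun w => (s w).1 w) z := fun z =>
    Coeff.SecAt.congr ((h z).mono fun w hw => hw.symm) (s z).2
  refine ⟨⟨fun w => (s w).1 w, hc⟩, fun z => (hs z).symm.trans ((cgMk_eq_iff _ _).2 ?_)⟩
  filter_upwards [h z] with w hw using hw.symm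

/-- The family of sections defined by a function. -/
def coeffFam (f : Z.carrier → F.A) : EtaleFam F.sheaf Z := fun _ g => open Classical in
  if h : ∀ x, F.SecAt Z f (g.toFun x) then
    (⟨fun x => f (g.toFun x), fun x => (h x).pull g⟩ : F.sections (EtaleSpace.ofOpens _)) else 0

lemma coeffFam_apply {f : Z.carrier → F.A} {U : Site G} {g : LocSec Z U}
    (h : ∀ x, F.SecAt Z f (g.toFun x)) : coeffFam f U g =
      (⟨fun x => f (g.toFun x), fun x => (h x).pull g⟩ : F.sections (EtaleSpace.ofOpens U.opens)) :=
  dif_pos h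

lemma coeffFam_restr {f : Z.carrier → F.A} {U V : Site G} (hU : U.opens ≤ V.opens) {g : LocSec Z V}
    (h : ∀ x, F.SecAt Z f (g.toFun x)) :
    secMap F.sheaf (Site.inclHom hU) (coeffFam f V g) = coeffFam f U (g.restr hU) := by
  rw [coeffFam_apply h, coeffFam_apply (g := g.restr hU) fun x => h ⟨x.1, hU x.2⟩]
  exact Subtype.ext (funext fun x => F.restrict_inclHom hU _ x)

lemma coeffFam_compat {f : Z.carrier → F.A} {z : Z.carrier} (h : F.SecAt Z f z) :
    coeffFam f ∈ compatNear F.sheaf Z z :=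
  (mem_compatNear F.sheaf Z).2 ⟨_, h.eventually, fun _ _ hUV _ hg => coeffFam_restr hUV hg⟩

/-- A germ of a function as a germ of a section of the associated sheaf on the site. -/
def toGsMk (z : Z.carrier) : secAtSub F Z z →+ (gs F.sheaf Z).stalk z :=
  AddMonoidHom.mk' (fun f => gsMk z ⟨coeffFam f.1, coeffFam_compat f.2⟩) fun f g => by
    rw [← map_add]
    refine (gsMk_eq_iff _ _).2 ⟨_, f.2.eventually.and g.2.eventually, fun U q hq => ?_⟩
    change coeffFam (f.1 + g.1) U q = coeffFam f.1 U q + coeffFam g.1 U q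
    rw [coeffFam_apply fun x => (hq x).1, coeffFam_apply fun x => (hq x).2,
      coeffFam_apply fun x => (hq x).1.add (hq x).2]
    rfl

lemma toGsMk_eq_zero_iff (z : Z.carrier) (f : secAtSub F Z z) :
    toGsMk z f = 0 ↔ ∀ᶠ w in 𝓝 z, f.1 w = 0 := by
  refine (gsMk_eq_zero_iff _).trans ⟨fun ⟨W, hW, h⟩ => ?_, fun h => ?_⟩
  · obtain ⟨U, q, x, rfl, hq⟩ := exists_locSec z ((show ∀ᶠ w in 𝓝 z,
      w ∈ W from hW).and f.2.eventually)
    filter_upwards [eventually_mem_range q x]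
    rintro _ ⟨y, rfl⟩
    have h1 := h U q fun x => (hq x).1
    change coeffFam f.1 U q = 0 at h1
    rw [coeffFam_apply fun x => (hq x).2] at h1
    exact congrArg (fun e : F.sections (EtaleSpace.ofOpens U.opens) => e.1 y) h1
  · refine ⟨_, h.and f.2.eventually, fun U q hq => ?_⟩
    change coeffFam f.1 U q = 0
    rw [coeffFam_apply fun x => (hq x).2]
    exact Subtype.ext (funext fun x => (hq x).1)

variable (F Z)

/-- The comparison of the two sheaves on an étale space defined by a sheaf of germs of functions. -/
def toGs : GermSheaf.Hom (cg F Z) (gs F.sheaf Z) :=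
  GermSheaf.ofLocalHom continuous_id toGsMk
    (fun z f hf => (toGsMk_eq_zero_iff z f).2 hf)
    fun z f hf => by
      classical
      refine ⟨fun w => if h : F.SecAt Z f w then toGsMk w ⟨f, h⟩ else 0, isSec_gs.2 ⟨coeffFam f,
          ?_⟩, ?_⟩
      · filter_upwards [Coeff.SecAt.eventually hf] with w hw
        exact ⟨coeffFam_compat hw, dif_pos hw⟩
      · filter_upwards with w hw
        exact Eq.symm (dif_pos (c := F.SecAt Z f w) hw)

lemma toGs_cgMk (z : Z.carrier) (f : secAtSub F Z z) : (toGs F Z).app z (cgMk z f) = toGsMk z f :=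
  rfl

lemma toGs_bijective (z : Z.carrier) : Function.Bijective ((toGs F Z).app z) := by
  classical
  constructor
  · rw [injective_iff_map_eq_zero]
    intro a ha
    obtain ⟨f, rfl⟩ := cgMk_surjective z a
    rw [toGs_cgMk, toGsMk_eq_zero_iff] at ha
    rwa [cgMk_eq_zero_iff]
  · intro a
    obtain ⟨U, g, ⟨x, rfl⟩, s, -, rfl⟩ := exists_gsGerm z a (Eventually.of_forall fun _ => trivial)
    let s' : F.sections (EtaleSpace.ofOpens U.opens) := s
    -- The section over the open set is extended to a function on `Z` through the projection. Only
    -- its germs at points of the local section `g` matter.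
    let f : Z.carrier → F.A := fun w => if h : Z.proj w ∈ U.opens then s'.1 ⟨Z.proj w, h⟩ else 0
    have hf : ∀ y, f (g.toFun y) = s'.1 y := fun y => by
      have hy : Z.proj (g.toFun y) = y.1 := proj_locSec g y
      have h1 : Z.proj (g.toFun y) ∈ U.opens := hy ▸ y.2
      exact (dif_pos h1).trans (congrArg s'.1 (Subtype.ext hy))
    have hsec : ∀ y, F.SecAt Z f (g.toFun y) := by
      intro y
      obtain ⟨η, h1, h2⟩ := s'.2 y
      refine ⟨η, (proj_locSec g y).symm ▸ h1, ?_⟩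
      obtain ⟨V, hV, hx, h3⟩ := exists_site_nhds h2
      filter_upwards [eventually_mem_range (g.restr hV) ⟨y.1, hx⟩]
      rintro _ ⟨w, rfl⟩
      refine (hf ⟨w.1, hV w.2⟩).trans ((h3 w).trans ?_)
      exact congrArg η (proj_locSec (g.restr hV) w).symm
    refine ⟨cgMk _ ⟨f, hsec x⟩, ?_⟩
    rw [toGs_cgMk]
    refine (gsMk_eq_gsGerm _ (W := {w | F.SecAt Z f w}) (fun _ _ hUV _ hg => coeffFam_restr hUV hg)
        g
      ⟨x, rfl⟩ hsec).trans (congrArg _ ?_)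
    exact (coeffFam_apply hsec).trans (Subtype.ext (funext hf))

variable {F Z}

lemma acyclic_gs {q : ℕ} (h : GermSheaf.Acyclic q (cg F Z)) :
    GermSheaf.Acyclic q (gs F.sheaf Z) := h.of_bijective (toGs F Z) (toGs_bijective F Z)

end CoeffGerms

/-! ### Constant sheaves -/

section Constants

variable {n : ℕ} {G : SmoothEtaleGroupoid.{u} n}

/-- Contract every component to one of its points. Components are open by local connectedness, so
the contractions fit together continuously and the final map is locally constant. -/
lemma exists_homotopy_of_components {X : Type u} [TopologicalSpace X] [LocallyConnectedSpace X]
    (h : ∀ x : X, ContractibleSpace (connectedComponent x)) :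
    ∃ H : X × unitInterval → X, Continuous H ∧ (∀ x, H (x, 1) = x) ∧
      ∀ x, ∀ᶠ y in 𝓝 x, H (y, 0) = H (x, 0) := by
  let r : X → X := fun x => Quotient.out (ConnectedComponents.mk x : ConnectedComponents X)
  have hr : ∀ x, x ∈ connectedComponent (r x) := fun x => by
    have h1 : (ConnectedComponents.mk (r x) : ConnectedComponents X) = ConnectedComponents.mk x :=
      Quotient.out_eq _
    exact ConnectedComponents.coe_eq_coe'.1 h1.symm
  have hloc : ∀ x y, y ∈ connectedComponent (r x) → r y = r x := fun x y hy => by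
    have h1 : (ConnectedComponents.mk y : ConnectedComponents X) = ConnectedComponents.mk (r x) :=
      ConnectedComponents.coe_eq_coe'.2 hy
    have h2 : (ConnectedComponents.mk (r x) : ConnectedComponents X) = ConnectedComponents.mk x :=
      Quotient.out_eq _
    exact congrArg Quotient.out (h1.trans h2)
  choose c hc using fun p : X => id_nullhomotopic ↥(connectedComponent p)
  let F := fun p => (hc p).some
  let H : X × unitInterval → X := fun z => (F (r z.1) (unitInterval.symm z.2, ⟨z.1, hr z.1⟩)).1
  -- The contraction used at `y` depends only on the chosen point of its component. This is
  -- generalised over that point, because the component occurs in the type of the contraction.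
  have hH : ∀ x y t (hy : y ∈ connectedComponent (r x)),
      H (y, t) = (F (r x) (unitInterval.symm t, ⟨y, hy⟩)).1 := fun x y t hy => by
    have h1 := hloc x y hy
    have : ∀ p (hp : r y = p) (hy : y ∈ connectedComponent p),
        H (y, t) = (F p (unitInterval.symm t, ⟨y, hy⟩)).1 := by
      rintro p rfl _
      rfl
    exact this _ h1 hy
  refine ⟨H, continuous_iff_continuousAt.2 fun ⟨x, t⟩ => ?_, fun x => ?_, fun x => ?_⟩
  · have ho : IsOpen ((connectedComponent (r x)) ×ˢ (Set.univ : Set unitInterval)) :=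
      isOpen_connectedComponent.prod isOpen_univ
    refine ContinuousOn.continuousAt (continuousOn_iff_continuous_domRestrict.2 ?_)
      (ho.mem_nhds ⟨hr x, trivial⟩)
    have : Continuous fun z : ↥((connectedComponent (r x)) ×ˢ (Set.univ : Set unitInterval)) =>
        (F (r x) (unitInterval.symm z.1.2, ⟨z.1.1, z.2.1⟩)).1 := by fun_prop
    exact this.congr fun z => (hH x z.1.1 z.1.2 z.2.1).symm
  · change (F (r x) (unitInterval.symm 1, ⟨x, hr x⟩)).1 = x
    rw [unitInterval.symm_one, ContinuousMap.Homotopy.apply_zero]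
    rfl
  · have key : ∀ y, y ∈ connectedComponent (r x) → H (y, 0) = (c (r x)).1 := fun y hy => by
      rw [hH x y 0 hy, unitInterval.symm_zero, ContinuousMap.Homotopy.apply_one]
      rfl
    filter_upwards [isOpen_connectedComponent.mem_nhds (hr x)] with y hy
    rw [key y hy, key x (hr x)]

/-- The space of objects is locally Euclidean, and the local homeomorphisms transfer local
connectedness to the étale space. -/
lemma locallyConnected_etale (Z : EtaleSpace G.Obj) : LocallyConnectedSpace Z.carrier := by
  have : LocallyConnectedSpace G.Obj := ChartedSpace.locallyConnectedSpace (Model n) G.Obj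
  let : ChartedSpace G.Obj Z.carrier :=
    { atlas := Set.univ
      chartAt := fun z => (Z.isLocalHomeomorph z).choose
      mem_chart_source := fun z => (Z.isLocalHomeomorph z).choose_spec.1
      chart_mem_atlas := fun _ => trivial }
  exact ChartedSpace.locallyConnectedSpace G.Obj Z.carrier

/-- The constant sheaf `ℤ(p)` as a sheaf of germs of functions. -/
def toCgConst (p : ℕ) (Z : EtaleSpace G.Obj) :
    GermSheaf.Hom (GermSheaf.const (ULift.{u} (twistedIntegers p)) Z.carrier)
      (cg (constants G p) Z) where
  app z := (cgMk (F := constants G p) z).comp (AddMonoidHom.mk'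
    (fun a => ⟨fun _ => a.down.1, fun _ => a.down.1, ⟨_, a.down.2, Eventually.of_forall fun _ =>
        rfl⟩,
      Eventually.of_forall fun _ => rfl⟩) fun _ _ => rfl)
  isSec η z h := isSec_cg.2 ⟨fun _ => (η z).down.1, by
    filter_upwards [h] with w hw
    exact ⟨⟨fun _ => (η z).down.1, ⟨_, (η z).down.2, Eventually.of_forall fun _ => rfl⟩,
      Eventually.of_forall fun _ => rfl⟩, (cgMk_eq_iff _ _).2 (Eventually.of_forall fun _ =>
        congrArg (fun a : ULift.{u} (twistedIntegers p) => a.down.1) hw)⟩⟩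

lemma toCgConst_bijective (p : ℕ) (Z : EtaleSpace G.Obj) (z : Z.carrier) :
    Function.Bijective ((toCgConst p Z).app z) := by
  constructor
  · rw [injective_iff_map_eq_zero]
    intro a ha
    have := ((cgMk_eq_zero_iff _).1 ha).self_of_nhds
    exact ULift.ext _ _ (Subtype.ext this)
  · intro a
    obtain ⟨⟨f, η, ⟨c, hc, h1⟩, h2⟩, rfl⟩ := cgMk_surjective z a
    refine ⟨⟨⟨c, hc⟩⟩, (cgMk_eq_iff _ _).2 ?_⟩
    filter_upwards [h2, (Z.tendsto_proj z).eventually h1] with w h3 h4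
    exact (h3.trans h4).symm

/-- The contraction of the components of `W` is transported to `Z`, and homotopy invariance applies.
The homeomorphism need not be over the objects: the constant sheaf depends only on the topology of
`Z`. -/
lemma acyclic_constants (p : ℕ) {Z W : EtaleSpace G.Obj}
    (h : ∀ z : W.carrier, ContractibleSpace (connectedComponent z)) (e : Z.carrier ≃ₜ W.carrier)
    (q : ℕ) : GermSheaf.Acyclic q (cg (constants G p) Z) := by
  have := locallyConnected_etale W
  obtain ⟨H, hH, h1, h0⟩ := exists_homotopy_of_components h
  refine (GermSheaf.acyclic_const _ (fun y => e.symm (H (e y.1, y.2)))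
    (e.symm.continuous.comp (hH.comp (by fun_prop))) (fun z => ?_) (fun z => ?_) q).of_bijective
    (toCgConst p Z) (toCgConst_bijective p Z)
  · simp [h1]
  · filter_upwards [e.continuous.continuousAt.eventually (h0 (e z))] with y hy
    exact congrArg e.symm hy

end Constants
end EtaleGerbe
end

noncomputable section
open CategoryTheory Filter Topology
open scoped Manifold ContDiff
namespace EtaleGerbe
open SmoothEtaleGroupoid

/-! ### Partitions of unity -/

section Partitions

variable {n : ℕ} {M : Type u} [TopologicalSpace M] [ChartedSpace (Model n) M]
  [IsManifold (𝓡 n) ∞ M] [T2Space M]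

/-- Finitely many bump functions with support in `W` cover the compact set, and their sum is
positive on it. -/
lemma exists_smooth_pos_on_compact {K W : Set M} (hK : IsCompact K) (hW : IsOpen W) (h : K ⊆ W) :
    ∃ f : M → ℝ, ContMDiff (𝓡 n) 𝓘(ℝ, ℝ) ∞ f ∧ (∀ x, 0 ≤ f x) ∧ tsupport f ⊆ W ∧
      ∀ x ∈ K, 0 < f x := by
  refine hK.induction_on (p := fun K => ∃ f : M → ℝ, ContMDiff (𝓡 n) 𝓘(ℝ, ℝ) ∞ f ∧
    (∀ x, 0 ≤ f x) ∧ tsupport f ⊆ W ∧ ∀ x ∈ K, 0 < f x) ?_ ?_ ?_ ?_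
  · exact ⟨fun _ => 0, contMDiff_const, fun _ => le_rfl, by simp, by simp⟩
  · rintro s t hst ⟨f, h1, h2, h3, h4⟩
    exact ⟨f, h1, h2, h3, fun x hx => h4 x (hst hx)⟩
  · rintro s t ⟨f, h1, h2, h3, h4⟩ ⟨g, k1, k2, k3, k4⟩
    refine ⟨f + g, h1.add k1, fun x => add_nonneg (h2 x) (k2 x),
      (tsupport_add f g).trans (Set.union_subset h3 k3), ?_⟩
    rintro x (hx | hx)
    · exact add_pos_of_pos_of_nonneg (h4 x hx) (k2 x)
    · exact add_pos_of_nonneg_of_pos (h2 x) (k4 x hx)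
  · intro x hx
    obtain ⟨φ, -, hφ⟩ := ((SmoothBumpFunction.nhds_basis_tsupport (I := 𝓡 n) x).mem_iff).1
      (hW.mem_nhds (h hx))
    refine ⟨Function.support φ, mem_nhdsWithin_of_mem_nhds φ.support_mem_nhds, φ, φ.contMDiff,
      fun x => φ.nonneg, hφ, fun y hy => lt_of_le_of_ne φ.nonneg (Ne.symm hy)⟩

/-- No countability is assumed, so the partition is built from a locally finite refinement with
relatively compact members: shrink it, choose a function positive on each compact closure of the
shrinking, and divide by the locally finite sum. -/
lemma exists_smooth_partition [ParacompactSpace M] (U : M → Set M) (hU : ∀ x, U x ∈ 𝓝 x) :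
    ∃ ρ : M → M → ℝ, (∀ i, ContMDiff (𝓡 n) 𝓘(ℝ, ℝ) ∞ (ρ i)) ∧
      (∀ x, ∃ S : Finset M, ∀ᶠ z in 𝓝 x, (∀ i ∉ S, ρ i z = 0) ∧ ∑ i ∈ S, ρ i z = 1) ∧
      ∀ i x, (∀ᶠ z in 𝓝 x, ρ i z = 0) ∨ U i ∈ 𝓝 x := by
  have : LocallyCompactSpace M := Manifold.locallyCompact_of_finiteDimensional (𝓡 n)
  choose K hK hKx using fun x : M => exists_compact_mem_nhds x
  obtain ⟨W, hWo, hWu, hWf, hWU⟩ := precise_refinement (fun x => interior (K x ∩ U x))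
    (fun _ => isOpen_interior) (Set.eq_univ_of_forall fun x => Set.mem_iUnion.2
      ⟨x, mem_interior_iff_mem_nhds.2 (inter_mem (hKx x) (hU x))⟩)
  obtain ⟨V, hVu, hVo, hVW⟩ := exists_iUnion_eq_closure_subset hWo (fun x => hWf.point_finite x) hWu
  have hVc : ∀ i, IsCompact (closure (V i)) := fun i =>
    (hK i).of_isClosed_subset isClosed_closure fun x hx =>
      (interior_subset (hWU i (hVW i hx))).1
  choose f hf hf0 hfW hfV using fun i => exists_smooth_pos_on_compact (n := n) (hVc i) (hWo i)
      (hVW i)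
  have hfz : ∀ i x, x ∉ W i → f i x = 0 := fun i x hx => by
    by_contra h
    exact hx (hfW i (subset_tsupport _ h))
  have hlf : LocallyFinite fun i => Function.support (f i) :=
    hWf.subset fun i x hx => hfW i (subset_tsupport _ hx)
  have hF : ContMDiff (𝓡 n) 𝓘(ℝ, ℝ) ∞ fun x => ∑ᶠ i, f i x := contMDiff_finsum hf hlf
  have hpos : ∀ x, 0 < ∑ᶠ i, f i x := fun x => by
    obtain ⟨i, hi⟩ := Set.mem_iUnion.1 (hVu.symm ▸ Set.mem_univ x : x ∈ ⋃ i, V i)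
    exact finsum_pos (fun i => hf0 i x) ⟨i, hfV i x (subset_closure hi)⟩ (hlf.point_finite x)
  refine ⟨fun i x => f i x / ∑ᶠ j, f j x, fun i => (hf i).div₀ hF fun x => (hpos x).ne', ?_, ?_⟩
  · intro x
    obtain ⟨t, ht, hfin⟩ := hWf x
    refine ⟨hfin.toFinset, ?_⟩
    filter_upwards [ht] with z hz
    have h0 : ∀ i ∉ hfin.toFinset, f i z = 0 := fun i hi => hfz i z fun hzi =>
      hi (hfin.mem_toFinset.2 ⟨z, hzi, hz⟩)
    refine ⟨fun i hi => by rw [h0 i hi, zero_div], ?_⟩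
    rw [← Finset.sum_div, ← finsum_eq_sum_of_support_subset _ fun i hi =>
      not_imp_comm.1 (h0 i) hi]
    exact div_self (hpos z).ne'
  · intro i x
    by_cases hx : x ∈ tsupport (f i)
    · exact Or.inr (mem_of_superset ((isOpen_interior.mem_nhds (hWU i (hfW i hx))))
        (interior_subset.trans Set.inter_subset_right))
    · left
      filter_upwards [(isClosed_tsupport _).isOpen_compl.mem_nhds hx] with z hz
      rw [image_eq_zero_of_notMem_tsupport hz, zero_div]

end Partitions

/-! ### Sheaves of forms are fine -/

section Fine

variable {n : ℕ} {G : SmoothEtaleGroupoid.{u} n}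

lemma SmoothForm.smul {l : ℕ} {u : G.Obj → ℝ} {η : G.Obj → Alt n l} {x : G.Obj}
    (hu : ∀ᶠ y in 𝓝 x, ContMDiffAt (𝓡 n) 𝓘(ℝ, ℝ) ∞ u y) (hη : SmoothForm η x) :
    SmoothForm (fun y => u y • η y) x := by
  have hx : x ∈ (chart n x).source := mem_extChartAt_source x
  filter_upwards [chart_target_mem (n := n) hx, (tendsto_chart_symm (n := n) hx).eventually hu, hη]
    with y hy h1 h2
  exact (ContMDiffAt.comp (I' := 𝓡 n) y h1 (chart_symm_smooth hy)).contDiffAt.smul h2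

/-- A function on an étale space is smooth. -/
def EtaleSmooth {Z : EtaleSpace G.Obj} (ρ : Z.carrier → ℝ) : Prop :=
  ∀ z, ∀ᶠ y in 𝓝 (Z.proj z), ContMDiffAt (𝓡 n) 𝓘(ℝ, ℝ) ∞ (ρ ∘ Z.loc z) y

/-- A value of the sheaf of forms, as an alternating form. -/
abbrev toAlt {l : ℕ} (a : (forms G l).A) : Alt n l := a

/-- Multiplication of form-valued functions by a function. -/
def smulFun (l : ℕ) {Z : EtaleSpace G.Obj} (ρ : Z.carrier → ℝ) :
    (Z.carrier → (forms G l).A) →+ (Z.carrier → (forms G l).A) :=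
  AddMonoidHom.mk' (fun f w => (ρ w • toAlt (f w) : Alt n l))
    fun _ _ => funext fun w => smul_add (ρ w) _ _

lemma Coeff.SecAt.smul {l : ℕ} {Z : EtaleSpace G.Obj} {ρ : Z.carrier → ℝ} (hρ : EtaleSmooth ρ)
    {f : Z.carrier → (forms G l).A} {z : Z.carrier} (h : (forms G l).SecAt Z f z) :
    (forms G l).SecAt Z (smulFun l ρ f) z := by
  obtain ⟨η, h1, h2⟩ := h
  refine ⟨fun y => ρ (Z.loc z y) • toAlt (η y), SmoothForm.smul (hρ z) h1, ?_⟩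
  filter_upwards [h2, Z.eventually_loc z] with w hw hw'
  change ρ w • toAlt (f w) = ρ (Z.loc z (Z.proj w)) • toAlt (η (Z.proj w))
  rw [hw', hw]
  rfl

/-- Multiplication of forms by a smooth function. -/
def smulForms (l : ℕ) {Z : EtaleSpace G.Obj} {ρ : Z.carrier → ℝ} (hρ : EtaleSmooth ρ) :
    GermSheaf.Hom (cg (forms G l) Z) (cg (forms G l) Z) :=
  GermSheaf.ofLocalMap continuous_id (smulFun l ρ) (fun _ _ h => Coeff.SecAt.smul hρ h)
    fun _ f _ h => Filter.Eventually.mono (p := fun w => f w = 0) h fun w hw =>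
      (congrArg (fun a : Alt n l => ρ w • a) hw).trans (smul_zero (A := Alt n l) (ρ w))

lemma smulForms_cgMk (l : ℕ) {Z : EtaleSpace G.Obj} {ρ : Z.carrier → ℝ} (hρ : EtaleSmooth ρ)
    (z : Z.carrier) (f : secAtSub (forms G l) Z z) : (smulForms l hρ).app z (cgMk z f) =
      cgMk z ⟨smulFun l ρ f.1, Coeff.SecAt.smul hρ f.2⟩ := rfl

/-- Multiplication by the functions of a smooth partition of unity on `M`, pulled back along `e`.
The hypothesis `he` says that `e` is smooth for the smooth structure which `Z` inherits from the
objects. -/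
lemma fine_forms (l : ℕ) {Z : EtaleSpace G.Obj} {M : Type u} [TopologicalSpace M]
    [ChartedSpace (Model n) M] [IsManifold (𝓡 n) ∞ M] [T2Space M] [ParacompactSpace M]
    (e : Z.carrier ≃ₜ M)
    (he : ∀ z, ∀ᶠ y in 𝓝 (Z.proj z), ContMDiffAt (𝓡 n) (𝓡 n) ∞ (fun y => e (Z.loc z y)) y) :
    (cg (forms G l) Z).Fine := by
  intro U hU
  obtain ⟨ρ, h1, h2, h3⟩ := exists_smooth_partition (n := n)
    (fun m => e.symm ⁻¹' U (e.symm m)) fun m => e.symm.continuous.continuousAt (hU _)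
  have hρ : ∀ i, EtaleSmooth fun z : Z.carrier => ρ i (e z) := fun i z => by
    filter_upwards [he z] with y hy
    exact ContMDiffAt.comp (I' := 𝓡 n) (g := ρ i) y (h1 i).contMDiffAt hy
  refine ⟨M, e.symm, fun i => smulForms l (hρ i), fun x => ?_, fun i x => ?_⟩
  · obtain ⟨S, hS⟩ := h2 (e x)
    refine ⟨S, ?_⟩
    filter_upwards [(e.continuous.continuousAt.eventually hS).eventually_nhds] with z hz
    constructor
    · intro i hi a
      obtain ⟨f, rfl⟩ := cgMk_surjective z a
      rw [smulForms_cgMk, cgMk_eq_zero_iff]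
      filter_upwards [hz] with w hw
      exact (congrArg (fun r : ℝ => r • toAlt (f.1 w))
          (hw.1 i hi)).trans (zero_smul ℝ (toAlt (f.1 w)))
    · intro a
      obtain ⟨f, rfl⟩ := cgMk_surjective z a
      simp only [smulForms_cgMk]
      rw [← map_sum, cgMk_eq_iff]
      filter_upwards [hz] with w hw
      rw [AddSubgroup.val_finsetSum, Finset.sum_apply]
      exact (Finset.sum_smul (x := toAlt (f.1 w))).symm.trans
        ((congrArg (fun r : ℝ => r • toAlt (f.1 w)) hw.2).trans (one_smul _ _))
  · rcases h3 i (e x) with h | h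
    · left
      filter_upwards [(e.continuous.continuousAt.eventually h).eventually_nhds] with z hz a
      obtain ⟨f, rfl⟩ := cgMk_surjective z a
      rw [smulForms_cgMk, cgMk_eq_zero_iff]
      filter_upwards [hz] with w hw
      exact (congrArg (fun r : ℝ => r • toAlt (f.1 w)) hw).trans (zero_smul ℝ (toAlt (f.1 w)))
    · right
      filter_upwards [e.continuous.continuousAt h] with w hw
      simpa using hw

/-- The space `G_1` is the space of arrows. -/
def nerveOneHomeo (G : SmoothEtaleGroupoid.{u} n) : (G.nerve 1).carrier ≃ₜ G.Arr where
  toFun z := z.1.2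
  invFun g := ⟨(G.src g, g), rfl⟩
  left_inv z := Subtype.ext (Prod.ext z.2.symm rfl)
  right_inv _ := rfl
  continuous_toFun := continuous_snd.comp continuous_subtype_val
  continuous_invFun := (G.src_etale.contMDiff.continuous.prodMk continuous_id).subtype_mk _

lemma fine_forms_zero (hG : G.IsLeray) (l : ℕ) : (cg (forms G l) (G.nerve 0)).Fine := by
  have := hG.t2_obj
  have := hG.paracompact_obj
  refine fine_forms l (M := G.Obj) (Homeomorph.refl G.Obj) fun z => ?_
  filter_upwards [((G.nerve 0).proj_loc z).eventually_nhds] with y hy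
  exact contMDiffAt_id.congr_of_eventuallyEq hy

lemma fine_forms_arrows (hG : G.IsLeray) (l : ℕ) : (cg (forms G l) G.arrows).Fine := by
  have := hG.t2_arr
  have := hG.paracompact_arr
  exact fine_forms l (M := G.Arr) (Homeomorph.refl G.Arr) fun z => G.smooth_loc z

lemma fine_forms_one (hG : G.IsLeray) (l : ℕ) : (cg (forms G l) (G.nerve 1)).Fine := by
  have := hG.t2_arr
  have := hG.paracompact_arr
  refine fine_forms l (M := G.Arr) (nerveOneHomeo G) fun z => ?_
  have h1 : Tendsto (fun y => nerveOneHomeo G ((G.nerve 1).loc z y)) (𝓝 ((G.nerve 1).proj z))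
      (𝓝 z.1.2) := ((nerveOneHomeo G).continuous.tendsto z).comp ((G.nerve 1).tendsto_loc z)
  have h2 : (fun y => nerveOneHomeo G ((G.nerve 1).loc z y)) =ᶠ[𝓝 ((G.nerve 1).proj z)]
      G.arrLoc z.1.2 := by
    filter_upwards [h1.eventually (G.eventually_arrLoc z.1.2), (G.nerve 1).proj_loc z] with y h3 h4
    exact h3.symm.trans (congrArg (G.arrLoc z.1.2) h4)
  filter_upwards [h2.eventuallyEq_nhds, G.smooth_loc z.1.2] with y h3 h4
  exact h4.congr_of_eventuallyEq h3

end Fine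
end EtaleGerbe
end

noncomputable section
open CategoryTheory Filter Topology
open scoped Manifold ContDiff
namespace EtaleGerbe
open SmoothEtaleGroupoid

/-! ### Consequences of the vanishing of the first cohomology -/

section Primitives

variable {n : ℕ} {G : SmoothEtaleGroupoid.{u} n} {F F' : Coeff G} {Z : EtaleSpace G.Obj}

lemma Coeff.SecAt.map (L : CoeffHom F F') {f : Z.carrier → F.A} {z : Z.carrier}
    (h : F.SecAt Z f z) : F'.SecAt Z (L.app Z f) z := by
  obtain ⟨η, h1, h2⟩ := h
  exact ⟨L.op η, L.isSec h1, L.app_eventuallyEq Z h2⟩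

lemma CoeffHom.app_add (L : CoeffHom F F') {f g : Z.carrier → F.A} {z : Z.carrier}
    (hf : F.SecAt Z f z) (hg : F.SecAt Z g z) :
    L.app Z (f + g) z = L.app Z f z + L.app Z g z := by
  obtain ⟨η, h1, h2⟩ := hf
  obtain ⟨θ, h3, h4⟩ := hg
  have h5 : f + g =ᶠ[𝓝 z] (η + θ) ∘ Z.proj := h2.add h4
  rw [L.app_eq Z h5, L.app_eq Z h2, L.app_eq Z h4, L.add h1 h3]

lemma CoeffHom.app_congr (L : CoeffHom F F') {f g : Z.carrier → F.A} {z : Z.carrier}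
    (h : f =ᶠ[𝓝 z] g) : L.app Z f z = L.app Z g z :=
  L.congr ((Z.tendsto_loc z).eventually h)

lemma CoeffHom.app_zero (L : CoeffHom F F') (z : Z.carrier) : L.app Z 0 z = 0 := by
  have h : F.SecAt Z 0 z := ⟨0, F.zero _, Eventually.of_forall fun _ => rfl⟩
  have := L.app_add h h
  rwa [add_zero, left_eq_add] at this

lemma CoeffHom.app_neg (L : CoeffHom F F') {f : Z.carrier → F.A} {z : Z.carrier}
    (hf : F.SecAt Z f z) : L.app Z (-f) z = -L.app Z f z := by
  have := L.app_add hf hf.neg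
  rw [add_neg_cancel, L.app_zero] at this
  exact (neg_eq_of_add_eq_zero_right this.symm).symm

/-- The map of sheaves of germs given by a local operator. -/
def CoeffHom.toCg (L : CoeffHom F F') (Z : EtaleSpace G.Obj) : GermSheaf.Hom (cg F Z) (cg F' Z) :=
  GermSheaf.ofLocalHom continuous_id
    (fun z => AddMonoidHom.mk' (fun f => cgMk z ⟨L.app Z f.1, f.2.map L⟩) fun f g => by
      rw [← map_add]
      refine (cgMk_eq_iff _ _).2 ?_
      filter_upwards [f.2.eventually, g.2.eventually] with w h1 h2
      exact L.app_add h1 h2)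
    (fun z f hf => (cgMk_eq_zero_iff _).2 (by
      filter_upwards [show ∀ᶠ w in 𝓝 z, ∀ᶠ w' in 𝓝 w, f.1 w' = 0 from
        Filter.Eventually.eventually_nhds hf] with w hw
      exact (L.app_congr hw).trans (L.app_zero w)))
    fun z f hf => by
      classical
      refine ⟨fun w => if h : F.SecAt Z f w then cgMk w ⟨L.app Z f, h.map L⟩ else 0,
        isSec_cg.2 ⟨L.app Z f, ?_⟩, ?_⟩
      · filter_upwards [Coeff.SecAt.eventually hf] with w hw
        exact ⟨hw.map L, dif_pos (c := F.SecAt Z f w) hw⟩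
      · filter_upwards with w hw
        exact Eq.symm (dif_pos (c := F.SecAt Z f w) hw)

lemma CoeffHom.toCg_cgMk (L : CoeffHom F F') (z : Z.carrier) (f : secAtSub F Z z) :
    (L.toCg Z).app z (cgMk z f) = cgMk z ⟨L.app Z f.1, f.2.map L⟩ := rfl

/-- If the first cohomology of `F` vanishes, local data which agree up to sections of `F` come from
a global function. -/
lemma exists_primitive (h : GermSheaf.Acyclic 0 (cg F Z)) (f : Z.carrier → Z.carrier → F.A)
    (hf : ∀ z, ∀ᶠ w in 𝓝 z, F.SecAt Z (f w - f z) w) :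
    ∃ g : Z.carrier → F.A, ∀ z, F.SecAt Z (g - f z) z := by
  -- All functions are allowed as local elements. Modulo functions vanishing nearby they form the
  -- sheaf of all germs of functions; modulo local sections of `F`, the quotient sheaf in which the
  -- data `f` define a global section.
  let T : Z.carrier → AddSubgroup (Z.carrier → F.A) := fun _ => ⊤
  have hT : ∀ z, ∀ s ∈ T z, ∀ᶠ w in 𝓝 z, s ∈ T w := fun _ _ _ =>
    Eventually.of_forall fun _ => AddSubgroup.mem_top _
  have hP : ∀ z, ∀ s ∈ secAtSub F Z z, ∀ᶠ w in 𝓝 z, s ∈ secAtSub F Z w :=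
    fun _ _ h => Coeff.SecAt.eventually h
  have hN : ∀ z, ∀ s ∈ nullAt F Z z, ∀ᶠ w in 𝓝 z, s ∈ nullAt F Z w :=
    fun _ _ h => Filter.Eventually.eventually_nhds h
  let i : GermSheaf.Hom (cg F Z) (GermSheaf.ofLocal T (nullAt F Z) hT hN) :=
    GermSheaf.ofLocalMap continuous_id (AddMonoidHom.id _) (fun _ _ _ => AddSubgroup.mem_top _)
      fun _ _ _ h => h
  let p : GermSheaf.Hom (GermSheaf.ofLocal T (nullAt F Z) hT hN)
      (GermSheaf.ofLocal T (secAtSub F Z) hT hP) :=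
    GermSheaf.ofLocalMap continuous_id (AddMonoidHom.id _) (fun _ _ _ => AddSubgroup.mem_top _)
      fun z s _ h => ⟨0, F.zero _, h⟩
  have hS : GermSheaf.SES i p :=
    { inj := fun z => by
        rw [injective_iff_map_eq_zero]
        intro a ha
        obtain ⟨s, rfl⟩ := cgMk_surjective z a
        exact (cgMk_eq_zero_iff s).2 ((GermSheaf.germ_eq_zero_iff (hP := hT) (hN := hN) _).1 ha)
      zero := fun z a => by
        obtain ⟨s, rfl⟩ := cgMk_surjective z a
        exact (GermSheaf.germ_eq_zero_iff (hP := hT) (hN := hP) _).2 s.2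
      exact := fun z a ha => by
        obtain ⟨s, rfl⟩ := GermSheaf.germ_surjective (hP := hT) (hN := hN) z a
        exact ⟨cgMk z ⟨s.1, (GermSheaf.germ_eq_zero_iff (hP := hT) (hN := hP) _).1 ha⟩, rfl⟩
      surj := fun z a => by
        obtain ⟨s, rfl⟩ := GermSheaf.germ_surjective (hP := hT) (hN := hP) z a
        exact ⟨GermSheaf.germ T (nullAt F Z) hT hN z s, rfl⟩ }
  obtain ⟨e, he, hpe⟩ := hS.lift h
    (r := fun z => GermSheaf.germ T (secAtSub F Z) hT hP z ⟨f z, AddSubgroup.mem_top _⟩) fun z => by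
      refine GermSheaf.isSec_ofLocal.2 ⟨f z, ?_⟩
      filter_upwards [hf z] with w hw
      exact ⟨AddSubgroup.mem_top _, (GermSheaf.germ_eq_iff _ _).2 hw⟩
  choose s hs using fun z => GermSheaf.germ_surjective (hP := hT) (hN := hN) z (e z)
  have key : ∀ z, ∀ᶠ w in 𝓝 z, (s w).1 w = (s z).1 w := by
    intro z
    obtain ⟨t, ht⟩ := GermSheaf.isSec_ofLocal.1 (he z)
    have h1 : ∀ᶠ w in 𝓝 z, t w = (s w).1 w := by
      filter_upwards [ht] with w ⟨hw, e'⟩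
      have : ∀ᶠ w' in 𝓝 w, (t - (s w).1) w' = 0 :=
        (GermSheaf.germ_eq_iff _ _).1 (e'.symm.trans (hs w).symm)
      exact sub_eq_zero.1 this.self_of_nhds
    obtain ⟨h2, e2⟩ := ht.self_of_nhds
    have h3 : ∀ᶠ w in 𝓝 z, (t - (s z).1) w = 0 :=
      (GermSheaf.germ_eq_iff _ _).1 (e2.symm.trans (hs z).symm)
    filter_upwards [h1, h3] with w h4 h5
    exact h4.symm.trans (sub_eq_zero.1 h5)
  refine ⟨fun w => (s w).1 w, fun z => ?_⟩
  have h1 : F.SecAt Z ((s z).1 - f z) z := by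
    refine (GermSheaf.germ_eq_iff (hP := hT) (hN := hP) (s z) ⟨f z, AddSubgroup.mem_top _⟩).1 ?_
    exact (congrArg (p.app z) (hs z)).trans (hpe z)
  refine Coeff.SecAt.congr ?_ h1
  filter_upwards [key z] with w hw
  rw [Pi.sub_apply, Pi.sub_apply, hw]

end Primitives

/-! ### The exponential -/

section Exp

variable {n : ℕ} (G : SmoothEtaleGroupoid.{u} n)

/-- The value of a `0`-form. -/
def val₀ (η : G.Obj → Alt n 0) (x : G.Obj) : ℂ := η x 0

lemma zeroForm_val₀ (η : G.Obj → Alt n 0) : zeroForm (val₀ G η) = η := by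
  funext x
  ext v
  exact congrArg (η x) (Subsingleton.elim _ _)

lemma smooth_val₀ {η : G.Obj → Alt n 0} {x : G.Obj} (h : SmoothForm η x) :
    ∀ᶠ y in 𝓝 x, ContMDiffAt (𝓡 n) 𝓘(ℝ, ℂ) ∞ (val₀ G η) y := by
  have hx : x ∈ (chart n x).source := mem_extChartAt_source x
  filter_upwards [(chart_smooth (n := n) hx).continuousAt.eventually h,
    Filter.Eventually.eventually_nhds (show ∀ᶠ y in 𝓝 x, y ∈ (chart n x).source from
      chart_source_mem hx)] with y h1 h2
  have h3 : ContDiffAt ℝ ∞ (fun w => rep η x w 0) (chart n x y) :=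
    (ContinuousAlternatingMap.constOfIsEmptyLIE ℝ (Model n) ℂ
      (Fin 0)).symm.toContinuousLinearEquiv.toContinuousLinearMap.contDiff.contDiffAt.comp _ h1
  refine (ContMDiffAt.comp (I' := 𝓘(ℝ, Model n)) y h3.contMDiffAt
    (chart_smooth h2.self_of_nhds)).congr_of_eventuallyEq ?_
  filter_upwards [h2] with z hz
  change η z 0 = (η ((chart n x).symm (chart n x z))).compContinuousLinearMap _ 0
  rw [(chart n x).left_inv hz]
  exact congrArg (η z) (Subsingleton.elim _ _)

/-- The constant `(2πi)²`. -/
def twoPiISq : ℂ := (2 * Real.pi * Complex.I) ^ 2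

lemma twoPiISq_ne_zero : twoPiISq ≠ 0 := pow_ne_zero _ Complex.two_pi_I_ne_zero

/-- The exponential of a complex number, scaled by `(2πi)⁻²`. -/
def expUnit (a : ℂ) : Additive ℂˣ :=
  Additive.ofMul (Units.mk0 (Complex.exp (twoPiISq⁻¹ * a)) (Complex.exp_ne_zero _))

lemma expUnit_add (a b : ℂ) : expUnit (a + b) = expUnit a + expUnit b := by
  refine congrArg Additive.ofMul (Units.ext ?_)
  change Complex.exp (twoPiISq⁻¹ * (a + b)) = Complex.exp _ * Complex.exp _
  rw [mul_add, Complex.exp_add]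

lemma expUnit_eq_iff {a : ℂ} {b : Additive ℂˣ} :
    expUnit a = b ↔ Complex.exp (twoPiISq⁻¹ * a) = (b.toMul : ℂ) :=
  ⟨fun h => congrArg (fun c : Additive ℂˣ => (c.toMul : ℂ)) h,
    fun h => Additive.toMul.injective (Units.ext h)⟩

/-- The exponential map `𝓐⁰ → ℂˣ`, `x ↦ exp((2πi)⁻² x)`. -/
def expHom : CoeffHom (forms G 0) (units G) where
  op η x := expUnit (val₀ G η x)
  congr h := congrArg (fun a : Alt n 0 => expUnit (a 0)) h.self_of_nhds
  isSec {η x} h := by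
    filter_upwards [smooth_val₀ G h] with y hy
    have h1 : ContDiff ℝ ∞ fun a : ℂ => Complex.exp (twoPiISq⁻¹ * a) :=
      (contDiff_const.mul contDiff_id).cexp
    exact h1.contMDiff.contMDiffAt.comp y hy
  add _ _ := expUnit_add _ _
  act {η} g _ := by
    refine congrArg expUnit ?_
    change (toAlt (η (G.germ g (G.tgt g)))).compContinuousLinearMap _ 0 = toAlt (η (G.src g)) 0
    rw [G.germ_tgt]
    exact congrArg (toAlt (η (G.src g))) (Subsingleton.elim _ _)

variable {G}

lemma expHom_app (Z : EtaleSpace G.Obj) (f : Z.carrier → (forms G 0).A) (z : Z.carrier) :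
    (expHom G).app Z f z = expUnit (toAlt (f z) 0) :=
  congrArg (fun w => expUnit (toAlt (f w) 0)) (Z.loc_proj z)

/-- The values of `v` near `x` lie in the kernel `(2πi)³ℤ` of the scaled exponential. This subgroup
is discrete, with minimal distance `|(2πi)³|`, so continuity forces `v` to be constant nearby. -/
lemma eventually_const_of_exp {v : G.Obj → ℂ} {x : G.Obj} (hv : ContinuousAt v x)
    (h : ∀ᶠ y in 𝓝 x, expUnit (v y) = 0) : (constants G 3).IsSec v x := by
  have h1 : ∀ᶠ y in 𝓝 x, ∃ k : ℤ, v y = k * (2 * Real.pi * Complex.I) ^ 3 := by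
    filter_upwards [h] with y hy
    have h2 : Complex.exp (twoPiISq⁻¹ * v y) = 1 := expUnit_eq_iff.1 hy
    obtain ⟨k, hk⟩ := Complex.exp_eq_one_iff.1 h2
    refine ⟨k, ?_⟩
    rw [inv_mul_eq_iff_eq_mul₀ twoPiISq_ne_zero] at hk
    rw [hk, twoPiISq]
    ring
  have hc : ‖(2 * Real.pi * Complex.I) ^ 3‖ ≠ 0 :=
    norm_ne_zero_iff.2 (pow_ne_zero _ Complex.two_pi_I_ne_zero)
  obtain ⟨k, hk⟩ := h1.self_of_nhds
  refine ⟨v x, ⟨k, by simp [hk]⟩, ?_⟩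
  filter_upwards [h1, Metric.continuousAt_iff'.1 hv _ (lt_of_le_of_ne (norm_nonneg _) hc.symm)]
    with y ⟨j, hj⟩ hd
  rw [dist_eq_norm, hj, hk, ← sub_mul, norm_mul, mul_lt_iff_lt_one_left
    (lt_of_le_of_ne (norm_nonneg _) hc.symm), ← Int.cast_sub, Complex.norm_intCast] at hd
  have : j - k = 0 := Int.abs_lt_one_iff.1 (by exact_mod_cast hd)
  rw [hj, hk, sub_eq_zero.1 this]

lemma secAt_constants_of_exp {Z : EtaleSpace G.Obj} {f : Z.carrier → (forms G 0).A} {z : Z.carrier}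
    (hf : (forms G 0).SecAt Z f z) (h : ∀ᶠ w in 𝓝 z, (expHom G).app Z f w = 0) :
    (constants G 3).SecAt Z (fun w => toAlt (f w) 0) z := by
  obtain ⟨η, h1, h2⟩ := hf
  refine ⟨val₀ G η, eventually_const_of_exp
    (smooth_val₀ G h1).self_of_nhds.continuousAt ?_, ?_⟩
  · have h3 : ∀ᶠ w in 𝓝 z, expUnit (val₀ G η (Z.proj w)) = 0 := by
      filter_upwards [h, h2] with w h4 h5
      rw [expHom_app, h5] at h4
      exact h4
    filter_upwards [(Z.tendsto_loc z).eventually h3, Z.proj_loc z] with y h4 h5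
    rwa [h5] at h4
  · filter_upwards [h2] with w hw
    exact congrArg (fun a => toAlt a 0) hw

/-- Local logarithms. -/
lemma exists_log {u : G.Obj → Additive ℂˣ} {x : G.Obj} (h : (units G).IsSec u x) :
    ∃ η, (forms G 0).IsSec η x ∧ (expHom G).op η =ᶠ[𝓝 x] u := by
  have h0 : unitsVal u x ≠ 0 := Units.ne_zero _
  -- Dividing by the value at `x` moves the function close to `1`, where the principal logarithm is
  -- smooth; the logarithm of the value at `x` is added back as a constant.
  have hlim : ∀ᶠ y in 𝓝 x, unitsVal u y / unitsVal u x ∈ Complex.slitPlane := by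
    have hc : ContinuousAt (fun y => unitsVal u y / unitsVal u x) x :=
      h.self_of_nhds.continuousAt.div_const _
    refine hc.eventually (Complex.isOpen_slitPlane.mem_nhds ?_)
    change unitsVal u x / unitsVal u x ∈ _
    rw [div_self h0]
    exact Complex.one_mem_slitPlane
  let v : G.Obj → ℂ := fun y =>
    twoPiISq * (Complex.log (unitsVal u y / unitsVal u x) + Complex.log (unitsVal u x))
  refine ⟨zeroForm v, smoothForm_zeroForm G ?_, ?_⟩
  · filter_upwards [h, hlim] with y h1 h2
    have h3 : ContDiffAt ℝ ∞ (fun a : ℂ =>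
        twoPiISq * (Complex.log (a / unitsVal u x) + Complex.log (unitsVal u x))) (unitsVal u y) :=
      contDiffAt_const.mul (((Complex.contDiffAt_log h2).restrict_scalars ℝ |>.comp (unitsVal u y)
        (contDiffAt_id.div_const (unitsVal u x))).add contDiffAt_const)
    exact h3.contMDiffAt.comp y h1
  · filter_upwards with y
    refine expUnit_eq_iff.2 ?_
    change Complex.exp (twoPiISq⁻¹ * v y) = unitsVal u y
    have h1 : unitsVal u y ≠ 0 := Units.ne_zero _
    rw [inv_mul_cancel_left₀ twoPiISq_ne_zero, Complex.exp_add, Complex.exp_log (div_ne_zero h1 h0),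
      Complex.exp_log h0, div_mul_cancel₀ _ h0]

/-- A value of a constant sheaf, as a complex number. -/
abbrev toComplex {p : ℕ} (a : (constants G p).A) : ℂ := a

/-- The exponential sequence. The scaling by `(2πi)⁻²` is what makes the kernel `ℤ(3) = (2πi)³ℤ`
rather than `2πiℤ`. -/
lemma ses_exp (Z : EtaleSpace G.Obj) :
    GermSheaf.SES ((inclusion G 3).toCg Z) ((expHom G).toCg Z) where
  inj z := by
    rw [injective_iff_map_eq_zero]
    intro a ha
    obtain ⟨f, rfl⟩ := cgMk_surjective z a
    rw [CoeffHom.toCg_cgMk, cgMk_eq_zero_iff] at ha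
    rw [cgMk_eq_zero_iff]
    filter_upwards [ha] with w hw
    have h2 : toAlt (zeroForm (n := n) (fun y => f.1 (Z.loc w y)) (Z.proj w)) 0 = 0 :=
      congrArg (fun a => toAlt (G := G) a 0) hw
    change f.1 (Z.loc w (Z.proj w)) = 0 at h2
    rwa [Z.loc_proj] at h2
  zero z a := by
    obtain ⟨f, rfl⟩ := cgMk_surjective z a
    rw [CoeffHom.toCg_cgMk, CoeffHom.toCg_cgMk, cgMk_eq_zero_iff]
    filter_upwards [f.2.eventually] with w ⟨η, ⟨c, ⟨k, hk⟩, h1⟩, h2⟩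
    refine (expHom_app Z _ w).trans (expUnit_eq_iff.2 ?_)
    change Complex.exp (twoPiISq⁻¹ * toComplex (f.1 (Z.loc w (Z.proj w)))) = 1
    have h3 : toComplex (f.1 w) = c := h2.self_of_nhds.trans h1.self_of_nhds
    rw [Z.loc_proj, h3, ← hk, Complex.exp_eq_one_iff]
    refine ⟨k, ?_⟩
    rw [inv_mul_eq_iff_eq_mul₀ twoPiISq_ne_zero, twoPiISq]
    refine (zsmul_eq_mul _ k).trans ?_
    ring
  exact z a ha := by
    obtain ⟨f, rfl⟩ := cgMk_surjective z a
    rw [CoeffHom.toCg_cgMk, cgMk_eq_zero_iff] at ha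
    refine ⟨cgMk z ⟨_, secAt_constants_of_exp f.2 ha⟩, ?_⟩
    rw [CoeffHom.toCg_cgMk, cgMk_eq_iff]
    filter_upwards with w
    have h1 : toAlt (f.1 (Z.loc w (Z.proj w))) = f.1 w := congrArg f.1 (Z.loc_proj w)
    refine Eq.trans ?_ h1
    exact congrFun (zeroForm_val₀ G fun y => toAlt (f.1 (Z.loc w y))) (Z.proj w)
  surj z a := by
    obtain ⟨⟨f, u, h1, h2⟩, rfl⟩ := cgMk_surjective z a
    obtain ⟨η, h3, h4⟩ := exists_log h1
    refine ⟨cgMk z ⟨η ∘ Z.proj, η, h3, Eventually.of_forall fun _ => rfl⟩, ?_⟩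
    rw [CoeffHom.toCg_cgMk, cgMk_eq_iff]
    filter_upwards [h2, (Z.tendsto_proj z).eventually h4] with w h5 h6
    exact (expHom_app Z _ w).trans (h6.trans h5.symm)

/-- Global logarithms. -/
lemma exists_global_log {Z : EtaleSpace G.Obj} (hZ : GermSheaf.Acyclic 0 (cg (constants G 3) Z))
    (c : (units G).sections Z) : ∃ y : (forms G 0).sections Z, (expHom G).map Z y = c := by
  obtain ⟨e, he, h⟩ := (ses_exp Z).lift hZ (isSec_cgMk c)
  obtain ⟨y, hy⟩ := exists_cg_sections he
  refine ⟨y, Subtype.ext (funext fun z => ?_)⟩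
  have h1 := h z
  rw [hy z, CoeffHom.toCg_cgMk, cgMk_eq_iff] at h1
  exact h1.self_of_nhds

lemma exists_constants_of_exp {Z : EtaleSpace G.Obj} {y : (forms G 0).sections Z}
    (h : (expHom G).map Z y = 0) : ∃ x, (inclusion G 3).map Z x = y := by
  refine ⟨⟨_, fun z => secAt_constants_of_exp (y.2 z)
    (Eventually.of_forall fun w => congrArg (fun c => c.1 w) h)⟩, Subtype.ext (funext fun z => ?_)⟩
  have h1 : toAlt (y.1 (Z.loc z (Z.proj z))) = y.1 z := congrArg y.1 (Z.loc_proj z)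
  refine Eq.trans ?_ h1
  exact congrFun (zeroForm_val₀ G fun w => toAlt (y.1 (Z.loc z w))) (Z.proj z)

lemma expHom_map_inclusion {Z : EtaleSpace G.Obj} (x : (constants G 3).sections Z) :
    (expHom G).map Z ((inclusion G 3).map Z x) = 0 := by
  refine Subtype.ext (funext fun z => ?_)
  have := (ses_exp Z).zero z (cgMk z ⟨x.1, x.2 z⟩)
  rw [CoeffHom.toCg_cgMk, CoeffHom.toCg_cgMk, cgMk_eq_zero_iff] at this
  exact this.self_of_nhds

lemma inclusion_map_injective (Z : EtaleSpace G.Obj) :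
    Function.Injective ((inclusion G 3).map Z) := by
  rw [injective_iff_map_eq_zero]
  intro x hx
  refine Subtype.ext (funext fun z => ?_)
  have h1 := (injective_iff_map_eq_zero _).1 ((ses_exp Z).inj z) (cgMk z ⟨x.1, x.2 z⟩) (by
    rw [CoeffHom.toCg_cgMk, cgMk_eq_zero_iff]
    exact Eventually.of_forall fun w => congrArg (fun c => c.1 w) hx)
  exact ((cgMk_eq_zero_iff _).1 h1).self_of_nhds

lemma dlogForm_exp {η : G.Obj → Alt n 0} {x : G.Obj} (h : SmoothForm η x) :
    dlogForm (n := n) ((expHom G).op η) x = twoPiISq⁻¹ • extD η x := by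
  have hv := smooth_val₀ G h
  have hx : (chart n x).symm (chart n x x) = x := (chart n x).left_inv (mem_extChartAt_source x)
  conv_rhs => rw [← zeroForm_val₀ G η]
  unfold dlogForm
  rw [extD_zeroForm, extD_zeroForm]
  have h1 := (smooth_comp_chart_symm G hv).self_of_nhds.differentiableAt (by simp)
  have h2 := ((h1.hasFDerivAt.const_mul twoPiISq⁻¹).cexp).fderiv
  have h3 : (unitsVal ((expHom G).op η) ∘ (chart n x).symm) = fun w =>
    Complex.exp (twoPiISq⁻¹ * (val₀ G η ∘ (chart n x).symm) w) := rfl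
  rw [h3, h2]
  have h4 : unitsVal ((expHom G).op η) x =
    Complex.exp (twoPiISq⁻¹ * (val₀ G η ∘ (chart n x).symm) (chart n x x)) := by
    rw [Function.comp_apply, hx]; rfl
  rw [h4]
  have h5 : Complex.exp (twoPiISq⁻¹ * (val₀ G η ∘ (chart n x).symm) (chart n x x)) ≠ 0 :=
    Complex.exp_ne_zero _
  ext v
  change (Complex.exp _)⁻¹ * (Complex.exp _ * (twoPiISq⁻¹ * _)) = twoPiISq⁻¹ * _
  rw [inv_mul_cancel_left₀ h5]
  rfl

end Exp
end EtaleGerbe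
end

noncomputable section
open CategoryTheory Filter Topology
open scoped Manifold ContDiff
namespace EtaleGerbe
open SmoothEtaleGroupoid

/-! ### Zigzags in the double complexes of sections over the nerve -/

section Zigzag

variable {n : ℕ} {G : SmoothEtaleGroupoid.{u} n}

/-- The sections over `G_k` of the term of degree `i` of a complex of sheaves. -/
abbrev NerveSec (K : CochainComplex (GSheaf G) ℕ) (i k : ℕ) : Type u :=
  etaleSections (K.X i) (G.nerve k)

/-- The vertical differential. -/
def vd (K : CochainComplex (GSheaf G) ℕ) (i : ℕ) {k : ℕ} : NerveSec K i k →+ NerveSec K (i + 1) k :=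
  etaleMap (K.d i (i + 1)) (G.nerve k)

/-- The horizontal differential. -/
def hd (K : CochainComplex (GSheaf G) ℕ) {i : ℕ} (k : ℕ) : NerveSec K i k →+ NerveSec K i (k + 1) :=
  etaleDelta (K.X i) k

/-- The map of double complexes given by a map of complexes. -/
def nerveSecMap {K T : CochainComplex (GSheaf G) ℕ} (η : K ⟶ T) {i k : ℕ} :
    NerveSec K i k →+ NerveSec T i k := etaleMap (η.f i) (G.nerve k)

lemma etaleMap_comp {F F' F'' : GSheaf G} (φ : F ⟶ F') (ψ : F' ⟶ F'') {Z : EtaleSpace G.Obj}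
    (c : etaleSections F Z) : etaleMap ψ Z (etaleMap φ Z c) = etaleMap (φ ≫ ψ) Z c :=
  Subtype.ext (funext fun U => funext fun _ => (homOn_comp φ ψ U _).symm)

lemma etaleMap_zero {F F' : GSheaf G} {Z : EtaleSpace G.Obj} (c : etaleSections F Z) :
    etaleMap (0 : F ⟶ F') Z c = 0 :=
  Subtype.ext (funext fun U => funext fun _ => homOn_zero U _)

variable (K : CochainComplex (GSheaf G) ℕ) {i k : ℕ}

lemma vd_vd (c : NerveSec K i k) : vd K (i + 1) (vd K i c) = 0 := by
  refine (etaleMap_comp _ _ c).trans ?_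
  rw [K.d_comp_d]
  exact etaleMap_zero c

lemma hd_hd (c : NerveSec K i k) : hd K (k + 1) (hd K k c) = 0 := etaleDelta_etaleDelta _ k c

lemma hd_vd (c : NerveSec K i k) : hd K k (vd K i c) = vd K i (hd K k c) :=
  etaleDelta_etaleMap _ k c

variable {K} {T : CochainComplex (GSheaf G) ℕ} (η : K ⟶ T)

lemma nerveSecMap_vd (c : NerveSec K i k) :
    nerveSecMap η (vd K i c) = vd T i (nerveSecMap η c) :=
  (etaleMap_comp _ _ c).trans
    ((congrArg (fun φ => etaleMap φ _ c) (η.comm i (i + 1)).symm).trans (etaleMap_comp _ _ c).symm)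

lemma nerveSecMap_hd (c : NerveSec K i k) :
    nerveSecMap η (hd K k c) = hd T k (nerveSecMap η c) := (etaleDelta_etaleMap _ k c).symm

/-- The image of a cochain of total degree `3` and the section `t` differ by a coboundary. -/
def Linked (x₃ : NerveSec K 0 3) (x₂ : NerveSec K 1 2) (x₁ : NerveSec K 2 1) (x₀ : NerveSec K 3 0)
    (b₀ : NerveSec T 2 0) (b₁ : NerveSec T 1 1) (b₂ : NerveSec T 0 2) (t : NerveSec T 3 0) : Prop :=
  nerveSecMap η x₀ - t = vd T 2 b₀ ∧ nerveSecMap η x₁ - vd T 1 b₁ = hd T 0 b₀ ∧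
    nerveSecMap η x₂ - vd T 0 b₂ = hd T 1 b₁ ∧ nerveSecMap η x₃ = hd T 2 b₂

variable {η}

section Injective

variable (hT : ∀ i, Injective (T.X i))

include hT in
lemma exists_hd_eq (c : NerveSec T i (k + 1)) (hc : hd T (k + 1) c = 0) : ∃ b, hd T k b = c :=
  have := hT i
  exists_etaleDelta_eq (T.X i) k c hc

-- Exactness over the nerve pushes a cocycle of `K` towards `G_0`. Its component over `G_3` has a
-- primitive `b₂`; subtracting the differential of `b₂` makes the component over `G_2` a cocycle for
-- `δ`, and so on. What remains over `G_0` is closed and killed by `δ`.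
include hT in
lemma exists_linked {x₃ : NerveSec K 0 3} {x₂ : NerveSec K 1 2} {x₁ : NerveSec K 2 1}
    {x₀ : NerveSec K 3 0} (h₃ : hd K 3 x₃ = 0) (h₂ : vd K 0 x₃ = hd K 2 x₂)
    (h₁ : vd K 1 x₂ = hd K 1 x₁) (h₀ : vd K 2 x₁ = hd K 0 x₀) (h : vd K 3 x₀ = 0) :
    ∃ b₀ b₁ b₂ t, Linked η x₃ x₂ x₁ x₀ b₀ b₁ b₂ t ∧ hd T 0 t = 0 ∧ vd T 3 t = 0 := by
  obtain ⟨b₂, e₂⟩ := exists_hd_eq hT (nerveSecMap η x₃) (by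
    rw [← nerveSecMap_hd, h₃, map_zero])
  obtain ⟨b₁, e₁⟩ := exists_hd_eq hT (nerveSecMap η x₂ - vd T 0 b₂) (by
    rw [map_sub, ← nerveSecMap_hd, hd_vd, e₂, ← h₂, nerveSecMap_vd, sub_self])
  obtain ⟨b₀, e₀⟩ := exists_hd_eq hT (nerveSecMap η x₁ - vd T 1 b₁) (by
    rw [map_sub, ← nerveSecMap_hd, hd_vd, e₁, ← h₁, nerveSecMap_vd, map_sub, vd_vd, sub_zero,
      sub_self])
  refine ⟨b₀, b₁, b₂, nerveSecMap η x₀ - vd T 2 b₀, ⟨sub_sub_cancel _ _, e₀.symm, e₁.symm, e₂.symm⟩,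
    ?_, ?_⟩
  · rw [map_sub, ← nerveSecMap_hd, hd_vd, e₀, ← h₀, nerveSecMap_vd, map_sub, vd_vd, sub_zero,
      sub_self]
  · rw [map_sub, ← nerveSecMap_vd, h, map_zero, vd_vd, sub_zero]

-- The difference between `(b₂, b₁, b₀)` and the image of the primitive `(z₂, y₁, y₀)` has its total
-- differential concentrated over `G_0`. Exactness over the nerve moves this cochain, modulo
-- coboundaries, to a single section `s` over `G_0`.
include hT in
lemma exists_of_linked_coboundary {z₂ : NerveSec K 0 2} {y₁ : NerveSec K 1 1} {y₀ : NerveSec K 2 0}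
    {b₀ : NerveSec T 2 0} {b₁ : NerveSec T 1 1} {b₂ : NerveSec T 0 2} {t : NerveSec T 3 0}
    (h : Linked η (hd K 2 z₂) (hd K 1 y₁ + vd K 0 z₂) (hd K 0 y₀ + vd K 1 y₁) (vd K 2 y₀)
      b₀ b₁ b₂ t) : ∃ s : NerveSec T 2 0, hd T 0 s = 0 ∧ t = vd T 2 s := by
  obtain ⟨e₀, e₁, e₂, e₃⟩ := h
  obtain ⟨c₁, h₁⟩ := exists_hd_eq hT (b₂ - nerveSecMap η z₂) (by
    rw [map_sub, ← nerveSecMap_hd, ← e₃, sub_self])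
  obtain ⟨c₀, h₀⟩ := exists_hd_eq hT (b₁ - (nerveSecMap η y₁ - vd T 0 c₁)) (by
    rw [map_sub, map_sub, ← nerveSecMap_hd, hd_vd, h₁, ← e₂, map_add, map_sub, nerveSecMap_vd]
    abel)
  refine ⟨-(b₀ - (nerveSecMap η y₀ - vd T 1 c₀)), ?_, ?_⟩
  · rw [map_neg, map_sub, map_sub, ← nerveSecMap_hd, hd_vd, h₀, ← e₁, map_add, map_sub, map_sub,
      nerveSecMap_vd, vd_vd]
    abel
  · rw [map_neg, map_sub, map_sub, vd_vd, ← e₀, nerveSecMap_vd]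
    abel

-- The opposite chase, in the direction of the sheaf degree. Since `t` is closed and `K` contributes
-- nothing in degree `4`, it lifts to `x₀` up to a boundary; applying `δ` gives the data of the same
-- lifting problem over `G_1`, then over `G_2` and `G_3`. Each step lowers the sheaf degree by one,
-- so the required degree of acyclicity decreases, and the last step needs none.
include hT in
lemma exists_linked_of_cocycle (hη : QuasiIso η)
    (v₀ : ∀ i k, i + k = 2 → GermSheaf.Acyclic k (gs (K.X i) (G.nerve 0)))
    (v₁ : ∀ i k, i + k = 1 → GermSheaf.Acyclic k (gs (K.X i) (G.nerve 1)))
    (v₂ : ∀ i k, i + k = 0 → GermSheaf.Acyclic k (gs (K.X i) (G.nerve 2)))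
    {t : NerveSec T 3 0} (ht : hd T 0 t = 0) (ht' : vd T 3 t = 0)
    (hK : ∀ (x : NerveSec K 3 1), vd K 3 x = 0) :
    ∃ x₃ x₂ x₁ x₀ b₀ b₁ b₂, Linked η x₃ x₂ x₁ x₀ b₀ b₁ b₂ t ∧ vd K 0 x₃ = hd K 2 x₂ ∧
      vd K 1 x₂ = hd K 1 x₁ ∧ vd K 2 x₁ = hd K 0 x₀ := by
  obtain ⟨x₀, b₀, -, e₀⟩ := exists_etale_lift_succ (G.nerve 0) hη hT v₀ 0 t (map_zero _)
    ((map_zero _).trans ht'.symm)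
  obtain ⟨x₁, b₁, h₀, e₁⟩ := exists_etale_lift_succ (G.nerve 1) hη hT v₁ (hd K 0 x₀) (-hd T 0 b₀)
      (hK _) (by
    have h1 : hd T 0 t = hd T 0 (nerveSecMap η x₀) + hd T 0 (vd T 2 b₀) := by
      rw [← map_add]
      exact congrArg _ e₀
    rw [ht, ← nerveSecMap_hd, hd_vd] at h1
    exact (eq_neg_of_add_eq_zero_left h1.symm).trans (map_neg (vd T 2) _).symm)
  obtain ⟨x₂, b₂, h₁, e₂⟩ := exists_etale_lift_succ (G.nerve 2) hη hT v₂ (hd K 1 x₁) (-hd T 1 b₁)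
      (by
      change vd K 2 (hd K 1 x₁) = 0
      rw [← hd_vd]
      exact (congrArg _ h₀).trans (hd_hd K x₀)) (by
    have h1 : -hd T 1 (hd T 0 b₀) = hd T 1 (nerveSecMap η x₁) + hd T 1 (vd T 1 b₁) := by
      rw [← map_add, ← map_neg]
      exact congrArg _ e₁
    rw [hd_hd, neg_zero, ← nerveSecMap_hd, hd_vd] at h1
    exact (eq_neg_of_add_eq_zero_left h1.symm).trans (map_neg (vd T 1) _).symm)
  obtain ⟨x₃, h₂, e₃⟩ := exists_etale_lift_zero (G.nerve 3) hη (hd K 2 x₂) (-hd T 2 b₂) (by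
      change vd K 1 (hd K 2 x₂) = 0
      rw [← hd_vd]
      exact (congrArg _ h₁).trans (hd_hd K x₁)) (by
    have h1 : -hd T 2 (hd T 1 b₁) = hd T 2 (nerveSecMap η x₂) + hd T 2 (vd T 0 b₂) := by
      rw [← map_add, ← map_neg]
      exact congrArg _ e₂
    rw [hd_hd, neg_zero, ← nerveSecMap_hd, hd_vd] at h1
    exact (eq_neg_of_add_eq_zero_left h1.symm).trans (map_neg (vd T 0) _).symm)
  have e₀' : t = nerveSecMap η x₀ + vd T 2 b₀ := e₀
  have e₁' : -hd T 0 b₀ = nerveSecMap η x₁ + vd T 1 b₁ := e₁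
  have e₂' : -hd T 1 b₁ = nerveSecMap η x₂ + vd T 0 b₂ := e₂
  have e₃' : -hd T 2 b₂ = nerveSecMap η x₃ := e₃
  -- The liftings write sections of `T` as images plus differentials, while `Linked` has differences
  -- equal to differentials; hence the signs of all `b`.
  refine ⟨x₃, x₂, x₁, x₀, -b₀, -b₁, -b₂, ⟨?_, ?_, ?_, ?_⟩, h₂, h₁, h₀⟩
  · rw [e₀', map_neg]; abel
  · rw [map_neg, map_neg, e₁']; abel
  · rw [map_neg, map_neg, e₂']; abel
  · rw [map_neg, e₃']

-- If the class in `T` is trivial, absorb `s` into `b₀`. The equation over `G_0` then asks for a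
-- primitive of `x₀`, and each primitive found corrects the equation over the next space of the
-- nerve.
include hT in
lemma exists_coboundary_of_linked (hη : QuasiIso η)
    (v₀ : ∀ i k, i + k = 1 → GermSheaf.Acyclic k (gs (K.X i) (G.nerve 0)))
    (v₁ : ∀ i k, i + k = 0 → GermSheaf.Acyclic k (gs (K.X i) (G.nerve 1)))
    {x₃ : NerveSec K 0 3} {x₂ : NerveSec K 1 2} {x₁ : NerveSec K 2 1} {x₀ : NerveSec K 3 0}
    (k₁ : vd K 1 x₂ = hd K 1 x₁) (k₀ : vd K 2 x₁ = hd K 0 x₀) (k : vd K 3 x₀ = 0)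
    {b₀ : NerveSec T 2 0} {b₁ : NerveSec T 1 1} {b₂ : NerveSec T 0 2} {s : NerveSec T 2 0}
    (hs : hd T 0 s = 0) (h : Linked η x₃ x₂ x₁ x₀ b₀ b₁ b₂ (vd T 2 s)) :
    ∃ z₂ y₁ y₀, x₂ = hd K 1 y₁ + vd K 0 z₂ ∧ x₁ = hd K 0 y₀ + vd K 1 y₁ ∧ x₀ = vd K 2 y₀ := by
  obtain ⟨e₀, e₁, e₂, e₃⟩ := h
  obtain ⟨y₀, c₀, h₀, f₀⟩ := exists_etale_lift_succ (G.nerve 0) hη hT v₀ x₀ (b₀ + s) k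
    ((eq_add_of_sub_eq e₀).trans (map_add (vd T 2) _ _).symm)
  have h₀' : vd K 2 y₀ = x₀ := h₀
  have f₀' : b₀ + s = nerveSecMap η y₀ + vd T 1 c₀ := f₀
  have g₀ : hd T 0 b₀ = nerveSecMap η (hd K 0 y₀) + vd T 1 (hd T 0 c₀) := by
    rw [nerveSecMap_hd, ← hd_vd, ← map_add, ← f₀', map_add, hs, add_zero]
  obtain ⟨y₁, c₁, h₁, f₁⟩ := exists_etale_lift_succ (G.nerve 1) hη hT v₁ (x₁ - hd K 0 y₀) (b₁ +
      hd T 0 c₀) (by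
      change vd K 2 _ = 0
      rw [map_sub, ← hd_vd, h₀', k₀, sub_self]) (by
    change nerveSecMap η (x₁ - hd K 0 y₀) = vd T 1 (b₁ + hd T 0 c₀)
    rw [map_sub, map_add, sub_eq_iff_eq_add, add_assoc, add_comm (vd T 1 (hd T 0 c₀)), ← g₀, ← e₁]
    abel)
  have h₁' : vd K 1 y₁ = x₁ - hd K 0 y₀ := h₁
  have f₁' : b₁ + hd T 0 c₀ = nerveSecMap η y₁ + vd T 0 c₁ := f₁
  have g₁ : hd T 1 b₁ = nerveSecMap η (hd K 1 y₁) + vd T 0 (hd T 1 c₁) := by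
    rw [nerveSecMap_hd, ← hd_vd, ← map_add, ← f₁', map_add, hd_hd, add_zero]
  obtain ⟨z₂, h₂, -⟩ := exists_etale_lift_zero (G.nerve 2) hη (x₂ - hd K 1 y₁) (b₂ + hd T 1 c₁) (by
      change vd K 1 _ = 0
      rw [map_sub, ← hd_vd, h₁', k₁, map_sub, hd_hd, sub_zero, sub_self]) (by
    change nerveSecMap η (x₂ - hd K 1 y₁) = vd T 0 (b₂ + hd T 1 c₁)
    rw [map_sub, map_add, sub_eq_iff_eq_add, add_assoc, add_comm (vd T 0 (hd T 1 c₁)), ← g₁, ← e₂]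
    abel)
  have h₂' : vd K 0 z₂ = x₂ - hd K 1 y₁ := h₂
  exact ⟨z₂, y₁, y₀, by rw [h₂']; abel, by rw [h₁']; abel, h₀'.symm⟩

end Injective

lemma Linked.sub {x₃ x₃' : NerveSec K 0 3} {x₂ x₂' : NerveSec K 1 2} {x₁ x₁' : NerveSec K 2 1}
    {x₀ x₀' : NerveSec K 3 0} {b₀ b₀' : NerveSec T 2 0} {b₁ b₁' : NerveSec T 1 1}
    {b₂ b₂' : NerveSec T 0 2} {t t' : NerveSec T 3 0} (h : Linked η x₃ x₂ x₁ x₀ b₀ b₁ b₂ t)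
    (h' : Linked η x₃' x₂' x₁' x₀' b₀' b₁' b₂' t') :
    Linked η (x₃ - x₃') (x₂ - x₂') (x₁ - x₁') (x₀ - x₀') (b₀ - b₀') (b₁ - b₁') (b₂ - b₂')
      (t - t') := by
  obtain ⟨e₀, e₁, e₂, e₃⟩ := h
  obtain ⟨f₀, f₁, f₂, f₃⟩ := h'
  refine ⟨?_, ?_, ?_, ?_⟩
  · rw [map_sub, map_sub, ← e₀, ← f₀]; abel
  · rw [map_sub, map_sub, map_sub, ← e₁, ← f₁]; abel
  · rw [map_sub, map_sub, map_sub, ← e₂, ← f₂]; abel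
  · rw [map_sub, map_sub, ← e₃, ← f₃]

end Zigzag
end EtaleGerbe
end

noncomputable section
open CategoryTheory Filter Topology
open scoped Manifold ContDiff
namespace EtaleGerbe
open SmoothEtaleGroupoid

/-! ### Čech cocycles with coefficients in the Deligne complex -/

/-- An additive relation which is total in both directions and matches the two subgroups is the
graph of an isomorphism of quotients. Closure under differences gives additivity, and `h0` makes the
relation independent of the representative on the right. -/
lemma exists_quotient_equiv {A B : Type*} [AddCommGroup A] [AddCommGroup B] (A' : AddSubgroup A)
    (B' : AddSubgroup B) (r : A → B → Prop)
    (hsub : ∀ a a' b b', r a b → r a' b' → r (a - a') (b - b')) (htot : ∀ a, ∃ b, r a b)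
    (hsurj : ∀ b, ∃ a, r a b) (h0 : ∀ b ∈ B', r 0 b) (hr : ∀ a b, r a b → (a ∈ A' ↔ b ∈ B')) :
    ∃ Φ : A ⧸ A' ≃+ B ⧸ B', ∀ a b,
      Φ (QuotientAddGroup.mk a) = QuotientAddGroup.mk b ↔ r a b := by
  choose f hf using htot
  have key : ∀ a b b', r a b → r a b' → (QuotientAddGroup.mk b : B ⧸ B') = QuotientAddGroup.mk b' :=
    fun a b b' h h' => by
      rw [eq_comm, ← sub_eq_zero, ← QuotientAddGroup.mk_sub, QuotientAddGroup.eq_zero_iff]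
      refine (hr (a - a) _ (hsub _ _ _ _ h' h)).1 ?_
      rw [sub_self]
      exact A'.zero_mem
  have hneg : ∀ a b, r a b → r (-a) (-b) := fun a b h => by
    have := hsub _ _ _ _ (h0 0 B'.zero_mem) h
    rwa [zero_sub, zero_sub] at this
  have hadd : ∀ a a' b b', r a b → r a' b' → r (a + a') (b + b') := fun a a' b b' h h' => by
    have := hsub _ _ _ _ h (hneg _ _ h')
    rwa [sub_neg_eq_add, sub_neg_eq_add] at this
  let g : A →+ B ⧸ B' := AddMonoidHom.mk' (fun a => QuotientAddGroup.mk (f a)) fun a a' =>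
    key _ _ _ (hf _) (hadd _ _ _ _ (hf a) (hf a'))
  have hker : g.ker = A' := by
    ext a
    exact ⟨fun h => (hr a _ (hf a)).2 ((QuotientAddGroup.eq_zero_iff _).1 h),
      fun h => (QuotientAddGroup.eq_zero_iff _).2 ((hr a _ (hf a)).1 h)⟩
  have hg : Function.Surjective g := fun b => by
    obtain ⟨b, rfl⟩ := QuotientAddGroup.mk_surjective b
    obtain ⟨a, ha⟩ := hsurj b
    exact ⟨a, key _ _ _ (hf a) ha⟩
  refine ⟨(QuotientAddGroup.quotientAddEquivOfEq hker.symm).trans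
    (QuotientAddGroup.quotientKerEquivOfSurjective g hg), fun a b => ?_⟩
  change (QuotientAddGroup.mk (f a) : B ⧸ B') = QuotientAddGroup.mk b ↔ _
  refine ⟨fun h => ?_, fun h => key _ _ _ (hf a) h⟩
  have h1 : b - f a ∈ B' := by
    rw [← QuotientAddGroup.eq_zero_iff, QuotientAddGroup.mk_sub, h, sub_self]
  have := hadd _ _ _ _ (hf a) (h0 _ h1)
  rwa [add_zero, add_sub_cancel] at this

/-! ### Scaling of forms by `(2πi)²` -/

section Scale

variable {n : ℕ} (G : SmoothEtaleGroupoid.{u} n)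

/-- Multiplication of forms by a real number. -/
def scaleHom (r : ℝ) (l : ℕ) : CoeffHom (forms G l) (forms G l) where
  op η y := (r • toAlt (η y) : Alt n l)
  congr h := congrArg (fun a : Alt n l => r • a) h.self_of_nhds
  isSec h := SmoothForm.smul (u := fun _ => r) (Eventually.of_forall fun _ => contMDiffAt_const) h
  add _ _ := smul_add r (_ : Alt n l) _
  act {η} g _ := by
    change r • (toAlt (η (G.germ g (G.tgt g)))).compContinuousLinearMap _ = _
    rw [G.germ_tgt, G.loc_tgt]
    rfl

variable {G} {r : ℝ} {l : ℕ} {Z : EtaleSpace G.Obj}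

lemma scaleHom_map_apply (c : (forms G l).sections Z) (z : Z.carrier) :
    ((scaleHom G r l).map Z c).1 z = r • toAlt (c.1 z) :=
  congrArg (fun w => r • toAlt (c.1 w)) (Z.loc_proj z)

lemma scaleHom_map_inv (hr : r ≠ 0) (c : (forms G l).sections Z) :
    (scaleHom G r l).map Z ((scaleHom G r⁻¹ l).map Z c) = c := by
  refine Subtype.ext (funext fun z => ?_)
  rw [scaleHom_map_apply, scaleHom_map_apply]
  exact smul_inv_smul₀ hr (toAlt (c.1 z))

lemma scaleHom_map_injective (hr : r ≠ 0) : Function.Injective ((scaleHom G r l).map Z) := by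
  intro c c' h
  have h1 := scaleHom_map_inv (inv_ne_zero hr) c
  rw [inv_inv, h] at h1
  have h2 := scaleHom_map_inv (inv_ne_zero hr) c'
  rw [inv_inv] at h2
  exact h1.symm.trans h2

lemma dForms_scaleHom (c : (forms G l).sections Z) :
    (dForms G l).map Z ((scaleHom G r l).map Z c) =
      (scaleHom G r (l + 1)).map Z ((dForms G l).map Z c) := by
  refine Subtype.ext (funext fun z => ?_)
  obtain ⟨η, h1, h2⟩ := c.2 z
  refine ((dForms G l).app_eq Z ((scaleHom G r l).app_eventuallyEq Z h2)).trans ?_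
  refine Eq.trans ?_ ((scaleHom G r (l + 1)).app_eq Z ((dForms G l).app_eventuallyEq Z h2)).symm
  change (extDeriv (r • rep (fun y => toAlt (η y)) (Z.proj z)) (chart n (Z.proj z)
      (Z.proj z))).compContinuousLinearMap
    (chartDeriv (Z.proj z)) = r • extD (fun y => toAlt (η y)) (Z.proj z)
  rw [extDeriv_smul]
  rfl

/-- The real number `(2πi)²`. -/
def realSq : ℝ := -(2 * Real.pi) ^ 2

lemma realSq_ne_zero : realSq ≠ 0 := neg_ne_zero.2 (pow_ne_zero _ Real.two_pi_pos.ne')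

lemma coe_realSq : (realSq : ℂ) = twoPiISq := by
  rw [realSq, twoPiISq, mul_pow _ Complex.I, Complex.I_sq]
  push_cast
  ring

/-- The number `(2πi)²` is real, so the normalisation of `A` and `B` is a real scaling, which
commutes with the exterior derivative taken over `ℝ`. -/
lemma realSq_smul (a : Alt n l) : realSq • a = ((2 * Real.pi * Complex.I) ^ 2 : ℂ) • a := by
  ext v
  change realSq • a v = twoPiISq * a v
  rw [← coe_realSq]
  rfl

/-- The scaling of forms cancels the factor in the exponential: `(2πi)² d log exp((2πi)⁻² y) = dy`.
So the exponential and the scalings together relate the Deligne differential to `d log`. -/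
lemma scaleHom_dlog_exp (y : (forms G 0).sections Z) :
    (scaleHom G realSq 1).map Z ((dlog G).map Z ((expHom G).map Z y)) = (dForms G 0).map Z y := by
  refine Subtype.ext (funext fun z => ?_)
  obtain ⟨η, h1, h2⟩ := y.2 z
  rw [scaleHom_map_apply]
  have e1 : toAlt (((dlog G).map Z ((expHom G).map Z y)).1 z) =
      dlogForm (n := n) ((expHom G).op η) (Z.proj z) :=
    (dlog G).app_eq Z ((expHom G).app_eventuallyEq Z h2)
  have e2 : toAlt (((dForms G 0).map Z y).1 z) = extD η (Z.proj z) := (dForms G 0).app_eq Z h2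
  rw [e1]
  refine Eq.trans ?_ e2.symm
  rw [dlogForm_exp h1, realSq_smul]
  exact smul_inv_smul₀ twoPiISq_ne_zero (extD η (Z.proj z))

end Scale

/-! ### Logarithms of Čech cocycles -/

section Comparison

variable {n : ℕ} {G : SmoothEtaleGroupoid.{u} n}

/-- A Čech cochain of total degree `3` with coefficients in the Deligne complex is a cocycle. -/
structure IsDeligneCocycle (x₃ : (constants G 3).sections (G.nerve 3)) (x₂ : CechForms G 2 0)
    (x₁ : CechForms G 1 1) (x₀ : CechForms G 0 2) : Prop where
  eq₃ : (inclusion G 3).map (G.nerve 3) x₃ = δForms x₂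
  eq₂ : dCech x₂ = δForms x₁
  eq₁ : dCech x₁ = δForms x₀

lemma isDeligneLift_iff {c : Cech2 G} {x₃ : (constants G 3).sections (G.nerve 3)}
    {x₂ : CechForms G 2 0} {x₁ : CechForms G 1 1} {x₀ : CechForms G 0 2} :
    IsDeligneLift G c x₃ x₂ x₁ x₀ ↔ (expHom G).map (G.nerve 2) x₂ = c.1 ∧
      x₁ = (scaleHom G realSq 1).map _ c.2.1 ∧ x₀ = (scaleHom G realSq 2).map _ c.2.2 ∧
      (inclusion G 3).map (G.nerve 3) x₃ = δForms x₂ := by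
  constructor
  · rintro ⟨h1, h2, h3, h4⟩
    refine ⟨Subtype.ext (funext fun z => (expHom_app _ _ z).trans (expUnit_eq_iff.2 (h1 z).symm)),
      Subtype.ext (funext fun z => ?_), Subtype.ext (funext fun z => ?_), h4⟩
    · rw [scaleHom_map_apply]
      exact (h2 z).trans (realSq_smul _).symm
    · rw [scaleHom_map_apply]
      exact (h3 z).trans (realSq_smul _).symm
  · rintro ⟨h1, rfl, rfl, h4⟩
    refine ⟨fun z => ?_, fun z => ?_, fun z => ?_, h4⟩
    · rw [← h1]
      exact congrArg (fun a : Additive ℂˣ => (a.toMul : ℂ)) (expHom_app _ _ z)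
    · exact (scaleHom_map_apply _ z).trans (realSq_smul _)
    · exact (scaleHom_map_apply _ z).trans (realSq_smul _)

lemma mem_cechCocycles_iff (c : Cech2 G) : c ∈ cechCocycles G ↔
    δForms c.2.2 = dCech c.2.1 ∧ δForms c.2.1 = dlogCech c.1 ∧ δUnits c.1 = 0 := by
  have h : c ∈ cechCocycles G ↔ (δUnits c.1, δForms c.2.1 - dlogCech c.1,
      δForms c.2.2 - dCech c.2.1) = (0 : Cech3 G) := Iff.rfl
  rw [h, Prod.ext_iff, Prod.ext_iff]
  change _ = 0 ∧ _ - _ = 0 ∧ _ - _ = 0 ↔ _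
  rw [sub_eq_zero, sub_eq_zero]
  tauto

lemma IsDeligneLift.isDeligneCocycle {c : Cech2 G} (hc : c ∈ cechCocycles G)
    {x₃ : (constants G 3).sections (G.nerve 3)} {x₂ : CechForms G 2 0} {x₁ : CechForms G 1 1}
    {x₀ : CechForms G 0 2} (h : IsDeligneLift G c x₃ x₂ x₁ x₀) :
    IsDeligneCocycle x₃ x₂ x₁ x₀ := by
  obtain ⟨h1, rfl, rfl, h4⟩ := isDeligneLift_iff.1 h
  obtain ⟨k1, k2, k3⟩ := (mem_cechCocycles_iff c).1 hc
  refine ⟨h4, ?_, ?_⟩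
  · rw [← scaleHom_dlog_exp, h1, CoeffHom.map_delta, k2]
  · rw [dForms_scaleHom, CoeffHom.map_delta, k1]

/-- A logarithm of `h` exists over `G_2` because the first cohomology of `ℤ(3)` vanishes there.
Since `δh = 1`, the differential of the logarithm has trivial exponential and so takes values in
`ℤ(3)`. -/
lemma exists_isDeligneLift (h2 : GermSheaf.Acyclic 0 (cg (constants G 3) (G.nerve 2)))
    {c : Cech2 G} (hc : c ∈ cechCocycles G) : ∃ x₃ x₂ x₁ x₀, IsDeligneLift G c x₃ x₂ x₁ x₀ := by
  obtain ⟨x₂, hx₂⟩ := exists_global_log h2 c.1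
  obtain ⟨x₃, hx₃⟩ := exists_constants_of_exp (y := δForms x₂) (by
    rw [← CoeffHom.map_delta, hx₂]
    exact ((mem_cechCocycles_iff c).1 hc).2.2)
  exact ⟨x₃, x₂, _, _, isDeligneLift_iff.2 ⟨hx₂, rfl, rfl, hx₃⟩⟩

lemma IsDeligneCocycle.exists_cocycle {x₃ : (constants G 3).sections (G.nerve 3)}
    {x₂ : CechForms G 2 0} {x₁ : CechForms G 1 1} {x₀ : CechForms G 0 2}
    (h : IsDeligneCocycle x₃ x₂ x₁ x₀) :
    ∃ c ∈ cechCocycles G, IsDeligneLift G c x₃ x₂ x₁ x₀ := by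
  refine ⟨((expHom G).map _ x₂, (scaleHom G realSq⁻¹ 1).map _ x₁, (scaleHom G realSq⁻¹ 2).map _ x₀),
    (mem_cechCocycles_iff _).2 ⟨?_, ?_, ?_⟩, isDeligneLift_iff.2 ⟨rfl,
      (scaleHom_map_inv realSq_ne_zero _).symm, (scaleHom_map_inv realSq_ne_zero _).symm, h.eq₃⟩⟩
  · refine (CoeffHom.map_delta _ _ _).trans ?_
    refine Eq.trans ?_ (dForms_scaleHom _).symm
    rw [h.eq₁]
  · refine scaleHom_map_injective realSq_ne_zero ?_
    refine Eq.trans ?_ (scaleHom_dlog_exp x₂).symm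
    rw [← CoeffHom.map_delta, scaleHom_map_inv realSq_ne_zero]
    exact h.eq₂.symm
  · refine (CoeffHom.map_delta _ _ _).trans ?_
    refine (congrArg _ h.eq₃.symm).trans (expHom_map_inclusion x₃)

/-- Coboundaries, in terms of a lift. -/
lemma mem_range_D1_iff (h1 : GermSheaf.Acyclic 0 (cg (constants G 3) (G.nerve 1))) {c : Cech2 G}
    {x₃ : (constants G 3).sections (G.nerve 3)} {x₂ : CechForms G 2 0} {x₁ : CechForms G 1 1}
    {x₀ : CechForms G 0 2} (h : IsDeligneLift G c x₃ x₂ x₁ x₀) :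
    c ∈ (D1 G).range ↔ ∃ z₂ y₁ y₀, x₂ = δForms y₁ + (inclusion G 3).map (G.nerve 2) z₂ ∧
      x₁ = δForms y₀ + dCech y₁ ∧ x₀ = dCech y₀ := by
  obtain ⟨k1, rfl, rfl, k4⟩ := isDeligneLift_iff.1 h
  constructor
  · rintro ⟨⟨f, a⟩, rfl⟩
    obtain ⟨y₁, rfl⟩ := exists_global_log h1 f
    -- Two logarithms of `h = δf`, namely `x₂` and `δ` of a logarithm of `f`, differ by a section of
    -- `ℤ(3)`; this accounts for the extra term `z₂`.
    obtain ⟨z₂, hz₂⟩ := exists_constants_of_exp (y := x₂ - δForms y₁) (by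
      rw [map_sub, ← CoeffHom.map_delta]
      exact sub_eq_zero.2 k1)
    refine ⟨z₂, y₁, (scaleHom G realSq 1).map _ a, by rw [hz₂]; abel, ?_, ?_⟩
    · refine (map_add ((scaleHom G realSq 1).map _) _ _).trans ?_
      refine congrArg₂ (· + ·) (CoeffHom.map_delta _ _ _).symm (scaleHom_dlog_exp y₁)
    · exact (dForms_scaleHom a).symm
  · rintro ⟨z₂, y₁, y₀, e2, e1, e0⟩
    refine ⟨((expHom G).map _ y₁, (scaleHom G realSq⁻¹ 1).map _ y₀), Prod.ext ?_ (Prod.ext ?_ ?_)⟩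
    · refine (CoeffHom.map_delta _ _ _).trans ?_
      rw [← k1, e2, map_add, expHom_map_inclusion, add_zero]
    · refine scaleHom_map_injective realSq_ne_zero (Eq.trans ?_ e1.symm)
      refine (map_add ((scaleHom G realSq 1).map _) _ _).trans ?_
      refine congrArg₂ (· + ·) ((CoeffHom.map_delta _ _ _).symm.trans ?_) (scaleHom_dlog_exp y₁)
      exact congrArg _ (scaleHom_map_inv realSq_ne_zero y₀)
    · refine scaleHom_map_injective realSq_ne_zero (Eq.trans ?_ e0.symm)
      refine (dForms_scaleHom _).symm.trans ?_
      exact congrArg _ (scaleHom_map_inv realSq_ne_zero y₀)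

end Comparison

/-! ### Čech cochains as cochains of the Deligne double complex -/

section Transfer

variable {n : ℕ} {G : SmoothEtaleGroupoid.{u} n} {k : ℕ}

/-- The sections of the terms of the Deligne complex as sections over the nerve. -/
def sec₀ : (constants G 3).sections (G.nerve k) →+ NerveSec (deligne G) 0 k :=
  etaleOfCoeffHom (constants G 3) (G.nerve k)

/-- Sections of `𝓐^0` over the nerve, as sections of the Deligne complex. -/
def sec₁ : CechForms G k 0 →+ NerveSec (deligne G) 1 k :=
  etaleOfCoeffHom (forms G 0) (G.nerve k)

/-- Sections of `𝓐^1` over the nerve, as sections of the Deligne complex. -/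
def sec₂ : CechForms G k 1 →+ NerveSec (deligne G) 2 k :=
  etaleOfCoeffHom (forms G 1) (G.nerve k)

/-- Sections of `𝓐^2` over the nerve, as sections of the Deligne complex. -/
def sec₃ : CechForms G k 2 →+ NerveSec (deligne G) 3 k :=
  etaleOfCoeffHom (forms G 2) (G.nerve k)

lemma deligne_d (i : ℕ) : (deligne G).d i (i + 1) = deligneD G i := CochainComplex.of_d _ _ i

lemma vd_sec₀ (x : (constants G 3).sections (G.nerve k)) :
    vd (deligne G) 0 (sec₀ x) = sec₁ ((inclusion G 3).map _ x) :=
  (congrArg (fun φ => etaleMap φ _ (sec₀ x)) (deligne_d 0)).trans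
    (etaleMap_etaleOfCoeff (inclusion G 3) x)

lemma vd_sec₁ (x : CechForms G k 0) : vd (deligne G) 1 (sec₁ x) = sec₂ (dCech x) :=
  (congrArg (fun φ => etaleMap φ _ (sec₁ x)) (deligne_d 1)).trans
    (etaleMap_etaleOfCoeff (dForms G 0) x)

lemma vd_sec₂ (x : CechForms G k 1) : vd (deligne G) 2 (sec₂ x) = sec₃ (dCech x) :=
  (congrArg (fun φ => etaleMap φ _ (sec₂ x)) (deligne_d 2)).trans
    (etaleMap_etaleOfCoeff (dForms G 1) x)

lemma vd_deligne_three (x : NerveSec (deligne G) 3 k) : vd (deligne G) 3 x = 0 :=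
  (congrArg (fun φ => etaleMap φ _ x) (deligne_d 3)).trans (etaleMap_zero x)

lemma hd_sec₀ (x : (constants G 3).sections (G.nerve k)) :
    hd (deligne G) k (sec₀ x) = sec₀ ((constants G 3).delta k x) :=
  (etaleOfCoeff_delta (constants G 3) k x).symm

lemma hd_sec₁ (x : CechForms G k 0) : hd (deligne G) k (sec₁ x) = sec₁ (δForms x) :=
  (etaleOfCoeff_delta (forms G 0) k x).symm

lemma hd_sec₂ (x : CechForms G k 1) : hd (deligne G) k (sec₂ x) = sec₂ (δForms x) :=
  (etaleOfCoeff_delta (forms G 1) k x).symm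

lemma hd_sec₃ (x : CechForms G k 2) : hd (deligne G) k (sec₃ x) = sec₃ (δForms x) :=
  (etaleOfCoeff_delta (forms G 2) k x).symm

lemma sec₁_injective : Function.Injective (sec₁ (G := G) (k := k)) :=
  etaleOfCoeff_injective (forms G 0) (G.nerve k)

lemma sec₂_injective : Function.Injective (sec₂ (G := G) (k := k)) :=
  etaleOfCoeff_injective (forms G 1) (G.nerve k)

lemma sec₃_injective : Function.Injective (sec₃ (G := G) (k := k)) :=
  etaleOfCoeff_injective (forms G 2) (G.nerve k)

lemma sec₀_surjective : Function.Surjective (sec₀ (G := G) (k := k)) :=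
  etaleOfCoeff_surjective (constants G 3) (G.nerve k)

lemma sec₁_surjective : Function.Surjective (sec₁ (G := G) (k := k)) :=
  etaleOfCoeff_surjective (forms G 0) (G.nerve k)

lemma sec₂_surjective : Function.Surjective (sec₂ (G := G) (k := k)) :=
  etaleOfCoeff_surjective (forms G 1) (G.nerve k)

lemma sec₃_surjective : Function.Surjective (sec₃ (G := G) (k := k)) :=
  etaleOfCoeff_surjective (forms G 2) (G.nerve k)

variable {R : InjectiveModel (deligne G)}

/-- Rewrites the correspondence with `δ` as a homomorphism, in the form to which the chases apply.
-/
lemma corresponds_iff {c : Cech2 G} {ξ : invSections (R.T.X 3)} : Corresponds R c ξ ↔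
    ∃ x₃ x₂ x₁ x₀, IsDeligneLift G c x₃ x₂ x₁ x₀ ∧ ∃ b₀ b₁ b₂,
      Linked R.η (sec₀ x₃) (sec₁ x₂) (sec₂ x₁) (sec₃ x₀) b₀ b₁ b₂ (etaleOfSec (R.T.X 3) ξ.1) := by
  unfold Corresponds
  simp only [isDelta_iff]
  rfl

end Transfer
end EtaleGerbe
end

noncomputable section
open CategoryTheory Filter Topology
open scoped Manifold ContDiff
namespace EtaleGerbe
open SmoothEtaleGroupoid

/-! ### The comparison of Čech cohomology and hypercohomology -/

section MainComparison

variable {n : ℕ} {G : SmoothEtaleGroupoid.{u} n}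

lemma acyclic_constants_nerve (hG : G.IsLeray) (k q : ℕ) :
    GermSheaf.Acyclic q (cg (constants G 3) (G.nerve k)) :=
  acyclic_constants 3 (hG.contractible k) (Homeomorph.refl _) q

/-- Contractible components handle `ℤ(3)` over every `G_k`; partitions of unity handle the forms. -/
lemma acyclic_deligne (hG : G.IsLeray) {k : ℕ}
    (h : ∀ l, (cg (forms G l) (G.nerve k)).Fine) : ∀ i ≤ 3, ∀ q,
    GermSheaf.Acyclic q (gs ((deligne G).X i) (G.nerve k))
  | 0, _, q => acyclic_gs (acyclic_constants_nerve hG k q)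
  | 1, _, q => acyclic_gs ((h 0).acyclic q)
  | 2, _, q => acyclic_gs ((h 1).acyclic q)
  | 3, _, q => acyclic_gs ((h 2).acyclic q)
  | _ + 4, hi, _ => absurd hi (by omega)

variable (R : InjectiveModel (deligne G))

lemma etaleOfSec_sub (T : GSheaf G) (ξ ξ' : invSections T) :
    etaleOfSec T (ξ - ξ').1 = etaleOfSec T ξ.1 - etaleOfSec T ξ'.1 :=
  Subtype.ext (funext fun _ => funext fun _ => map_sub _ _ _)

lemma etaleOfSec_invMap {T T' : GSheaf G} (φ : T ⟶ T') (ξ : invSections T) :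
    etaleOfSec T' (invMap φ ξ).1 = etaleMap φ (G.nerve 0) (etaleOfSec T ξ.1) :=
  Subtype.ext (funext fun _ => funext fun _ => (homOn_secMap φ _ _).symm)

lemma etaleOfSec_zero (T : GSheaf G) : etaleOfSec T (0 : invSections T).1 = 0 :=
  Subtype.ext (funext fun _ => funext fun _ => map_zero _)

lemma invMap_eq_zero_iff {T T' : GSheaf G} (φ : T ⟶ T') (ξ : invSections T) :
    invMap φ ξ = 0 ↔ etaleMap φ (G.nerve 0) (etaleOfSec T ξ.1) = 0 := by
  rw [← etaleOfSec_invMap]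
  exact ⟨fun h => by rw [h, etaleOfSec_zero], fun h =>
    etaleOfSec_injective T' (h.trans (etaleOfSec_zero T').symm)⟩

variable {R}

/-- Lift to the Deligne complex and push to `G_0`; a section over `G_0` killed by `δ` is an
invariant section. -/
lemma exists_corresponds_of_cocycle (hG : G.IsLeray) {c : Cech2 G} (hc : c ∈ cechCocycles G) :
    ∃ ξ ∈ invCocycles R.T 3, Corresponds R c ξ := by
  obtain ⟨x₃, x₂, x₁, x₀, hx⟩ := exists_isDeligneLift (acyclic_constants_nerve hG 2 0) hc
  have h := hx.isDeligneCocycle hc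
  -- Since `x₃` is `δx₂` regarded in `ℤ(3)`, injectivity of the inclusion reduces this to `δ² = 0`.
  have h3 : (constants G 3).delta 3 x₃ = 0 := by
    apply inclusion_map_injective
    rw [map_zero, ← CoeffHom.map_delta, h.eq₃]
    exact delta_delta (forms G 0) 2 x₂
  obtain ⟨b₀, b₁, b₂, t, hl, ht, ht'⟩ := exists_linked (η := R.η) R.injective
    (x₃ := sec₀ x₃) (x₂ := sec₁ x₂) (x₁ := sec₂ x₁) (x₀ := sec₃ x₀)
    (by rw [hd_sec₀, h3, map_zero]) (by rw [vd_sec₀, hd_sec₁, h.eq₃])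
    (by rw [vd_sec₁, hd_sec₂, h.eq₂]) (by rw [vd_sec₂, hd_sec₃, h.eq₁]) (vd_deligne_three _)
  obtain ⟨ξ, rfl⟩ := exists_etaleOfSec_eq (R.T.X 3) t ht
  exact ⟨ξ, (invMap_eq_zero_iff _ _).2 ht', corresponds_iff.2
    ⟨x₃, x₂, x₁, x₀, hx, b₀, b₁, b₂, hl⟩⟩

/-- The chase needs cohomology of `ℤ(3)` over `G_0`, `G_1` and `G_2`, but of forms only over `G_0`
and `G_1`, which is where Hausdorffness and paracompactness are available. -/
lemma exists_corresponds_of_class (hG : G.IsLeray) {ξ : invSections (R.T.X 3)}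
    (hξ : ξ ∈ invCocycles R.T 3) : ∃ c ∈ cechCocycles G, Corresponds R c ξ := by
  have hf0 := acyclic_deligne hG (fine_forms_zero hG)
  have hf1 := acyclic_deligne hG (fine_forms_one hG)
  obtain ⟨x₃, x₂, x₁, x₀, b₀, b₁, b₂, hl, h₂, h₁, h₀⟩ := exists_linked_of_cocycle (η := R.η)
    R.injective R.quasiIso (fun i k hik => hf0 i (by omega) k) (fun i k hik => hf1 i (by omega) k)
    (fun i k hik => by
      obtain rfl : i = 0 := by omega
      exact acyclic_gs (acyclic_constants_nerve hG 2 k))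
    (t := etaleOfSec (R.T.X 3) ξ.1) (etaleDelta_etaleOfSec _ ξ) ((invMap_eq_zero_iff _ _).1 hξ)
    vd_deligne_three
  obtain ⟨x₃, rfl⟩ := sec₀_surjective x₃
  obtain ⟨x₂, rfl⟩ := sec₁_surjective x₂
  obtain ⟨x₁, rfl⟩ := sec₂_surjective x₁
  obtain ⟨x₀, rfl⟩ := sec₃_surjective x₀
  have h : IsDeligneCocycle x₃ x₂ x₁ x₀ :=
    ⟨sec₁_injective (by rw [← vd_sec₀, ← hd_sec₁, h₂]),
      sec₂_injective (by rw [← vd_sec₁, ← hd_sec₂, h₁]),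
      sec₃_injective (by rw [← vd_sec₂, ← hd_sec₃, h₀])⟩
  obtain ⟨c, hc, hx⟩ := h.exists_cocycle
  exact ⟨c, hc, corresponds_iff.2 ⟨x₃, x₂, x₁, x₀, hx, b₀, b₁, b₂, hl⟩⟩

lemma Corresponds.sub {c c' : Cech2 G} {ξ ξ' : invSections (R.T.X 3)} (h : Corresponds R c ξ)
    (h' : Corresponds R c' ξ') : Corresponds R (c - c') (ξ - ξ') := by
  obtain ⟨x₃, x₂, x₁, x₀, hx, b₀, b₁, b₂, hl⟩ := corresponds_iff.1 h
  obtain ⟨x₃', x₂', x₁', x₀', hx', b₀', b₁', b₂', hl'⟩ := corresponds_iff.1 h'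
  obtain ⟨k1, rfl, rfl, k4⟩ := isDeligneLift_iff.1 hx
  obtain ⟨k1', rfl, rfl, k4'⟩ := isDeligneLift_iff.1 hx'
  refine corresponds_iff.2 ⟨x₃ - x₃', x₂ - x₂', _, _, isDeligneLift_iff.2
    ⟨by rw [map_sub, k1, k1']; rfl, rfl, rfl, by rw [map_sub, map_sub, k4, k4']⟩,
    b₀ - b₀', b₁ - b₁', b₂ - b₂', ?_⟩
  have := hl.sub hl'
  rw [← map_sub, ← map_sub, ← map_sub, ← map_sub, ← etaleOfSec_sub, ← map_sub, ← map_sub] at this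
  exact this

/-- The coboundary of an invariant `ζ` is linked to the zero cocycle through the cochain `-ζ` over
`G_0`, because `ζ` is killed by `δ`. -/
lemma corresponds_zero (ζ : invSections (R.T.X 2)) :
    Corresponds R 0 (invMap (R.T.d 2 3) ζ) := by
  refine corresponds_iff.2 ⟨0, 0, 0, 0, isDeligneLift_iff.2
    ⟨map_zero _, (map_zero _).symm, (map_zero _).symm, (map_zero _).trans (map_zero _).symm⟩,
    -etaleOfSec (R.T.X 2) ζ.1, 0, 0, ?_, ?_, ?_, ?_⟩
  · rw [map_zero, map_zero, zero_sub, map_neg, etaleOfSec_invMap]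
    rfl
  · rw [map_zero, map_zero, map_zero, sub_zero, map_neg]
    exact (neg_eq_zero.2 (etaleDelta_etaleOfSec _ ζ)).symm
  · rw [map_zero, map_zero, map_zero, map_zero, sub_zero]
  · rw [map_zero, map_zero, map_zero]

/-- Coboundaries on the Čech side become Deligne coboundaries by taking logarithms over `G_1`; the
two chases then exchange these with coboundaries of invariant sections. -/
lemma Corresponds.mem_range_iff (hG : G.IsLeray) {c : Cech2 G} (hc : c ∈ cechCocycles G)
    {ξ : invSections (R.T.X 3)} (h : Corresponds R c ξ) :
    c ∈ (D1 G).range ↔ ξ ∈ (invMap (R.T.d 2 3)).range := by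
  have hf0 := acyclic_deligne hG (fine_forms_zero hG)
  obtain ⟨x₃, x₂, x₁, x₀, hx, b₀, b₁, b₂, hl⟩ := corresponds_iff.1 h
  have hx' := hx.isDeligneCocycle hc
  rw [mem_range_D1_iff (acyclic_constants_nerve hG 1 0) hx]
  constructor
  · rintro ⟨z₂, y₁, y₀, rfl, rfl, rfl⟩
    have e₃ : x₃ = (constants G 3).delta 2 z₂ := by
      apply inclusion_map_injective
      rw [hx'.eq₃, ← CoeffHom.map_delta, map_add, (delta_delta (forms G 0) 1 y₁ : _ = _), zero_add]
    rw [e₃, ← hd_sec₀, map_add, map_add, ← hd_sec₁, ← hd_sec₂, ← vd_sec₀, ← vd_sec₁,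
      ← vd_sec₂] at hl
    obtain ⟨s, hs, e⟩ := exists_of_linked_coboundary R.injective hl
    obtain ⟨ζ, rfl⟩ := exists_etaleOfSec_eq (R.T.X 2) s hs
    exact ⟨ζ, etaleOfSec_injective _ ((etaleOfSec_invMap _ _).trans e.symm)⟩
  · rintro ⟨ζ, rfl⟩
    rw [etaleOfSec_invMap] at hl
    obtain ⟨z₂, y₁, y₀, e₂, e₁, e₀⟩ := exists_coboundary_of_linked R.injective R.quasiIso
      (fun i k hik => hf0 i (by omega) k)
      (fun i k hik => by
        obtain rfl : i = 0 := by omega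
        exact acyclic_gs (acyclic_constants_nerve hG 1 k))
      (by rw [vd_sec₁, hd_sec₂, hx'.eq₂]) (by rw [vd_sec₂, hd_sec₃, hx'.eq₁])
      (vd_deligne_three _) (s := etaleOfSec (R.T.X 2) ζ.1) (etaleDelta_etaleOfSec _ ζ) hl
    obtain ⟨z₂, rfl⟩ := sec₀_surjective z₂
    obtain ⟨y₁, rfl⟩ := sec₁_surjective y₁
    obtain ⟨y₀, rfl⟩ := sec₂_surjective y₀
    rw [vd_sec₀, hd_sec₁, ← map_add] at e₂
    rw [vd_sec₁, hd_sec₂, ← map_add] at e₁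
    rw [vd_sec₂] at e₀
    exact ⟨z₂, y₁, y₀, sec₁_injective e₂, sec₂_injective e₁, sec₃_injective e₀⟩

/-- The comparison isomorphism. -/
theorem exists_comparison (hG : G.IsLeray) (R : InjectiveModel (deligne G)) :
    ∃ Φ : CechH2 G ≃+ InvCohomology R.T 2, ∀ (c : cechCocycles G) (ξ : invCocycles R.T 3),
      Φ (QuotientAddGroup.mk c) = QuotientAddGroup.mk ξ ↔ Corresponds R c.1 ξ.1 := by
  refine exists_quotient_equiv _ _
    (fun (c : cechCocycles G) (ξ : invCocycles R.T 3) => Corresponds R c.1 ξ.1) ?_ ?_ ?_ ?_ ?_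
  · intro c c' ξ ξ' h h'
    exact h.sub h'
  · intro c
    obtain ⟨ξ, hξ, h⟩ := exists_corresponds_of_cocycle (R := R) hG c.2
    exact ⟨⟨ξ, hξ⟩, h⟩
  · intro ξ
    obtain ⟨c, hc, h⟩ := exists_corresponds_of_class hG ξ.2
    exact ⟨⟨c, hc⟩, h⟩
  · rintro ⟨_, hξ⟩ ⟨ζ, rfl⟩
    exact corresponds_zero ζ
  · intro c ξ h
    exact h.mem_range_iff hG c.2

end MainComparison
end EtaleGerbe
end

/-! ### Existence of injective models -/

noncomputable section
open CategoryTheory Filter Topology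
open scoped Manifold ContDiff

namespace EtaleGerbe

section

variable {C : Type*} [Category* C] [Abelian C] [EnoughInjectives C]

/-- In an abelian category with enough injectives, every cochain complex in non-negative degrees
has a quasi-isomorphism to a complex of injective objects in non-negative degrees. -/
theorem exists_injective_resolution_complex (K : CochainComplex C ℕ) :
    ∃ (T : CochainComplex C ℕ) (η : K ⟶ T), QuasiIso η ∧ ∀ i, Injective (T.X i) := by
  -- The complex is extended by zero to all integer degrees, where bounded below complexes have
  -- injective resolutions. The bound `0` makes the result vanish in negative degrees, so nothing is
  -- lost by restricting it to natural numbers.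
  obtain ⟨L, f, hf, hL, hge⟩ := CochainComplex.Plus.modelCategoryQuillen.exists_quasiIso_injective
    (K := K.extend ComplexShape.embeddingUpNat) 0
  let e := ComplexShape.embeddingUpNat
  have hzero : ∀ i : ℤ, (∀ j, e.f j ≠ i) → Limits.IsZero (L.X i) := fun i hi =>
    L.isZero_of_isStrictlyGE 0 i
      (not_le.1 fun h => hi i.toNat (Int.toNat_of_nonneg h))
  have hlift : e.HasLift (𝟙 (L.restriction e)) := by
    intro j hj i' hi'
    exact (hzero i' (hj.notMem hi')).eq_of_src _ _
  let ψ : L ⟶ (L.restriction e).extend e := e.liftExtend (𝟙 _) hlift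
  -- In degrees `≥ 0` the comparison map is an isomorphism by construction of the restriction; in
  -- negative degrees both sides are zero.
  have hψ : IsIso ψ := by
    have : ∀ i, IsIso (ψ.f i) := by
      intro i
      by_cases h : ∃ j, e.f j = i
      · obtain ⟨j, hj⟩ := h
        exact (e.isIso_liftExtend_f_iff _ hlift hj).2 inferInstance
      · push Not at h
        exact Limits.isIso_of_isTerminal
          (hzero i h).isTerminal
          ((L.restriction e).isZero_extend_X e i h).isTerminal _
    exact HomologicalComplex.Hom.isIso_of_components ψ
  -- Extension by zero is fully faithful, so the resolution of the extended complex descends; it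
  -- also reflects quasi-isomorphisms.
  let η := (e.fullyFaithfulExtendFunctor C).preimage (X := K) (Y := L.restriction e) (f ≫ ψ)
  refine ⟨L.restriction e, η, ?_, fun i => hL _⟩
  have h : HomologicalComplex.extendMap η e = f ≫ ψ :=
    (e.fullyFaithfulExtendFunctor C).map_preimage (X := K) (Y := L.restriction e) (f ≫ ψ)
  rw [← HomologicalComplex.quasiIso_extendMap_iff η e, h]
  infer_instance

end

instance InjectiveModel.nonempty {n : ℕ} {G : SmoothEtaleGroupoid.{u} n}
    (K : CochainComplex (GSheaf G) ℕ) : Nonempty (InjectiveModel K) := by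
  obtain ⟨T, η, h, h'⟩ := exists_injective_resolution_complex K
  exact ⟨⟨T, η, h, h'⟩⟩

end EtaleGerbe
end

/-! ### Local operators at a point, and explicit formulas for `δ` -/

noncomputable section
open CategoryTheory Filter Topology
open scoped Manifold ContDiff

namespace EtaleGerbe
open SmoothEtaleGroupoid

section HasApp

variable {n : ℕ} {G : SmoothEtaleGroupoid.{u} n} {F F' : Coeff G} {Z W : EtaleSpace G.Obj}

/-- The function `f` is a section near `z`, and `b` is the value at `z` of the section obtained
from it by the local operator `L`. -/
def CoeffHom.HasApp (L : CoeffHom F F') (Z : EtaleSpace G.Obj) (f : Z.carrier → F.A)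
    (z : Z.carrier) (b : F'.A) : Prop :=
  F.SecAt Z f z ∧ L.app Z f z = b

variable {L : CoeffHom F F'} {f g : Z.carrier → F.A} {z : Z.carrier} {b c : F'.A}

lemma Coeff.SecAt.hasApp (L : CoeffHom F F') (h : F.SecAt Z f z) :
    L.HasApp Z f z (L.app Z f z) := ⟨h, rfl⟩

lemma CoeffHom.HasApp.congr (h : L.HasApp Z f z b) (e : f =ᶠ[𝓝 z] g) : L.HasApp Z g z b :=
  ⟨h.1.congr e, (L.app_congr e).symm.trans h.2⟩

lemma CoeffHom.HasApp.add (h : L.HasApp Z f z b) (h' : L.HasApp Z g z c) :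
    L.HasApp Z (fun w => f w + g w) z (b + c) :=
  ⟨h.1.add h'.1, (L.app_add h.1 h'.1).trans (congrArg₂ _ h.2 h'.2)⟩

lemma CoeffHom.HasApp.neg (h : L.HasApp Z f z b) : L.HasApp Z (fun w => -f w) z (-b) :=
  ⟨h.1.neg, (L.app_neg h.1).trans (congrArg _ h.2)⟩

lemma CoeffHom.HasApp.sub (h : L.HasApp Z f z b) (h' : L.HasApp Z g z c) :
    L.HasApp Z (fun w => f w - g w) z (b - c) := by
  simpa only [sub_eq_add_neg] using h.add h'.neg

lemma CoeffHom.HasApp.pull (q : W.Hom Z) {w : W.carrier} (h : L.HasApp Z f (q.toFun w) b) :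
    L.HasApp W (fun w => f (q.toFun w)) w b := by
  refine ⟨h.1.pull q, ?_⟩
  obtain ⟨⟨η, -, h2⟩, h3⟩ := h
  have h4 : (fun w => f (q.toFun w)) =ᶠ[𝓝 w] η ∘ W.proj := by
    filter_upwards [q.continuous_toFun.continuousAt.eventually h2] with w hw
    exact hw.trans (congrArg η (q.proj_toFun w))
  rw [L.app_eq Z h2, q.proj_toFun] at h3
  rw [L.app_eq W h4, h3]

/-- Transport of sections along a continuous family of arrows. -/
lemma CoeffHom.HasApp.twist {p : W.carrier → Z.carrier} {a : W.carrier → G.Arr}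
    (hp : Continuous p) (ha : Continuous a) (hs : ∀ w, Z.proj (p w) = G.src (a w))
    (ht : ∀ w, G.tgt (a w) = W.proj w) {w : W.carrier} (h : L.HasApp Z f (p w) b) :
    L.HasApp W (fun w => F.act (a w) (f (p w))) w (F'.act (a w) b) := by
  obtain ⟨⟨η, h1, h2⟩, h3⟩ := h
  rw [hs] at h1
  have h4 : (fun w => F.act (a w) (f (p w))) =ᶠ[𝓝 w]
      (fun y => F.act (G.arrLoc (a w) y) (η (G.germ (a w) y))) ∘ W.proj := by
    filter_upwards [(hp.tendsto w).eventually h2,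
      (ha.tendsto w).eventually (G.eventually_arrLoc (a w))] with v hv hv'
    change _ = F.act (G.arrLoc (a w) (W.proj v)) (η (G.src (G.arrLoc (a w) (W.proj v))))
    rw [← ht, hv', hv, Function.comp_apply, hs]
  refine ⟨⟨_, ?_, h4⟩, ?_⟩
  · rw [← ht]
    exact F.isSec_act _ η h1
  · rw [L.app_eq Z h2, hs] at h3
    rw [L.app_eq W h4, ← ht, L.act _ h1, h3]

end HasApp

section Delta

variable {n : ℕ} {G : SmoothEtaleGroupoid.{u} n} {F : Coeff G}

lemma delta_zero_apply (c : F.sections (G.nerve 0)) (z : (G.nerve 1).carrier) :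
    (F.delta 0 c).1 z = c.1 (G.tgt z.1.2) - F.act z.1.2 (c.1 z.1.1) := by
  have h : F.delta 0 c = F.pull (G.face 0 0) c - F.deltaLast 0 c := by
    unfold Coeff.delta
    simp [sub_eq_add_neg]
  rw [h]
  rfl

/-- The chain `x₀ ⟶ x₁` given by an arrow. -/
def chainOne (g : G.Arr) : (G.nerve 1).carrier := ⟨(G.src g, g), rfl⟩

/-- The chain `x₀ ⟶ x₁ ⟶ x₂` given by a composable pair. -/
def chainTwo (g h : G.Arr) (e : G.tgt g = G.src h) : (G.nerve 2).carrier := ⟨(chainOne g, h), e⟩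

lemma chainOne_eta (z : (G.nerve 1).carrier) : chainOne z.1.2 = z :=
  Subtype.ext (Prod.ext z.2.symm rfl)

lemma chainTwo_eta (z : (G.nerve 2).carrier) :
    chainTwo (fstArr z) (sndArr z) (tgt_fstArr z) = z :=
  Subtype.ext (Prod.ext (chainOne_eta z.1.1) rfl)

lemma chainTwo_congr {g g' h h' : G.Arr} (hg : g = g') (hh : h = h') (e : G.tgt g = G.src h)
    (e' : G.tgt g' = G.src h') : chainTwo g h e = chainTwo g' h' e' := by
  subst hg hh
  rfl

/-- The formula is written in terms of arrows, so that it can be compared directly with the factor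
of a product and with connection forms. The last face is the one twisted by the action of the arrow.
-/
lemma delta_one_apply (c : F.sections (G.nerve 1)) (z : (G.nerve 2).carrier) :
    (F.delta 1 c).1 z = c.1 (chainOne (sndArr z)) - c.1 (chainOne (compArr z)) +
      F.act (sndArr z) (c.1 (chainOne (fstArr z))) := by
  have h : F.delta 1 c =
      F.pull (G.face 1 0) c - F.pull (G.face 1 1) c + F.deltaLast 1 c := by
    unfold Coeff.delta
    simp [Fin.sum_univ_two, sub_eq_add_neg]
  rw [h]
  have h0 : (G.face 1 0).toFun z = chainOne (sndArr z) :=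
    (chainOne_eta ((G.face 1 0).toFun z)).symm
  have h1 : (G.face 1 1).toFun z = chainOne (compArr z) :=
    (chainOne_eta ((G.face 1 1).toFun z)).symm
  change c.1 ((G.face 1 0).toFun z) - c.1 ((G.face 1 1).toFun z) + F.act z.1.2 (c.1 z.1.1) = _
  rw [h0, h1, fstArr, chainOne_eta]
  rfl

lemma delta_two_apply (c : F.sections (G.nerve 2)) (z : (G.nerve 2).carrier) (k : G.Arr)
    (e : G.tgt (sndArr z) = G.src k) :
    (F.delta 2 c).1 ⟨(z, k), e⟩ = c.1 (chainTwo (sndArr z) k e) -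
      c.1 (chainTwo (compArr z) k ((G.tgt_comp _ _ _).trans e)) +
      c.1 (chainTwo (fstArr z) (G.comp (sndArr z) k e)
        ((tgt_fstArr z).trans (G.src_comp _ _ _).symm)) - F.act k (c.1 z) := by
  have h : F.delta 2 c = F.pull (G.face 2 0) c - F.pull (G.face 2 1) c +
      F.pull (G.face 2 2) c - F.deltaLast 2 c := by
    unfold Coeff.delta
    simp [Fin.sum_univ_three, sub_eq_add_neg]
  rw [h]
  have h0 : (G.face 2 0).toFun ⟨(z, k), e⟩ = chainTwo (sndArr z) k e :=
    (chainTwo_eta ((G.face 2 0).toFun ⟨(z, k), e⟩)).symm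
  have h1 : (G.face 2 1).toFun ⟨(z, k), e⟩ =
      chainTwo (compArr z) k ((G.tgt_comp _ _ _).trans e) :=
    (chainTwo_eta ((G.face 2 1).toFun ⟨(z, k), e⟩)).symm
  have h2 : (G.face 2 2).toFun ⟨(z, k), e⟩ = chainTwo (fstArr z) (G.comp (sndArr z) k e)
      ((tgt_fstArr z).trans (G.src_comp _ _ _).symm) :=
    (chainTwo_eta ((G.face 2 2).toFun ⟨(z, k), e⟩)).symm
  change c.1 ((G.face 2 0).toFun ⟨(z, k), e⟩) - c.1 ((G.face 2 1).toFun ⟨(z, k), e⟩) +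
    c.1 ((G.face 2 2).toFun ⟨(z, k), e⟩) - F.act k (c.1 z) = _
  rw [h0, h1, h2]

end Delta

section Maps

variable {n : ℕ} (G : SmoothEtaleGroupoid.{u} n)

/-- The homeomorphism between `G_1` and the space of arrows, as a map over the objects. -/
def chainHom : G.arrows.Hom (G.nerve 1) where
  toFun := chainOne
  continuous_toFun := (nerveOneHomeo G).symm.continuous
  proj_toFun _ := rfl

/-- The map `(x, g) ↦ g`. -/
def arrowHom : (G.nerve 1).Hom G.arrows where
  toFun z := z.1.2
  continuous_toFun := (nerveOneHomeo G).continuous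
  proj_toFun _ := rfl

/-- The map `g ↦ t(g)`. -/
def tgtHom : G.arrows.Hom (G.nerve 0) where
  toFun := G.tgt
  continuous_toFun := G.tgt_etale.contMDiff.continuous
  proj_toFun _ := rfl

/-- The map `(g₁, g₂) ↦ g₂`. -/
def sndHom : (G.nerve 2).Hom G.arrows where
  toFun := sndArr
  continuous_toFun := continuous_snd.comp continuous_subtype_val
  proj_toFun _ := rfl

lemma continuous_fstArr : Continuous (fstArr (G := G)) :=
  (nerveOneHomeo G).continuous.comp (continuous_fst.comp continuous_subtype_val)

/-- The map `(g₁, g₂) ↦ g₁g₂`. -/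
def compHom : (G.nerve 2).Hom G.arrows where
  toFun := compArr
  continuous_toFun := by
    have h : Continuous fun z : (G.nerve 2).carrier =>
        (⟨(fstArr z, sndArr z), tgt_fstArr z⟩ : {z : G.Arr × G.Arr // G.tgt z.1 = G.src z.2}) :=
      ((continuous_fstArr G).prodMk (sndHom G).continuous_toFun).subtype_mk _
    exact G.continuous_comp.comp h
  proj_toFun _ := G.tgt_comp _ _ _

variable {G} {F F' : Coeff G} {L : CoeffHom F F'}

lemma CoeffHom.HasApp.src {f : G.Obj → F.A} {g : G.Arr} {b : F'.A}
    (h : L.HasApp (G.nerve 0) f (G.src g) b) :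
    L.HasApp G.arrows (fun g => F.act g (f (G.src g))) g (F'.act g b) :=
  h.twist (Z := G.nerve 0) (W := G.arrows) (p := G.src) (a := id)
      G.src_etale.contMDiff.continuous continuous_id
    (fun _ => rfl) fun _ => rfl

lemma CoeffHom.HasApp.fst {f : G.Arr → F.A} {z : (G.nerve 2).carrier} {b : F'.A}
    (h : L.HasApp G.arrows f (fstArr z) b) :
    L.HasApp (G.nerve 2) (fun z => F.act (sndArr z) (f (fstArr z))) z (F'.act (sndArr z) b) :=
  h.twist (continuous_fstArr G) (sndHom G).continuous_toFun tgt_fstArr fun _ => rfl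

end Maps

end EtaleGerbe
end

/-! ### Logarithmic derivatives and principal `ℂˣ`-bundles -/

noncomputable section
open CategoryTheory Filter Topology
open scoped Manifold ContDiff

namespace EtaleGerbe
open SmoothEtaleGroupoid

section Closed

variable {n : ℕ} {G : SmoothEtaleGroupoid.{u} n} {Z : EtaleSpace G.Obj}

lemma extD_dlogForm_exp {θ : G.Obj → Alt n 0} {x : G.Obj} (h : SmoothForm θ x) :
    extD (n := n) (dlogForm ((expHom G).op θ)) x = 0 := by
  have h1 : dlogForm (n := n) ((expHom G).op θ) =ᶠ[𝓝 x] realSq⁻¹ • extD θ := by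
    filter_upwards [h.eventually] with y hy
    rw [dlogForm_exp hy, Pi.smul_apply, eq_inv_smul_iff₀ realSq_ne_zero, realSq_smul]
    exact smul_inv_smul₀ twoPiISq_ne_zero _
  rw [extD_congr h1]
  change (extDeriv (realSq⁻¹ • rep (extD θ) x) (chart n x x)).compContinuousLinearMap
    (chartDeriv x) = 0
  rw [extDeriv_smul]
  change realSq⁻¹ • extD (extD θ) x = 0
  rw [extD_extD h]
  exact smul_zero (A := Alt n 2) realSq⁻¹

/-- Local logarithms write the form as a multiple of an exact form. It follows that curvature does
not depend on the chosen section. -/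
lemma extD_dlogForm {η : G.Obj → Additive ℂˣ} {x : G.Obj} (h : (units G).IsSec η x) :
    extD (n := n) (dlogForm η) x = 0 := by
  obtain ⟨θ, h1, h2⟩ := exists_log h
  have h3 : dlogForm (n := n) η =ᶠ[𝓝 x] dlogForm ((expHom G).op θ) := by
    filter_upwards [h2.eventuallyEq_nhds] with y hy
    exact dlogForm_congr G hy.symm
  exact (extD_congr h3).trans (extD_dlogForm_exp h1)

lemma hasApp_dlog_closed {v : Z.carrier → (units G).A} {z : Z.carrier}
    (h : (units G).SecAt Z v z) : (dForms G 1).HasApp Z ((dlog G).app Z v) z 0 := by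
  obtain ⟨η, h1, h2⟩ := h
  have h3 := (dlog G).app_eventuallyEq Z h2
  exact ⟨⟨_, (dlog G).isSec h1, h3⟩, ((dForms G 1).app_eq Z h3).trans (extD_dlogForm h1)⟩

end Closed

section Units

variable {n : ℕ} {G : SmoothEtaleGroupoid.{u} n}

/-- A unit, as a value of the sheaf `ℂˣ`. -/
def ofUnit (a : ℂˣ) : (units G).A := Additive.ofMul a

lemma unitOf_injective : Function.Injective (unitOf (G := G)) := fun _ _ h => h

lemma unitOf_add (a b : (units G).A) : unitOf (a + b) = unitOf a * unitOf b := rfl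

lemma unitOf_neg (a : (units G).A) : unitOf (-a) = (unitOf a)⁻¹ := rfl

lemma unitOf_sub (a b : (units G).A) : unitOf (a - b) = unitOf a * (unitOf b)⁻¹ := by
  rw [sub_eq_add_neg, unitOf_add, unitOf_neg]

end Units

namespace LineBundle

variable {n : ℕ} {G : SmoothEtaleGroupoid.{u} n} {Z : EtaleSpace G.Obj} (L : LineBundle G Z)

lemma smul_left_cancel {a b : ℂˣ} {p : L.P} (h : a • p = b • p) : a = b :=
  (L.existsUnique_smul p (b • p) (L.π_smul b p).symm).unique h rfl

variable {L}

/-- The function `f` with `τ = f σ`. -/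
def ratio (σ τ : L.Sect) (z : Z.carrier) : (units G).A :=
  ofUnit (L.existsUnique_smul (σ.1 z) (τ.1 z) ((σ.2 z).trans (τ.2 z).symm)).choose

lemma ratio_smul (σ τ : L.Sect) (z : Z.carrier) : unitOf (ratio σ τ z) • σ.1 z = τ.1 z :=
  (L.existsUnique_smul (σ.1 z) (τ.1 z) ((σ.2 z).trans (τ.2 z).symm)).choose_spec.1

lemma secAt_ratio {σ τ : L.Sect} {z : Z.carrier} (h : L.SmoothAt σ z) (h' : L.SmoothAt τ z) :
    (units G).SecAt Z (ratio σ τ) z :=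
  (L.smoothAt_iff σ τ z _ h (Eventually.of_forall fun w => (ratio_smul σ τ w).symm)).1 h'

lemma conn_ratio {σ τ : L.Sect} {z : Z.carrier} (h : L.SmoothAt σ z) (h' : L.SmoothAt τ z) :
    L.conn τ z = L.conn σ z + (dlog G).app Z (ratio σ τ) z :=
  L.conn_smul σ τ z _ h h' (Eventually.of_forall fun w => (ratio_smul σ τ w).symm)

/-- A principal `ℂˣ`-bundle has a global smooth section if the first cohomology of the sheaf `ℂˣ`
vanishes. -/
theorem exists_smooth (h : GermSheaf.Acyclic 0 (cg (units G) Z)) :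
    ∃ σ : L.Sect, ∀ z, L.SmoothAt σ z := by
  choose s hs using L.surjective
  let σ₀ : L.Sect := ⟨s, hs⟩
  choose σ hσ using L.exists_smoothAt
  -- All sections are compared with one possibly discontinuous section `s`. The section `g s` is
  -- smooth near `z` when `g` and the ratio of `σ z` to `s` differ by a smooth function.
  have key : ∀ (g : Z.carrier → (units G).A) z w,
      unitOf ((g - ratio σ₀ (σ z)) w) • (σ z).1 w = unitOf (g w) • s w := fun g z w => by
    rw [← ratio_smul σ₀ (σ z) w, smul_smul]
    refine congrArg (· • s w) ?_
    refine (unitOf_add _ _).symm.trans (congrArg unitOf ?_)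
    exact sub_add_cancel _ _
  -- The ratios of local smooth sections to `s` agree up to smooth functions on overlaps. They form
  -- a class in the first cohomology of `ℂˣ`; its vanishing provides a single `g`.
  obtain ⟨g, hg⟩ := exists_primitive h (fun z => ratio σ₀ (σ z)) fun z => by
    filter_upwards [L.eventually_smoothAt _ _ (hσ z)] with w hw
    refine (L.smoothAt_iff (σ z) (σ w) w _ hw (Eventually.of_forall fun x => ?_)).1 (hσ w)
    exact ((key _ z x).trans (ratio_smul σ₀ (σ w) x)).symm
  refine ⟨⟨fun w => unitOf (g w) • s w, fun w => (L.π_smul _ _).trans (hs w)⟩, fun z => ?_⟩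
  exact (L.smoothAt_iff (σ z) _ z _ (hσ z)
    (Eventually.of_forall fun w => (key g z w).symm)).2 (hg z)

/-- The trivial bundle with the connection form `a`. -/
def trivial (a : (forms G 1).sections Z) : LineBundle G Z where
  P := Z.carrier × ℂˣ
  action :=
    { smul := fun c p => (p.1, c * p.2)
      one_smul := fun p => Prod.ext rfl (one_mul _)
      mul_smul := fun c d p => Prod.ext rfl (mul_assoc c d _) }
  π := Prod.fst
  surjective z := ⟨(z, 1), rfl⟩
  π_smul _ _ := rfl
  existsUnique_smul p q h := ⟨q.2 * p.2⁻¹,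
    Prod.ext h (inv_mul_cancel_right _ _), fun c hc =>
      eq_mul_inv_of_mul_eq (congrArg (fun r : Z.carrier × ℂˣ => r.2) hc)⟩
  SmoothAt σ z := (units G).SecAt Z (fun w => ofUnit (σ.1 w).2) z
  eventually_smoothAt _ _ h := h.eventually
  exists_smoothAt z := ⟨⟨fun w => (w, 1), fun _ => rfl⟩, ((units G).sections Z).zero_mem z⟩
  smoothAt_iff σ τ z f h e := by
    have h1 : (fun w => ofUnit (G := G) (τ.1 w).2) =ᶠ[𝓝 z]
        f + fun w => ofUnit (σ.1 w).2 := by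
      filter_upwards [e] with w hw
      exact congrArg (fun r : Z.carrier × ℂˣ => ofUnit (G := G) r.2) hw
    refine ⟨fun h2 => ?_, fun h2 => (h2.add h).congr h1.symm⟩
    have h3 := (h2.congr h1).sub h
    rwa [add_sub_cancel_right] at h3
  conn σ z := a.1 z + (dlog G).app Z (fun w => ofUnit (σ.1 w).2) z
  secAt_conn σ z h := (a.2 z).add (h.map _)
  conn_smul σ τ z f h h' e := by
    have h1 : (fun w => ofUnit (G := G) (τ.1 w).2) =ᶠ[𝓝 z]
        (fun w => ofUnit (σ.1 w).2) + f := by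
      filter_upwards [e] with w hw
      refine (congrArg (fun r : Z.carrier × ℂˣ => ofUnit (G := G) r.2) hw).trans ?_
      exact add_comm (f w) _
    have h3 : (units G).SecAt Z f z := by
      have h3 := (h'.congr h1).sub h
      rwa [add_sub_cancel_left] at h3
    rw [CoeffHom.app_congr _ h1, CoeffHom.app_add _ h h3, add_assoc]

end LineBundle

end EtaleGerbe
end

/-! ### From gerbes to cocycles -/

noncomputable section
open CategoryTheory Filter Topology
open scoped Manifold ContDiff

namespace EtaleGerbe
open SmoothEtaleGroupoid

variable {n : ℕ} {G : SmoothEtaleGroupoid.{u} n}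

/-- By the exponential sequence, `H¹(ℂˣ)` vanishes because `H¹(𝓐⁰)` and `H²(ℤ(3))` do.
Contractibility is given for `G_1`, so the homeomorphism with the space of arrows enters. -/
lemma acyclic_units_arrows (hG : G.IsLeray) : GermSheaf.Acyclic 0 (cg (units G) G.arrows) :=
  (ses_exp G.arrows).acyclic_right
    (acyclic_constants 3 (hG.contractible 1) (nerveOneHomeo G).symm 1)
    ((fine_forms_arrows hG 0).acyclic 0)

lemma acyclic_units_zero (hG : G.IsLeray) : GermSheaf.Acyclic 0 (cg (units G) (G.nerve 0)) :=
  (ses_exp (G.nerve 0)).acyclic_right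
    (acyclic_constants 3 (hG.contractible 0) (Homeomorph.refl _) 1)
    ((fine_forms_zero hG 0).acyclic 0)

namespace Gerbe

variable (𝒢 : Gerbe G)

lemma mul_congr {p p' q q' : 𝒢.L.P} (hp : p = p') (hq : q = q')
    (e : G.tgt (𝒢.L.π p) = G.src (𝒢.L.π q)) (e' : G.tgt (𝒢.L.π p') = G.src (𝒢.L.π q')) :
    𝒢.mul p q e = 𝒢.mul p' q' e' := by
  subst hp hq
  rfl

variable {𝒢}

lemma smul_mul_left (a : ℂˣ) (p q : 𝒢.L.P) (e : G.tgt (𝒢.L.π (a • p)) = G.src (𝒢.L.π q))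
    (e' : G.tgt (𝒢.L.π p) = G.src (𝒢.L.π q)) : 𝒢.mul (a • p) q e = a • 𝒢.mul p q e' := by
  have h := 𝒢.smul_mul a 1 p q e' (e.trans (congrArg G.src (𝒢.L.π_smul _ _)).symm)
  rw [mul_one] at h
  exact (𝒢.mul_congr rfl (one_smul _ _).symm _ _).trans h

lemma smul_mul_right (a : ℂˣ) (p q : 𝒢.L.P) (e : G.tgt (𝒢.L.π p) = G.src (𝒢.L.π (a • q)))
    (e' : G.tgt (𝒢.L.π p) = G.src (𝒢.L.π q)) : 𝒢.mul p (a • q) e = a • 𝒢.mul p q e' := by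
  have h := 𝒢.smul_mul 1 a p q e' ((congrArg G.tgt (𝒢.L.π_smul _ _)).trans e)
  rw [one_mul] at h
  exact (𝒢.mul_congr (one_smul _ _).symm rfl _ _).trans h

lemma tgt_sect (σ : 𝒢.L.Sect) {g h : G.Arr} (e : G.tgt g = G.src h) :
    G.tgt (𝒢.L.π (σ.1 g)) = G.src (𝒢.L.π (σ.1 h)) :=
  (congrArg G.tgt (σ.2 g)).trans (e.trans (congrArg G.src (σ.2 h)).symm)

/-- The function `h` with `σ(g₁)σ(g₂) = h(g₁, g₂) σ(g₁g₂)`. -/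
lemma exists_factor (σ : 𝒢.L.Sect) : ∃ h : (G.nerve 2).carrier → (units G).A,
    ∀ z e, 𝒢.mul (σ.1 (fstArr z)) (σ.1 (sndArr z)) e = unitOf (h z) • σ.1 (compArr z) := by
  have key : ∀ z : (G.nerve 2).carrier, ∃ a : (units G).A,
      unitOf a • σ.1 (compArr z) =
        𝒢.mul (σ.1 (fstArr z)) (σ.1 (sndArr z)) (tgt_sect σ (tgt_fstArr z)) := fun z => by
    obtain ⟨a, ha, -⟩ := 𝒢.L.existsUnique_smul (σ.1 (compArr z))
      (𝒢.mul (σ.1 (fstArr z)) (σ.1 (sndArr z)) (tgt_sect σ (tgt_fstArr z))) ((σ.2 _).trans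
        ((Site.comp_congr (σ.2 _).symm (σ.2 _).symm _ _).trans (𝒢.π_mul _ _ _).symm))
    exact ⟨ofUnit a, ha⟩
  choose h hh using key
  exact ⟨h, fun z e => (hh z).symm⟩

theorem exists_presents (hG : G.IsLeray) (𝒢 : Gerbe G) : ∃ c : Cech2 G, 𝒢.Presents c := by
  obtain ⟨σ, hσ⟩ := LineBundle.exists_smooth (L := 𝒢.L) (acyclic_units_arrows hG)
  obtain ⟨h, hh⟩ := exists_factor σ
  refine ⟨(⟨h, fun z => ?_⟩, (forms G 1).pull (arrowHom G) ⟨𝒢.L.conn σ, fun g => ?_⟩, 𝒢.B),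
    σ, hσ, hh, fun _ => rfl, rfl⟩
  · exact (𝒢.mul_smooth σ σ σ z h (hσ _) (hσ _) (hσ _) (Eventually.of_forall hh)).1
  · exact 𝒢.L.secAt_conn σ g (hσ g)

lemma Presents.delta_curving {c : Cech2 G} (hc : 𝒢.Presents c) : δForms c.2.2 = dCech c.2.1 := by
  obtain ⟨σ, h1, -, h3, h4⟩ := hc
  refine Subtype.ext (funext fun z => ?_)
  rw [delta_zero_apply, h4]
  have e1 : c.2.1.1 = fun z => 𝒢.L.conn σ ((arrowHom G).toFun z) := funext h3
  have e2 : (dForms G 1).app (G.nerve 1) c.2.1.1 z =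
      (dForms G 1).app G.arrows (𝒢.L.conn σ) z.1.2 := by
    rw [e1]
    exact (((𝒢.L.secAt_conn σ z.1.2 (h1 _)).hasApp (dForms G 1)).pull (arrowHom G)).2
  refine Eq.trans ?_ e2.symm
  rw [𝒢.curvature σ z.1.2 (h1 _)]
  exact congrArg (fun x => 𝒢.B.1 (G.tgt z.1.2) - (forms G 2).act z.1.2 (𝒢.B.1 x)) z.2

lemma Presents.delta_conn {c : Cech2 G} (hc : 𝒢.Presents c) : δForms c.2.1 = dlogCech c.1 := by
  obtain ⟨σ, h1, h2, h3, -⟩ := hc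
  refine Subtype.ext (funext fun z => ?_)
  have h := (𝒢.mul_smooth σ σ σ z c.1.1 (h1 _) (h1 _) (h1 _) (Eventually.of_forall h2)).2
  rw [delta_one_apply, h3, h3, h3]
  refine Eq.trans ?_ (sub_eq_of_eq_add' h)
  exact sub_add_eq_add_sub _ _ _ |>.trans (congrArg (· - _) (add_comm _ _))

/-- Associativity for a triple of arrows: the two bracketings of `σ(g₁)σ(g₂)σ(g₃)` are multiples of
the same `σ(g₁g₂g₃)`, and equality of the multipliers is the cocycle condition. -/
lemma Presents.delta_factor {c : Cech2 G} (hc : 𝒢.Presents c) : δUnits c.1 = 0 := by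
  obtain ⟨σ, -, h2, -, -⟩ := hc
  refine Subtype.ext (funext fun y => ?_)
  obtain ⟨⟨z, k⟩, e⟩ := y
  change G.tgt (sndArr z) = G.src k at e
  refine (delta_two_apply c.1 z k e).trans ?_
  let z1 := chainTwo (sndArr z) k e
  let z2 := chainTwo (compArr z) k ((G.tgt_comp _ _ _).trans e)
  let z3 := chainTwo (fstArr z) (G.comp (sndArr z) k e)
    ((tgt_fstArr z).trans (G.src_comp _ _ _).symm)
  have ht : ∀ {g h : G.Arr}, G.tgt g = G.src h →
      G.tgt (𝒢.L.π (σ.1 g)) = G.src (𝒢.L.π (σ.1 h)) := tgt_sect σ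
  have f1 := h2 z (ht (tgt_fstArr z))
  have f2 := h2 z1 (ht e)
  have f3 := h2 z2 (ht (tgt_fstArr z2))
  have f4 := h2 z3 (ht (tgt_fstArr z3))
  have e1 : G.tgt (𝒢.L.π (𝒢.mul (σ.1 (fstArr z)) (σ.1 (sndArr z)) (ht (tgt_fstArr z)))) =
      G.src (𝒢.L.π (σ.1 k)) := 
    (congrArg G.tgt (𝒢.π_mul _ _ _)).trans ((G.tgt_comp _ _ _).trans (ht e))
  have e2 : G.tgt (𝒢.L.π (σ.1 (fstArr z))) =
      G.src (𝒢.L.π (𝒢.mul (σ.1 (sndArr z)) (σ.1 k) (ht e))) := 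
    (ht (tgt_fstArr z)).trans
      ((G.src_comp _ _ _).symm.trans (congrArg G.src (𝒢.π_mul _ _ _).symm))
  have key := 𝒢.mul_assoc (σ.1 (fstArr z)) (σ.1 (sndArr z)) (σ.1 k) (ht (tgt_fstArr z)) e1
    (ht e) e2
  have l : 𝒢.mul _ (σ.1 k) e1 = (unitOf (c.1.1 z) * unitOf (c.1.1 z2)) • σ.1 (compArr z2) := by
    rw [mul_smul, ← f3]
    exact (𝒢.mul_congr f1 rfl _ ((congrArg G.tgt (𝒢.L.π_smul _ _)).trans (ht (tgt_fstArr z2)))).trans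
      (smul_mul_left _ _ _ _ _)
  have r : 𝒢.mul (σ.1 (fstArr z)) _ e2 =
      (unitOf (c.1.1 z1) * unitOf (c.1.1 z3)) • σ.1 (compArr z3) := by
    rw [mul_smul, ← f4]
    exact (𝒢.mul_congr rfl f2 _ 
        ((ht (tgt_fstArr z3)).trans (congrArg G.src (𝒢.L.π_smul _ _)).symm)).trans
      (smul_mul_right _ _ _ _ _)
  have ha : compArr z2 = compArr z3 := G.assoc _ _ _ _ _
  rw [l, r, ha] at key
  have key' : c.1.1 z + c.1.1 z2 = c.1.1 z1 + c.1.1 z3 :=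
    unitOf_injective (𝒢.L.smul_left_cancel key)
  change c.1.1 z1 - c.1.1 z2 + c.1.1 z3 - c.1.1 z = 0
  rw [sub_add_eq_add_sub, ← key', add_sub_cancel_right, sub_self]

theorem Presents.mem_cechCocycles {c : Cech2 G} (hc : 𝒢.Presents c) : c ∈ cechCocycles G :=
  (mem_cechCocycles_iff c).2 ⟨hc.delta_curving, hc.delta_conn, hc.delta_factor⟩

end Gerbe

end EtaleGerbe
end

/-! ### From cocycles to gerbes -/

noncomputable section
open CategoryTheory Filter Topology
open scoped Manifold ContDiff

namespace EtaleGerbe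
open SmoothEtaleGroupoid

variable {n : ℕ} {G : SmoothEtaleGroupoid.{u} n}

/-- The cocycle condition in the form of associativity: the action on `ℂˣ`-values is trivial, so no
translation remains in the last term. -/
lemma delta_two_eq_zero {h : CechUnits G 2} (hh : δUnits h = 0) (g₁ g₂ g₃ : G.Arr)
    (e : G.tgt g₁ = G.src g₂) (e' : G.tgt g₂ = G.src g₃)
    (e₁ : G.tgt (G.comp g₁ g₂ e) = G.src g₃) (e₂ : G.tgt g₁ = G.src (G.comp g₂ g₃ e')) :
    h.1 (chainTwo g₁ g₂ e) + h.1 (chainTwo (G.comp g₁ g₂ e) g₃ e₁) =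
      h.1 (chainTwo g₂ g₃ e') + h.1 (chainTwo g₁ (G.comp g₂ g₃ e') e₂) := by
  have h1 := (delta_two_apply h (chainTwo g₁ g₂ e) g₃ e').symm.trans
    (congrArg (fun c : CechUnits G 3 => c.1 ⟨(chainTwo g₁ g₂ e, g₃), e'⟩) hh)
  have h2 := sub_eq_zero.1 h1
  refine (congrArg (· + _) h2.symm).trans ?_
  have key : ∀ {A : Type} [AddCommGroup A] (a b c : A), a - b + c + b = a + c := by
    intros; abel
  exact key (A := (units G).A) _ _ _

namespace LineBundle

variable {Z : EtaleSpace G.Obj} (a : (forms G 1).sections Z)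

/-- The section `1` of the trivial bundle. -/
def oneSect : (trivial a).Sect := ⟨fun z => ((z, 1) : Z.carrier × ℂˣ), fun _ => rfl⟩

lemma smoothAt_oneSect (z : Z.carrier) : (trivial a).SmoothAt (oneSect a) z :=
  ⟨0, (units G).zero _, Eventually.of_forall fun _ => rfl⟩

lemma conn_oneSect (z : Z.carrier) : (trivial a).conn (oneSect a) z = a.1 z := by
  have h : (dlog G).app Z (fun _ => ofUnit 1) z = 0 := (dlog G).app_zero z
  change a.1 z + (dlog G).app Z (fun _ => ofUnit 1) z = a.1 z
  rw [h, add_zero]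

end LineBundle

namespace Gerbe

/-- The gerbe given by a cocycle `(h, A, B)`: the trivial bundle on the arrows, with the connection
form `A`, the product `(a, b) ↦ a b h` and the curving `B`. -/
def ofCocycle (c : Cech2 G) (hc : c ∈ cechCocycles G) : Gerbe G where
  L := LineBundle.trivial ((forms G 1).pull (chainHom G) c.2.1)
  mul p q e := (G.comp p.1 q.1 e, p.2 * q.2 * unitOf (c.1.1 (chainTwo p.1 q.1 e)))
  π_mul _ _ _ := rfl
  smul_mul a b p q e e' := Prod.ext rfl
    ((congrArg (· * unitOf (c.1.1 (chainTwo p.1 q.1 e))) (mul_mul_mul_comm a p.2 b q.2)).trans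
      (_root_.mul_assoc _ _ _))
  mul_assoc p q r e₁ e₂ e₃ e₄ := Prod.ext (G.assoc _ _ _ _ _) (by
    have h := delta_two_eq_zero ((mem_cechCocycles_iff c).1 hc).2.2 p.1 q.1 r.1 e₁ e₃ e₂ e₄
    have h' := congrArg unitOf h
    rw [unitOf_add, unitOf_add] at h'
    have key : ∀ x y z a b c d : ℂˣ, a * b = c * d →
        x * y * a * z * b = x * (y * z * c) * d := by
      intro x y z a b c d e
      rw [mul_right_comm _ a z, _root_.mul_assoc _ a b, e]
      simp only [_root_.mul_assoc]
    exact key _ _ _ _ _ _ _ h')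
  mul_smooth σ₁ σ₂ σ₃ z h' H₁ H₂ H₃ H := by
    -- The factor `h'` equals `σ₁ σ₂ h / σ₃` in coordinates. Its smoothness and its logarithmic
    -- derivative follow from those of the four functions.
    have k := (((H₁.hasApp (dlog G)).fst.add ((H₂.hasApp (dlog G)).pull (sndHom G))).add
      ((c.1.2 z).hasApp (dlog G))).sub ((H₃.hasApp (dlog G)).pull (compHom G))
    have k' := k.congr (g := h') (by
      filter_upwards [H] with w hw
      have e : G.tgt (σ₁.1 (fstArr w)).1 = G.src (σ₂.1 (sndArr w)).1 :=
        (congrArg G.tgt (σ₁.2 _)).trans ((tgt_fstArr w).trans (congrArg G.src (σ₂.2 _)).symm)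
      have h1 : chainTwo (σ₁.1 (fstArr w)).1 (σ₂.1 (sndArr w)).1 e = w :=
        (chainTwo_congr (σ₁.2 _) (σ₂.2 _) _ _).trans (chainTwo_eta w)
      have h2 := congrArg Prod.snd (hw e)
      change _ * unitOf (c.1.1 (chainTwo (σ₁.1 (fstArr w)).1 (σ₂.1 (sndArr w)).1 e)) = _ at h2
      rw [h1] at h2
      exact sub_eq_of_eq_add (a := ofUnit (G := G) _ + ofUnit _ + c.1.1 w)
        (b := ofUnit _) (c := h' w) h2)
    refine ⟨k'.1, ?_⟩
    -- The condition `δA = d log h` is what remains after the logarithmic derivatives of the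
    -- coordinates cancel.
    have hA := (delta_one_apply c.2.1 z).symm.trans
      (congrArg (fun c : CechForms G 2 1 => c.1 z) ((mem_cechCocycles_iff c).1 hc).2.1)
    have key : ∀ {A : Type} [AddCommGroup A] (f : A →+ A) (a₁ a₂ a₃ v₁ v₂ v₃ h r : A),
        r = f v₁ + v₂ + h - v₃ → a₂ - a₃ + f a₁ = h →
        f (a₁ + v₁) + (a₂ + v₂) = a₃ + v₃ + r := by
      rintro A _ f a₁ a₂ a₃ v₁ v₂ v₃ h r rfl rfl
      rw [map_add]
      abel
    exact key ((forms G 1).act (sndArr z)) _ _ _ _ _ _ _ _ k'.2 hA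
  B := c.2.2
  curvature σ g H := by
    -- Changing the section adds a closed logarithmic derivative to `A`, so the curvature is `dA`,
    -- and `dA = δB`.
    have k := ((((c.2.1.2 (chainOne g)).hasApp (dForms G 1)).pull (chainHom G)).add
      (hasApp_dlog_closed H)).2
    refine k.trans ((add_zero _).trans ?_)
    exact (congrArg (fun c : CechForms G 1 2 => c.1 (chainOne g))
      ((mem_cechCocycles_iff c).1 hc).1).symm.trans (delta_zero_apply c.2.2 (chainOne g))

theorem ofCocycle_presents (c : Cech2 G) (hc : c ∈ cechCocycles G) :
    (ofCocycle c hc).Presents c := by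
  let σ := LineBundle.oneSect ((forms G 1).pull (chainHom G) c.2.1)
  refine ⟨σ, LineBundle.smoothAt_oneSect _, fun z e => ?_, fun z => ?_, rfl⟩
  · refine Prod.ext rfl ?_
    change 1 * 1 * unitOf (c.1.1 (chainTwo (fstArr z) (sndArr z) _)) = unitOf (c.1.1 z) * 1
    rw [chainTwo_eta, one_mul, one_mul, mul_one]
  · refine Eq.symm ((LineBundle.conn_oneSect _ _).trans ?_)
    exact congrArg c.2.1.1 (chainOne_eta z)

end Gerbe

namespace LineBundle

variable {Z : EtaleSpace G.Obj} {L : LineBundle G Z}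

/-- The coordinate of a point with respect to a section. -/
def coord (σ : L.Sect) (p : L.P) : ℂˣ :=
  (L.existsUnique_smul (σ.1 (L.π p)) p (σ.2 _)).choose

lemma coord_smul_sect (σ : L.Sect) (p : L.P) : coord σ p • σ.1 (L.π p) = p :=
  (L.existsUnique_smul (σ.1 (L.π p)) p (σ.2 _)).choose_spec.1

lemma coord_eq {σ : L.Sect} {p : L.P} {z : Z.carrier} {a : ℂˣ} (h : a • σ.1 z = p) :
    coord σ p = a := by
  have hz : L.π p = z := by rw [← h, L.π_smul, σ.2]
  refine L.smul_left_cancel (p := σ.1 z) (Eq.trans ?_ h.symm)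
  have := coord_smul_sect σ p
  rwa [hz] at this

lemma coord_smul (σ : L.Sect) (a : ℂˣ) (p : L.P) : coord σ (a • p) = a * coord σ p :=
  coord_eq (z := L.π p) (by rw [mul_smul, coord_smul_sect])

lemma coord_sect (σ τ : L.Sect) (z : Z.carrier) : coord σ (τ.1 z) = unitOf (ratio σ τ z) :=
  coord_eq (ratio_smul σ τ z)

end LineBundle

end EtaleGerbe
end

/-! ### From cochains to isomorphisms of gerbes -/

noncomputable section
open CategoryTheory Filter Topology
open scoped Manifold ContDiff

namespace EtaleGerbe
open SmoothEtaleGroupoid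

variable {n : ℕ} {G : SmoothEtaleGroupoid.{u} n}

namespace Gerbe

variable {𝒢 𝒢' : Gerbe G}

lemma mul_sect {σ : 𝒢.L.Sect} {h : (G.nerve 2).carrier → (units G).A}
    (hh : ∀ z e, 𝒢.mul (σ.1 (fstArr z)) (σ.1 (sndArr z)) e = unitOf (h z) • σ.1 (compArr z))
    (x y : ℂˣ) {g k : G.Arr} (e : G.tgt g = G.src k)
    (e' : G.tgt (𝒢.L.π (x • σ.1 g)) = G.src (𝒢.L.π (y • σ.1 k))) :
    𝒢.mul (x • σ.1 g) (y • σ.1 k) e' =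
      (x * y * unitOf (h (chainTwo g k e))) • σ.1 (G.comp g k e) :=
  (𝒢.smul_mul x y _ _ (tgt_sect σ e) e').trans
    ((congrArg ((x * y) • ·) (hh (chainTwo g k e) _)).trans (smul_smul _ _ _))

lemma coord_mul {σ : 𝒢.L.Sect} {h : (G.nerve 2).carrier → (units G).A}
    (hh : ∀ z e, 𝒢.mul (σ.1 (fstArr z)) (σ.1 (sndArr z)) e = unitOf (h z) • σ.1 (compArr z))
    (r r' : 𝒢.L.P) (e : G.tgt (𝒢.L.π r) = G.src (𝒢.L.π r')) :
    LineBundle.coord σ (𝒢.mul r r' e) =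
      LineBundle.coord σ r * LineBundle.coord σ r' * unitOf (h (chainTwo _ _ e)) := by
  have e' : G.tgt (𝒢.L.π (LineBundle.coord σ r • σ.1 (𝒢.L.π r))) =
      G.src (𝒢.L.π (LineBundle.coord σ r' • σ.1 (𝒢.L.π r'))) := by
    rw [LineBundle.coord_smul_sect, LineBundle.coord_smul_sect]
    exact e
  refine LineBundle.coord_eq (z := G.comp _ _ e) ((mul_sect hh _ _ e e').symm.trans ?_)
  exact 𝒢.mul_congr (LineBundle.coord_smul_sect σ r) (LineBundle.coord_smul_sect σ r') _ _

lemma Iso.map_congr (I : 𝒢.Iso 𝒢') {p p' q q' : I.Q.P} {r r' : 𝒢.L.P} (hp : p = p') (hq : q = q')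
    (hr : r = r') (e₁ e₂ e₃ e₄) : I.map p q r e₁ e₂ = I.map p' q' r' e₃ e₄ := by
  subst hp hq hr
  rfl

section ofCochain

variable {c c' : Cech2 G} {b : Cech1 G} (hb : c' = c + D1 G b) (σ : 𝒢.L.Sect) (σ' : 𝒢'.L.Sect)

include hb

lemma curving_of_cochain : c'.2.2 = c.2.2 + dCech b.2 := congrArg (fun c => c.2.2) hb

lemma conn_of_cochain (g : G.Arr) : c'.2.1.1 (chainOne g) = c.2.1.1 (chainOne g) +
    (b.2.1 (G.tgt g) - (forms G 1).act g (b.2.1 (G.src g)) +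
      (dlog G).app (G.nerve 1) b.1.1 (chainOne g)) :=
  (congrArg (fun c : Cech2 G => c.2.1.1 (chainOne g)) hb).trans
    (congrArg (fun x => c.2.1.1 (chainOne g) + (x + (dlog G).app (G.nerve 1) b.1.1 (chainOne g)))
      (delta_zero_apply b.2 (chainOne g)))

lemma factor_of_cochain (z : (G.nerve 2).carrier) : c'.1.1 z = c.1.1 z +
    (b.1.1 (chainOne (sndArr z)) - b.1.1 (chainOne (compArr z)) + b.1.1 (chainOne (fstArr z))) :=
  (congrArg (fun c : Cech2 G => c.1.1 z) hb).trans
    (congrArg (c.1.1 z + ·) (delta_one_apply b.1 z))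

/-- The isomorphism of gerbes given by a cochain `(f, a)`: the trivial bundle on the objects with
the connection form `a`, and the map `(x, y, σ) ↦ x⁻¹ y f⁻¹ σ'`. -/
def isoOfCochain
    (h₁ : ∀ g, 𝒢.L.SmoothAt σ g) (h₁' : ∀ g, 𝒢'.L.SmoothAt σ' g)
    (h₂ : ∀ z e, 𝒢.mul (σ.1 (fstArr z)) (σ.1 (sndArr z)) e = unitOf (c.1.1 z) • σ.1 (compArr z))
    (h₂' : ∀ z e, 𝒢'.mul (σ'.1 (fstArr z)) (σ'.1 (sndArr z)) e =
      unitOf (c'.1.1 z) • σ'.1 (compArr z))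
    (h₃ : ∀ z : (G.nerve 1).carrier, c.2.1.1 z = 𝒢.L.conn σ z.1.2)
    (h₃' : ∀ z : (G.nerve 1).carrier, c'.2.1.1 z = 𝒢'.L.conn σ' z.1.2)
    (h₄ : c.2.2 = 𝒢.B) (h₄' : c'.2.2 = 𝒢'.B) : 𝒢.Iso 𝒢' where
  Q := LineBundle.trivial b.2
  -- The inverse of `f` is forced by compatibility with products: with `h' = h · δf`, the product of
  -- `f(g₁)⁻¹`, `f(g₂)⁻¹` and `h'` is `h · f(g₁g₂)⁻¹`.
  map p q r _ _ := (p.2⁻¹ * LineBundle.coord σ r * q.2 *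
    (unitOf (b.1.1 (chainOne (𝒢.L.π r))))⁻¹) • σ'.1 (𝒢.L.π r)
  π_map p q r _ _ := (𝒢'.L.π_smul _ _).trans (σ'.2 _)
  map_smul x y w p q r _ _ _ _ := by
    rw [smul_smul]
    refine congrArg₂ (fun (u : ℂˣ) g => u • σ'.1 g) ?_ (𝒢.L.π_smul w r)
    have h1 : unitOf (b.1.1 (chainOne (𝒢.L.π (w • r)))) = unitOf (b.1.1 (chainOne (𝒢.L.π r))) :=
      congrArg (fun g => unitOf (b.1.1 (chainOne g))) (𝒢.L.π_smul w r)
    rw [h1, LineBundle.coord_smul]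
    change (x * p.2)⁻¹ * (w * _) * (y * q.2) * _ = _
    rw [mul_inv]
    have key : ∀ x p w r y q f : ℂˣ,
        x * p * (w * r) * (y * q) * f = x * w * y * (p * r * q * f) := by
      intros
      simp only [_root_.mul_assoc, mul_left_comm]
    exact key _ _ _ _ _ _ _
  map_mul p q k r r' _ _ _ _ _ e _ _ := by
    have hc := factor_of_cochain hb (chainTwo (𝒢.L.π r) (𝒢.L.π r') e)
    have hπ : 𝒢.L.π (𝒢.mul r r' e) = compArr (chainTwo (𝒢.L.π r) (𝒢.L.π r') e) := 𝒢.π_mul _ _ _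
    refine (mul_sect h₂' _ _ e _).trans ?_
    refine congrArg₂ (fun (u : ℂˣ) g => u • σ'.1 g) ?_ hπ.symm
    have h1 := congrArg (fun g => unitOf (b.1.1 (chainOne g))) hπ
    have h2 := congrArg unitOf hc
    rw [unitOf_add, unitOf_add, unitOf_sub] at h2
    refine Eq.trans ?_ (congrArg₂ (fun x y : ℂˣ => p.2⁻¹ * x * k.2 * y⁻¹)
      (coord_mul h₂ r r' e) h1).symm
    rw [h2]
    have key : ∀ p q k ρ ρ' f f' f'' c : ℂˣ,
        p⁻¹ * ρ * q * f⁻¹ * (q⁻¹ * ρ' * k * f'⁻¹) * (c * (f' * f''⁻¹ * f)) =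
          p⁻¹ * (ρ * ρ' * c) * k * f''⁻¹ := by
      intro p q k ρ ρ' f f' f'' c
      apply Units.ext
      push_cast
      field_simp
    exact key _ _ _ _ _ _ _ _ _
  map_smooth ρ₁ ρ₂ τ τ' g φ H₁ H₂ H₃ H₄ H := by
    -- In coordinates the factor `φ` is the alternating product of the ratio of `τ` to `σ`, the two
    -- coordinates of the sections of `Q`, `f`, and the ratio of `τ'` to `σ'`; its logarithmic
    -- derivative is the corresponding sum.
    have k := (((((LineBundle.secAt_ratio (h₁ g) H₃).hasApp (dlog G)).sub
      (H₁.hasApp (dlog G)).src).add ((H₂.hasApp (dlog G)).pull (tgtHom G))).sub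
      (((b.1.2 (chainOne g)).hasApp (dlog G)).pull (chainHom G))).sub
      ((LineBundle.secAt_ratio (h₁' g) H₄).hasApp (dlog G))
    have k' := k.congr (g := φ) (by
      filter_upwards [H] with w hw
      have hw' := hw ((ρ₁.2 _).trans (congrArg G.src (τ.2 w)).symm)
        ((ρ₂.2 _).trans (congrArg G.tgt (τ.2 w)).symm)
      have e1 : ((ρ₁.1 (G.src w)).2⁻¹ * LineBundle.coord σ (τ.1 w) * (ρ₂.1 (G.tgt w)).2 *
          (unitOf (b.1.1 (chainOne w)))⁻¹) • σ'.1 w = unitOf (φ w) • τ'.1 w := by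
        refine Eq.trans ?_ hw'
        exact congrArg (fun g => ((ρ₁.1 (G.src w)).2⁻¹ * LineBundle.coord σ (τ.1 w) *
          (ρ₂.1 (G.tgt w)).2 * (unitOf (b.1.1 (chainOne g)))⁻¹) • σ'.1 g) (τ.2 w).symm
      rw [← LineBundle.ratio_smul σ' τ' w, smul_smul, LineBundle.coord_sect] at e1
      have e2 := 𝒢'.L.smul_left_cancel e1
      refine unitOf_injective ?_
      refine (unitOf_sub _ _).trans ?_
      refine Eq.trans (congrArg (· * _) ?_) (eq_mul_inv_iff_mul_eq.2 e2.symm).symm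
      exact congrArg (· * (ρ₂.1 (G.tgt w)).2 * (unitOf (b.1.1 (chainOne w)))⁻¹)
        (mul_comm (unitOf (LineBundle.ratio σ τ w)) (ρ₁.1 (G.src w)).2⁻¹))
    refine ⟨k'.1, ?_⟩
    have hA := conn_of_cochain hb g
    have hA₁ := h₃ (chainOne g)
    have hA₂ := h₃' (chainOne g)
    have hτ := LineBundle.conn_ratio (h₁ g) H₃
    have hτ' := LineBundle.conn_ratio (h₁' g) H₄
    have key : ∀ {A : Type} [AddCommGroup A] (f : A →+ A)
        (A₁ A₁' A₂ A₂' a₀ a₁ v₀ v₁ r r' b t t' x : A),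
        A₁' = A₁ + (a₁ - f a₀ + b) → A₁ = A₂ → A₁' = A₂' → t = A₂ + r → t' = A₂' + r' →
        x = r - f v₀ + v₁ - b - r' →
        t + (a₁ + v₁) - f (a₀ + v₀) = t' + x := by
      rintro A _ f A₁ A₁' A₂ A₂' a₀ a₁ v₀ v₁ r r' b t t' x h rfl rfl rfl rfl rfl
      rw [h, map_add]
      abel
    exact key ((forms G 1).act g) _ _ _ _ _ _ _ _ _ _ _ _ _ _ hA hA₁ hA₂ hτ hτ' k'.2
  curving ρ x H := by
    have k := (((b.2.2 x).hasApp (dForms G 1)).add (hasApp_dlog_closed H)).2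
    have h := congrArg (fun c : CechForms G 0 2 => c.1 x) (curving_of_cochain hb)
    rw [← h₄, ← h₄']
    exact h.trans (congrArg (c.2.2.1 x + ·) (k.trans (add_zero _)).symm)

end ofCochain

lemma Presents.nonempty_iso {c c' : Cech2 G} (hc : 𝒢.Presents c) (hc' : 𝒢'.Presents c')
    {b : Cech1 G} (hb : c' = c + D1 G b) : Nonempty (𝒢.Iso 𝒢') := by
  obtain ⟨σ, h1, h2, h3, h4⟩ := hc
  obtain ⟨σ', h1', h2', h3', h4'⟩ := hc'
  exact ⟨isoOfCochain hb σ σ' h1 h1' h2 h2' h3 h3' h4 h4'⟩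

end Gerbe

end EtaleGerbe
end

/-! ### From isomorphisms of gerbes to cochains -/

noncomputable section
open CategoryTheory Filter Topology
open scoped Manifold ContDiff

namespace EtaleGerbe
open SmoothEtaleGroupoid

variable {n : ℕ} {G : SmoothEtaleGroupoid.{u} n}

namespace Gerbe

variable {𝒢 𝒢' : Gerbe G}

/-- The function `φ` with `I(ρ, ρ, σ) = φ σ'`. -/
lemma Iso.exists_factor (I : 𝒢.Iso 𝒢') (ρ : I.Q.Sect) (σ : 𝒢.L.Sect) (σ' : 𝒢'.L.Sect) :
    ∃ φ : G.Arr → (units G).A, ∀ g e₁ e₂,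
      I.map (ρ.1 (G.src g)) (ρ.1 (G.tgt g)) (σ.1 g) e₁ e₂ = unitOf (φ g) • σ'.1 g := by
  have key : ∀ g : G.Arr, ∃ a : (units G).A, unitOf a • σ'.1 g =
      I.map (ρ.1 (G.src g)) (ρ.1 (G.tgt g)) (σ.1 g)
        ((ρ.2 _).trans (congrArg G.src (σ.2 g)).symm)
        ((ρ.2 _).trans (congrArg G.tgt (σ.2 g)).symm) := fun g => by
    obtain ⟨a, ha, -⟩ := 𝒢'.L.existsUnique_smul (σ'.1 g) _
      ((σ'.2 g).trans ((σ.2 g).symm.trans (I.π_map (ρ.1 (G.src g)) (ρ.1 (G.tgt g)) (σ.1 g)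
        ((ρ.2 _).trans (congrArg G.src (σ.2 g)).symm)
        ((ρ.2 _).trans (congrArg G.tgt (σ.2 g)).symm)).symm))
    exact ⟨ofUnit a, ha⟩
  choose φ hφ using key
  exact ⟨φ, fun g _ _ => (hφ g).symm⟩

/-- The compatibility of an isomorphism of gerbes with the products, in terms of sections. -/
lemma Iso.factor_mul (I : 𝒢.Iso 𝒢') {ρ : I.Q.Sect} {σ : 𝒢.L.Sect} {σ' : 𝒢'.L.Sect}
    {h h' : (G.nerve 2).carrier → (units G).A} {φ : G.Arr → (units G).A}
    (hh : ∀ z e, 𝒢.mul (σ.1 (fstArr z)) (σ.1 (sndArr z)) e = unitOf (h z) • σ.1 (compArr z))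
    (hh' : ∀ z e, 𝒢'.mul (σ'.1 (fstArr z)) (σ'.1 (sndArr z)) e = unitOf (h' z) • σ'.1 (compArr z))
    (hφ : ∀ g e₁ e₂, I.map (ρ.1 (G.src g)) (ρ.1 (G.tgt g)) (σ.1 g) e₁ e₂ = unitOf (φ g) • σ'.1 g)
    (z : (G.nerve 2).carrier) :
    φ (fstArr z) + φ (sndArr z) + h' z = h z + φ (compArr z) := by
  have hs : ∀ g : G.Arr, I.Q.π (ρ.1 (G.src g)) = G.src (𝒢.L.π (σ.1 g)) := fun g =>
    (ρ.2 _).trans (congrArg G.src (σ.2 g)).symm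
  have ht : ∀ g : G.Arr, I.Q.π (ρ.1 (G.tgt g)) = G.tgt (𝒢.L.π (σ.1 g)) := fun g =>
    (ρ.2 _).trans (congrArg G.tgt (σ.2 g)).symm
  have em : I.Q.π (ρ.1 (G.tgt (fstArr z))) = G.src (𝒢.L.π (σ.1 (sndArr z))) :=
    (congrArg (fun x => I.Q.π (ρ.1 x)) (tgt_fstArr z)).trans (hs _)
  have f₁ := hφ (fstArr z) (hs _) (ht _)
  have f₂ : I.map (ρ.1 (G.tgt (fstArr z))) (ρ.1 (G.tgt (sndArr z))) (σ.1 (sndArr z)) em (ht _) =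
      unitOf (φ (sndArr z)) • σ'.1 (sndArr z) :=
    (I.map_congr (congrArg ρ.1 (tgt_fstArr z)) rfl rfl _ _ _ _).trans (hφ _ (hs _) (ht _))
  have e₅ : G.tgt (𝒢'.L.π (unitOf (φ (fstArr z)) • σ'.1 (fstArr z))) =
      G.src (𝒢'.L.π (unitOf (φ (sndArr z)) • σ'.1 (sndArr z))) := by
    rw [𝒢'.L.π_smul, 𝒢'.L.π_smul]
    exact tgt_sect σ' (tgt_fstArr z)
  have e₆ := tgt_sect σ (tgt_fstArr z)
  have hπ : 𝒢.L.π (𝒢.mul _ _ e₆) = compArr z :=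
    (𝒢.π_mul _ _ _).trans (Site.comp_congr (σ.2 _) (σ.2 _) _ _)
  have e₇ : I.Q.π (ρ.1 (G.src (fstArr z))) = G.src (𝒢.L.π (𝒢.mul _ _ e₆)) :=
    (ρ.2 _).trans (Eq.trans (G.src_comp _ _ _).symm (congrArg G.src hπ).symm)
  have e₈ : I.Q.π (ρ.1 (G.tgt (sndArr z))) = G.tgt (𝒢.L.π (𝒢.mul _ _ e₆)) :=
    (ρ.2 _).trans (Eq.trans (G.tgt_comp _ _ _).symm (congrArg G.tgt hπ).symm)
  have hl : 𝒢'.mul (I.map _ _ _ (hs (fstArr z)) (ht (fstArr z))) (I.map _ _ _ em (ht (sndArr z)))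
      (by rw [f₁, f₂]; exact e₅) = (unitOf (φ (fstArr z)) * unitOf (φ (sndArr z)) *
        unitOf (h' z)) • σ'.1 (compArr z) := by
    refine (𝒢'.mul_congr f₁ f₂ _ e₅).trans ((mul_sect hh' _ _ (tgt_fstArr z) e₅).trans ?_)
    rw [chainTwo_eta]
    rfl
  have hr : I.map _ _ (𝒢.mul _ _ e₆) e₇ e₈ =
      (unitOf (h z) * unitOf (φ (compArr z))) • σ'.1 (compArr z) := by
    -- The trivial factors `1` put the points of `Q` in the form required by `map_smul`, which
    -- scales all three arguments at once.
    have es : I.Q.π ((1 : ℂˣ) • ρ.1 (G.src (compArr z))) =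
        G.src (𝒢.L.π (unitOf (h z) • σ.1 (compArr z))) := by
      rw [I.Q.π_smul, 𝒢.L.π_smul]
      exact hs _
    have et : I.Q.π ((1 : ℂˣ) • ρ.1 (G.tgt (compArr z))) =
        G.tgt (𝒢.L.π (unitOf (h z) • σ.1 (compArr z))) := by
      rw [I.Q.π_smul, 𝒢.L.π_smul]
      exact ht _
    refine (I.map_congr (p' := (1 : ℂˣ) • ρ.1 (G.src (compArr z)))
      (q' := (1 : ℂˣ) • ρ.1 (G.tgt (compArr z)))
      ((congrArg ρ.1 (G.src_comp _ _ _).symm).trans (one_smul _ _).symm)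
      ((congrArg ρ.1 (G.tgt_comp _ _ _).symm).trans (one_smul _ _).symm) (hh z e₆)
          _ _ es et).trans ?_
    refine (I.map_smul _ _ _ _ _ _ _ _ (hs _) (ht _)).trans ?_
    rw [hφ, smul_smul, inv_one, one_mul, mul_one]
  have key := hl.symm.trans ((I.map_mul _ _ _ _ _ _ _ _ _ _ e₆ e₇ e₈).trans hr)
  exact unitOf_injective (𝒢'.L.smul_left_cancel key)

/-- After a global section `ρ` of `Q` is chosen, the isomorphism is a function `φ` on the arrows.
Compatibility with products, connections and curvings gives the three components of `c' - c`, with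
`a` the connection form of `ρ`. -/
theorem Iso.exists_cochain (hG : G.IsLeray) (I : 𝒢.Iso 𝒢') {c c' : Cech2 G} (hc : 𝒢.Presents c)
    (hc' : 𝒢'.Presents c') : ∃ b, c' = c + D1 G b := by
  obtain ⟨σ, h₁, h₂, h₃, h₄⟩ := hc
  obtain ⟨σ', h₁', h₂', h₃', h₄'⟩ := hc'
  obtain ⟨ρ, hρ⟩ := LineBundle.exists_smooth (L := I.Q) (acyclic_units_zero hG)
  obtain ⟨φ, hφ⟩ := I.exists_factor ρ σ σ'
  have hs := fun g => I.map_smooth ρ ρ σ σ' g φ (hρ _) (hρ _) (h₁ g) (h₁' g)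
      (Eventually.of_forall hφ)
  let ψ : (units G).sections G.arrows := ⟨φ, fun g => (hs g).1⟩
  let a : CechForms G 0 1 := ⟨I.Q.conn ρ, fun x => I.Q.secAt_conn ρ x (hρ x)⟩
  -- The cochain is `φ⁻¹`, written additively, since `φ(g₁)φ(g₂)h' = h φ(g₁g₂)` says that `h'/h` is
  -- `δ(φ⁻¹)`.
  let f : CechUnits G 1 := -(units G).pull (arrowHom G) ψ
  refine ⟨(f, a), Prod.ext (Subtype.ext (funext fun z => ?_))
    (Prod.ext (Subtype.ext (funext fun z => ?_)) (Subtype.ext (funext fun x => ?_)))⟩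
  · change c'.1.1 z = c.1.1 z + (δUnits f).1 z
    have h := I.factor_mul h₂ h₂' hφ z
    refine Eq.trans ?_ (congrArg (c.1.1 z + ·) (delta_one_apply f z)).symm
    have key : ∀ {A : Type} [AddCommGroup A] (u v w x y : A), u + v + y = x + w →
        y = x + (-v - -w + -u) := by
      intro A _ u v w x y e
      rw [eq_sub_of_add_eq' e]
      abel
    exact key _ _ _ _ _ h
  · have hf : (dlog G).app (G.nerve 1) f.1 z = -(dlog G).app G.arrows φ z.1.2 :=
      (((hs z.1.2).1.hasApp (dlog G)).pull (arrowHom G)).neg.2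
    have h := (hs z.1.2).2
    have hx : I.Q.conn ρ z.1.1 = I.Q.conn ρ (G.src z.1.2) := congrArg (I.Q.conn ρ) z.2
    change c'.2.1.1 z = c.2.1.1 z + ((δForms a).1 z + (dlog G).app (G.nerve 1) f.1 z)
    rw [h₃, h₃', hf]
    refine Eq.trans ?_ (congrArg (fun y => 𝒢.L.conn σ z.1.2 + (y + -(dlog G).app G.arrows φ z.1.2))
      ((delta_zero_apply a z).trans (congrArg (fun y => I.Q.conn ρ (G.tgt z.1.2) -
        (forms G 1).act z.1.2 y) hx))).symm
    have key : ∀ {A : Type} [AddCommGroup A] (t t' u v d : A), t + u - v = t' + d →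
        t' = t + (u - v + -d) := by
      intro A _ t t' u v d e
      rw [eq_sub_of_add_eq e.symm]
      abel
    exact key _ _ _ _ _ h
  · have h := I.curving ρ x (hρ x)
    rw [← h₄, ← h₄'] at h
    exact h

end Gerbe

/-- Gerbes with connection are isomorphic if and only if the cocycles which present them are
cohomologous. -/
theorem Gerbe.nonempty_iso_iff (hG : G.IsLeray) {𝒢 𝒢' : Gerbe G} (c c' : cechCocycles G)
    (hc : 𝒢.Presents c.1) (hc' : 𝒢'.Presents c'.1) :
    Nonempty (𝒢.Iso 𝒢') ↔ (QuotientAddGroup.mk c : CechH2 G) = QuotientAddGroup.mk c' := by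
  rw [QuotientAddGroup.eq, AddSubgroup.mem_addSubgroupOf]
  constructor
  · rintro ⟨I⟩
    obtain ⟨b, hb⟩ := I.exists_cochain hG hc hc'
    exact ⟨b, eq_neg_add_of_add_eq hb.symm⟩
  · rintro ⟨b, hb⟩
    exact hc.nonempty_iso hc' (eq_add_of_neg_add_eq hb.symm)

end EtaleGerbe
end

/-! ### The classification theorem -/

theorem mainTheorem2 {n m : ℕ} (G : SmoothEtaleGroupoid.{u} n)
    (H : SmoothEtaleGroupoid.{v} m)
    (D : LerayDescription G H) :
    -- the `2`-cocycles of the Čech complex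
    (∀ c : Cech2 G, c ∈ cechCocycles G ↔
      δForms c.2.2 = dCech c.2.1 ∧ δForms c.2.1 = dlogCech c.1 ∧ δUnits c.1 = 0) ∧
    -- gerbes with connection are `2`-cocycles
    (∀ 𝒢 : Gerbe G, ∃ c ∈ cechCocycles G, 𝒢.Presents c) ∧
    (∀ (𝒢 : Gerbe G) (c : Cech2 G), 𝒢.Presents c → c ∈ cechCocycles G) ∧
    (∀ c ∈ cechCocycles G, ∃ 𝒢 : Gerbe G, 𝒢.Presents c) ∧
    -- gerbes with connection are isomorphic if and only if their cocycles are cohomologous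
    (∀ (𝒢 𝒢' : Gerbe G) (c c' : cechCocycles G), 𝒢.Presents c.1 → 𝒢'.Presents c'.1 →
      (Nonempty (𝒢.Iso 𝒢') ↔ (QuotientAddGroup.mk c : CechH2 G) = QuotientAddGroup.mk c')) ∧
    -- the classification by the Deligne cohomology group `ℍ³(G, ℤ(3)_D^∞)`
    Nonempty (InjectiveModel (deligne G)) ∧
    ∀ R : InjectiveModel (deligne G),
      ∃ Φ : CechH2 G ≃+ InvCohomology R.T 2,
        (∀ (c : cechCocycles G) (ξ : invCocycles R.T 3),
          Φ (QuotientAddGroup.mk c) = QuotientAddGroup.mk ξ ↔ Corresponds R c.1 ξ.1) ∧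
        ∃ cl : Gerbe G → InvCohomology R.T 2, Function.Surjective cl ∧
          (∀ 𝒢 𝒢' : Gerbe G, cl 𝒢 = cl 𝒢' ↔ Nonempty (𝒢.Iso 𝒢')) ∧
          ∀ (𝒢 : Gerbe G) (c : cechCocycles G), 𝒢.Presents c.1 →
            cl 𝒢 = Φ (QuotientAddGroup.mk c) := by
  have hG := D.isLeray
  have hex : ∀ 𝒢 : Gerbe G, ∃ c ∈ cechCocycles G, 𝒢.Presents c := fun 𝒢 => by
    obtain ⟨c, hc⟩ := Gerbe.exists_presents hG 𝒢
    exact ⟨c, hc.mem_cechCocycles, hc⟩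
  refine ⟨mem_cechCocycles_iff, hex, fun 𝒢 c hc => hc.mem_cechCocycles,
    fun c hc => ⟨_, Gerbe.ofCocycle_presents c hc⟩,
    fun 𝒢 𝒢' c c' hc hc' => Gerbe.nonempty_iso_iff hG c c' hc hc', inferInstance, fun R => ?_⟩
  obtain ⟨Φ, hΦ⟩ := exists_comparison hG R
  choose c hc hp using hex
  -- The class of a gerbe is defined by a chosen presenting cocycle. Independence of the choice
  -- follows from the criterion for isomorphism applied to a gerbe and itself.
  refine ⟨Φ, hΦ, fun 𝒢 => Φ (QuotientAddGroup.mk ⟨c 𝒢, hc 𝒢⟩), fun ξ => ?_, fun 𝒢 𝒢' => ?_,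
    fun 𝒢 b hb => congrArg Φ ?_⟩
  · obtain ⟨x, rfl⟩ := Φ.surjective ξ
    obtain ⟨b, rfl⟩ := QuotientAddGroup.mk_surjective x
    refine ⟨Gerbe.ofCocycle b.1 b.2, congrArg Φ ?_⟩
    -- Reflexivity of isomorphism comes from the criterion: a cocycle is cohomologous to itself. The
    -- same criterion, read backwards, compares the chosen cocycle with `b`.
    have I : Nonempty ((Gerbe.ofCocycle b.1 b.2).Iso (Gerbe.ofCocycle b.1 b.2)) :=
      (Gerbe.nonempty_iso_iff hG b b (Gerbe.ofCocycle_presents _ _)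
        (Gerbe.ofCocycle_presents _ _)).2 rfl
    exact (Gerbe.nonempty_iso_iff hG ⟨c _, hc _⟩ b (hp _) (Gerbe.ofCocycle_presents _ _)).1 I
  · rw [Φ.injective.eq_iff]
    exact (Gerbe.nonempty_iso_iff hG ⟨c 𝒢, hc 𝒢⟩ ⟨c 𝒢', hc 𝒢'⟩ (hp _) (hp _)).symm
  · have I : Nonempty (𝒢.Iso 𝒢) :=
      (Gerbe.nonempty_iso_iff hG b b hb hb).2 rfl
    exact (Gerbe.nonempty_iso_iff hG ⟨c 𝒢, hc 𝒢⟩ b (hp 𝒢) hb).1 I
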